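/- Let $N\ge 2$ and identify $x=(x^{(1)},x^{(2)})\in\mathbb R^2$ with $z=x^{(1)}+\mathrm i x^{(2)}\in\mathbb C$. Let $v:[0,\infty)\to[0,\infty]$ be measurable, vanishing outside a bounded set, and not almost everywhere zero ($v$ need not be integrable and may be $+\infty$ on a set of positive measure). For $a>0$ put $v_a(r)=a^{-2}v(r/a)$, and on $\mathcal H=L^2(\mathbb R^{2N})$ let $$H_a=\sum_{i=1}^N\Big[(-\mathrm i\nabla_i-x_i^\perp)^2-2\Big]+\sum_{1\le i<j\le N}v_a(|x_i-x_j|),\qquad x^\perp=(-x^{(2)},x^{(1)}),$$ be the operator associated with the corresponding quadratic form on the domain of all $\Psi\in\mathcal H$ with $(-\mathrm i\nabla_i-x_i^\perp)\Psi\in L^2$ (weakly) for all $i$ and $\int\sum_{i<j}v_a(|x_i-x_j|)|\Psi|^2<\infty$. If this domain is not dense, $H_a$ acts in its closure, and $(\mu+cH_a)^{-1}$ (for $c,\mu>0$) is extended by $0$ to the orthogonal complement. For $\ell\in\{0,1,2,\dots\}$ let $\mathfrak B_\ell\subset\mathcal H$ be the space of all $\Psi\in\mathcal H$ of the form $$\Psi(x_1,\dots,x_N)=\mathrm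 e^{-\frac12\sum_i|x_i|^2}\,\varphi(z_1,\dots,z_N)\prod_{i<j}(z_i-z_j)^\ell,\qquad \varphi:\mathbb C^N\to\mathbb C\ \text{entire},$$ which is closed, and let $P_\ell$ be the orthogonal projection onto it. Let $\mathfrak h_\ell=\sum_{i<j}\mathfrak D^{(\ell)}_{ij}$ be the bounded operator on $\mathfrak B_\ell$ with $$\langle\Psi|\mathfrak D^{(\ell)}_{ij}\Psi\rangle=\int_{\mathbb R^{2(N-1)}}\mathrm e^{-2|x_j|^2-\sum_{k\ne i,j}|x_k|^2}\,\big|\xi_{ij}\big|^2_{z_i=z_j}\prod_{k\neq i}dx_k,$$ where $\xi_{ij}=\varphi\prod_{k<l,\,(k,l)\ne(i,j)}(z_k-z_l)^\ell$; these integrals are finite, and $\mathfrak h_\ell$ exists and is unique. For $\ell\ge1$ let $$b_\ell=\frac1{4\pi\ell}\inf\Big\{\int_{\mathbb R^2}|x|^{2\ell}\big(|\nabla f|^2+\tfrac12v(|x|)|f|^2\big)dx\ :\ f:\mathbb R^2\to\mathbb R\ \text{weakly differentiable},\ \lim_{|x|\to\infty}f(x)=1\Big\}.$$ Then for every $\ell\ge1$,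 $a^{-2\ell}H_a$ converges to $8\pi\ell b_\ell\mathfrak h_\ell$ in strong resolvent sense as $a\downarrow0$: for all $\mu>0$ and $\psi\in\mathcal H$, $$\lim_{a\downarrow0}\big(\mu+a^{-2\ell}H_a\big)^{-1}\psi=\big(\mu+8\pi\ell b_\ell\mathfrak h_\ell\big)^{-1}P_\ell\psi\quad\text{in }L^2(\mathbb R^{2N}).$$ For $\ell=0$, $\ln(1/a^2)H_a$ converges in the same sense to $8\pi\mathfrak h_0$: for all $\mu>0$ and $\psi\in\mathcal H$, $\lim_{a\downarrow0}(\mu+\ln(1/a^2)H_a)^{-1}\psi=(\mu+8\pi\mathfrak h_0)^{-1}P_0\psi$ in $L^2(\mathbb R^{2N})$. -/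

import Mathlib

open MeasureTheory Filter Topology Complex
open scoped ENNReal ContDiff ComplexConjugate InnerProductSpace

noncomputable section

namespace QHall

/-! ### Operators associated with quadratic forms, and their resolvents -/

section Forms

variable {H : Type*} [NormedAddCommGroup H] [InnerProductSpace ℂ H]

/-- The graph of the operator associated with the sesquilinear form `q` with form domain `Q`:
the pairs `(u, f)` with `u ∈ Q`, `f` in the closure of `Q`, and `q(w, u) = ⟨w, f⟩` for all
`w ∈ Q`. The form domain need not be dense: the operator acts in the Hilbert space `closure Q`. -/
def formGraph (Q : Submodule ℂ H) (q : Q →ₗ⋆[ℂ] Q →ₗ[ℂ] ℂ) : Submodule ℂ (H × H) where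
  carrier := {p | p.2 ∈ Q.topologicalClosure ∧
    ∃ h : p.1 ∈ Q, ∀ w : Q, q w ⟨p.1, h⟩ = ⟪(w : H), p.2⟫_ℂ}
  zero_mem' := ⟨Submodule.zero_mem _, Q.zero_mem, fun w => by
    have : (⟨0, Q.zero_mem⟩ : Q) = 0 := rfl
    simp [this]⟩
  add_mem' := by
    rintro x y ⟨hx, hx1, hx2⟩ ⟨hy, hy1, hy2⟩
    refine ⟨Submodule.add_mem _ hx hy, Q.add_mem hx1 hy1, fun w => ?_⟩
    have : (⟨(x + y).1, Q.add_mem hx1 hy1⟩ : Q) = ⟨x.1, hx1⟩ + ⟨y.1, hy1⟩ := rfl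
    rw [this, map_add, hx2, hy2, Prod.snd_add, inner_add_right]
  smul_mem' := by
    rintro c x ⟨hx, hx1, hx2⟩
    refine ⟨Submodule.smul_mem _ c hx, Q.smul_mem c hx1, fun w => ?_⟩
    have : (⟨(c • x).1, Q.smul_mem c hx1⟩ : Q) = c • ⟨x.1, hx1⟩ := rfl
    rw [this, map_smul, hx2, Prod.smul_snd, inner_smul_right, smul_eq_mul]

/-- The graph is single valued, so that `Submodule.toLinearPMap` below is not a junk value. -/
theorem formGraph_single_valued (Q : Submodule ℂ H) (q : Q →ₗ⋆[ℂ] Q →ₗ[ℂ] ℂ)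
    (x : H × H) (hx : x ∈ formGraph Q q) (h0 : x.1 = 0) : x.2 = 0 := by
  obtain ⟨hcl, h1, h2⟩ := hx
  have hz : (⟨x.1, h1⟩ : Q) = 0 := Subtype.ext h0
  have horth : ∀ w ∈ Q, ⟪w, x.2⟫_ℂ = 0 := fun w hw => by
    rw [← h2 ⟨w, hw⟩, hz, map_zero]
  have hclosed : IsClosed {w : H | ⟪w, x.2⟫_ℂ = 0} :=
    isClosed_eq (by fun_prop) continuous_const
  have : x.2 ∈ {w : H | ⟪w, x.2⟫_ℂ = 0} :=
    closure_minimal (fun w hw => horth w hw) hclosed hcl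
  exact inner_self_eq_zero.1 this

/-- The operator associated with a sesquilinear form. -/
def formOperator (Q : Submodule ℂ H) (q : Q →ₗ⋆[ℂ] Q →ₗ[ℂ] ℂ) : H →ₗ.[ℂ] H :=
  (formGraph Q q).toLinearPMap

variable [CompleteSpace H]

/-- `R = (μ + T)⁻¹`, where `T` acts in the closure of its domain, and where the inverse is extended
by zero to the orthogonal complement of this closure: `(μ + T) R ψ = Π ψ` for all `ψ`, with `Π` the
orthogonal projection onto the closure of the domain of `T`. -/
def IsResolvent (T : H →ₗ.[ℂ] H) (μ : ℝ) (R : H →L[ℂ] H) : Prop :=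
  ∀ ψ : H, ∃ h : R ψ ∈ T.domain,
    (μ : ℂ) • R ψ + T ⟨R ψ, h⟩ = T.domain.topologicalClosure.starProjection ψ

open scoped Classical in
/-- The resolvent `(μ + T)⁻¹` (the zero operator if there is none, or more than one). -/
def resolventAt (T : H →ₗ.[ℂ] H) (μ : ℝ) : H →L[ℂ] H :=
  if h : ∃! R, IsResolvent T μ R then h.choose else 0

/-- Strong resolvent convergence, as `a → 0` from the right, of the operators `A a` to the bounded
operator `T` on the closed subspace `B`: for all `μ > 0` the resolvents exist, and
`(μ + A a)⁻¹ ψ → (μ + T)⁻¹ P ψ` for all `ψ`, with `P` the orthogonal projection onto `B`. -/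
def StrongResolventLimit (A : ℝ → (H →ₗ.[ℂ] H)) (B : Submodule ℂ H) (T : B →L[ℂ] B) : Prop :=
  ∃ _ : B.HasOrthogonalProjection, ∀ μ : ℝ, 0 < μ →
    (∀ᶠ a in 𝓝[>] (0 : ℝ), ∃! R, IsResolvent (A a) μ R) ∧
    IsUnit ((μ : ℂ) • (1 : B →L[ℂ] B) + T) ∧
    ∀ ψ : H, Tendsto (fun a => resolventAt (A a) μ ψ) (𝓝[>] (0 : ℝ))
      (𝓝 ((Ring.inverse ((μ : ℂ) • (1 : B →L[ℂ] B) + T) (B.orthogonalProjectionOnto ψ) : B) : H))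

end Forms

/-! ### The configuration space and the magnetic kinetic energy -/

/-- Positions of `N` particles in the plane `ℝ² = ℂ`. -/
abbrev Config (N : ℕ) := Fin N → ℂ

/-- The Hilbert space `L²(ℝ^{2N})`. -/
abbrev L2 (N : ℕ) := Lp ℂ 2 (volume : Measure (Config N))

/-- The pairs `i < j`. -/
abbrev Pair (N : ℕ) := {p : Fin N × Fin N // p.1 < p.2}

/-- The two coordinate directions of the plane. -/
def dir (k : Fin 2) : ℂ := ![1, I] k

/-- The components of the vector potential `x^⊥ = (-x⁽²⁾, x⁽¹⁾)`. -/
def vecPot (k : Fin 2) (w : ℂ) : ℝ := ![-w.im, w.re] k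

/-- The `k`-th component of `(-i∇ - x^⊥) χ` in the variable of particle `i`. -/
def magD {N : ℕ} (i : Fin N) (k : Fin 2) (χ : Config N → ℂ) (z : Config N) : ℂ :=
  -I * fderiv ℝ χ z (Pi.single i (dir k)) - (vecPot k (z i) : ℂ) * χ z

/-- `g ∈ L²` is the `k`-th component of `(-i∇_i - x_i^⊥) Ψ` in the sense of distributions. -/
def HasWeakMagD {N : ℕ} (i : Fin N) (k : Fin 2) (Ψ g : L2 N) : Prop :=
  ∀ χ : Config N → ℂ, ContDiff ℝ ∞ χ → HasCompactSupport χ →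
    ∫ z, conj (χ z) * g z = ∫ z, conj (magD i k χ z) * Ψ z

theorem continuous_magD {N : ℕ} (i : Fin N) (k : Fin 2) {χ : Config N → ℂ}
    (h : ContDiff ℝ ∞ χ) : Continuous (magD i k χ) := by
  have h1 : Continuous fun z => fderiv ℝ χ z (Pi.single i (dir k)) :=
    (h.continuous_fderiv (by simp)).clm_apply continuous_const
  have h2 : Continuous (vecPot k) := by
    unfold vecPot
    fin_cases k <;> simp <;> fun_prop
  have h3 := h.continuous
  unfold magD
  fun_prop

theorem hasCompactSupport_magD {N : ℕ} (i : Fin N) (k : Fin 2) {χ : Config N → ℂ}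
    (h : HasCompactSupport χ) : HasCompactSupport (magD i k χ) := by
  have h1 : HasCompactSupport fun z => fderiv ℝ χ z (Pi.single i (dir k)) :=
    (h.fderiv (𝕜 := ℝ)).comp_left (g := fun L : Config N →L[ℝ] ℂ => L (Pi.single i (dir k))) rfl
  have h2 : HasCompactSupport fun z => -I * fderiv ℝ χ z (Pi.single i (dir k)) :=
    h1.comp_left (g := fun w : ℂ => -I * w) (mul_zero _)
  have h3 : HasCompactSupport fun z => (vecPot k (z i) : ℂ) * χ z :=
    HasCompactSupport.mul_left (f := fun z : Config N => (vecPot k (z i) : ℂ)) h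
  exact HasCompactSupport.sub h2 h3

theorem integrable_conj_mul {N : ℕ} {χ : Config N → ℂ} (h : Continuous χ)
    (hs : HasCompactSupport χ) (Ψ : L2 N) : Integrable fun z => conj (χ z) * Ψ z := by
  have h1 : MemLp (fun z => conj (χ z)) 2 (volume : Measure (Config N)) :=
    (h.memLp_of_hasCompactSupport hs).star
  exact h1.integrable_mul (Lp.memLp Ψ)

theorem HasWeakMagD.add {N : ℕ} {i : Fin N} {k : Fin 2} {Ψ Ψ' g g' : L2 N}
    (h : HasWeakMagD i k Ψ g) (h' : HasWeakMagD i k Ψ' g') :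
    HasWeakMagD i k (Ψ + Ψ') (g + g') := by
  intro χ hχ hs
  have e1 : ∫ z, conj (χ z) * (g + g' : L2 N) z =
      ∫ z, (conj (χ z) * g z + conj (χ z) * g' z) :=
    integral_congr_ae (by
      filter_upwards [Lp.coeFn_add g g'] with z hz
      rw [hz, Pi.add_apply, mul_add])
  have e2 : ∫ z, conj (magD i k χ z) * (Ψ + Ψ' : L2 N) z =
      ∫ z, (conj (magD i k χ z) * Ψ z + conj (magD i k χ z) * Ψ' z) :=
    integral_congr_ae (by
      filter_upwards [Lp.coeFn_add Ψ Ψ'] with z hz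
      rw [hz, Pi.add_apply, mul_add])
  have c := continuous_magD i k hχ
  have d := hasCompactSupport_magD i k hs
  rw [e1, e2, integral_add (integrable_conj_mul hχ.continuous hs _)
    (integrable_conj_mul hχ.continuous hs _), integral_add (integrable_conj_mul c d _)
    (integrable_conj_mul c d _), h χ hχ hs, h' χ hχ hs]

theorem HasWeakMagD.smul {N : ℕ} {i : Fin N} {k : Fin 2} {Ψ g : L2 N} (c : ℂ)
    (h : HasWeakMagD i k Ψ g) : HasWeakMagD i k (c • Ψ) (c • g) := by
  intro χ hχ hs
  have e1 : ∫ z, conj (χ z) * (c • g : L2 N) z = ∫ z, c * (conj (χ z) * g z) :=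
    integral_congr_ae (by
      filter_upwards [Lp.coeFn_smul c g] with z hz
      rw [hz, Pi.smul_apply, smul_eq_mul, mul_left_comm])
  have e2 : ∫ z, conj (magD i k χ z) * (c • Ψ : L2 N) z =
      ∫ z, c * (conj (magD i k χ z) * Ψ z) :=
    integral_congr_ae (by
      filter_upwards [Lp.coeFn_smul c Ψ] with z hz
      rw [hz, Pi.smul_apply, smul_eq_mul, mul_left_comm])
  rw [e1, e2, integral_const_mul, integral_const_mul, h χ hχ hs]

theorem HasWeakMagD.unique {N : ℕ} {i : Fin N} {k : Fin 2} {Ψ g g' : L2 N}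
    (h : HasWeakMagD i k Ψ g) (h' : HasWeakMagD i k Ψ g') : g = g' := by
  have hl : ∀ f : L2 N, LocallyIntegrable f (volume : Measure (Config N)) := fun f =>
    (Lp.memLp f).locallyIntegrable (by norm_num)
  refine Lp.ext (ae_eq_of_integral_contDiff_smul_eq (hl g) (hl g') fun χ hχ hs => ?_)
  have e := (h (fun z => (χ z : ℂ)) (ofRealCLM.contDiff.comp hχ)
    (hs.comp_left (g := fun r : ℝ => (r : ℂ)) rfl)).trans
    (h' (fun z => (χ z : ℂ)) (ofRealCLM.contDiff.comp hχ)
      (hs.comp_left (g := fun r : ℝ => (r : ℂ)) rfl)).symm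
  simpa [conj_ofReal, real_smul] using e

theorem HasWeakMagD.zero {N : ℕ} (i : Fin N) (k : Fin 2) :
    HasWeakMagD i k (0 : L2 N) 0 := by
  have h0 := Lp.coeFn_zero ℂ 2 (volume : Measure (Config N))
  intro χ _ _
  rw [integral_eq_zero_of_ae, integral_eq_zero_of_ae]
  · filter_upwards [h0] with z _
    simp
  · filter_upwards [h0] with z _
    simp

open scoped Classical in
/-- The weak magnetic derivative, if it exists in `L²`. -/
def weakMagD {N : ℕ} (i : Fin N) (k : Fin 2) (Ψ : L2 N) : L2 N :=
  if h : ∃ g, HasWeakMagD i k Ψ g then h.choose else 0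

theorem weakMagD_spec {N : ℕ} {i : Fin N} {k : Fin 2} {Ψ : L2 N}
    (h : ∃ g, HasWeakMagD i k Ψ g) : HasWeakMagD i k Ψ (weakMagD i k Ψ) := by
  rw [weakMagD, dif_pos h]
  exact h.choose_spec

/-! ### The Hamiltonian -/

/-- The rescaled pair potential `v_a(r) = a⁻² v(r/a)`. -/
def vScaled (v : ℝ → ℝ≥0∞) (a r : ℝ) : ℝ≥0∞ := ENNReal.ofReal (a ^ 2)⁻¹ * v (r / a)

/-- The interaction `∑_{i<j} v_a(|x_i - x_j|)`. -/
def interaction (N : ℕ) (v : ℝ → ℝ≥0∞) (a : ℝ) (z : Config N) : ℝ≥0∞ :=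
  ∑ p : Pair N, vScaled v a ‖z p.1.1 - z p.1.2‖

theorem measurable_interaction {N : ℕ} {v : ℝ → ℝ≥0∞} (hv : Measurable v) (a : ℝ) :
    Measurable (interaction N v a) := by
  unfold interaction vScaled
  refine Finset.measurable_sum _ fun p _ => Measurable.const_mul (hv.comp ?_) _
  fun_prop

/-- The form domain of `H_a`: `Ψ` and all components of `(-i∇_i - x_i^⊥) Ψ` are in `L²`, and
the interaction energy is finite. In particular `Ψ` vanishes where the interaction is infinite. -/
def formDomain (N : ℕ) {v : ℝ → ℝ≥0∞} (hv : Measurable v) (a : ℝ) : Submodule ℂ (L2 N) where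
  carrier := {Ψ | (∀ i k, ∃ g, HasWeakMagD i k Ψ g) ∧
    ∫⁻ z, interaction N v a z * ‖Ψ z‖ₑ ^ 2 < ⊤}
  zero_mem' := by
    refine ⟨fun i k => ⟨0, HasWeakMagD.zero i k⟩, ?_⟩
    rw [lintegral_congr_ae (g := fun _ => 0)]
    · simp
    · filter_upwards [Lp.coeFn_zero ℂ 2 (volume : Measure (Config N))] with z _
      simp
  add_mem' := by
    rintro Ψ Φ ⟨h1, h2⟩ ⟨h3, h4⟩
    refine ⟨fun i k => ⟨_, (h1 i k).choose_spec.add (h3 i k).choose_spec⟩, ?_⟩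
    have hb : ∫⁻ z, interaction N v a z * ‖(Ψ + Φ : L2 N) z‖ₑ ^ 2 ≤
        ∫⁻ z, (2 * (interaction N v a z * ‖Ψ z‖ₑ ^ 2) +
          2 * (interaction N v a z * ‖Φ z‖ₑ ^ 2)) := by
      refine lintegral_mono_ae ?_
      filter_upwards [Lp.coeFn_add Ψ Φ] with z hz
      rw [hz, Pi.add_apply]
      have : ‖Ψ z + Φ z‖ₑ ^ 2 ≤ 2 * (‖Ψ z‖ₑ ^ 2 + ‖Φ z‖ₑ ^ 2) := by
        refine (pow_le_pow_left' (enorm_add_le _ _) 2).trans ?_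
        have := ENNReal.rpow_add_le_mul_rpow_add_rpow ‖Ψ z‖ₑ ‖Φ z‖ₑ (p := 2) (by norm_num)
        norm_num at this
        exact_mod_cast this
      calc _ ≤ interaction N v a z * (2 * (‖Ψ z‖ₑ ^ 2 + ‖Φ z‖ₑ ^ 2)) := by gcongr
        _ = _ := by ring
    refine hb.trans_lt ?_
    have hm : ∀ f : L2 N, AEMeasurable
        (fun z => 2 * (interaction N v a z * ‖f z‖ₑ ^ 2)) volume := fun f =>
      (((measurable_interaction hv a).aemeasurable.mul
        ((Lp.aestronglyMeasurable f).enorm.pow_const 2))).const_mul 2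
    rw [lintegral_add_left' (hm Ψ), lintegral_const_mul' _ _ (by simp),
      lintegral_const_mul' _ _ (by simp)]
    exact ENNReal.add_lt_top.2 ⟨ENNReal.mul_lt_top (by simp) h2, ENNReal.mul_lt_top (by simp) h4⟩
  smul_mem' := by
    rintro c Ψ ⟨h1, h2⟩
    refine ⟨fun i k => ⟨_, (h1 i k).choose_spec.smul c⟩, ?_⟩
    have e : ∫⁻ z, interaction N v a z * ‖(c • Ψ : L2 N) z‖ₑ ^ 2 =
        ∫⁻ z, ‖c‖ₑ ^ 2 * (interaction N v a z * ‖Ψ z‖ₑ ^ 2) := by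
      refine lintegral_congr_ae ?_
      filter_upwards [Lp.coeFn_smul c Ψ] with z hz
      rw [hz, Pi.smul_apply, smul_eq_mul, enorm_mul, mul_pow]
      ring
    rw [e, lintegral_const_mul' _ _ (by simp)]
    exact ENNReal.mul_lt_top (by simp) h2

/-- The interaction part `⟨Φ, V Ψ⟩` of the form. Where `V = ∞`, functions of the form domain
vanish, so that the value `0` of `toReal` there does not matter. -/
def potForm (N : ℕ) (v : ℝ → ℝ≥0∞) (a : ℝ) (Φ Ψ : L2 N) : ℂ :=
  ∫ z, ((interaction N v a z).toReal : ℂ) * (conj (Φ z) * Ψ z)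

theorem integrable_potForm {N : ℕ} {v : ℝ → ℝ≥0∞} (hv : Measurable v) {a : ℝ} {Φ Ψ : L2 N}
    (hΦ : Φ ∈ formDomain N hv a) (hΨ : Ψ ∈ formDomain N hv a) :
    Integrable fun z => ((interaction N v a z).toReal : ℂ) * (conj (Φ z) * Ψ z) := by
  have hm := (measurable_interaction (N := N) hv a)
  refine ⟨?_, ?_⟩
  · refine AEStronglyMeasurable.mul ?_ ?_
    · exact (measurable_ofReal.comp hm.ennreal_toReal).aestronglyMeasurable
    · exact (continuous_conj.comp_aestronglyMeasurable (Lp.aestronglyMeasurable Φ)).mul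
        (Lp.aestronglyMeasurable Ψ)
  · have hb : ∫⁻ z, ‖((interaction N v a z).toReal : ℂ) * (conj (Φ z) * Ψ z)‖ₑ ≤
        ∫⁻ z, (interaction N v a z * ‖Φ z‖ₑ ^ 2 + interaction N v a z * ‖Ψ z‖ₑ ^ 2) := by
      refine lintegral_mono fun z => ?_
      have h1 : ‖((interaction N v a z).toReal : ℂ)‖ₑ ≤ interaction N v a z := by
        rw [← ofReal_norm, norm_real, Real.norm_of_nonneg ENNReal.toReal_nonneg]
        exact ENNReal.ofReal_toReal_le
      have h2 : ‖conj (Φ z) * Ψ z‖ₑ ≤ ‖Φ z‖ₑ ^ 2 + ‖Ψ z‖ₑ ^ 2 := by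
        rw [enorm_mul, RCLike.enorm_conj]
        rcases le_total ‖Φ z‖ₑ ‖Ψ z‖ₑ with h | h
        · calc _ ≤ ‖Ψ z‖ₑ * ‖Ψ z‖ₑ := by gcongr
            _ = ‖Ψ z‖ₑ ^ 2 := (sq _).symm
            _ ≤ _ := le_add_self
        · calc _ ≤ ‖Φ z‖ₑ * ‖Φ z‖ₑ := by gcongr
            _ = ‖Φ z‖ₑ ^ 2 := (sq _).symm
            _ ≤ _ := le_self_add
      rw [enorm_mul, ← mul_add]
      gcongr
    refine hb.trans_lt ?_
    have hm' : AEMeasurable (fun z => interaction N v a z * ‖Φ z‖ₑ ^ 2) volume :=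
      hm.aemeasurable.mul ((Lp.aestronglyMeasurable Φ).enorm.pow_const 2)
    rw [lintegral_add_left' hm']
    exact ENNReal.add_lt_top.2 ⟨hΦ.2, hΨ.2⟩

theorem weakMagD_add {N : ℕ} {i : Fin N} {k : Fin 2} {Ψ Φ : L2 N}
    (h : ∃ g, HasWeakMagD i k Ψ g) (h' : ∃ g, HasWeakMagD i k Φ g) :
    weakMagD i k (Ψ + Φ) = weakMagD i k Ψ + weakMagD i k Φ :=
  have e := (weakMagD_spec h).add (weakMagD_spec h')
  (weakMagD_spec ⟨_, e⟩).unique e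

theorem weakMagD_smul {N : ℕ} {i : Fin N} {k : Fin 2} {Ψ : L2 N} (c : ℂ)
    (h : ∃ g, HasWeakMagD i k Ψ g) : weakMagD i k (c • Ψ) = c • weakMagD i k Ψ :=
  have e := (weakMagD_spec h).smul c
  (weakMagD_spec ⟨_, e⟩).unique e

theorem potForm_conj {N : ℕ} (v : ℝ → ℝ≥0∞) (a : ℝ) (Φ Ψ : L2 N) :
    conj (potForm N v a Φ Ψ) = potForm N v a Ψ Φ := by
  unfold potForm
  rw [← integral_conj]
  refine integral_congr_ae (Eventually.of_forall fun z => ?_)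
  simp only [map_mul, conj_ofReal, conj_conj]
  ring

theorem potForm_add {N : ℕ} {v : ℝ → ℝ≥0∞} (hv : Measurable v) {a : ℝ} {Φ Ψ Ψ' : L2 N}
    (h : Φ ∈ formDomain N hv a) (h1 : Ψ ∈ formDomain N hv a) (h2 : Ψ' ∈ formDomain N hv a) :
    potForm N v a Φ (Ψ + Ψ') = potForm N v a Φ Ψ + potForm N v a Φ Ψ' := by
  unfold potForm
  rw [← integral_add (integrable_potForm hv h h1) (integrable_potForm hv h h2)]
  refine integral_congr_ae ?_
  filter_upwards [Lp.coeFn_add Ψ Ψ'] with z hz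
  rw [hz, Pi.add_apply]
  ring

theorem potForm_smul {N : ℕ} (v : ℝ → ℝ≥0∞) (a : ℝ) (c : ℂ) (Φ Ψ : L2 N) :
    potForm N v a Φ (c • Ψ) = c * potForm N v a Φ Ψ := by
  unfold potForm
  rw [← integral_const_mul]
  refine integral_congr_ae ?_
  filter_upwards [Lp.coeFn_smul c Ψ] with z hz
  rw [hz, Pi.smul_apply, smul_eq_mul]
  ring

/-- The sesquilinear form of `H_a`:
`∑_i ⟨(-i∇_i - x_i^⊥) Φ, (-i∇_i - x_i^⊥) Ψ⟩ - 2N ⟨Φ, Ψ⟩ + ∑_{i<j} ⟨Φ, v_a(|x_i - x_j|) Ψ⟩`. -/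
def hamForm (N : ℕ) {v : ℝ → ℝ≥0∞} (hv : Measurable v) (a : ℝ) :
    formDomain N hv a →ₗ⋆[ℂ] formDomain N hv a →ₗ[ℂ] ℂ :=
  LinearMap.mk₂'ₛₗ (starRingEnd ℂ) (RingHom.id ℂ)
    (fun Φ Ψ => ∑ i, (∑ k, ⟪weakMagD i k (Φ : L2 N), weakMagD i k (Ψ : L2 N)⟫_ℂ
      - 2 * ⟪(Φ : L2 N), (Ψ : L2 N)⟫_ℂ) + potForm N v a Φ Ψ)
    (fun Φ Φ' Ψ => by
      have e : potForm N v a (Φ + Φ' : L2 N) Ψ = potForm N v a Φ Ψ + potForm N v a Φ' Ψ := by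
        rw [← potForm_conj, potForm_add hv Ψ.2 Φ.2 Φ'.2, map_add, potForm_conj, potForm_conj]
      simp only [Submodule.coe_add, e, weakMagD_add (Φ.2.1 _ _) (Φ'.2.1 _ _), inner_add_left,
        Finset.sum_add_distrib, Finset.sum_sub_distrib, mul_add]
      ring)
    (fun c Φ Ψ => by
      have e : potForm N v a (c • Φ : L2 N) Ψ = conj c * potForm N v a Φ Ψ := by
        rw [← potForm_conj, potForm_smul, map_mul, potForm_conj]
      simp only [Submodule.coe_smul, e, weakMagD_smul c (Φ.2.1 _ _), inner_smul_left,
        smul_eq_mul, mul_add, Finset.mul_sum, mul_sub, mul_left_comm _ (conj c)])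
    (fun Φ Ψ Ψ' => by
      simp only [Submodule.coe_add, potForm_add hv Φ.2 Ψ.2 Ψ'.2,
        weakMagD_add (Ψ.2.1 _ _) (Ψ'.2.1 _ _), inner_add_right,
        Finset.sum_add_distrib, Finset.sum_sub_distrib, mul_add]
      ring)
    (fun c Φ Ψ => by
      simp only [Submodule.coe_smul, potForm_smul, weakMagD_smul c (Ψ.2.1 _ _), inner_smul_right,
        RingHom.id_apply, smul_eq_mul, mul_add, Finset.mul_sum, mul_sub, mul_left_comm _ c])

/-- The Hamiltonian `H_a = ∑_i ((-i∇_i - x_i^⊥)² - 2) + ∑_{i<j} v_a(|x_i - x_j|)` on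
`L²(ℝ^{2N})`, as the operator associated with its quadratic form. -/
def hamiltonian (N : ℕ) {v : ℝ → ℝ≥0∞} (hv : Measurable v) (a : ℝ) : L2 N →ₗ.[ℂ] L2 N :=
  formOperator (formDomain N hv a) (hamForm N hv a)

/-! ### The spaces `𝔅_ℓ` and the limiting operators `𝔥_ℓ` -/

/-- `Ψ = exp(-½ ∑ |x_i|²) φ(z_1, …, z_N) ∏_{i<j} (z_i - z_j)^ℓ` with `φ` entire. -/
def IsLLLRep {N : ℕ} (ℓ : ℕ) (Ψ : L2 N) (φ : Config N → ℂ) : Prop :=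
  Differentiable ℂ φ ∧ Ψ =ᵐ[volume] fun z =>
    (Real.exp (-(1 / 2) * ∑ i, ‖z i‖ ^ 2) : ℂ) * φ z * ∏ p : Pair N, (z p.1.1 - z p.1.2) ^ ℓ

/-- The space `𝔅_ℓ`. -/
def spaceB (N ℓ : ℕ) : Submodule ℂ (L2 N) where
  carrier := {Ψ | ∃ φ, IsLLLRep ℓ Ψ φ}
  zero_mem' := ⟨0, differentiable_const _, by
    filter_upwards [Lp.coeFn_zero ℂ 2 (volume : Measure (Config N))] with z _
    simp⟩
  add_mem' := by
    rintro Ψ Φ ⟨φ, h1, h2⟩ ⟨η, h3, h4⟩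
    refine ⟨φ + η, h1.add h3, ?_⟩
    filter_upwards [Lp.coeFn_add Ψ Φ, h2, h4] with z e1 e2 e3
    rw [e1, Pi.add_apply, e2, e3, Pi.add_apply]
    ring
  smul_mem' := by
    rintro c Ψ ⟨φ, h1, h2⟩
    refine ⟨c • φ, h1.const_smul c, ?_⟩
    filter_upwards [Lp.coeFn_smul c Ψ, h2] with z e1 e2
    rw [e1, Pi.smul_apply, e2, Pi.smul_apply, smul_eq_mul, smul_eq_mul]
    ring

/-- The configuration in which particle `i` sits at the position of particle `j`, for a pair
`p = (i, j)`, given the positions of all the particles but `i`. -/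
def collapse {N : ℕ} (p : Pair N) (y : {k : Fin N // k ≠ p.1.1} → ℂ) : Config N :=
  fun k => if h : k ≠ p.1.1 then y ⟨k, h⟩ else y ⟨p.1.2, p.2.ne'⟩

/-- The density of `⟨Ψ, 𝔇_{ij} Ψ⟩` for `p = (i, j)`, where `Ψ` is given by the entire function `φ`:
writing `φ ∏_{k<l} (z_k - z_l)^ℓ = ξ · (z_i - z_j)^ℓ`, this is
`exp(-∑_{k≠i,j} |x_k|²) exp(-2|x_j|²) |ξ|²` at `z_i = z_j`; the exponential is
`exp(-∑_k |z_k|²)` at the collapsed configuration. -/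
def pairDensity {N : ℕ} (ℓ : ℕ) (φ : Config N → ℂ) (p : Pair N)
    (y : {k : Fin N // k ≠ p.1.1} → ℂ) : ℝ :=
  Real.exp (-∑ k, ‖collapse p y k‖ ^ 2) *
    ‖φ (collapse p y) *
      ∏ q ∈ Finset.univ.erase p, (collapse p y q.1.1 - collapse p y q.1.2) ^ ℓ‖ ^ 2

/-- `T` is the bounded operator `𝔥_ℓ = ∑_{i<j} 𝔇_{ij}` on `𝔅_ℓ`, given through its quadratic form
`⟨Ψ, 𝔥_ℓ Ψ⟩ = ∑_{i<j} ∫ pairDensity`. -/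
def IsPseudoHamiltonian (N ℓ : ℕ) (T : spaceB N ℓ →L[ℂ] spaceB N ℓ) : Prop :=
  ∀ (Ψ : spaceB N ℓ) (φ : Config N → ℂ), IsLLLRep ℓ (Ψ : L2 N) φ →
    (∀ p : Pair N, Integrable (pairDensity ℓ φ p)) ∧
    ⟪Ψ, T Ψ⟫_ℂ = ((∑ p : Pair N, ∫ y, pairDensity ℓ φ p y : ℝ) : ℂ)

open scoped Classical in
/-- The operator `𝔥_ℓ` on `𝔅_ℓ` (zero if it did not exist uniquely). -/
def pseudoHamiltonian (N ℓ : ℕ) : spaceB N ℓ →L[ℂ] spaceB N ℓ :=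
  if h : ∃! T, IsPseudoHamiltonian N ℓ T then h.choose else 0

/-! ### The scattering parameters -/

/-- `g = (g 0, g 1)` is the weak gradient of `f : ℝ² → ℝ`. -/
def IsWeakGradient (f : ℂ → ℝ) (g : Fin 2 → ℂ → ℝ) : Prop :=
  LocallyIntegrable f ∧ ∀ k, LocallyIntegrable (g k) ∧
    ∀ χ : ℂ → ℝ, ContDiff ℝ ∞ χ → HasCompactSupport χ →
      ∫ x, f x * fderiv ℝ χ x (dir k) = -∫ x, g k x * χ x

/-- `∫ |x|^{2ℓ} (|∇f|² + ½ v(|x|) |f|²) dx`, with `g` the gradient of `f`. -/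
def scatteringEnergy (v : ℝ → ℝ≥0∞) (ℓ : ℕ) (f : ℂ → ℝ) (g : Fin 2 → ℂ → ℝ) : ℝ≥0∞ :=
  ∫⁻ x, ENNReal.ofReal (‖x‖ ^ (2 * ℓ)) *
    (ENNReal.ofReal (∑ k, g k x ^ 2) + v ‖x‖ / 2 * ENNReal.ofReal (f x ^ 2))

/-- The `ℓ`-wave scattering parameter `b_ℓ`, for `ℓ ≥ 1`. -/
def scatteringParam (v : ℝ → ℝ≥0∞) (ℓ : ℕ) : ℝ :=
  1 / (4 * Real.pi * ℓ) * (⨅ (f : ℂ → ℝ) (g : Fin 2 → ℂ → ℝ) (_ : IsWeakGradient f g)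
    (_ : Tendsto f (cocompact ℂ) (𝓝 1)), scatteringEnergy v ℓ f g).toReal

end QHall

end

open MeasureTheory Filter Topology Complex
open scoped ENNReal ContDiff ComplexConjugate InnerProductSpace

noncomputable section

namespace QHall

open Real (sq_sqrt norm_of_nonneg norm_eq_abs sqrt_sq exp_pos sqrt_nonneg pi_pos)
open ENNReal (rpow_natCast rpow_mul toReal_pow mul_ne_top ofReal_le_ofReal tendsto_ofReal
  tendsto_toReal toReal_mul toReal_nonneg ofReal_toReal toReal_le_of_le_ofReal mul_lt_top
  ofReal_lt_top ofReal_ne_top ofReal_coe_nnreal toReal_ofReal toReal_sum toReal_mono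
  ofReal_sum_of_nonneg toReal_add ofNat_ne_top)
open Finset (single_le_sum mem_univ sum_nonneg sum_add_distrib sum_eq_single mul_sum sum_congr
  prod_insert univ ne_of_mem_erase sum_comm sum_sub_distrib sum_mul sum_le_sum)
open Set (uIoc mem_iInter mem_setOf_eq indicator_of_mem indicator_of_notMem Iic indicator_nonneg
  Ioc Ioi Icc uIcc_of_le)
open Metric (closedBall ball)
open Fintype (card)
open Pi (single)
open Continuous (intervalIntegrable)
open intervalIntegral (integral_add_adjacent_intervals integral_of_le integral_mono_on
  integral_eq_sub_of_hasDerivAt integral_hasDerivAt_right integral_mono_interval)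
open scoped Real

local notation "toE" => ENNReal.ofReal
local notation "𝓝₊" => 𝓝[>] (0 : ℝ)
local notation:67 f:68 "⋆ᵥ" g:67 => convolution f g (ContinuousLinearMap.lsmul ℝ ℝ) volume

variable {N l : ℕ} {ε Q : ℝ} {v : ℝ → ℝ≥0∞} {k F V : ℝ → ℝ} {φ χ : Config N → ℂ} {Ψ : L2 N}


/-! ### Resolvents of closed nonnegative forms -/

section FormResolvent

variable {H : Type*} [NormedAddCommGroup H] [InnerProductSpace ℂ H]

/-- A nonnegative Hermitian form which is complete in its form norm. -/
structure IsClosedForm (Q : Submodule ℂ H) (q : Q →ₗ⋆[ℂ] Q →ₗ[ℂ] ℂ) : Prop where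
  symm : ∀ u w, conj (q u w) = q w u
  nonneg : ∀ u, 0 ≤ (q u u).re
  complete : ∀ u : ℕ → Q, (∀ ε > 0, ∃ n₀, ∀ m ≥ n₀, ∀ n ≥ n₀,
      ‖((u m - u n : Q) : H)‖ ^ 2 + (q (u m - u n) (u m - u n)).re < ε) →
    ∃ w : Q, Tendsto (fun n => ‖((u n - w : Q) : H)‖ ^ 2 + (q (u n - w) (u n - w)).re) atTop (𝓝 0)

/-- The form domain, as a type without topology. -/
def FormSpace (Q : Submodule ℂ H) : Type _ := Q

instance (Q : Submodule ℂ H) : AddCommGroup (FormSpace Q) := inferInstanceAs (AddCommGroup Q)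
instance (Q : Submodule ℂ H) : Module ℂ (FormSpace Q) := inferInstanceAs (Module ℂ Q)

/-- The identification of `FormSpace Q` with `Q`. -/
def toForm {Q : Submodule ℂ H} : FormSpace Q ≃ₗ[ℂ] Q := LinearEquiv.refl ℂ Q

variable {Q : Submodule ℂ H} {q : Q →ₗ⋆[ℂ] Q →ₗ[ℂ] ℂ}

theorem IsClosedForm.eq_zero (hq : IsClosedForm Q q) {μ c : ℝ} (hμ : 0 < μ) (hc : 0 < c) {d : Q}
    (h : (μ : ℂ) * ⟪(d : H), (d : H)⟫_ℂ + (c : ℂ) * q d d = 0) : d = 0 := by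
  have h1 := congrArg Complex.re h
  rw [add_re, re_ofReal_mul, re_ofReal_mul, zero_re, show (⟪(d : H), (d : H)⟫_ℂ).re = ‖(d : H)‖ ^ 2
    from inner_self_eq_norm_sq (𝕜 := ℂ) _] at h1
  have h2 := mul_nonneg hc.le (hq.nonneg d)
  have h3 : μ * ‖(d : H)‖ ^ 2 = 0 := le_antisymm (by linarith) (by positivity)
  simpa [hμ.ne'] using h3

/-- The inner product `μ ⟨u, w⟩ + c q(u, w)` on the form domain. -/
@[reducible] def IsClosedForm.core (hq : IsClosedForm Q q) {μ c : ℝ} (hμ : 0 < μ) (hc : 0 < c) :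
    InnerProductSpace.Core ℂ (FormSpace Q) where
  inner u w := (μ : ℂ) * ⟪(toForm u : H), (toForm w : H)⟫_ℂ
    + (c : ℂ) * q (toForm u) (toForm w)
  conj_inner_symm u w := by simp only [map_add, map_mul, conj_ofReal, inner_conj_symm, hq.symm]
  re_inner_nonneg u := by
    have h1 := hq.nonneg (toForm u)
    have h2 : 0 ≤ (⟪(toForm u : H), (toForm u : H)⟫_ℂ).re :=
      inner_self_nonneg (𝕜 := ℂ)
    simp only [RCLike.re_to_complex, add_re, re_ofReal_mul]
    positivity
  add_left u u' w := by
    simp only [map_add, Submodule.coe_add, inner_add_left, LinearMap.add_apply]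
    ring
  smul_left u w r := by
    simp only [map_smul, Submodule.coe_smul, inner_smul_left, LinearMap.map_smulₛₗ,
      LinearMap.smul_apply, smul_eq_mul]
    ring
  definite u h := toForm.map_eq_zero_iff.1 (hq.eq_zero hμ hc h)

variable [CompleteSpace H]

theorem exists_adjoint_factor {K : Type*} [NormedAddCommGroup K] [InnerProductSpace ℂ K]
    [CompleteSpace K] (J : K →L[ℂ] H) :
    ∃ R : H →L[ℂ] H, ∀ ψ, ∃ k, R ψ = J k ∧ ∀ k', ⟪k', k⟫_ℂ = ⟪J k', ψ⟫_ℂ :=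
  ⟨J ∘L J.adjoint, fun ψ => ⟨J.adjoint ψ, rfl, fun k' => J.adjoint_inner_right k' ψ⟩⟩

/-- The weak form of the resolvent equation is solvable. -/
theorem IsClosedForm.exists_weak_resolvent (hq : IsClosedForm Q q) {μ c : ℝ} (hμ : 0 < μ)
    (hc : 0 < c) : ∃ R : H →L[ℂ] H, ∀ ψ, ∃ h : R ψ ∈ Q, ∀ w : Q,
      (μ : ℂ) * ⟪(w : H), R ψ⟫_ℂ + (c : ℂ) * q w ⟨R ψ, h⟩ = ⟪(w : H), ψ⟫_ℂ := by
  let core := hq.core hμ hc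
  let _ : NormedAddCommGroup (FormSpace Q) := core.toNormedAddCommGroup
  let _ : InnerProductSpace ℂ (FormSpace Q) := InnerProductSpace.ofCore core.toCore
  have hinner : ∀ u w : FormSpace Q, ⟪u, w⟫_ℂ =
      (μ : ℂ) * ⟪(toForm u : H), (toForm w : H)⟫_ℂ
        + (c : ℂ) * q (toForm u) (toForm w) := fun u w => rfl
  have hnorm : ∀ u : FormSpace Q, ‖u‖ ^ 2 =
      μ * ‖(toForm u : H)‖ ^ 2 + c * (q (toForm u) (toForm u)).re := by
    intro u
    have h1 : ‖u‖ ^ 2 = (⟪u, u⟫_ℂ).re := (inner_self_eq_norm_sq (𝕜 := ℂ) u).symm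
    rw [h1, hinner, add_re, re_ofReal_mul, re_ofReal_mul]
    congr 2
    exact inner_self_eq_norm_sq (𝕜 := ℂ) _
  have _ : CompleteSpace (FormSpace Q) := by
    refine Metric.complete_of_cauchySeq_tendsto fun u hu => ?_
    have hm : 0 < min μ c := lt_min hμ hc
    obtain ⟨w, hw⟩ := hq.complete (fun n => toForm (u n)) (fun ε hε => by
      obtain ⟨n₀, h⟩ := Metric.cauchySeq_iff.1 hu (√(min μ c * ε)) (by positivity)
      refine ⟨n₀, fun m hm' n hn => ?_⟩
      have h1 := h m hm' n hn
      rw [dist_eq_norm, Real.lt_sqrt (norm_nonneg _)] at h1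
      rw [hnorm] at h1
      rw [map_sub] at h1
      have h2 := hq.nonneg (toForm (u m) - toForm (u n))
      have h3 := sq_nonneg ‖((toForm (u m) - toForm (u n) : Q) : H)‖
      have h4 := mul_le_mul_of_nonneg_right (min_le_left μ c) h3
      have h5 := mul_le_mul_of_nonneg_right (min_le_right μ c) h2
      refine lt_of_mul_lt_mul_left (a := min μ c) ?_ hm.le
      refine lt_of_le_of_lt ?_ h1
      rw [mul_add]
      exact add_le_add h4 h5)
    refine ⟨toForm.symm w, tendsto_iff_norm_sub_tendsto_zero.2 ?_⟩
    have hM : ∀ n, ‖u n - toForm.symm w‖ ≤ √(max μ c * (‖((toForm (u n) - w : Q) : H)‖ ^ 2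
        + (q (toForm (u n) - w) (toForm (u n) - w)).re)) := by
      intro n
      refine Real.le_sqrt_of_sq_le ?_
      rw [hnorm]
      rw [map_sub, LinearEquiv.apply_symm_apply, mul_add]
      have h2 := hq.nonneg (toForm (u n) - w)
      gcongr
      · exact le_max_left _ _
      · exact le_max_right _ _
    refine squeeze_zero (fun n => norm_nonneg _) hM ?_
    simpa using (hw.const_mul (max μ c)).sqrt
  let J : FormSpace Q →L[ℂ] H := LinearMap.mkContinuous (Q.subtype ∘ₗ toForm.toLinearMap) (√μ)⁻¹ (fun u => by
    have h1 := hnorm u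
    have h2 := hq.nonneg (toForm u)
    have h3 : μ * ‖(toForm u : H)‖ ^ 2 ≤ ‖u‖ ^ 2 := by rw [h1]; nlinarith
    rw [← div_eq_inv_mul, le_div_iff₀ (by positivity)]
    refine (pow_le_pow_iff_left₀ (by positivity) (norm_nonneg _) two_ne_zero).1 ?_
    rw [mul_pow, sq_sqrt hμ.le, mul_comm]
    exact h3)
  obtain ⟨R, hR⟩ := exists_adjoint_factor J
  refine ⟨R, fun ψ => ?_⟩
  obtain ⟨k, hk, hk'⟩ := hR ψ
  have hk0 : R ψ = (toForm k : H) := hk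
  refine ⟨hk0 ▸ (toForm k).2, fun w => ?_⟩
  have h1 := hk' (toForm.symm w)
  rw [hinner, LinearEquiv.apply_symm_apply] at h1
  have e : (⟨R ψ, hk0 ▸ (toForm k).2⟩ : Q) = (toForm k) := Subtype.ext hk0
  rw [e, hk0]
  exact h1

theorem inner_starProjection (w : Q) (ψ : H) :
    ⟪(w : H), Q.topologicalClosure.starProjection ψ⟫_ℂ = ⟪(w : H), ψ⟫_ℂ := by
  rw [← Submodule.inner_starProjection_left_eq_right,
    Submodule.starProjection_eq_self_iff.2 (Q.le_topologicalClosure w.2)]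

theorem formOperator_domain_iff (u : H) : u ∈ (formOperator Q q).domain ↔
    ∃ f, (u, f) ∈ formGraph Q q := by
  simp [formOperator, Submodule.toLinearPMap_domain]

theorem formOperator_mem_graph (u : (formOperator Q q).domain) :
    ((u : H), formOperator Q q u) ∈ formGraph Q q :=
  Submodule.mem_graph_toLinearPMap (formGraph_single_valued Q q) u

theorem formOperator_eq {u f : H} (h : (u, f) ∈ formGraph Q q)
    (hu : u ∈ (formOperator Q q).domain) : formOperator Q q ⟨u, hu⟩ = f := by
  have h1 := (formGraph Q q).sub_mem (formOperator_mem_graph ⟨u, hu⟩) h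
  have h2 := formGraph_single_valued Q q _ h1 (by simp)
  exact sub_eq_zero.1 h2

theorem formOperator_closure_domain (hq : IsClosedForm Q q) :
    (formOperator Q q).domain.topologicalClosure = Q.topologicalClosure := by
  have hd : (formOperator Q q).domain.topologicalClosure ≤ Q.topologicalClosure :=
    Submodule.topologicalClosure_mono fun u hu => by
      obtain ⟨f, hf⟩ := (formOperator_domain_iff u).1 hu
      exact hf.2.1
  refine le_antisymm hd ?_
  obtain ⟨R, hR⟩ := hq.exists_weak_resolvent one_pos one_pos
  refine Submodule.topologicalClosure_minimal _ (fun x hx => ?_)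
    (Submodule.isClosed_topologicalClosure _)
  set D := (formOperator Q q).domain.topologicalClosure
  have hRD : ∀ ψ, R ψ ∈ (formOperator Q q).domain := by
    intro ψ
    obtain ⟨h, hw⟩ := hR ψ
    refine (formOperator_domain_iff _).2 ⟨Q.topologicalClosure.starProjection ψ - R ψ, ?_, h, ?_⟩
    · exact Submodule.sub_mem _ (Submodule.starProjection_apply_mem _ _)
        (Q.le_topologicalClosure h)
    · intro w
      have h1 := hw w
      simp only [ofReal_one, one_mul] at h1
      simp only [inner_sub_right, inner_starProjection, ← h1]
      ring
  set y := x - D.starProjection x with hy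
  have hyQ : y ∈ Q.topologicalClosure := Submodule.sub_mem _ (Q.le_topologicalClosure hx)
    (hd (Submodule.starProjection_apply_mem _ _))
  have hyD : ∀ d ∈ D, ⟪d, y⟫_ℂ = 0 := fun d hd' =>
    Submodule.inner_right_of_mem_orthogonal hd' (Submodule.sub_starProjection_mem_orthogonal x)
  obtain ⟨h, hw⟩ := hR y
  have h1 := hw ⟨R y, h⟩
  rw [hyD _ (Submodule.le_topologicalClosure _ (hRD y))] at h1
  have e := hq.eq_zero one_pos one_pos h1
  have h6 : ∀ w ∈ Q, ⟪w, y⟫_ℂ = 0 := fun w hw' => by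
    rw [← hw ⟨w, hw'⟩, e, show R y = 0 from congrArg Subtype.val e]
    simp
  have h7 : y ∈ {w : H | ⟪w, y⟫_ℂ = 0} :=
    closure_minimal (fun w hw => h6 w hw) (isClosed_eq (by fun_prop) continuous_const) hyQ
  rw [sub_eq_zero.1 (inner_self_eq_zero.1 h7)]
  exact Submodule.starProjection_apply_mem _ _

/-- The resolvent of the operator of a closed nonnegative form exists, is unique, and satisfies
the weak resolvent equation. -/
theorem IsClosedForm.resolvent (hq : IsClosedForm Q q) {μ c : ℝ} (hμ : 0 < μ) (hc : 0 < c) :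
    (∃! R, IsResolvent ((c : ℂ) • formOperator Q q) μ R) ∧
    ∀ ψ, ∃ h : resolventAt ((c : ℂ) • formOperator Q q) μ ψ ∈ Q, ∀ w : Q,
      (μ : ℂ) * ⟪(w : H), resolventAt ((c : ℂ) • formOperator Q q) μ ψ⟫_ℂ
        + (c : ℂ) * q w ⟨_, h⟩ = ⟪(w : H), ψ⟫_ℂ := by
  have hc' : (c : ℂ) ≠ 0 := ofReal_ne_zero.2 hc.ne'
  have key : ∀ R, IsResolvent ((c : ℂ) • formOperator Q q) μ R ↔ ∀ ψ, ∃ h : R ψ ∈ Q, ∀ w : Q,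
      (μ : ℂ) * ⟪(w : H), R ψ⟫_ℂ + (c : ℂ) * q w ⟨R ψ, h⟩ = ⟪(w : H), ψ⟫_ℂ := by
    intro R
    have hdom : ((c : ℂ) • formOperator Q q).domain.topologicalClosure = Q.topologicalClosure :=
      formOperator_closure_domain hq
    refine forall_congr' fun ψ => ⟨?_, ?_⟩
    · rintro ⟨h, he⟩
      obtain ⟨-, h1, h2⟩ := formOperator_mem_graph ⟨R ψ, h⟩
      refine ⟨h1, fun w => ?_⟩
      rw [← inner_starProjection w ψ]
      simp only [hdom] at he
      rw [← he, inner_add_right, inner_smul_right, LinearPMap.smul_apply, inner_smul_right, h2 w]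
    · rintro ⟨h, hw⟩
      have hg : (R ψ, (c : ℂ)⁻¹ • (Q.topologicalClosure.starProjection ψ - (μ : ℂ) • R ψ)) ∈
          formGraph Q q := by
        refine ⟨?_, h, fun w => ?_⟩
        · exact Submodule.smul_mem _ _ (Submodule.sub_mem _ (Submodule.starProjection_apply_mem _ _)
            (Submodule.smul_mem _ _ (Q.le_topologicalClosure h)))
        · rw [inner_smul_right, inner_sub_right, inner_starProjection, ← hw w, inner_smul_right]
          field_simp
          ring
      have hd : R ψ ∈ (formOperator Q q).domain := (formOperator_domain_iff _).2 ⟨_, hg⟩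
      refine ⟨hd, ?_⟩
      simp only [hdom]
      rw [LinearPMap.smul_apply, formOperator_eq hg hd, smul_inv_smul₀ hc']
      abel
  have hex : ∃! R, IsResolvent ((c : ℂ) • formOperator Q q) μ R := by
    obtain ⟨R, hR⟩ := hq.exists_weak_resolvent hμ hc
    refine ⟨R, (key R).2 hR, fun R' hR' => ?_⟩
    ext ψ
    obtain ⟨h, hw⟩ := hR ψ
    obtain ⟨h', hw'⟩ := (key R').1 hR' ψ
    have h1 := (hw' (⟨R' ψ, h'⟩ - ⟨R ψ, h⟩)).trans (hw (⟨R' ψ, h'⟩ - ⟨R ψ, h⟩)).symm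
    set d : Q := ⟨R' ψ, h'⟩ - ⟨R ψ, h⟩ with hd
    have h2 : (μ : ℂ) * ⟪(d : H), (d : H)⟫_ℂ + (c : ℂ) * q d d = 0 := by
      have e1 : (d : H) = R' ψ - R ψ := rfl
      have e2 : ⟪(d : H), (d : H)⟫_ℂ = ⟪(d : H), R' ψ⟫_ℂ - ⟪(d : H), R ψ⟫_ℂ := by
        rw [← inner_sub_right, ← e1]
      have e3 : q d d = q d ⟨R' ψ, h'⟩ - q d ⟨R ψ, h⟩ := by rw [← map_sub]
      rw [e2, e3]
      linear_combination h1
    exact sub_eq_zero.1 (congrArg Subtype.val (hq.eq_zero hμ hc h2))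
  refine ⟨hex, ?_⟩
  refine (key _).1 ?_
  rw [resolventAt, dif_pos hex]
  exact hex.choose_spec.1

end FormResolvent

/-! ### Square integrals and mollification -/

section Mollify

theorem eLpNorm_two_sq {α E : Type*} [MeasurableSpace α] {μ : Measure α} [NormedAddCommGroup E]
    (f : α → E) : eLpNorm f 2 μ ^ 2 = ∫⁻ x, ‖f x‖ₑ ^ 2 ∂μ := by
  rw [eLpNorm_eq_lintegral_rpow_enorm_toReal (by simp) (by simp), ← rpow_natCast,
    ← rpow_mul]
  simp

theorem memLp_two_of_lintegral {α E : Type*} [MeasurableSpace α] {μ : Measure α}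
    [NormedAddCommGroup E] {f : α → E} (hf : AEStronglyMeasurable f μ)
    (h : ∫⁻ x, ‖f x‖ₑ ^ 2 ∂μ < ⊤) : MemLp f 2 μ := by
  refine ⟨hf, ?_⟩
  rw [← eLpNorm_two_sq] at h
  exact (ENNReal.pow_lt_top_iff.1 h).resolve_right (by simp)

theorem MemLp.lintegral_sq_lt_top {α E : Type*} [MeasurableSpace α] {μ : Measure α}
    [NormedAddCommGroup E] {f : α → E} (hf : MemLp f 2 μ) : ∫⁻ x, ‖f x‖ₑ ^ 2 ∂μ < ⊤ := by
  rw [← eLpNorm_two_sq]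
  exact ENNReal.pow_lt_top hf.2

theorem enorm_Lp_sq {α E : Type*} [MeasurableSpace α] {μ : Measure α} [NormedAddCommGroup E]
    (f : Lp E 2 μ) : ‖f‖ₑ ^ 2 = ∫⁻ x, ‖f x‖ₑ ^ 2 ∂μ := by
  rw [← eLpNorm_two_sq, Lp.enorm_def]

theorem norm_Lp_sq {α E : Type*} [MeasurableSpace α] {μ : Measure α} [NormedAddCommGroup E]
    (f : Lp E 2 μ) : ‖f‖ ^ 2 = (∫⁻ x, ‖f x‖ₑ ^ 2 ∂μ).toReal := by
  rw [← enorm_Lp_sq, toReal_pow, toReal_enorm]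

variable {E : Type*} [NormedAddCommGroup E] [NormedSpace ℝ E] [FiniteDimensional ℝ E]
  [MeasurableSpace E] [BorelSpace E]

/-- Bump functions with radii `1 / (n + 1)` and `2 / (n + 1)`. -/
def shrinkingBump (E : Type*) [NormedAddCommGroup E] [NormedSpace ℝ E] [HasContDiffBump E] (n : ℕ) :
    ContDiffBump (0 : E) :=
  ⟨1 / (n + 1), 2 / (n + 1), by positivity, by gcongr; norm_num⟩

theorem tendsto_shrinkingBump_rOut : Tendsto (fun n => (shrinkingBump E n).rOut) atTop (𝓝 0) := by
  have h := (tendsto_one_div_add_atTop_nhds_zero_nat (𝕜 := ℝ)).const_mul 2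
  simp only [mul_zero, mul_one_div] at h
  exact h

open scoped Convolution in
theorem ae_tendsto_mollify {F : Type*} [NormedAddCommGroup F] [NormedSpace ℝ F] [CompleteSpace F]
    (μ : Measure E) [μ.IsAddHaarMeasure] {g : E → F} (hg : LocallyIntegrable g μ) :
    ∀ᵐ x ∂μ, Tendsto (fun n => ((shrinkingBump E n).normed μ
      ⋆[ContinuousLinearMap.lsmul ℝ ℝ, μ] g) x) atTop (𝓝 (g x)) := by
  refine ContDiffBump.ae_convolution_tendsto_right_of_locallyIntegrable (K := 2)
    tendsto_shrinkingBump_rOut (.of_forall fun n => ?_) hg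
  simp [shrinkingBump, mul_one_div, ← div_eq_mul_inv]

end Mollify

/-! ### The magnetic form identity -/

section MagneticForm

theorem L2_inner_eq {α : Type*} [MeasurableSpace α] {μ : Measure α} (f g : Lp ℂ 2 μ) :
    ⟪f, g⟫_ℂ = ∫ z, conj (f z) * g z ∂μ := by
  rw [L2.inner_def]
  simp [mul_comm]

theorem inner_toLp {α : Type*} [MeasurableSpace α] {μ : Measure α} {f : α → ℂ} (hf : MemLp f 2 μ)
    (g : Lp ℂ 2 μ) : ⟪hf.toLp f, g⟫_ℂ = ∫ z, conj (f z) * g z ∂μ := by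
  rw [L2_inner_eq]
  refine integral_congr_ae ?_
  filter_upwards [hf.coeFn_toLp] with z hz
  rw [hz]

/-- `vecPot k` as a linear form. -/
def vecPotL (k : Fin 2) : ℂ →L[ℝ] ℝ := ![-imCLM, reCLM] k

theorem vecPotL_apply (k : Fin 2) (w : ℂ) : vecPotL k w = vecPot k w := by
  fin_cases k <;> simp [vecPotL, vecPot]

theorem vecPot_sub (k : Fin 2) (w w' : ℂ) : vecPot k (w - w') = vecPot k w - vecPot k w' := by
  simp only [← vecPotL_apply, map_sub]

theorem contDiff_vecPot (i : Fin N) (k : Fin 2) :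
    ContDiff ℝ ∞ fun z : Config N => (vecPot k (z i) : ℂ) := by
  simp only [← vecPotL_apply]
  exact ofRealCLM.contDiff.comp ((vecPotL k).contDiff.comp (contDiff_apply ℝ ℂ i))

theorem fderiv_vecPot (i : Fin N) (k k' : Fin 2) (z : Config N) :
    fderiv ℝ (fun z : Config N => (vecPot k (z i) : ℂ)) z (single i (dir k'))
      = vecPot k (dir k') := by
  have : (fun z : Config N => (vecPot k (z i) : ℂ)) =
      (ofRealCLM.comp ((vecPotL k).comp (ContinuousLinearMap.proj i)) : Config N →L[ℝ] ℂ) := by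
    ext z
    simp [vecPotL_apply]
  rw [this, ContinuousLinearMap.fderiv]
  simp [vecPotL_apply]

theorem contDiff_fderiv_apply (h : ContDiff ℝ ∞ χ) (d : Config N) :
    ContDiff ℝ ∞ fun z => fderiv ℝ χ z d :=
  (h.fderiv_right (m := ∞) (by simp)).clm_apply contDiff_const

theorem contDiff_magD (i : Fin N) (k : Fin 2) (h : ContDiff ℝ ∞ χ) : ContDiff ℝ ∞ (magD i k χ) := by
  unfold magD
  exact (contDiff_const.mul (contDiff_fderiv_apply h _)).sub ((contDiff_vecPot i k).mul h)

theorem magD_commutator (i : Fin N) (h : ContDiff ℝ ∞ χ) (z : Config N) :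
    magD i 1 (magD i 0 χ) z - magD i 0 (magD i 1 χ) z = -2 * I * χ z := by
  have hd : Differentiable ℝ χ := h.differentiable (by simp)
  have key : ∀ k k' : Fin 2, fderiv ℝ (magD i k χ) z (single i (dir k')) =
      -I * fderiv ℝ (fderiv ℝ χ) z (single i (dir k')) (single i (dir k))
      - (vecPot k (dir k') * χ z + vecPot k (z i) * fderiv ℝ χ z (single i (dir k'))) := by
    intro k k'
    have h1 : HasFDerivAt (fun z => fderiv ℝ χ z (single i (dir k)))
        ((fderiv ℝ (fderiv ℝ χ) z).flip (single i (dir k))) z := by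
      have := ((h.fderiv_right (m := ∞) (by simp)).differentiable (by simp) z).hasFDerivAt
      simpa using this.clm_apply (hasFDerivAt_const (single i (dir k)) z)
    have h2 : HasFDerivAt (fun z : Config N => (vecPot k (z i) : ℂ))
      (fderiv ℝ (fun z : Config N => (vecPot k (z i) : ℂ)) z) z :=
      ((contDiff_vecPot i k).differentiable (by simp) z).hasFDerivAt
    have h3 := (h1.const_mul (-I)).sub (h2.mul (hd z).hasFDerivAt)
    have h4 : HasFDerivAt (magD i k χ) _ z := h3
    rw [h4.fderiv]
    simp only [ContinuousLinearMap.sub_apply, ContinuousLinearMap.smul_apply,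
      ContinuousLinearMap.flip_apply, ContinuousLinearMap.add_apply, fderiv_vecPot, smul_eq_mul]
    ring
  have hs : fderiv ℝ (fderiv ℝ χ) z (single i (dir 0)) (single i (dir 1)) =
      fderiv ℝ (fderiv ℝ χ) z (single i (dir 1)) (single i (dir 0)) :=
    (h.contDiffAt.isSymmSndFDerivAt (by
      rw [minSmoothness_of_isRCLikeNormedField]
      exact WithTop.coe_le_coe.2 (le_top : (2 : ℕ∞) ≤ ⊤))).eq _ _
  have e : ∀ (k : Fin 2) (η : Config N → ℂ), magD i k η z =
    -I * fderiv ℝ η z (single i (dir k)) - (vecPot k (z i) : ℂ) * η z := fun _ _ => rfl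
  rw [e 1 (magD i 0 χ), e 0 (magD i 1 χ), key, key, hs, e 0 χ, e 1 χ]
  simp only [vecPot, dir, Matrix.cons_val_zero, Matrix.cons_val_one, I_im, one_re]
  push_cast
  linear_combination (0 : ℂ)

theorem magD_mul (i : Fin N) (k : Fin 2) {θ : Config N → ℂ} {z : Config N}
    (hθ : DifferentiableAt ℝ θ z) (hχ : DifferentiableAt ℝ χ z) :
    magD i k (fun z => θ z * χ z) z = θ z * magD i k χ z
      - I * fderiv ℝ θ z (single i (dir k)) * χ z := by
  have : fderiv ℝ (fun z => θ z * χ z) z = θ z • fderiv ℝ χ z + χ z • fderiv ℝ θ z :=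
    (hθ.hasFDerivAt.mul hχ.hasFDerivAt).fderiv
  simp only [magD, this, ContinuousLinearMap.add_apply, ContinuousLinearMap.smul_apply, smul_eq_mul]
  ring

theorem integrable_conj_mul_memLp {α : Type*} [MeasurableSpace α] {μ : Measure α} {f g : α → ℂ}
    (hf : MemLp f 2 μ) (hg : MemLp g 2 μ) : Integrable (fun z => conj (f z) * g z) μ :=
  (show MemLp (fun z => conj (f z)) 2 μ from hf.star).integrable_mul hg

theorem memLp_test (h : Continuous χ) (hs : HasCompactSupport χ) :
    MemLp χ 2 := h.memLp_of_hasCompactSupport hs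

/-- The magnetic derivative of a mollified function. -/
theorem magD_mollify {i : Fin N} {k : Fin 2} {u g : L2 N} (h : HasWeakMagD i k u g)
    {ρ : Config N → ℝ} (hρ : ContDiff ℝ ∞ ρ) (hs : HasCompactSupport ρ) (z : Config N) :
    magD i k (ρ ⋆ᵥ u) z = (ρ ⋆ᵥ g) z - ∫ t, (ρ t * vecPot k (t i) : ℂ) * u (z - t) := by
  have hu : LocallyIntegrable u := (Lp.memLp u).locallyIntegrable (by norm_num)
  set d : Config N := single i (dir k) with hd
  have hD := hs.hasFDerivAt_convolution_left (μ := (volume : Measure (Config N)))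
    (ContinuousLinearMap.lsmul ℝ ℝ) (hρ.of_le (by simp)) hu z
  have hint : Integrable (fun t => ((ContinuousLinearMap.lsmul ℝ ℝ : ℝ →L[ℝ] ℂ →L[ℝ] ℂ).precompL
      (Config N)) (fderiv ℝ ρ t) (u (z - t))) :=
    (hs.fderiv ℝ).convolutionExists_left _ (hρ.continuous_fderiv (by simp)) hu z
  have hDd : fderiv ℝ (ρ ⋆ᵥ u) z d =
      ∫ t, ((fderiv ℝ ρ t d : ℝ) : ℂ) * u (z - t) := by
    rw [hD.fderiv, convolution_def, ContinuousLinearMap.integral_apply hint]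
    refine integral_congr_ae (.of_forall fun t => ?_)
    simp [ContinuousLinearMap.precompL_apply, real_smul]
  have hloc : ∀ {η : Config N → ℝ}, Continuous η → HasCompactSupport η →
      Integrable (fun t => (η t : ℂ) * u (z - t)) := by
    intro η hη hηs
    simpa [ConvolutionExistsAt, real_smul] using hηs.convolutionExists_left (ContinuousLinearMap.lsmul ℝ ℝ : ℝ →L[ℝ] ℂ →L[ℝ] ℂ)
      hη hu z
  -- the test function `y ↦ ρ (z - y)`
  have hχ : ContDiff ℝ ∞ fun y => (ρ (z - y) : ℂ) :=
    ofRealCLM.contDiff.comp (hρ.comp (contDiff_const.sub contDiff_id))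
  have hχs : HasCompactSupport fun y => (ρ (z - y) : ℂ) := by
    have h1 : HasCompactSupport fun y => ρ (z - y) := hs.comp_homeomorph (Homeomorph.subLeft z)
    exact h1.comp_left (g := fun r : ℝ => (r : ℂ)) rfl
  have hw := h _ hχ hχs
  have hfd : ∀ y, fderiv ℝ (fun y => (ρ (z - y) : ℂ)) y d = -(fderiv ℝ ρ (z - y) d : ℂ) := by
    intro y
    have h1 : HasFDerivAt (fun y => z - y) (-ContinuousLinearMap.id ℝ (Config N)) y :=
      (hasFDerivAt_id y).const_sub z
    have h2 : HasFDerivAt (fun y => ρ (z - y)) _ y :=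
      (hρ.differentiable (by simp) (z - y)).hasFDerivAt.comp y h1
    have h3 : HasFDerivAt (fun y => (ρ (z - y) : ℂ)) _ y := ofRealCLM.hasFDerivAt.comp y h2
    rw [h3.fderiv]
    simp
  have e1 : ∫ y, conj (ρ (z - y) : ℂ) * g y =
      (ρ ⋆ᵥ g) z := by
    rw [convolution_def, ← integral_sub_left_eq_self _ volume z]
    refine integral_congr_ae (.of_forall fun t => ?_)
    simp [conj_ofReal, real_smul]
  have e2 : ∫ y, conj (magD i k (fun y => (ρ (z - y) : ℂ)) y) * u y =
      ∫ t, (-I * (((fderiv ℝ ρ t d : ℝ) : ℂ) * u (z - t))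
        - (vecPot k (z i) : ℂ) * ((ρ t : ℂ) * u (z - t))
        + (ρ t * vecPot k (t i) : ℂ) * u (z - t)) := by
    rw [← integral_sub_left_eq_self _ volume z]
    refine integral_congr_ae (.of_forall fun t => ?_)
    simp only [magD, ← hd, hfd, sub_sub_cancel, map_sub, map_mul, map_neg, conj_I, conj_ofReal,
      Pi.sub_apply, vecPot_sub, ofReal_sub]
    ring
  have i1 := (hloc (hρ.continuous_fderiv (by simp) |>.clm_apply continuous_const)
    ((hs.fderiv (𝕜 := ℝ)).comp_left (g := fun L : Config N →L[ℝ] ℝ => L d) rfl)).const_mul (-I)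
  have i2 := (hloc hρ.continuous hs).const_mul (vecPot k (z i) : ℂ)
  have i3 : Integrable (fun t => (ρ t * vecPot k (t i) : ℂ) * u (z - t)) := by
    have h3 : Continuous fun t : Config N => vecPot k (t i) := by
      simp only [← vecPotL_apply]; fun_prop
    simpa using hloc (hρ.continuous.mul h3) (hs.mul_right (f' := fun t : Config N => vecPot k (t i)))
  have i12 : Integrable (fun t => -I * (((fderiv ℝ ρ t d : ℝ) : ℂ) * u (z - t))
        - (vecPot k (z i) : ℂ) * ((ρ t : ℂ) * u (z - t))) := i1.sub i2
  rw [e1, e2, integral_add i12 i3, integral_sub i1 i2, integral_const_mul,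
    integral_const_mul, ← hDd] at hw
  rw [hw]
  simp only [magD, ← hd]
  have e3 : (ρ ⋆ᵥ u) z = ∫ t, (ρ t : ℂ) * u (z - t) := by
    rw [convolution_def]
    simp [real_smul]
  rw [e3]
  ring

end MagneticForm

section MagneticFormIdentity

/-- A smooth cutoff at scale `n + 1`. -/
def cutoff (N n : ℕ) (z : Config N) : ℝ :=
  (⟨1, 2, one_pos, one_lt_two⟩ : ContDiffBump (0 : Config N)) (((n : ℝ) + 1)⁻¹ • z)

theorem contDiff_cutoff (n : ℕ) : ContDiff ℝ ∞ (cutoff N n) :=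
  (ContDiffBump.contDiff _).comp (contDiff_const_smul _)

theorem hasCompactSupport_cutoff (n : ℕ) : HasCompactSupport (cutoff N n) :=
  (ContDiffBump.hasCompactSupport _).comp_smul (by positivity)

theorem cutoff_nonneg (n : ℕ) (z : Config N) : 0 ≤ cutoff N n z := ContDiffBump.nonneg _

theorem cutoff_le_one (n : ℕ) (z : Config N) : cutoff N n z ≤ 1 := ContDiffBump.le_one _

theorem cutoff_eq_one (z : Config N) : ∀ᶠ n in atTop, cutoff N n z = 1 := by
  obtain ⟨n₀, h⟩ := exists_nat_ge ‖z‖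
  filter_upwards [eventually_ge_atTop n₀] with n hn
  refine ContDiffBump.one_of_mem_closedBall _ ?_
  rw [mem_closedBall_zero_iff, norm_smul, norm_inv, norm_of_nonneg (by positivity),
    inv_mul_le_iff₀ (by positivity)]
  have : (n₀ : ℝ) ≤ n := by exact_mod_cast hn
  simp only [mul_one]
  linarith

theorem exists_fderiv_cutoff_le (N : ℕ) : ∃ C : ℝ, 0 ≤ C ∧ ∀ n (z d : Config N),
    |fderiv ℝ (cutoff N n) z d| ≤ C * ‖d‖ / (n + 1) := by
  set θ : ContDiffBump (0 : Config N) := ⟨1, 2, one_pos, one_lt_two⟩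
  have hc : Continuous (fderiv ℝ θ) := θ.contDiff.continuous_fderiv (n := ∞) (by simp)
  obtain ⟨C, hC⟩ := (hc.norm).bounded_above_of_compact_support
    ((θ.hasCompactSupport.fderiv (𝕜 := ℝ)).norm)
  refine ⟨C, (norm_nonneg _).trans (hC 0), fun n z d => ?_⟩
  have h1 : HasFDerivAt (cutoff N n)
      ((fderiv ℝ θ (((n : ℝ) + 1)⁻¹ • z)).comp (((n : ℝ) + 1)⁻¹ • ContinuousLinearMap.id ℝ _)) z :=
    (θ.contDiff.differentiable (n := ∞) (by simp) _).hasFDerivAt.comp z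
      ((hasFDerivAt_id z).const_smul (((n : ℝ) + 1)⁻¹))
  rw [h1.fderiv]
  simp only [ContinuousLinearMap.comp_smul, ContinuousLinearMap.smul_apply,
    ContinuousLinearMap.comp_apply, ContinuousLinearMap.id_apply, smul_eq_mul, abs_mul]
  rw [abs_of_pos (by positivity : (0 : ℝ) < ((n : ℝ) + 1)⁻¹), div_eq_inv_mul]
  gcongr
  have h2 := (fderiv ℝ θ (((n : ℝ) + 1)⁻¹ • z)).le_opNorm d
  have h3 := hC (((n : ℝ) + 1)⁻¹ • z)
  rw [norm_of_nonneg (norm_nonneg _)] at h3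
  rw [← norm_eq_abs]
  refine h2.trans ?_
  gcongr

theorem norm_dir (k : Fin 2) : ‖dir k‖ = 1 := by fin_cases k <;> simp [dir]

theorem tendsto_lintegral_enorm_sq_zero {α E : Type*} [MeasurableSpace α] {μ : Measure α}
    [NormedAddCommGroup E] {f : ℕ → α → E} {g : α → E} (hf : ∀ n, AEStronglyMeasurable (f n) μ)
    (hg : MemLp g 2 μ) (hle : ∀ n, ∀ᵐ x ∂μ, ‖f n x‖ ≤ ‖g x‖)
    (hlim : ∀ᵐ x ∂μ, Tendsto (fun n => f n x) atTop (𝓝 0)) :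
    Tendsto (fun n => ∫⁻ x, ‖f n x‖ₑ ^ 2 ∂μ) atTop (𝓝 0) := by
  have := tendsto_lintegral_of_dominated_convergence' (μ := μ) (F := fun n x => ‖f n x‖ₑ ^ 2)
    (f := fun _ => 0) (fun x => ‖g x‖ₑ ^ 2) (fun n => (hf n).enorm.pow_const 2)
    (fun n => by
      filter_upwards [hle n] with x hx
      have : ‖f n x‖ₑ ≤ ‖g x‖ₑ := enorm_le_iff_norm_le.2 hx
      gcongr) (MemLp.lintegral_sq_lt_top hg).ne (by
      filter_upwards [hlim] with x hx
      have := ENNReal.Tendsto.pow (n := 2) hx.enorm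
      simpa using this)
  simpa using this

theorem continuous_integral_translate {𝕜 : Type*} [RCLike 𝕜] {f g : Config N → 𝕜} (hf : MemLp f 2)
    (hg : MemLp g 2) : Continuous fun t => ∫ z, inner 𝕜 (f (z - t)) (g z) := by
  have hT : ∀ t : Config N, MeasurePreserving
      ((ContinuousMap.mk fun x : Config N × Config N => x.2 - x.1).curry t) :=
    measurePreserving_sub_right volume
  have hF := ((continuous_const (y := hf.toLp)).compMeasurePreservingLp
    (ContinuousMap.continuous _) hT (by simp)).inner (𝕜 := 𝕜) (continuous_const (y := hg.toLp))
  refine hF.congr fun t => ?_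
  rw [L2.inner_def, Lp.toLp_compMeasurePreserving hf (hT t)]
  refine integral_congr_ae ?_
  filter_upwards [hg.coeFn_toLp, (hf.comp_measurePreserving (hT t)).coeFn_toLp] with z h1 h2
  rw [h1, h2]
  rfl

/-- The average of `a f` over a small ball. -/
def mollify (n : ℕ) (a : Config N → ℝ) (f : Config N → ℂ) (z : Config N) : ℂ :=
  ∫ t, ((shrinkingBump (Config N) n).normed volume t * a t : ℂ) * f (z - t)

/-- Mollifications converge weakly. -/
theorem tendsto_integral_mollify {a : Config N → ℝ} (ha : Continuous a) {f g : Config N → ℂ}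
    (hf : MemLp f 2) (hg : MemLp g 2) : (∀ n, Integrable fun z => conj (mollify n a f z) * g z) ∧
      Tendsto (fun n => ∫ z, conj (mollify n a f z) * g z) atTop
        (𝓝 (a 0 * ∫ z, conj (f z) * g z)) := by
  set ρ : ℕ → Config N → ℝ := fun n => (shrinkingBump (Config N) n).normed volume
  set c : Config N → ℂ := fun t => a t * ∫ z, inner ℂ (f (z - t)) (g z)
  have hc : Continuous c := by have := continuous_integral_translate hf hg; fun_prop
  have hint : ∀ n, Integrable (Function.uncurry fun z t =>
      (ρ n t * a t : ℂ) * inner ℂ (f (z - t)) (g z)) (volume.prod volume) := fun n => by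
    have hρ : Continuous (ρ n) := ContDiffBump.continuous_normed _
    have hft : ∀ t, MemLp (fun z => f (z - t)) 2 := fun t =>
      hf.comp_measurePreserving (measurePreserving_sub_right volume t)
    refine (integrable_prod_iff' ?_).2 ⟨.of_forall fun t => ?_, ?_⟩
    · exact ((Continuous.aestronglyMeasurable (by fun_prop)).mul
        ((hf.1.comp_quasiMeasurePreserving
          (quasiMeasurePreserving_sub_of_right_invariant volume volume)).inner hg.1.comp_fst))
    · simpa [Function.uncurry_def, mul_comm] using
        (integrable_conj_mul_memLp (hft t) hg).mul_const (a t * ρ n t : ℂ)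
    · have h1 := continuous_integral_translate hf.norm hg.norm
      refine ((Continuous.integrable_of_hasCompactSupport (f := fun t => |ρ n t| * (|a t| *
        ∫ z, inner ℝ ‖f (z - t)‖ ‖g z‖)) (by fun_prop) ?_)).congr (.of_forall fun t => ?_)
      · exact ((ContDiffBump.hasCompactSupport_normed _).norm).mul_right
      · simp only [Function.uncurry_def, norm_mul, norm_real, integral_const_mul, norm_eq_abs]
        simp [mul_comm]
        ring
  have hsw : ∀ n z, conj (mollify n a f z) * g z = ∫ t, (ρ n t * a t : ℂ) * inner ℂ (f (z - t)) (g z) :=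
    fun n z => by
      rw [mollify, ← integral_conj, ← integral_mul_const]
      refine integral_congr_ae (.of_forall fun t => ?_)
      simp [ρ]
      ring
  simp only [hsw]
  refine ⟨fun n => (hint n).integral_prod_left, ?_⟩
  have h2 := ContDiffBump.convolution_tendsto_right_of_continuous (μ := volume)
    (tendsto_shrinkingBump_rOut (E := Config N)) (hc.comp continuous_neg) 0
  convert h2 using 2 with n
  · rw [integral_integral_swap (hint n), convolution_def]
    simp [integral_const_mul, c, ρ, mul_assoc]
  · simp [c, mul_comm]

theorem tendsto_integral_cutoff {F : Config N → ℂ} (hF : Integrable F) :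
    Tendsto (fun n => ∫ z, (cutoff N n z : ℂ) * F z) atTop (𝓝 (∫ z, F z)) := by
  refine tendsto_integral_of_dominated_convergence (fun z => ‖F z‖) (fun n =>
    (continuous_ofReal.comp (contDiff_cutoff n).continuous).aestronglyMeasurable.mul hF.1) hF.norm
    (fun n => .of_forall fun z => ?_) (.of_forall fun z => ?_)
  · rw [norm_mul, norm_real, norm_of_nonneg (cutoff_nonneg n z)]
    exact mul_le_of_le_one_left (norm_nonneg _) (cutoff_le_one n z)
  · refine tendsto_const_nhds.congr' ?_
    filter_upwards [cutoff_eq_one z] with n hn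
    simp [hn]

theorem continuous_fderiv_cutoff (n : ℕ) (d : Config N) :
    Continuous fun z => fderiv ℝ (cutoff N n) z d :=
  ((contDiff_cutoff n).continuous_fderiv (by simp)).clm_apply continuous_const

theorem tendsto_integral_fderiv_cutoff {F : Config N → ℂ} (hF : Integrable F) (d : Config N) :
    Tendsto (fun n => ∫ z, (fderiv ℝ (cutoff N n) z d : ℂ) * F z) atTop (𝓝 0) := by
  obtain ⟨C, hC0, hC⟩ := exists_fderiv_cutoff_le N
  refine squeeze_zero_norm (a := fun n : ℕ => C * ‖d‖ * (∫ z, ‖F z‖) * (1 / ((n : ℝ) + 1)))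
    (fun n => ?_) (by
      simpa using (tendsto_one_div_add_atTop_nhds_zero_nat (𝕜 := ℝ)).const_mul (C * ‖d‖ * ∫ z, ‖F z‖))
  refine (norm_integral_le_of_norm_le (hF.norm.const_mul (C * ‖d‖ / (n + 1)))
    (.of_forall fun z => ?_)).trans_eq ?_
  · rw [norm_mul, norm_real]
    exact mul_le_mul_of_nonneg_right (hC n z d) (norm_nonneg _)
  · rw [integral_const_mul]; ring

theorem convolution_eq_mollify (n : ℕ) (u : L2 N) :
    (shrinkingBump (Config N) n).normed volume ⋆ᵥ u = mollify n (fun _ => 1) u := by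
  ext z
  rw [convolution_def, mollify]
  simp

theorem contDiff_mollify (n : ℕ) (u : L2 N) : ContDiff ℝ ∞ (mollify n (fun _ => 1) u) := by
  rw [← convolution_eq_mollify]
  exact (ContDiffBump.hasCompactSupport_normed _).contDiff_convolution_left _
    (ContDiffBump.contDiff_normed _ (n := ⊤)) ((Lp.memLp u).locallyIntegrable (by norm_num))

theorem memLp_ofReal_mul {b : Config N → ℝ} (hb : Continuous b) (hs : HasCompactSupport b)
    (G : L2 N) : MemLp (fun z => (b z : ℂ) * G z) 2 :=
  (Lp.memLp G).mul (p := ∞) ((continuous_ofReal.comp hb).memLp_of_hasCompactSupport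
    (hs.comp_left (g := fun r : ℝ => (r : ℂ)) rfl))

theorem tendsto_integral_magD_mollify {i : Fin N} {k : Fin 2} {u g : L2 N}
    (h : HasWeakMagD i k u g) (m : ℕ) (G : L2 N) :
    Tendsto (fun n => ∫ z, conj (magD i k (fun z => (cutoff N m z : ℂ) *
      mollify n (fun _ => 1) u z) z) * G z) atTop
      (𝓝 ((∫ z, (cutoff N m z : ℂ) * (conj (g z) * G z)) +
        I * ∫ z, (fderiv ℝ (cutoff N m) z (single i (dir k)) : ℂ) * (conj (u z) * G z))) := by
  set d : Config N := single i (dir k) with hd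
  have h1 := memLp_ofReal_mul (contDiff_cutoff m).continuous (hasCompactSupport_cutoff m) G
  have h2 := memLp_ofReal_mul (continuous_fderiv_cutoff m d)
    ((hasCompactSupport_cutoff m).fderiv_apply (𝕜 := ℝ) d) G
  have hA : Continuous fun t : Config N => vecPot k (t i) := by
    simp only [← vecPotL_apply]; fun_prop
  obtain ⟨i1, l1⟩ := tendsto_integral_mollify (a := fun _ => 1) continuous_const (Lp.memLp g) h1
  obtain ⟨i2, l2⟩ := tendsto_integral_mollify hA (Lp.memLp u) h1
  obtain ⟨i3, l3⟩ := tendsto_integral_mollify (a := fun _ => 1) continuous_const (Lp.memLp u) h2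
  have hl := (l1.sub l2).add (l3.const_mul I)
  convert hl using 2 with n
  · rw [← integral_const_mul, ← integral_sub (i1 n) (i2 n)]
    refine .trans (integral_congr_ae (.of_forall fun z => ?_))
      (integral_add ((i1 n).sub (i2 n)) ((i3 n).const_mul I))
    have hθ : HasFDerivAt (fun z => (cutoff N m z : ℂ)) (ofRealCLM.comp (fderiv ℝ (cutoff N m) z)) z :=
      ofRealCLM.hasFDerivAt.comp z ((contDiff_cutoff m).differentiable (by simp) z).hasFDerivAt
    simp only
    rw [magD_mul i k hθ.differentiableAt ((contDiff_mollify n u).differentiable (by simp) z),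
      hθ.fderiv, ← convolution_eq_mollify, magD_mollify h (ContDiffBump.contDiff_normed _)
      (ContDiffBump.hasCompactSupport_normed _), convolution_eq_mollify, convolution_eq_mollify]
    simp [mollify, ← hd]
    ring
  · have h0 : vecPot k 0 = 0 := by rw [← vecPotL_apply, map_zero]
    simp [h0, mul_left_comm]

/-- The canonical commutation relation in weak form. -/
theorem inner_weakMagD_commutator {i : Fin N} {u : L2 N} {g : Fin 2 → L2 N}
    (h : ∀ k, HasWeakMagD i k u (g k)) : ⟪g 0, g 1⟫_ℂ - ⟪g 1, g 0⟫_ℂ = 2 * I * ⟪u, u⟫_ℂ := by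
  have key : ∀ χ : Config N → ℂ, ContDiff ℝ ∞ χ → HasCompactSupport χ →
      (∫ z, conj (magD i 0 χ z) * g 1 z) - ∫ z, conj (magD i 1 χ z) * g 0 z =
        2 * I * ∫ z, conj (χ z) * u z := fun χ hχ hs => by
    have c0 := contDiff_magD i 0 hχ
    have c1 := contDiff_magD i 1 hχ
    have s0 := hasCompactSupport_magD i 0 hs
    have s1 := hasCompactSupport_magD i 1 hs
    rw [h 1 _ c0 s0, h 0 _ c1 s1, ← integral_sub
      (integrable_conj_mul (continuous_magD i 1 c0) (hasCompactSupport_magD i 1 s0) _)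
      (integrable_conj_mul (continuous_magD i 0 c1) (hasCompactSupport_magD i 0 s1) _),
      ← integral_const_mul]
    refine integral_congr_ae (.of_forall fun z => ?_)
    have := congrArg conj (magD_commutator i hχ z)
    simp only [map_sub, map_mul, map_neg, conj_I, map_ofNat] at this
    simp only [← sub_mul, this]
    ring
  have hi : ∀ f f' : L2 N, Integrable fun z => conj (f z) * f' z := fun f f' =>
    integrable_conj_mul_memLp (Lp.memLp f) (Lp.memLp f')
  have hl := fun k f => (tendsto_integral_cutoff (hi (g k) f)).add
    ((tendsto_integral_fderiv_cutoff (hi u f) (single i (dir k))).const_mul I)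
  have := tendsto_nhds_unique ((hl 0 (g 1)).sub (hl 1 (g 0)))
    (((tendsto_integral_cutoff (hi u u)).const_mul (2 * I)).congr fun m => ?_)
  · rw [L2_inner_eq, L2_inner_eq, L2_inner_eq]
    simpa using this
  refine tendsto_nhds_unique ?_ ((tendsto_integral_magD_mollify (h 0) m (g 1)).sub
    (tendsto_integral_magD_mollify (h 1) m (g 0)))
  have hu := (tendsto_integral_mollify (a := fun _ => 1) continuous_const (Lp.memLp u)
    (memLp_ofReal_mul (contDiff_cutoff m).continuous (hasCompactSupport_cutoff m) u)).2.const_mul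
    (2 * I)
  convert hu using 2 with n
  · refine (key _ ((ofRealCLM.contDiff.comp (contDiff_cutoff m)).mul (contDiff_mollify n u))
      (((hasCompactSupport_cutoff m).comp_left (g := fun r : ℝ => (r : ℂ)) rfl).mul_right)).trans ?_
    congr 2 with z
    simp
    ring
  · simp [mul_left_comm]

end MagneticFormIdentity

section ClosedForm

/-- The weak annihilation operator `D₀ + i D₁` in the variable of particle `i`. -/
def annih (i : Fin N) (u : L2 N) : L2 N := weakMagD i 0 u + I • weakMagD i 1 u

theorem norm_weakMagD_sq {i : Fin N} {u : L2 N} (h : ∀ k, ∃ g, HasWeakMagD i k u g) :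
    ‖weakMagD i 0 u‖ ^ 2 + ‖weakMagD i 1 u‖ ^ 2 = ‖annih i u‖ ^ 2 + 2 * ‖u‖ ^ 2 := by
  have h1 := inner_weakMagD_commutator (g := fun k => weakMagD i k u) fun k => weakMagD_spec (h k)
  have h2 : ‖annih i u‖ ^ 2 = ‖weakMagD i 0 u‖ ^ 2 + 2 * RCLike.re ⟪weakMagD i 0 u, I • weakMagD i 1 u⟫_ℂ
      + ‖I • weakMagD i 1 u‖ ^ 2 := norm_add_sq _ _
  rw [norm_smul, norm_I, one_mul, inner_smul_right] at h2
  rw [← inner_conj_symm (weakMagD i 1 u), inner_self_eq_norm_sq_to_K] at h1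
  have h3 := congrArg Complex.im h1
  have h4 : (2 * I * (((‖u‖ : ℝ) : ℂ) ^ 2)).im = 2 * ‖u‖ ^ 2 := by
    rw [← ofReal_pow]
    simp only [mul_im, mul_re, I_re, I_im, ofReal_re, ofReal_im, re_ofNat, im_ofNat]
    ring
  replace h3 := h3.trans h4
  simp only [sub_im, conj_im, RCLike.re_to_complex, I_mul_re] at h3 h2
  linarith

theorem norm_weakMagD_sq_le {i : Fin N} {u : L2 N} (h : ∀ k, ∃ g, HasWeakMagD i k u g) (k : Fin 2) :
    ‖weakMagD i k u‖ ^ 2 ≤ ‖annih i u‖ ^ 2 + 2 * ‖u‖ ^ 2 := by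
  rw [← norm_weakMagD_sq h]
  fin_cases k
  · exact le_add_of_nonneg_right (sq_nonneg _)
  · exact le_add_of_nonneg_left (sq_nonneg _)

theorem inner_weakMagD_self {i : Fin N} {u : L2 N} (h : ∀ k, ∃ g, HasWeakMagD i k u g) :
    (∑ k, ⟪weakMagD i k u, weakMagD i k u⟫_ℂ - 2 * ⟪u, u⟫_ℂ) = ((‖annih i u‖ ^ 2 : ℝ) : ℂ) := by
  have h1 := norm_weakMagD_sq h
  simp only [Fin.sum_univ_two, inner_self_eq_norm_sq_to_K, coe_algebraMap]
  norm_cast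
  linarith

theorem weakMagD_sub {i : Fin N} {k : Fin 2} {u w : L2 N} (hu : ∃ g, HasWeakMagD i k u g)
    (hw : ∃ g, HasWeakMagD i k w g) : weakMagD i k (u - w) = weakMagD i k u - weakMagD i k w := by
  have h := weakMagD_add hu ⟨_, hw.choose_spec.smul (-1)⟩
  rw [weakMagD_smul _ hw] at h
  simpa [sub_eq_add_neg] using h

theorem annih_sub {i : Fin N} {u w : L2 N} (hu : ∀ k, ∃ g, HasWeakMagD i k u g)
    (hw : ∀ k, ∃ g, HasWeakMagD i k w g) : annih i (u - w) = annih i u - annih i w := by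
  rw [annih, weakMagD_sub (hu 0) (hw 0), weakMagD_sub (hu 1) (hw 1), annih, annih, smul_sub]
  abel

/-- The interaction energy. -/
def potEnergy (N : ℕ) (v : ℝ → ℝ≥0∞) (a : ℝ) (u : L2 N) : ℝ≥0∞ :=
  ∫⁻ z, interaction N v a z * ‖u z‖ₑ ^ 2

theorem potForm_self (hv : Measurable v) {a : ℝ} {u : L2 N}
    (h : u ∈ formDomain N hv a) : potForm N v a u u = ((potEnergy N v a u).toReal : ℂ) := by
  have hm : AEMeasurable (fun z => interaction N v a z * ‖u z‖ₑ ^ 2) :=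
    (measurable_interaction hv a).aemeasurable.mul ((Lp.aestronglyMeasurable u).enorm.pow_const 2)
  rw [potEnergy, ← integral_toReal hm (ae_lt_top' hm h.2.ne), ← integral_complex_ofReal, potForm]
  refine integral_congr_ae (.of_forall fun z => ?_)
  simp only [toReal_mul, toReal_pow, toReal_enorm, conj_mul']
  push_cast
  ring

theorem hamForm_self (hv : Measurable v) {a : ℝ} (u : formDomain N hv a) : hamForm N hv a u u =
      ((∑ i, ‖annih i (u : L2 N)‖ ^ 2 + (potEnergy N v a (u : L2 N)).toReal : ℝ) : ℂ) := by
  have h : hamForm N hv a u u = ∑ i, (∑ k, ⟪weakMagD i k (u : L2 N), weakMagD i k (u : L2 N)⟫_ℂ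
      - 2 * ⟪(u : L2 N), (u : L2 N)⟫_ℂ) + potForm N v a u u := rfl
  rw [h, potForm_self hv u.2]
  simp only [inner_weakMagD_self (u.2.1 _)]
  push_cast
  rfl

theorem hamForm_conj (hv : Measurable v) {a : ℝ} (u w : formDomain N hv a) :
    conj (hamForm N hv a u w) = hamForm N hv a w u := by
  have h : ∀ u w, hamForm N hv a u w =
      ∑ i, (∑ k, ⟪weakMagD i k (u : L2 N), weakMagD i k (w : L2 N)⟫_ℂ
      - 2 * ⟪(u : L2 N), (w : L2 N)⟫_ℂ) + potForm N v a u w := fun _ _ => rfl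
  rw [h, h]
  simp only [map_add, map_sum, map_sub, map_mul, inner_conj_symm, potForm_conj, map_ofNat]

theorem HasWeakMagD.of_tendsto {i : Fin N} {k : Fin 2} {u g : ℕ → L2 N} {u' g' : L2 N}
    (h : ∀ n, HasWeakMagD i k (u n) (g n)) (hu : Tendsto u atTop (𝓝 u'))
    (hg : Tendsto g atTop (𝓝 g')) : HasWeakMagD i k u' g' := by
  intro χ hχ hs
  have m1 := memLp_test hχ.continuous hs
  have m2 := memLp_test (continuous_magD i k hχ) (hasCompactSupport_magD i k hs)
  rw [← inner_toLp m1, ← inner_toLp m2]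
  refine tendsto_nhds_unique ((tendsto_const_nhds (x := m1.toLp)).inner hg) ?_
  refine ((tendsto_const_nhds (x := m2.toLp)).inner hu).congr fun n => ?_
  rw [inner_toLp, inner_toLp, h n χ hχ hs]

theorem potEnergy_le_of_tendsto (hv : Measurable v) {a : ℝ} {u : ℕ → L2 N}
    {u' : L2 N} (hu : Tendsto u atTop (𝓝 u')) {C : ℝ≥0∞}
    (h : ∀ᶠ n in atTop, potEnergy N v a (u n) ≤ C) : potEnergy N v a u' ≤ C := by
  have h1 : TendstoInMeasure volume (fun n => (u n : Config N → ℂ)) atTop u' :=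
    tendstoInMeasure_of_tendsto_Lp hu
  obtain ⟨ns, hns, hlim⟩ := h1.exists_seq_tendsto_ae
  have h2 : ∫⁻ z, liminf (fun n => interaction N v a z * ‖u (ns n) z‖ₑ ^ 2) atTop ≤
      liminf (fun n => ∫⁻ z, interaction N v a z * ‖u (ns n) z‖ₑ ^ 2) atTop :=
    lintegral_liminf_le' fun n => (measurable_interaction hv a).aemeasurable.mul
      ((Lp.aestronglyMeasurable _).enorm.pow_const 2)
  have h3 : liminf (fun n => ∫⁻ z, interaction N v a z * ‖u (ns n) z‖ₑ ^ 2) atTop ≤ C :=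
    liminf_le_of_frequently_le' (hns.tendsto_atTop.eventually h).frequently
  refine le_trans (lintegral_mono_ae ?_) (h2.trans h3)
  filter_upwards [hlim] with z hz
  have h4 : Tendsto (fun n => ‖u (ns n) z‖ₑ ^ 2) atTop (𝓝 (‖u' z‖ₑ ^ 2)) :=
    ENNReal.Tendsto.pow hz.enorm
  rcases eq_or_ne (u' z) 0 with h0 | h0
  · simp [h0]
  · refine le_of_eq (Tendsto.liminf_eq ?_).symm
    exact ENNReal.Tendsto.const_mul h4 (Or.inl (by simpa using h0))

/-- The form of the Hamiltonian is closed. -/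
theorem isClosedForm_hamForm (hv : Measurable v) (a : ℝ) :
    IsClosedForm (formDomain N hv a) (hamForm N hv a) where
  symm u w := hamForm_conj hv u w
  nonneg u := by
    rw [hamForm_self, ofReal_re]
    positivity
  complete u hu := by
    have hD : ∀ n (i : Fin N) k, HasWeakMagD i k (u n : L2 N) (weakMagD i k (u n : L2 N)) :=
      fun n i k => weakMagD_spec ((u n).2.1 i k)
    simp only [hamForm_self, ofReal_re] at hu ⊢
    have hsub : ∀ m n (i : Fin N) k, weakMagD i k ((u m - u n : formDomain N hv a) : L2 N) =
        weakMagD i k (u m : L2 N) - weakMagD i k (u n : L2 N) := fun m n i k =>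
      weakMagD_sub ((u m).2.1 i k) ((u n).2.1 i k)
    have hbound : ∀ w : formDomain N hv a, ∀ (i : Fin N) k, ‖weakMagD i k (w : L2 N)‖ ^ 2 ≤
        2 * (‖(w : L2 N)‖ ^ 2 + (∑ i, ‖annih i (w : L2 N)‖ ^ 2
          + (potEnergy N v a (w : L2 N)).toReal)) := by
      intro w i k
      have h1 := norm_weakMagD_sq_le (w.2.1 i) k
      have h2 : ‖annih i (w : L2 N)‖ ^ 2 ≤ ∑ i, ‖annih i (w : L2 N)‖ ^ 2 :=
        single_le_sum (f := fun i => ‖annih i (w : L2 N)‖ ^ 2)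
          (fun _ _ => sq_nonneg _) (mem_univ i)
      have h3 : 0 ≤ (potEnergy N v a (w : L2 N)).toReal := toReal_nonneg
      have h5 := sq_nonneg ‖annih i (w : L2 N)‖
      linarith
    have hc1 : CauchySeq fun n => (u n : L2 N) := by
      refine Metric.cauchySeq_iff.2 fun ε hε => ?_
      obtain ⟨n₀, h⟩ := hu (ε ^ 2) (by positivity)
      refine ⟨n₀, fun m hm n hn => ?_⟩
      have h1 := h m hm n hn
      rw [dist_eq_norm]
      refine lt_of_pow_lt_pow_left₀ 2 hε.le (lt_of_le_of_lt ?_ h1)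
      have : 0 ≤ ∑ i, ‖annih i ((u m - u n : formDomain N hv a) : L2 N)‖ ^ 2 :=
        sum_nonneg fun _ _ => sq_nonneg _
      have : 0 ≤ (potEnergy N v a ((u m - u n : formDomain N hv a) : L2 N)).toReal := toReal_nonneg
      push_cast at *
      linarith
    have hc2 : ∀ (i : Fin N) k, CauchySeq fun n => weakMagD i k (u n : L2 N) := by
      intro i k
      refine Metric.cauchySeq_iff.2 fun ε hε => ?_
      obtain ⟨n₀, h⟩ := hu (ε ^ 2 / 2) (by positivity)
      refine ⟨n₀, fun m hm n hn => ?_⟩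
      have h1 := h m hm n hn
      rw [dist_eq_norm, ← hsub]
      refine lt_of_pow_lt_pow_left₀ 2 hε.le (lt_of_le_of_lt (hbound _ i k) ?_)
      linarith
    obtain ⟨u', hu'⟩ := cauchySeq_tendsto_of_complete hc1
    have hc2' := fun i k => cauchySeq_tendsto_of_complete (hc2 i k)
    choose g hg using hc2'
    have hW : ∀ i k, HasWeakMagD i k u' (g i k) := fun i k =>
      HasWeakMagD.of_tendsto (fun n => hD n i k) hu' (hg i k)
    have hpot : ∀ ε > 0, ∃ n₀, ∀ n ≥ n₀, potEnergy N v a ((u n : L2 N) - u') ≤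
        toE ε := by
      intro ε hε
      obtain ⟨n₀, h⟩ := hu ε hε
      refine ⟨n₀, fun n hn => ?_⟩
      refine potEnergy_le_of_tendsto hv (u := fun m => (u n : L2 N) - (u m : L2 N))
        (tendsto_const_nhds.sub hu') ?_
      filter_upwards [eventually_ge_atTop n₀] with m hm
      have h1 := h n hn m hm
      have h2 : 0 ≤ ∑ i, ‖annih i ((u n - u m : formDomain N hv a) : L2 N)‖ ^ 2 :=
        sum_nonneg fun _ _ => sq_nonneg _
      have h3 := sq_nonneg ‖((u n - u m : formDomain N hv a) : L2 N)‖
      have h4 : potEnergy N v a ((u n - u m : formDomain N hv a) : L2 N) ≠ ⊤ := (u n - u m).2.2.ne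
      change potEnergy N v a ((u n - u m : formDomain N hv a) : L2 N) ≤ _
      rw [← ofReal_toReal h4]
      exact ofReal_le_ofReal (by linarith)
    obtain ⟨n₀, hn₀⟩ := hpot 1 one_pos
    have hdiff : (u n₀ : L2 N) - u' ∈ formDomain N hv a := by
      refine ⟨fun i k => ⟨weakMagD i k (u n₀ : L2 N) + (-1 : ℂ) • g i k, ?_⟩, lt_of_le_of_lt (hn₀ n₀ le_rfl) (by simp)⟩
      rw [sub_eq_add_neg, ← neg_one_smul ℂ u']
      exact (hD n₀ i k).add ((hW i k).smul (-1))
    have hmem : u' ∈ formDomain N hv a := by simpa using (formDomain N hv a).sub_mem (u n₀).2 hdiff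
    refine ⟨⟨u', hmem⟩, ?_⟩
    have hg' : ∀ i k, g i k = weakMagD i k u' := fun i k =>
      (hW i k).unique (weakMagD_spec ⟨_, hW i k⟩)
    have t1 : Tendsto (fun n => ‖((u n - ⟨u', hmem⟩ : formDomain N hv a) : L2 N)‖ ^ 2) atTop
        (𝓝 0) := by
      simpa using ((tendsto_iff_norm_sub_tendsto_zero.1 hu').pow 2)
    have t2 : Tendsto (fun n => ∑ i, ‖annih i ((u n - ⟨u', hmem⟩ : formDomain N hv a) : L2 N)‖ ^ 2)
        atTop (𝓝 0) := by
      rw [show (0 : ℝ) = ∑ i : Fin N, 0 by simp]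
      refine tendsto_finset_sum _ fun i _ => ?_
      have h1 : ∀ n, annih i ((u n - ⟨u', hmem⟩ : formDomain N hv a) : L2 N) =
          annih i (u n : L2 N) - annih i u' := fun n => annih_sub ((u n).2.1 i) (hmem.1 i)
      simp only [h1]
      have h2 : Tendsto (fun n => annih i (u n : L2 N)) atTop (𝓝 (annih i u')) := by
        rw [annih, ← hg', ← hg']
        exact (hg i 0).add ((hg i 1).const_smul I)
      simpa using ((tendsto_iff_norm_sub_tendsto_zero.1 h2).pow 2)
    have t3 : Tendsto (fun n => (potEnergy N v a
        ((u n - ⟨u', hmem⟩ : formDomain N hv a) : L2 N)).toReal) atTop (𝓝 0) := by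
      rw [Metric.tendsto_atTop]
      intro ε hε
      obtain ⟨n₀, h⟩ := hpot (ε / 2) (by positivity)
      refine ⟨n₀, fun n hn => ?_⟩
      rw [Real.dist_0_eq_abs, abs_of_nonneg toReal_nonneg]
      have := toReal_le_of_le_ofReal (by positivity) (h n hn)
      refine lt_of_le_of_lt this (by linarith)
    simpa using t1.add (t2.add t3)

end ClosedForm

/-! ### Entire functions of several variables -/

section Entire

/-- The mean value property, for weights which are invariant under rotations by phases. -/
theorem integral_mul_entire {V : Type*} [NormedAddCommGroup V] [NormedSpace ℂ V] [ProperSpace V]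
    [MeasurableSpace V] [BorelSpace V] [SecondCountableTopology V] {μ : Measure V} [SFinite μ]
    (hμ : ∀ θ : ℝ, MeasurePreserving (fun t : V => exp (θ * I) • t) μ μ)
    {k : V → ℂ} (hk : Integrable k μ) {R : ℝ} (hR : ∀ t, R < ‖t‖ → k t = 0)
    (hrot : ∀ (θ : ℝ) t, k (exp (θ * I) • t) = k t) {h : V → ℂ} (hh : Differentiable ℂ h) (x : V) :
    ∫ t, k t * h (x + t) ∂μ = (∫ t, k t ∂μ) * h x := by
  obtain ⟨C, hC⟩ := (isCompact_closedBall x R).exists_bound_of_continuousOn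
    hh.continuous.continuousOn
  have hnorm : ∀ (θ : ℝ) (t : V), ‖exp (θ * I) • t‖ = ‖t‖ := fun θ t => by
    rw [norm_smul, norm_exp_ofReal_mul_I, one_mul]
  have hinj : ∀ θ : ℝ, MeasurableEmbedding fun t : V => exp (θ * I) • t := fun θ =>
    (Homeomorph.smulOfNeZero (exp (θ * I)) (exp_ne_zero _)).measurableEmbedding
  have h1 : ∀ θ : ℝ, ∫ t, k t * h (x + exp (θ * I) • t) ∂μ = ∫ t, k t * h (x + t) ∂μ := by
    intro θ
    simpa only [hrot] using (hμ θ).integral_comp (hinj θ) (fun t => k t * h (x + t))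
  have hmv : ∀ t, (2 * π)⁻¹ • ∫ θ in (0 : ℝ)..2 * π, h (x + exp (θ * I) • t) = h x := by
    intro t
    have hd : Differentiable ℂ fun s : ℂ => h (x + s • t) :=
      hh.comp ((differentiable_const x).add (differentiable_id.smul_const t))
    simpa [Real.circleAverage_def, circleMap] using DiffContOnCl.circleAverage (c := 0) (R := 1) (hd.diffContOnCl)
  have hbd : ∀ (θ : ℝ) t, ‖k t * h (x + exp (θ * I) • t)‖ ≤ ‖k t‖ * C := by
    intro θ t
    rw [norm_mul]
    by_cases ht : R < ‖t‖
    · simp [hR t ht]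
    · gcongr
      refine hC _ ?_
      simpa [hnorm] using ht
  have hm : AEStronglyMeasurable (fun p : ℝ × V => k p.2 * h (x + exp (p.1 * I) • p.2))
      ((volume.restrict (uIoc 0 (2 * π))).prod μ) := by
    refine (hk.1.comp_snd).mul ?_
    exact (hh.continuous.comp (by fun_prop)).aestronglyMeasurable
  have hint : Integrable (fun p : ℝ × V => k p.2 * h (x + exp (p.1 * I) • p.2))
      ((volume.restrict (uIoc 0 (2 * π))).prod μ) := by
    have hfin : IsFiniteMeasure (volume.restrict (uIoc 0 (2 * π))) := by
      constructor; simpa using mul_lt_top (by simp) ofReal_lt_top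
    refine ((hk.norm.mul_const C).comp_snd _).mono' hm (.of_forall fun p => ?_)
    exact hbd p.1 p.2
  have hswap : ∫ θ in (0 : ℝ)..2 * π, ∫ t, k t * h (x + exp (θ * I) • t) ∂μ =
      ∫ t, (∫ θ in (0 : ℝ)..2 * π, k t * h (x + exp (θ * I) • t)) ∂μ :=
    intervalIntegral_integral_swap hint
  simp only [h1, intervalIntegral.integral_const, sub_zero, intervalIntegral.integral_const_mul]
    at hswap
  have e : ∫ t, k t * h (x + t) ∂μ = (2 * π)⁻¹ • ∫ t, k t *
      (∫ θ in (0 : ℝ)..2 * π, h (x + exp (θ * I) • t)) ∂μ := by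
    rw [← hswap, smul_smul, inv_mul_cancel₀ (by positivity), one_smul]
  rw [e, ← integral_smul, ← integral_mul_const]
  refine integral_congr_ae (.of_forall fun t => ?_)
  simp only
  rw [← hmv t, mul_smul_comm]

theorem measurePreserving_exp_smul (θ : ℝ) :
    MeasurePreserving (fun t : ℂ => exp (θ * I) • t) volume volume := by
  have := (rotation (Circle.exp θ)).measurePreserving
  refine (congrArg (fun f => MeasurePreserving f volume volume) ?_).mp this
  ext t
  simp [rotation_apply]

theorem measurePreserving_exp_smul_pi {ι : Type*} [Fintype ι] (θ : ℝ) :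
    MeasurePreserving (fun t : ι → ℂ => exp (θ * I) • t) volume volume :=
  volume_preserving_pi (α' := fun _ : ι => ℂ) (β' := fun _ : ι => ℂ)
    fun _ => measurePreserving_exp_smul θ

/-- A smooth compactly supported probability density invariant under rotations by phases. -/
theorem exists_rotation_invariant_bump (N : ℕ) : ∃ ρ : Config N → ℝ, ContDiff ℝ ∞ ρ ∧
    HasCompactSupport ρ ∧ (∀ (θ : ℝ) t, ρ (exp (θ * I) • t) = ρ t) ∧ ∫ t, ρ t = 1 := by
  set β : Config N → ℝ := fun t => Real.smoothTransition (1 - ∑ k, ‖t k‖ ^ 2) with hβ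
  have hc : ContDiff ℝ ∞ β := by
    refine Real.smoothTransition.contDiff.comp (contDiff_const.sub (ContDiff.sum fun k _ => ?_))
    exact (contDiff_norm_sq ℝ).comp (contDiff_apply ℝ ℂ k)
  have hs : HasCompactSupport β := by
    refine HasCompactSupport.intro (isCompact_closedBall (0 : Config N) 1) fun t ht => ?_
    refine Real.smoothTransition.zero_of_nonpos ?_
    rw [mem_closedBall_zero_iff, not_le] at ht
    by_contra hneg
    refine ht.not_ge ((pi_norm_le_iff_of_nonneg zero_le_one).2 fun k => ?_)
    have h1 : ‖t k‖ ^ 2 ≤ ∑ k, ‖t k‖ ^ 2 :=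
      single_le_sum (f := fun k => ‖t k‖ ^ 2) (fun _ _ => sq_nonneg _) (mem_univ k)
    have h2 := norm_nonneg (t k)
    nlinarith
  have hpos : 0 < ∫ t, β t := by
    refine Continuous.integral_pos_of_hasCompactSupport_nonneg_nonzero hc.continuous hs
      (fun t => Real.smoothTransition.nonneg _) (x := 0) ?_
    simp [hβ]
  refine ⟨fun t => (∫ t, β t)⁻¹ * β t, contDiff_const.mul hc, hs.mul_left, fun θ t => ?_, ?_⟩
  · simp [hβ, norm_exp_ofReal_mul_I]
  · rw [integral_const_mul, inv_mul_cancel₀ hpos.ne']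

theorem convolution_entire {ρ : Config N → ℝ} (hc : Continuous ρ) (hs : HasCompactSupport ρ)
    (hrot : ∀ (θ : ℝ) t, ρ (exp (θ * I) • t) = ρ t) (h1 : ∫ t, ρ t = 1) {F : Config N → ℂ}
    (hF : Differentiable ℂ F) : (ρ ⋆ᵥ F) = F := by
  ext z
  obtain ⟨R, hR⟩ := hs.isCompact.isBounded.exists_norm_le
  have hd : Differentiable ℂ fun t => F (-t) := hF.comp differentiable_id.neg
  have := integral_mul_entire (μ := (volume : Measure (Config N)))
    (fun θ => measurePreserving_exp_smul_pi θ) (k := fun t => (ρ t : ℂ)) (R := R)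
    (hc.integrable_of_hasCompactSupport hs).ofReal (fun t ht => by
      by_contra h0
      refine ht.not_ge (hR t (subset_tsupport _ ?_))
      simpa using h0) (fun θ t => by rw [hrot]) hd (-z)
  rw [integral_complex_ofReal, h1] at this
  simp only [ofReal_one, one_mul, neg_neg] at this
  rw [← this, convolution_def]
  refine integral_congr_ae (.of_forall fun t => ?_)
  simp [real_smul, sub_eq_add_neg, add_comm]

theorem contDiff_of_entire {F : Config N → ℂ} (hF : Differentiable ℂ F) : ContDiff ℝ ∞ F := by
  obtain ⟨ρ, hc, hs, hrot, h1⟩ := exists_rotation_invariant_bump N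
  rw [← convolution_entire hc.continuous hs hrot h1 hF]
  exact HasCompactSupport.contDiff_convolution_left (n := ⊤) _ hs hc
    hF.continuous.locallyIntegrable

theorem differentiable_of_dbar {F : Config N → ℂ} (hF : Differentiable ℝ F)
    (h : ∀ z i, fderiv ℝ F z (single i I) = I * fderiv ℝ F z (single i 1)) :
    Differentiable ℂ F := by
  intro z
  set L := fderiv ℝ F z with hL
  have hI : ∀ v, L (I • v) = I * L v := by
    intro v
    have hv : v = ∑ i, ((v i).re • (single i 1 : Config N) + (v i).im • (single i I : Config N)) := by
      ext j
      simp [Finset.sum_apply, Pi.single_apply, sum_add_distrib, re_add_im]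
    have hIv : I • v = ∑ i, ((v i).re • (single i I : Config N)
        - (v i).im • (single i 1 : Config N)) := by
      ext j
      simp only [Pi.smul_apply, smul_eq_mul, Finset.sum_apply, Pi.sub_apply, Pi.single_apply]
      rw [sum_eq_single j (by intro b _ hb; simp [hb.symm]) (by simp)]
      apply Complex.ext <;> simp
    rw [hIv]
    conv_rhs => rw [hv]
    simp only [map_sum, map_sub, map_add, map_smul, mul_sum]
    refine sum_congr rfl fun i _ => ?_
    rw [h z i]
    simp only [real_smul]
    linear_combination -(((v i).im : ℂ) * L (single i 1)) * I_mul_I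
  let Lc : Config N →L[ℂ] ℂ :=
    { toFun := L
      map_add' := L.map_add
      map_smul' := fun c v => by
        have : c • v = c.re • v + c.im • (I • v) := by
          ext j
          simp only [Pi.smul_apply, Pi.add_apply, smul_eq_mul, real_smul]
          conv_lhs => rw [← re_add_im c]
          ring
        rw [this, map_add, map_smul, map_smul, hI]
        simp only [real_smul, smul_eq_mul, RingHom.id_apply]
        conv_rhs => rw [← re_add_im c]
        ring
      cont := L.cont }
  exact (hasFDerivAt_of_restrictScalars (f' := Lc) ℝ (hF z).hasFDerivAt rfl).differentiableAt

theorem fderiv_convolution_apply {ρ : Config N → ℝ} (hρ : ContDiff ℝ ∞ ρ)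
    (hs : HasCompactSupport ρ) {f : Config N → ℂ} (hf : LocallyIntegrable f)
    (z d : Config N) : fderiv ℝ (ρ ⋆ᵥ f) z d = ∫ t, ((fderiv ℝ ρ t d : ℝ) : ℂ) * f (z - t) := by
  have hD := hs.hasFDerivAt_convolution_left (μ := (volume : Measure (Config N)))
    (ContinuousLinearMap.lsmul ℝ ℝ) (hρ.of_le (by simp)) hf z
  have hint : Integrable (fun t => ((ContinuousLinearMap.lsmul ℝ ℝ : ℝ →L[ℝ] ℂ →L[ℝ] ℂ).precompL
      (Config N)) (fderiv ℝ ρ t) (f (z - t))) :=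
    (hs.fderiv ℝ).convolutionExists_left _ (hρ.continuous_fderiv (by simp)) hf z
  rw [hD.fderiv, convolution_def, ContinuousLinearMap.integral_apply hint]
  refine integral_congr_ae (.of_forall fun t => ?_)
  simp [ContinuousLinearMap.precompL_apply, real_smul]

open scoped Convolution in
/-- Weak solutions of the Cauchy-Riemann equations are entire. -/
theorem ae_eq_entire_of_weak_dbar {f : Config N → ℂ} (hf : LocallyIntegrable f)
    (hw : ∀ (χ : Config N → ℝ) (i : Fin N), ContDiff ℝ ∞ χ → HasCompactSupport χ →
      ∫ z, ((fderiv ℝ χ z (single i 1) : ℂ) + I * (fderiv ℝ χ z (single i I) : ℂ)) * f z = 0) :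
    ∃ F : Config N → ℂ, Differentiable ℂ F ∧ f =ᵐ[volume] F := by
  have hol : ∀ ρ : Config N → ℝ, ContDiff ℝ ∞ ρ → HasCompactSupport ρ →
      Differentiable ℂ (ρ ⋆ᵥ f) := by
    intro ρ hρ hs
    have hcd : ContDiff ℝ ∞ (ρ ⋆ᵥ f) :=
      HasCompactSupport.contDiff_convolution_left (n := ⊤) _ hs hρ hf
    refine differentiable_of_dbar (hcd.differentiable (by simp)) fun z i => ?_
    rw [fderiv_convolution_apply hρ hs hf, fderiv_convolution_apply hρ hs hf]
    have hχ : ContDiff ℝ ∞ fun y => ρ (z - y) := hρ.comp (contDiff_const.sub contDiff_id)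
    have hχs : HasCompactSupport fun y => ρ (z - y) := hs.comp_homeomorph (Homeomorph.subLeft z)
    have h0 := hw _ i hχ hχs
    have hfd : ∀ y d, fderiv ℝ (fun y => ρ (z - y)) y d = -(fderiv ℝ ρ (z - y) d) := by
      intro y d
      have h1 : HasFDerivAt (fun y => z - y) (-ContinuousLinearMap.id ℝ (Config N)) y :=
        (hasFDerivAt_id y).const_sub z
      have h2 : HasFDerivAt (fun y => ρ (z - y)) _ y :=
        (hρ.differentiable (by simp) (z - y)).hasFDerivAt.comp y h1
      rw [h2.fderiv]
      simp
    simp only [hfd] at h0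
    rw [← integral_sub_left_eq_self _ volume z] at h0
    simp only [sub_sub_cancel] at h0
    have hi : ∀ d, Integrable (fun t => ((fderiv ℝ ρ t d : ℝ) : ℂ) * f (z - t)) := by
      intro d
      simpa [ConvolutionExistsAt, real_smul] using HasCompactSupport.convolutionExists_left
        (ContinuousLinearMap.lsmul ℝ ℝ : ℝ →L[ℝ] ℂ →L[ℝ] ℂ)
        ((hs.fderiv (𝕜 := ℝ)).comp_left (g := fun L : Config N →L[ℝ] ℝ => L d) rfl)
        ((hρ.continuous_fderiv (by simp)).clm_apply continuous_const) hf z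
    have h1 : ∫ t, (((-(fderiv ℝ ρ t (single i 1)) : ℝ) : ℂ)
        + I * ((-(fderiv ℝ ρ t (single i I)) : ℝ) : ℂ)) * f (z - t) =
        -(∫ t, ((fderiv ℝ ρ t (single i 1) : ℝ) : ℂ) * f (z - t))
        - I * ∫ t, ((fderiv ℝ ρ t (single i I) : ℝ) : ℂ) * f (z - t) := by
      have hn : Integrable (fun t => -(((fderiv ℝ ρ t (single i 1) : ℝ) : ℂ) * f (z - t)))
          volume := (hi _).neg
      rw [← integral_const_mul, ← integral_neg, ← integral_sub hn ((hi _).const_mul I)]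
      refine integral_congr_ae (.of_forall fun t => ?_)
      simp only [ofReal_neg]
      ring
    rw [h1] at h0
    linear_combination I * h0 + (∫ t, ((fderiv ℝ ρ t (single i I) : ℝ) : ℂ) * f (z - t)) * I_mul_I
  obtain ⟨ρ, hc, hs, hrot, h1⟩ := exists_rotation_invariant_bump N
  refine ⟨_, hol ρ hc hs, ?_⟩
  set F := (ρ ⋆ᵥ f) with hF
  have hFc : Continuous F := (hol ρ hc hs).continuous
  filter_upwards [ae_tendsto_mollify volume hf] with z hz
  refine tendsto_nhds_unique hz ?_
  have h2 : Tendsto (fun n => ((shrinkingBump (Config N) n).normed volume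
      ⋆ᵥ F) z) atTop (𝓝 (F z)) :=
    ContDiffBump.convolution_tendsto_right_of_continuous tendsto_shrinkingBump_rOut hFc z
  refine h2.congr fun n => ?_
  set β := (shrinkingBump (Config N) n).normed (volume : Measure (Config N)) with hβ
  have hβc : ContDiff ℝ ∞ β := ContDiffBump.contDiff_normed _
  have hβs : HasCompactSupport β := ContDiffBump.hasCompactSupport_normed _
  have assoc : ∀ σ τ : Config N → ℝ, Continuous σ → HasCompactSupport σ → Continuous τ →
      HasCompactSupport τ → ((σ ⋆[ContinuousLinearMap.mul ℝ ℝ, volume] τ)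
        ⋆ᵥ f) z =
        (σ ⋆ᵥ
          (τ ⋆ᵥ f)) z := by
    intro σ τ hσ hσs hτ hτs
    have hn : LocallyIntegrable (fun x => ‖f x‖) := fun x => (hf x).norm
    refine convolution_assoc _ _ _ _ (fun x y w => ?_) hσ.aestronglyMeasurable
      hτ.aestronglyMeasurable hf.aestronglyMeasurable ?_ ?_ ?_
    · simp [mul_smul]
    · exact .of_forall fun y => hσs.convolutionExists_left _ hσ hτ.locallyIntegrable y
    · exact .of_forall fun y => hτs.norm.convolutionExists_left _ hτ.norm hn y
    · exact hσs.norm.convolutionExists_left _ hσ.norm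
        (hτs.norm.continuous_convolution_left _ hτ.norm hn).locallyIntegrable z
  rw [hF, ← assoc β ρ hβc.continuous hβs hc.continuous hs]
  have hcomm : (β ⋆[ContinuousLinearMap.mul ℝ ℝ, volume] ρ)
      = (ρ ⋆[ContinuousLinearMap.mul ℝ ℝ, volume] β) := by
    rw [← convolution_flip]
    congr 1
    ext
    simp
  rw [hcomm, assoc ρ β hc.continuous hs hβc.continuous hβs,
    convolution_entire hc.continuous hs hrot h1 (hol β hβc hβs)]

end Entire


/-! ### The lowest Landau level -/

section LLL

/-- The Cauchy-Riemann operator `∂₁ + i ∂₂` in the variable of particle `i`. -/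
def dbar (i : Fin N) (F : Config N → ℂ) (z : Config N) : ℂ :=
  fderiv ℝ F z (single i 1) + I * fderiv ℝ F z (single i I)

/-- The operator `∂₁ - i ∂₂` in the variable of particle `i`. -/
def del (i : Fin N) (F : Config N → ℂ) (z : Config N) : ℂ :=
  fderiv ℝ F z (single i 1) - I * fderiv ℝ F z (single i I)

/-- The annihilation operator on differentiable functions. -/
def annihFun (i : Fin N) (F : Config N → ℂ) (z : Config N) : ℂ := magD i 0 F z + I * magD i 1 F z

/-- The creation operator on differentiable functions. -/
def annihAdjFun (i : Fin N) (F : Config N → ℂ) (z : Config N) : ℂ := magD i 0 F z - I * magD i 1 F z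

theorem dir_zero : dir 0 = 1 := rfl

theorem dir_one : dir 1 = I := rfl

theorem annihFun_eq (i : Fin N) (F : Config N → ℂ) (z : Config N) :
    annihFun i F z = -I * (dbar i F z + z i * F z) := by
  have h : z i = (z i).re + (z i).im * I := (re_add_im _).symm
  have e0 : (vecPot 0 (z i) : ℂ) = -((z i).im : ℂ) := by simp [vecPot]
  have e1 : (vecPot 1 (z i) : ℂ) = ((z i).re : ℂ) := by simp [vecPot]
  simp only [annihFun, magD, dbar, dir_zero, dir_one, e0, e1]
  linear_combination I * F z * h + (z i).im * F z * I_mul_I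

theorem annihAdjFun_eq (i : Fin N) (F : Config N → ℂ) (z : Config N) :
    annihAdjFun i F z = -I * (del i F z - conj (z i) * F z) := by
  have h : conj (z i) = (z i).re - (z i).im * I := by apply Complex.ext <;> simp
  have e0 : (vecPot 0 (z i) : ℂ) = -((z i).im : ℂ) := by simp [vecPot]
  have e1 : (vecPot 1 (z i) : ℂ) = ((z i).re : ℂ) := by simp [vecPot]
  simp only [annihAdjFun, magD, del, dir_zero, dir_one, e0, e1]
  linear_combination -I * F z * h + (z i).im * F z * I_mul_I

theorem annihFun_mul (i : Fin N) {θ : Config N → ℂ} {z : Config N}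
    (hθ : DifferentiableAt ℝ θ z) (hχ : DifferentiableAt ℝ χ z) :
    annihFun i (fun z => θ z * χ z) z = θ z * annihFun i χ z - I * dbar i θ z * χ z := by
  simp only [annihFun, magD_mul _ _ hθ hχ, dbar, dir_zero, dir_one]
  ring

theorem annihAdjFun_mul (i : Fin N) {θ : Config N → ℂ} {z : Config N}
    (hθ : DifferentiableAt ℝ θ z) (hχ : DifferentiableAt ℝ χ z) :
    annihAdjFun i (fun z => θ z * χ z) z = θ z * annihAdjFun i χ z - I * del i θ z * χ z := by
  simp only [annihAdjFun, magD_mul _ _ hθ hχ, del, dir_zero, dir_one]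
  ring

theorem dbar_eq_zero_of_entire {F : Config N → ℂ} (hF : Differentiable ℂ F) (i : Fin N)
    (z : Config N) : dbar i F z = 0 := by
  have e : (single i I : Config N) = I • single i 1 := by
    ext k
    by_cases h : k = i
    · subst h; simp
    · simp [h]
  have h1 : fderiv ℝ F z = (fderiv ℂ F z).restrictScalars ℝ := (hF z).fderiv_restrictScalars ℝ
  simp only [dbar, h1, ContinuousLinearMap.coe_restrictScalars', e, map_smul, smul_eq_mul]
  linear_combination (fderiv ℂ F z) (single i 1) * I_mul_I

/-- The Gaussian `exp(c ∑ |z_i|²)`. -/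
def expSq (c : ℝ) (z : Config N) : ℝ := rexp (c * ∑ i, ‖z i‖ ^ 2)

theorem contDiff_expSq (c : ℝ) : ContDiff ℝ ∞ (expSq c : Config N → ℝ) := by
  refine Real.contDiff_exp.comp (contDiff_const.mul (ContDiff.sum fun k _ => ?_))
  exact (contDiff_norm_sq ℝ).comp (contDiff_apply ℝ ℂ k)

theorem contDiff_ofReal_expSq (c : ℝ) : ContDiff ℝ ∞ (fun z : Config N => (expSq c z : ℂ)) :=
  ofRealCLM.contDiff.comp (contDiff_expSq c)

theorem expSq_pos (c : ℝ) (z : Config N) : 0 < expSq c z := exp_pos _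

theorem expSq_mul_neg (c : ℝ) (z : Config N) : expSq c z * expSq (-c) z = 1 := by
  rw [expSq, expSq, ← Real.exp_add]
  simp

theorem fderiv_expSq (c : ℝ) (z : Config N) (i : Fin N) (w : ℂ) :
    fderiv ℝ (fun z : Config N => (expSq c z : ℂ)) z (single i w) =
      ((2 * c * ((z i).re * w.re + (z i).im * w.im) * expSq c z : ℝ) : ℂ) := by
  have h1 : HasFDerivAt (fun z : Config N => ∑ k, ‖z k‖ ^ 2)
      (∑ k, (2 • innerSL ℝ (z k)).comp (ContinuousLinearMap.proj k)) z := by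
    refine HasFDerivAt.fun_sum fun k _ => ?_
    have ha : HasFDerivAt (fun z : Config N => z k) (ContinuousLinearMap.proj (R := ℝ) k) z :=
      hasFDerivAt_apply k z
    exact HasFDerivAt.comp z (hasStrictFDerivAt_norm_sq (z k)).hasFDerivAt ha
  have h2 := (h1.const_mul c).exp
  have h3 := ofRealCLM.hasFDerivAt.comp z h2
  have h4 : fderiv ℝ (fun z : Config N => (expSq c z : ℂ)) z = _ := h3.fderiv
  rw [h4]
  have hs : ∑ k, ⟪z k, (single i w : Config N) k⟫_ℝ = (z i).re * w.re + (z i).im * w.im := by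
    rw [sum_eq_single i (fun b _ hb => by simp [hb]) (by simp)]
    simp [Complex.inner]
    ring
  simp only [expSq, ContinuousLinearMap.comp_apply, ContinuousLinearMap.smul_apply,
    ContinuousLinearMap.sum_apply, ContinuousLinearMap.proj_apply, innerSL_apply_apply,
    ofRealCLM_apply, smul_eq_mul, nsmul_eq_mul, ← mul_sum, hs]
  push_cast
  ring

theorem annihFun_expSq (i : Fin N) (z : Config N) :
    annihFun i (fun z => (expSq (-(1 / 2)) z : ℂ)) z = 0 := by
  rw [annihFun_eq, dbar, fderiv_expSq, fderiv_expSq]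
  have h : z i = (z i).re + (z i).im * I := (re_add_im _).symm
  push_cast
  simp only [one_re, one_im, I_re, I_im]
  push_cast
  linear_combination -I * (expSq (-(1 / 2)) z : ℂ) * h

theorem annihAdjFun_expSq (i : Fin N) (z : Config N) :
    annihAdjFun i (fun z => (expSq (1 / 2) z : ℂ)) z = 0 := by
  have h : conj (z i) = (z i).re - (z i).im * I := by apply Complex.ext <;> simp
  rw [annihAdjFun_eq, del, fderiv_expSq, fderiv_expSq, h]
  simp only [one_re, one_im, I_re, I_im]
  push_cast
  ring

/-- Integration by parts against test functions. -/
theorem integral_conj_mul_magD (i : Fin N) (k : Fin 2) {Φ : Config N → ℂ} (hΦ : ContDiff ℝ 1 Φ)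
    (hχ : ContDiff ℝ 1 χ) (hs : HasCompactSupport χ) :
    ∫ z, conj (χ z) * magD i k Φ z = ∫ z, conj (magD i k χ z) * Φ z := by
  set d : Config N := single i (dir k)
  have hc : ContDiff ℝ 1 fun z => conj (χ z) := conjCLE.contDiff.comp hχ
  have hcs : HasCompactSupport fun z => conj (χ z) := hs.comp_left (map_zero _)
  have hfd : ∀ z, fderiv ℝ (fun z => conj (χ z)) z d = conj (fderiv ℝ χ z d) := fun z => by
    have h := conjCLE.toContinuousLinearMap.hasFDerivAt.comp z
      (hχ.differentiable (by simp) z).hasFDerivAt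
    have h' : fderiv ℝ (fun z => conj (χ z)) z = _ := h.fderiv
    rw [h']
    simp
  have hv : Continuous fun z : Config N => (vecPot k (z i) : ℂ) := (contDiff_vecPot i k).continuous
  have c1 : Continuous fun z => fderiv ℝ (fun z => conj (χ z)) z d :=
    (hc.continuous_fderiv (by simp)).clm_apply continuous_const
  have c2 : Continuous fun z => fderiv ℝ Φ z d :=
    (hΦ.continuous_fderiv (by simp)).clm_apply continuous_const
  have s1 : HasCompactSupport fun z => fderiv ℝ (fun z => conj (χ z)) z d :=
    (hcs.fderiv (𝕜 := ℝ)).comp_left (g := fun L : Config N →L[ℝ] ℂ => L d) rfl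
  have i1 : Integrable fun z => fderiv ℝ (fun z => conj (χ z)) z d * Φ z :=
    (c1.mul hΦ.continuous).integrable_of_hasCompactSupport s1.mul_right
  have i0 : Integrable fun z => conj (χ z) * Φ z :=
    (hc.continuous.mul hΦ.continuous).integrable_of_hasCompactSupport hcs.mul_right
  have i2 : Integrable fun z => conj (χ z) * fderiv ℝ Φ z d :=
    (hc.continuous.mul c2).integrable_of_hasCompactSupport hcs.mul_right
  have i3 : Integrable fun z => conj (χ z) * ((vecPot k (z i) : ℂ) * Φ z) :=
    (hc.continuous.mul (hv.mul hΦ.continuous)).integrable_of_hasCompactSupport hcs.mul_right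
  have ibp := integral_mul_fderiv_eq_neg_fderiv_mul_of_integrable (𝕜 := ℂ) (v := d) i1 i2 i0
    (fun z _ => (hc.differentiable (by simp) z)) (fun z _ => hΦ.differentiable (by simp) z)
  have e1 : ∀ z, conj (χ z) * magD i k Φ z = -I * (conj (χ z) * fderiv ℝ Φ z d)
      - conj (χ z) * ((vecPot k (z i) : ℂ) * Φ z) := fun z => by
    simp only [magD, d]; ring
  have e2 : ∀ z, conj (magD i k χ z) * Φ z = I * (fderiv ℝ (fun z => conj (χ z)) z d * Φ z)
      - conj (χ z) * ((vecPot k (z i) : ℂ) * Φ z) := fun z => by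
    rw [hfd]; simp only [magD, d, map_sub, map_mul, map_neg, conj_I, conj_ofReal]; ring
  simp only [e1, e2]
  rw [integral_sub (i2.const_mul _) i3, integral_sub (i1.const_mul _) i3, integral_const_mul,
    integral_const_mul, ibp]
  ring

theorem HasWeakMagD.of_contDiff (i : Fin N) (k : Fin 2) {Φ : Config N → ℂ} (hΦ : ContDiff ℝ 1 Φ)
    (h : MemLp Φ 2) (h' : MemLp (magD i k Φ) 2) :
    HasWeakMagD i k (h.toLp Φ) (h'.toLp (magD i k Φ)) := by
  intro χ hχ hs
  have e1 : ∫ z, conj (χ z) * h'.toLp (magD i k Φ) z = ∫ z, conj (χ z) * magD i k Φ z :=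
    integral_congr_ae (by filter_upwards [h'.coeFn_toLp] with z hz; rw [hz])
  have e2 : ∫ z, conj (magD i k χ z) * h.toLp Φ z = ∫ z, conj (magD i k χ z) * Φ z :=
    integral_congr_ae (by filter_upwards [h.coeFn_toLp] with z hz; rw [hz])
  rw [e1, e2, integral_conj_mul_magD i k hΦ (hχ.of_le (by simp)) hs]

theorem continuous_annihAdjFun (i : Fin N) (h : ContDiff ℝ ∞ χ) : Continuous (annihAdjFun i χ) :=
  (continuous_magD i 0 h).sub (continuous_const.mul (continuous_magD i 1 h))

theorem hasCompactSupport_annihAdjFun (i : Fin N) (h : HasCompactSupport χ) :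
    HasCompactSupport (annihAdjFun i χ) :=
  (hasCompactSupport_magD i 0 h).sub
    ((hasCompactSupport_magD i 1 h).comp_left (g := fun w : ℂ => I * w) (mul_zero _))

/-- The function `A_i^* χ`, as an element of `L²`. -/
def annihAdj (i : Fin N) (h : ContDiff ℝ ∞ χ) (hs : HasCompactSupport χ) : L2 N :=
  (memLp_test (continuous_annihAdjFun i h) (hasCompactSupport_annihAdjFun i hs)).toLp

theorem inner_annihAdj (i : Fin N) (h : ContDiff ℝ ∞ χ) (hs : HasCompactSupport χ) (u : L2 N) :
    ⟪annihAdj i h hs, u⟫_ℂ = (∫ z, conj (magD i 0 χ z) * u z) + I * ∫ z, conj (magD i 1 χ z) * u z := by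
  rw [annihAdj, inner_toLp, ← integral_const_mul, ← integral_add
    (integrable_conj_mul (continuous_magD i 0 h) (hasCompactSupport_magD i 0 hs) u)
    ((integrable_conj_mul (continuous_magD i 1 h) (hasCompactSupport_magD i 1 hs) u).const_mul I)]
  refine integral_congr_ae (.of_forall fun z => ?_)
  simp only [annihAdjFun, map_sub, map_mul, conj_I]
  ring

theorem inner_annihAdj_eq (i : Fin N) (h : ContDiff ℝ ∞ χ)
    (hs : HasCompactSupport χ) {u : L2 N} (hu : ∀ k, ∃ g, HasWeakMagD i k u g) :
    ⟪annihAdj i h hs, u⟫_ℂ = ⟪(memLp_test h.continuous hs).toLp, annih i u⟫_ℂ := by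
  rw [inner_annihAdj, annih, inner_add_right, inner_smul_right, inner_toLp, inner_toLp,
    weakMagD_spec (hu 0) χ h hs, weakMagD_spec (hu 1) χ h hs]

theorem contDiff_lll {F : Config N → ℂ} (hF : Differentiable ℂ F) :
    ContDiff ℝ ∞ fun z => F z * (expSq (-(1 / 2)) z : ℂ) :=
  (contDiff_of_entire hF).mul (contDiff_ofReal_expSq _)

theorem annihFun_lll {F : Config N → ℂ} (hF : Differentiable ℂ F) (i : Fin N) (z : Config N) :
    annihFun i (fun z => F z * (expSq (-(1 / 2)) z : ℂ)) z = 0 := by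
  rw [annihFun_mul i ((contDiff_of_entire hF).differentiable (by simp) z)
    ((contDiff_ofReal_expSq _).differentiable (by simp) z), annihFun_expSq,
    dbar_eq_zero_of_entire hF]
  simp

theorem isLLLRep_zero_iff : IsLLLRep 0 Ψ φ ↔
    Differentiable ℂ φ ∧ Ψ =ᵐ[volume] fun z => φ z * (expSq (-(1 / 2)) z : ℂ) := by
  refine and_congr_right fun _ => ?_
  simp only [pow_zero, Finset.prod_const_one, mul_one, expSq, mul_comm (φ _)]

theorem mem_spaceB_zero_iff : Ψ ∈ spaceB N 0 ↔
    ∀ (i : Fin N) (χ : Config N → ℂ) (h : ContDiff ℝ ∞ χ) (hs : HasCompactSupport χ),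
      ⟪annihAdj i h hs, Ψ⟫_ℂ = 0 := by
  constructor
  · rintro ⟨φ, hφ⟩ i χ h hs
    rw [isLLLRep_zero_iff] at hφ
    obtain ⟨hd, he⟩ := hφ
    have e : ∀ k, ∫ z, conj (magD i k χ z) * Ψ z =
        ∫ z, conj (χ z) * magD i k (fun z => φ z * (expSq (-(1 / 2)) z : ℂ)) z := fun k => by
      rw [integral_conj_mul_magD i k ((contDiff_lll hd).of_le (by simp)) (h.of_le (by simp)) hs]
      exact integral_congr_ae (by filter_upwards [he] with z hz; rw [hz])
    have hi : ∀ k, Integrable fun z =>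
        conj (χ z) * magD i k (fun z => φ z * (expSq (-(1 / 2)) z : ℂ)) z := fun k =>
      ((continuous_conj.comp h.continuous).mul
        (continuous_magD i k (contDiff_lll hd))).integrable_of_hasCompactSupport
        (HasCompactSupport.mul_right (hs.comp_left (map_zero _)))
    rw [inner_annihAdj, e, e, ← integral_const_mul, ← integral_add (hi 0) ((hi 1).const_mul I)]
    refine integral_eq_zero_of_ae (.of_forall fun z => ?_)
    have := annihFun_lll hd i z
    simp only [annihFun] at this
    simp only [Pi.zero_apply]
    linear_combination conj (χ z) * this
  · intro H
    have hf : LocallyIntegrable (fun z => (expSq (1 / 2) z : ℂ) * Ψ z) := by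
      have h1 : LocallyIntegrable Ψ (volume : Measure (Config N)) :=
        (Lp.memLp Ψ).locallyIntegrable (by norm_num)
      simpa [smul_eq_mul, mul_comm] using h1.smul_continuous (𝕜 := ℂ) (contDiff_ofReal_expSq (N := N) (1 / 2)).continuous
    obtain ⟨F, hF, he⟩ := ae_eq_entire_of_weak_dbar hf (fun χ i hχ hs => by
      have hχ' : ContDiff ℝ ∞ fun z => (χ z : ℂ) := ofRealCLM.contDiff.comp hχ
      have hfd : ∀ z d, fderiv ℝ (fun z => (χ z : ℂ)) z d = (fderiv ℝ χ z d : ℂ) := fun z d => by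
        have h := ofRealCLM.hasFDerivAt.comp z (hχ.differentiable (by simp) z).hasFDerivAt
        have h' : fderiv ℝ (fun z => (χ z : ℂ)) z = _ := h.fderiv
        rw [h']; simp
      have h := H i (fun z => (χ z : ℂ) * (expSq (1 / 2) z : ℂ))
        (hχ'.mul (contDiff_ofReal_expSq _))
        (HasCompactSupport.mul_right (hs.comp_left (g := fun r : ℝ => (r : ℂ)) rfl))
      rw [annihAdj, inner_toLp] at h
      have h2 : ∀ z, conj (annihAdjFun i (fun z => (χ z : ℂ) * (expSq (1 / 2) z : ℂ)) z) * Ψ z =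
          I * ((((fderiv ℝ χ z (single i 1) : ℂ) + I * (fderiv ℝ χ z (single i I) : ℂ)))
            * ((expSq (1 / 2) z : ℂ) * Ψ z)) := fun z => by
        rw [annihAdjFun_mul i (hχ'.differentiable (by simp) z)
          ((contDiff_ofReal_expSq _).differentiable (by simp) z), annihAdjFun_expSq, del, hfd, hfd]
        simp only [mul_zero, zero_sub, map_neg, map_mul, map_sub, conj_I, conj_ofReal]
        ring
      simp only [h2, integral_const_mul] at h
      exact (mul_eq_zero.1 h).resolve_left I_ne_zero)
    refine ⟨F, isLLLRep_zero_iff.2 ⟨hF, ?_⟩⟩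
    filter_upwards [he] with z hz
    rw [← hz]
    have := expSq_mul_neg (1 / 2) z
    have h' : (expSq (1 / 2) z : ℂ) * (expSq (-(1 / 2)) z : ℂ) = 1 := by exact_mod_cast this
    linear_combination -Ψ z * h'

theorem isClosed_spaceB_zero : IsClosed (spaceB N 0 : Set (L2 N)) := by
  have : (spaceB N 0 : Set (L2 N)) = ⋂ (i : Fin N) (χ : Config N → ℂ) (h : ContDiff ℝ ∞ χ)
      (hs : HasCompactSupport χ), {Ψ | ⟪annihAdj i h hs, Ψ⟫_ℂ = 0} := by
    ext Ψ
    simp only [SetLike.mem_coe, mem_spaceB_zero_iff, mem_iInter, mem_setOf_eq]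
  rw [this]
  refine isClosed_iInter fun i => isClosed_iInter fun χ => isClosed_iInter fun h =>
    isClosed_iInter fun hs => isClosed_eq (by fun_prop) continuous_const

end LLL


/-! ### Pair coordinates -/

section PairCoordinates

/-- The positions of the particles other than the first one of the pair `p`. -/
abbrev Rest (p : Pair N) := {k : Fin N // k ≠ p.1.1} → ℂ

/-- The Hilbert space over `Rest p`. -/
abbrev RestL2 (p : Pair N) := Lp ℂ 2 (volume : Measure (Rest p))

/-- The relative coordinate of a pair. -/
def rel (p : Pair N) (z : Config N) : ℂ := z p.1.1 - z p.1.2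

/-- The positions of the other particles, and the center of mass of the pair. -/
def cm (p : Pair N) (z : Config N) : Rest p :=
  fun k => if (k : Fin N) = p.1.2 then (z p.1.1 + z p.1.2) / 2 else z k

/-- The direction of relative motion of a pair. -/
def relDir (p : Pair N) : Config N :=
  fun k => if k = p.1.1 then 1 / 2 else if k = p.1.2 then -(1 / 2) else 0

/-- The configuration with given relative and other coordinates. -/
def pairCoord (p : Pair N) (x : ℂ × Rest p) : Config N := collapse p x.2 + x.1 • relDir p

theorem collapse_fst (p : Pair N) (y : Rest p) : collapse p y p.1.1 = y ⟨p.1.2, p.2.ne'⟩ := by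
  simp [collapse]

theorem collapse_of_ne (p : Pair N) (y : Rest p) {k : Fin N} (h : k ≠ p.1.1) :
    collapse p y k = y ⟨k, h⟩ := by
  simp [collapse, h]

theorem continuous_collapse (p : Pair N) : Continuous (collapse p) := by
  refine continuous_pi fun k => ?_
  by_cases h : k = p.1.1
  · subst h
    simp only [collapse_fst]
    fun_prop
  · simp only [collapse_of_ne p _ h]
    fun_prop

theorem continuous_pairCoord (p : Pair N) : Continuous (pairCoord p) :=
  ((continuous_collapse p).comp continuous_snd).add (continuous_fst.smul continuous_const)

theorem continuous_rel (p : Pair N) : Continuous (rel p) := by unfold rel; fun_prop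

theorem continuous_cm (p : Pair N) : Continuous (cm p) := by
  refine continuous_pi fun k => ?_
  by_cases h : (k : Fin N) = p.1.2
  · simp only [cm, h, if_true]; fun_prop
  · simp only [cm, h, if_false]; fun_prop

theorem pairCoord_fst (p : Pair N) (w : ℂ) (y : Rest p) :
    pairCoord p (w, y) p.1.1 = y ⟨p.1.2, p.2.ne'⟩ + w / 2 := by
  simp [pairCoord, collapse_fst, relDir]; ring

theorem pairCoord_snd (p : Pair N) (w : ℂ) (y : Rest p) :
    pairCoord p (w, y) p.1.2 = y ⟨p.1.2, p.2.ne'⟩ - w / 2 := by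
  simp [pairCoord, collapse_of_ne p y p.2.ne', relDir, p.2.ne']; ring

theorem pairCoord_of_ne (p : Pair N) (w : ℂ) (y : Rest p) {k : Fin N} (h : k ≠ p.1.1)
    (h' : k ≠ p.1.2) : pairCoord p (w, y) k = y ⟨k, h⟩ := by
  simp [pairCoord, collapse_of_ne p y h, relDir, h, h']

@[simp] theorem rel_pairCoord (p : Pair N) (w : ℂ) (y : Rest p) : rel p (pairCoord p (w, y)) = w := by
  rw [rel, pairCoord_fst, pairCoord_snd]; ring

@[simp] theorem cm_pairCoord (p : Pair N) (w : ℂ) (y : Rest p) : cm p (pairCoord p (w, y)) = y := by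
  ext ⟨k, hk⟩
  by_cases h : k = p.1.2
  · subst h
    simp only [cm, if_true, pairCoord_fst, pairCoord_snd]; ring
  · simp only [cm, h, if_false, pairCoord_of_ne p w y hk h]

theorem pairCoord_rel_cm (p : Pair N) (z : Config N) : pairCoord p (rel p z, cm p z) = z := by
  ext k
  by_cases h : k = p.1.1
  · subst h
    simp only [pairCoord_fst, cm, rel, if_true]; ring
  by_cases h' : k = p.1.2
  · subst h'
    simp only [pairCoord_snd, cm, rel, if_true]; ring
  · rw [pairCoord_of_ne p _ _ h h']; simp [cm, h']

@[simp] theorem pairCoord_zero (p : Pair N) (y : Rest p) : pairCoord p (0, y) = collapse p y := by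
  simp [pairCoord]

/-- Pair coordinates as a homeomorphism. -/
def pairHomeo (p : Pair N) : ℂ × Rest p ≃ₜ Config N where
  toFun := pairCoord p
  invFun z := (rel p z, cm p z)
  left_inv := fun ⟨w, y⟩ => by simp
  right_inv z := pairCoord_rel_cm p z
  continuous_toFun := continuous_pairCoord p
  continuous_invFun := (continuous_rel p).prodMk (continuous_cm p)

theorem measurableEmbedding_pairCoord (p : Pair N) : MeasurableEmbedding (pairCoord p) :=
  (pairHomeo p).measurableEmbedding

theorem measurePreserving_pairCoord (p : Pair N) : MeasurePreserving (pairCoord p) volume volume := by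
  let j : {k : Fin N // k ≠ p.1.1} := ⟨p.1.2, p.2.ne'⟩
  have h1 : MeasurePreserving (fun x : ℂ × Rest p => (x.1, x.2 + single j (-(x.1 / 2))))
      (volume.prod volume) (volume.prod volume) := by
    refine MeasurePreserving.skew_product (μc := (volume : Measure (Rest p)))
      (g := fun (w : ℂ) (y : Rest p) => y + single j (-(w / 2)))
      (MeasurePreserving.id volume) ?_ (.of_forall fun w => ?_)
    · refine Continuous.measurable (continuous_pi fun k => ?_)
      by_cases h : k = j
      · subst h; simp [Function.uncurry_def]; fun_prop
      · simp [Function.uncurry_def, h]; fun_prop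
    · exact (measurePreserving_add_right volume _).map_eq
  have h2 : MeasurePreserving (fun x : Rest p × ℂ => (x.1, x.2 + x.1 j))
      (volume.prod volume) (volume.prod volume) := by
    refine MeasurePreserving.skew_product (g := fun (y : Rest p) (w : ℂ) => w + y j)
      (MeasurePreserving.id volume) ?_ (.of_forall fun w => ?_)
    · exact Continuous.measurable (by fun_prop)
    · exact (measurePreserving_add_right volume _).map_eq
  have h3 : MeasurePreserving (fun x : ℂ × Rest p => (x.1 + x.2 j, x.2))
      (volume.prod volume) (volume.prod volume) :=
    (Measure.measurePreserving_swap.comp h2).comp Measure.measurePreserving_swap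
  have h4 := (volume_preserving_piEquivPiSubtypeProd (fun _ : Fin N => ℂ)
    (fun k => k = p.1.1)).symm
  have h5 : MeasurePreserving (MeasurableEquiv.funUnique {k : Fin N // k = p.1.1} ℂ).symm volume
      (@volume _ (@MeasureSpace.pi {k : Fin N // k = p.1.1} (Subtype.fintype _) (fun _ => ℂ) _)) := by
    convert (volume_preserving_funUnique {k : Fin N // k = p.1.1} ℂ).symm
  have h6 := h5.prod (MeasurePreserving.id (volume : Measure (Rest p)))
  have h7 := h4.comp (h6.comp (h3.comp h1))
  refine (congrArg (fun f => MeasurePreserving f volume volume) ?_).mp h7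
  ext ⟨w, y⟩ k
  by_cases h : k = p.1.1
  · subst h
    rw [pairCoord_fst]
    simp [MeasurableEquiv.piEquivPiSubtypeProd, Equiv.piEquivPiSubtypeProd, j]
    ring
  by_cases h' : k = p.1.2
  · subst h'
    rw [pairCoord_snd]
    simp [MeasurableEquiv.piEquivPiSubtypeProd, Equiv.piEquivPiSubtypeProd, j, h]
    ring
  · rw [pairCoord_of_ne p _ _ h h']
    have hj : (⟨k, h⟩ : {k : Fin N // k ≠ p.1.1}) ≠ j := fun e => h' (congrArg Subtype.val e)
    simp [MeasurableEquiv.piEquivPiSubtypeProd, Equiv.piEquivPiSubtypeProd, h, hj]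

theorem lintegral_pairCoord (p : Pair N) {f : Config N → ℝ≥0∞} (hf : AEMeasurable f) :
    ∫⁻ z, f z = ∫⁻ y : Rest p, ∫⁻ w : ℂ, f (pairCoord p (w, y)) := by
  rw [← (measurePreserving_pairCoord p).lintegral_comp_emb (measurableEmbedding_pairCoord p)]
  exact lintegral_prod_symm _
    (hf.comp_quasiMeasurePreserving (measurePreserving_pairCoord p).quasiMeasurePreserving)

theorem integral_pairCoord (p : Pair N) {f : Config N → ℂ} (hf : Integrable f) :
    ∫ z, f z = ∫ y : Rest p, ∫ w : ℂ, f (pairCoord p (w, y)) := by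
  rw [← (measurePreserving_pairCoord p).integral_comp (measurableEmbedding_pairCoord p)]
  exact integral_prod_symm _ ((measurePreserving_pairCoord p).integrable_comp_of_integrable hf)

theorem quasiMeasurePreserving_cm (p : Pair N) : Measure.QuasiMeasurePreserving (cm p) volume volume := by
  have h : MeasurePreserving (pairHomeo p).symm volume volume :=
    MeasurePreserving.symm (pairHomeo p).toMeasurableEquiv (measurePreserving_pairCoord p)
  exact Measure.quasiMeasurePreserving_snd.comp h.quasiMeasurePreserving

theorem sum_norm_sq_pairCoord (p : Pair N) (w : ℂ) (y : Rest p) :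
    ∑ k, ‖pairCoord p (w, y) k‖ ^ 2 = ∑ k, ‖collapse p y k‖ ^ 2 + ‖w‖ ^ 2 / 2 := by
  have hmem : p.1.2 ∈ univ.erase p.1.1 := Finset.mem_erase.2 ⟨p.2.ne', mem_univ _⟩
  have split : ∀ f : Fin N → ℝ, ∑ k, f k =
      f p.1.1 + (f p.1.2 + ∑ k ∈ (univ.erase p.1.1).erase p.1.2, f k) := fun f => by
    rw [Finset.add_sum_erase _ _ hmem, Finset.add_sum_erase _ _ (mem_univ _)]
  rw [split, split fun k => ‖collapse p y k‖ ^ 2]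
  have e : ∑ k ∈ (univ.erase p.1.1).erase p.1.2, ‖pairCoord p (w, y) k‖ ^ 2 =
      ∑ k ∈ (univ.erase p.1.1).erase p.1.2, ‖collapse p y k‖ ^ 2 := by
    refine sum_congr rfl fun k hk => ?_
    simp only [Finset.mem_erase, mem_univ, and_true] at hk
    rw [pairCoord_of_ne p w y hk.2 hk.1, collapse_of_ne p y hk.2]
  rw [e, pairCoord_fst, pairCoord_snd, collapse_fst, collapse_of_ne p y p.2.ne']
  simp only [Complex.sq_norm, normSq_apply, add_re, add_im, sub_re, sub_im]
  have h1 : (w / 2).re = w.re / 2 := by simp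
  have h2 : (w / 2).im = w.im / 2 := by simp
  rw [h1, h2]
  ring

theorem expSq_pairCoord (c : ℝ) (p : Pair N) (w : ℂ) (y : Rest p) :
    expSq c (pairCoord p (w, y)) = expSq c (collapse p y) * rexp (c / 2 * ‖w‖ ^ 2) := by
  rw [expSq, expSq, ← Real.exp_add, sum_norm_sq_pairCoord]
  congr 1
  ring

theorem ae_linear_ne_zero {V : Type*} [NormedAddCommGroup V] [NormedSpace ℝ V] [MeasurableSpace V]
    [BorelSpace V] [FiniteDimensional ℝ V] {μ : Measure V} [μ.IsAddHaarMeasure] (L : V →ₗ[ℝ] ℂ)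
    {v : V} (hv : L v ≠ 0) : ∀ᵐ x ∂μ, L x ≠ 0 := by
  have h : LinearMap.ker L ≠ ⊤ := fun h => hv (by
    have : v ∈ LinearMap.ker L := h ▸ Submodule.mem_top
    exact this)
  have := Measure.addHaar_submodule μ _ h
  rw [ae_iff]
  simp only [ne_eq, not_not]
  exact this

theorem ae_rel_ne_zero (p : Pair N) : ∀ᵐ z : Config N, rel p z ≠ 0 := by
  refine ae_linear_ne_zero (v := single p.1.1 1)
    ({ toFun := rel p
       map_add' := fun x y => by simp only [rel, Pi.add_apply]; ring
       map_smul' := fun c x => by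
        simp only [rel, Pi.smul_apply, RingHom.id_apply, smul_sub] } : Config N →ₗ[ℝ] ℂ) ?_
  change rel p (single p.1.1 1) ≠ 0
  simp [rel, p.2.ne']

theorem collapse_add (p : Pair N) (x y : Rest p) : collapse p (x + y) = collapse p x + collapse p y := by
  ext k
  by_cases h : k = p.1.1
  · subst h; simp [collapse_fst]
  · simp [collapse_of_ne p _ h]

theorem collapse_smul {R : Type*} [SMul R ℂ] (p : Pair N) (c : R) (x : Rest p) :
    collapse p (c • x) = c • collapse p x := by
  ext k
  by_cases h : k = p.1.1
  · subst h; simp [collapse_fst]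
  · simp [collapse_of_ne p _ h]

theorem exists_rel_collapse_ne_zero {p q : Pair N} (h : q ≠ p) :
    ∃ y : Rest p, rel q (collapse p y) ≠ 0 := by
  obtain ⟨⟨i, j⟩, hij⟩ := p
  obtain ⟨⟨k, l⟩, hkl⟩ := q
  simp only at hij hkl
  by_cases hk : k = i ∨ k = j
  · have hl : l ≠ i ∧ l ≠ j := by
      by_contra hc
      have : ¬ (k = i ∧ l = j) := fun e => h (by simp [e.1, e.2])
      omega
    refine ⟨fun m => if (m : Fin N) = l then 1 else 0, ?_⟩
    have hkl' : k ≠ l := hkl.ne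
    by_cases hki : k = i
    · simp [rel, collapse, hki, hl.1, hl.2.symm]
    · simp [rel, collapse, hki, hl.1, hkl']
  · push Not at hk
    refine ⟨fun m => if (m : Fin N) = k then 1 else 0, ?_⟩
    have hkl' : l ≠ k := hkl.ne'
    by_cases hli : l = i
    · simp [rel, collapse, hli, hk.1, hk.2.symm]
    · simp [rel, collapse, hli, hk.1, hkl']

theorem ae_rel_collapse_ne_zero {p q : Pair N} (h : q ≠ p) :
    ∀ᵐ y : Rest p, rel q (collapse p y) ≠ 0 := by
  obtain ⟨y, hy⟩ := exists_rel_collapse_ne_zero h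
  exact ae_linear_ne_zero (v := y)
    ({ toFun := fun y => rel q (collapse p y)
       map_add' := fun x y => by simp only [rel, collapse_add, Pi.add_apply]; ring
       map_smul' := fun c x => by
        simp only [rel, collapse_smul, Pi.smul_apply, RingHom.id_apply, smul_sub] } :
      Rest p →ₗ[ℝ] ℂ) hy

end PairCoordinates


/-! ### Slices of wave functions along coincidence planes -/

section Slices

/-- `exp(-½ ∑ |z_i|²) φ(z) ∏_{i<j} (z_i - z_j)^l`. -/
def wave (l : ℕ) (φ : Config N → ℂ) (z : Config N) : ℂ :=
  (expSq (-(1 / 2)) z : ℂ) * φ z * ∏ p : Pair N, rel p z ^ l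

/-- `φ(z) ∏_{i<j} (z_i - z_j)^l` without the factor that belongs to the pair `p`. -/
def reduced (l : ℕ) (φ : Config N → ℂ) (p : Pair N) (z : Config N) : ℂ :=
  φ z * ∏ q ∈ univ.erase p, rel q z ^ l

/-- The regular part of a wave function at the relative coordinate `w` of the pair `p`. -/
def slice (l : ℕ) (φ : Config N → ℂ) (p : Pair N) (w : ℂ) (y : Rest p) : ℂ :=
  (expSq (-(1 / 2)) (collapse p y) : ℂ) * reduced l φ p (pairCoord p (w, y))

theorem isLLLRep_iff : IsLLLRep l Ψ φ ↔ Differentiable ℂ φ ∧ Ψ =ᵐ[volume] wave l φ := Iff.rfl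

theorem wave_eq (l : ℕ) (φ : Config N → ℂ) (p : Pair N) (z : Config N) :
    wave l φ z = (expSq (-(1 / 2)) z : ℂ) * (rel p z ^ l * reduced l φ p z) := by
  rw [wave, reduced, ← Finset.mul_prod_erase _ _ (mem_univ p)]
  ring

theorem wave_pairCoord (l : ℕ) (φ : Config N → ℂ) (p : Pair N) (w : ℂ) (y : Rest p) :
    wave l φ (pairCoord p (w, y)) = (rexp (-(1 / 4) * ‖w‖ ^ 2) : ℂ) * w ^ l * slice l φ p w y := by
  rw [wave_eq l φ p, rel_pairCoord, expSq_pairCoord, slice]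
  have : (-(1 / 2) / 2 : ℝ) = -(1 / 4) := by norm_num
  rw [this]
  push_cast
  ring

theorem pairDensity_eq (l : ℕ) (φ : Config N → ℂ) (p : Pair N) (y : Rest p) :
    pairDensity l φ p y = ‖slice l φ p 0 y‖ ^ 2 := by
  rw [slice, norm_mul, mul_pow, pairCoord_zero, norm_real, norm_of_nonneg (expSq_pos _ _).le,
    expSq, ← Real.exp_nat_mul, pairDensity]
  congr 2
  push_cast
  ring

theorem differentiable_rel (q : Pair N) : Differentiable ℂ (rel q) := by unfold rel; fun_prop

theorem differentiable_prod {ι : Type*} (s : Finset ι) {f : ι → Config N → ℂ}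
    (h : ∀ q ∈ s, Differentiable ℂ (f q)) : Differentiable ℂ fun z => ∏ q ∈ s, f q z := by
  classical
  induction s using Finset.induction with
  | empty => simp
  | insert a s ha ih =>
    simp only [prod_insert ha]
    exact (h a (Finset.mem_insert_self _ _)).mul
      (ih fun q hq => h q (Finset.mem_insert_of_mem hq))

theorem differentiable_reduced (hφ : Differentiable ℂ φ) (p : Pair N) :
    Differentiable ℂ (reduced l φ p) := by
  exact hφ.mul (differentiable_prod _ fun q _ => (differentiable_rel q).pow l)

theorem continuous_wave (hφ : Differentiable ℂ φ) : Continuous (wave l φ) :=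
  ((contDiff_ofReal_expSq _).continuous.mul hφ.continuous).mul
    (continuous_finset_prod _ fun q _ => (continuous_rel q).pow l)

theorem differentiable_slice (hφ : Differentiable ℂ φ) (p : Pair N)
    (y : Rest p) : Differentiable ℂ fun w => slice l φ p w y := by
  refine ((differentiable_reduced hφ p).comp ?_).const_mul _
  change Differentiable ℂ fun w : ℂ => collapse p y + w • relDir p
  fun_prop

theorem continuous_slice (hφ : Differentiable ℂ φ) (p : Pair N) :
    Continuous fun x : ℂ × Rest p => slice l φ p x.1 x.2 :=
  (((contDiff_ofReal_expSq _).continuous.comp (continuous_collapse p)).comp continuous_snd).mul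
    ((differentiable_reduced hφ p).continuous.comp (continuous_pairCoord p))

theorem memLp_of_bounded_support {f : ℂ → ℂ} (hm : Measurable f) {C R : ℝ}
    (hC : ∀ w, ‖w‖ ≤ R → ‖f w‖ ≤ C) (hR : ∀ w, R < ‖w‖ → f w = 0) (r : ℝ≥0∞) : MemLp f r := by
  refine MemLp.mono (memLp_indicator_const r (μ := volume) (Metric.isClosed_closedBall
    (x := (0 : ℂ)) (ε := R)).measurableSet (C : ℂ) (Or.inr measure_closedBall_lt_top.ne))
    hm.aestronglyMeasurable (.of_forall fun w => ?_)
  by_cases h : ‖w‖ ≤ R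
  · rw [indicator_of_mem (by simpa using h), norm_real]
    exact (hC w h).trans (le_abs_self _)
  · rw [hR w (not_le.1 h)]; simp

/-- The mass of the annulus which is used in averages of slices. -/
def annulus : Set ℂ := {t | 2 < ‖t‖ ∧ ‖t‖ < 3}

theorem measurableSet_annulus : MeasurableSet annulus := by
  have : IsOpen annulus := (isOpen_lt continuous_const continuous_norm).inter
    (isOpen_lt continuous_norm continuous_const)
  exact this.measurableSet

theorem volume_annulus_ne_zero : volume annulus ≠ 0 := by
  have : IsOpen annulus := (isOpen_lt continuous_const continuous_norm).inter
    (isOpen_lt continuous_norm continuous_const)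
  refine (this.measure_pos volume ⟨((5 / 2 : ℝ) : ℂ), ?_⟩).ne'
  simp only [annulus, mem_setOf_eq, norm_real]
  norm_num

theorem volume_annulus_ne_top : volume annulus ≠ ⊤ := by
  refine ((measure_mono (t := closedBall 0 3) fun t ht => ?_).trans_lt
    measure_closedBall_lt_top).ne
  simpa using ht.2.le

theorem integral_annulus_add {h : ℂ → ℂ} (hh : Differentiable ℂ h) (w : ℂ) :
    ∫ t in annulus, h (w + t) = (volume annulus).toReal * h w := by
  have hm : Measurable (annulus.indicator fun _ : ℂ => (1 : ℂ)) :=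
    measurable_const.indicator measurableSet_annulus
  have hmem := memLp_of_bounded_support (C := 1) (R := 3) hm (fun w _ => by
    by_cases h : w ∈ annulus <;> simp [h]) (fun w hw => indicator_of_notMem
      (fun hc => (hc.2.trans hw).false) _) 1
  have := integral_mul_entire measurePreserving_exp_smul (memLp_one_iff_integrable.1 hmem)
    (R := 3) (fun w hw => indicator_of_notMem (fun hc => (hc.2.trans hw).false) _)
    (fun θ t => by
      have : exp (θ * I) • t ∈ annulus ↔ t ∈ annulus := by
        simp only [annulus, mem_setOf_eq, norm_smul, norm_exp_ofReal_mul_I, one_mul]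
      by_cases h : t ∈ annulus
      · rw [indicator_of_mem h, indicator_of_mem (this.2 h)]
      · rw [indicator_of_notMem h, indicator_of_notMem (fun h' => h (this.1 h'))]) hh w
  rw [integral_indicator_const _ measurableSet_annulus] at this
  rw [← integral_indicator measurableSet_annulus]
  simp only [Measure.real, real_smul, mul_one] at this
  rw [← this]
  refine integral_congr_ae (.of_forall fun t => ?_)
  by_cases h : t ∈ annulus <;> simp [h]

/-- Slices are controlled by the wave function. -/
theorem exists_slice_sq_le : ∃ C : ℝ≥0∞, C ≠ ⊤ ∧ ∀ (l : ℕ) (φ : Config N → ℂ),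
    Differentiable ℂ φ → ∀ (p : Pair N) (y : Rest p) (w : ℂ), ‖w‖ ≤ 1 →
      ‖slice l φ p w y‖ₑ ^ 2 ≤ C * ∫⁻ s : ℂ, ‖wave l φ (pairCoord p (s, y))‖ₑ ^ 2 := by
  refine ⟨(volume annulus)⁻¹ * toE (rexp 8),
    mul_ne_top (ENNReal.inv_ne_top.2 volume_annulus_ne_zero) ofReal_ne_top,
    fun l φ hφ p y w hw => ?_⟩
  set h : ℂ → ℂ := fun w => slice l φ p w y with hh
  have hd : Differentiable ℂ h := differentiable_slice hφ p y
  have h1 := integral_annulus_add (hd.pow 2) w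
  have h2 : volume annulus * ‖h w‖ₑ ^ 2 ≤ ∫⁻ t in annulus, ‖h (w + t)‖ₑ ^ 2 := by
    have h3 := enorm_integral_le_lintegral_enorm (μ := volume.restrict annulus)
      (fun t => (h ^ 2) (w + t))
    rw [h1] at h3
    simpa [enorm_mul, enorm_pow, ← ofReal_norm, norm_real,
      ofReal_toReal volume_annulus_ne_top] using h3
  have h3 : ∀ t ∈ annulus, ‖h (w + t)‖ₑ ^ 2 ≤ toE (rexp 8) *
      ‖wave l φ (pairCoord p (w + t, y))‖ₑ ^ 2 := by
    intro t ht
    have hs1 : 1 ≤ ‖w + t‖ := by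
      have := norm_sub_norm_le t (-w)
      rw [norm_neg, sub_neg_eq_add, add_comm t w] at this
      linarith [ht.1]
    have hs4 : ‖w + t‖ ≤ 4 := (norm_add_le _ _).trans (by linarith [ht.2])
    have hle : ‖h (w + t)‖ ^ 2 ≤ rexp 8 * ‖wave l φ (pairCoord p (w + t, y))‖ ^ 2 := by
      rw [wave_pairCoord, norm_mul, norm_mul, norm_real, norm_of_nonneg (exp_pos _).le,
        norm_pow, mul_pow, mul_pow, ← Real.exp_nat_mul, ← mul_assoc, ← mul_assoc, ← Real.exp_add]
      have e1 : 1 ≤ rexp (8 + ((2 : ℕ) : ℝ) * (-(1 / 4) * ‖w + t‖ ^ 2)) := by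
        rw [Real.one_le_exp_iff]
        push_cast
        nlinarith
      have e2 : 1 ≤ (‖w + t‖ ^ l) ^ 2 := one_le_pow₀ (one_le_pow₀ hs1)
      calc ‖h (w + t)‖ ^ 2 = 1 * 1 * ‖slice l φ p (w + t) y‖ ^ 2 := by rw [one_mul, one_mul]
        _ ≤ _ := by gcongr
    have := ofReal_le_ofReal hle
    rwa [ENNReal.ofReal_mul (exp_pos _).le, ENNReal.ofReal_pow (norm_nonneg _),
      ENNReal.ofReal_pow (norm_nonneg _), ofReal_norm, ofReal_norm] at this
  have h4 : volume annulus * ‖h w‖ₑ ^ 2 ≤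
      toE (rexp 8) * ∫⁻ s : ℂ, ‖wave l φ (pairCoord p (s, y))‖ₑ ^ 2 := by
    calc _ ≤ ∫⁻ t in annulus, ‖h (w + t)‖ₑ ^ 2 := h2
      _ ≤ ∫⁻ t in annulus, toE (rexp 8) *
          ‖wave l φ (pairCoord p (w + t, y))‖ₑ ^ 2 :=
        setLIntegral_mono' measurableSet_annulus h3
      _ ≤ ∫⁻ t, toE (rexp 8) * ‖wave l φ (pairCoord p (w + t, y))‖ₑ ^ 2 :=
        setLIntegral_le_lintegral _ _
      _ = toE (rexp 8) * ∫⁻ t, ‖wave l φ (pairCoord p (w + t, y))‖ₑ ^ 2 :=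
        lintegral_const_mul' _ _ ofReal_ne_top
      _ = _ := by rw [lintegral_add_left_eq_self (fun s => ‖wave l φ (pairCoord p (s, y))‖ₑ ^ 2) w]
  calc ‖h w‖ₑ ^ 2 = (volume annulus)⁻¹ * (volume annulus * ‖h w‖ₑ ^ 2) := by
        rw [← mul_assoc, ENNReal.inv_mul_cancel volume_annulus_ne_zero volume_annulus_ne_top,
          one_mul]
    _ ≤ (volume annulus)⁻¹ * _ := mul_le_mul' le_rfl h4
    _ = _ := by rw [mul_assoc]

theorem lintegral_wave_sq (h : IsLLLRep l Ψ φ)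
    (p : Pair N) : ∫⁻ y : Rest p, ∫⁻ s : ℂ, ‖wave l φ (pairCoord p (s, y))‖ₑ ^ 2 = ‖Ψ‖ₑ ^ 2 := by
  rw [enorm_Lp_sq, lintegral_congr_ae (g := fun z => ‖wave l φ z‖ₑ ^ 2)]
  · exact (lintegral_pairCoord p (f := fun z => ‖wave l φ z‖ₑ ^ 2)
      ((continuous_wave h.1).enorm.measurable.pow_const 2).aemeasurable).symm
  · filter_upwards [h.2] with z hz
    rw [hz]; rfl

theorem memLp_slice (h : IsLLLRep l Ψ φ) (p : Pair N)
    {w : ℂ} (hw : ‖w‖ ≤ 1) : MemLp (slice l φ p w) 2 := by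
  obtain ⟨C, hC, hle⟩ := exists_slice_sq_le (N := N)
  refine memLp_two_of_lintegral ((continuous_slice h.1 p).comp
    (Continuous.prodMk_right w)).aestronglyMeasurable ?_
  calc _ ≤ ∫⁻ y : Rest p, C * ∫⁻ s : ℂ, ‖wave l φ (pairCoord p (s, y))‖ₑ ^ 2 :=
        lintegral_mono fun y => hle l φ h.1 p y w hw
    _ = C * ‖Ψ‖ₑ ^ 2 := by rw [lintegral_const_mul' _ _ hC, lintegral_wave_sq h]
    _ < ⊤ := mul_lt_top hC.lt_top (by simp)

end Slices


section Lift

theorem enorm_prod_sq {p : Pair N} {κ : ℂ → ℂ} {E : Rest p → ℂ} (hκ : AEStronglyMeasurable κ)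
    (hE : AEStronglyMeasurable E) : ∫⁻ z : Config N, ‖κ (rel p z) * E (cm p z)‖ₑ ^ 2 =
      (∫⁻ w, ‖κ w‖ₑ ^ 2) * ∫⁻ y, ‖E y‖ₑ ^ 2 := by
  rw [← (measurePreserving_pairCoord p).lintegral_comp_emb (measurableEmbedding_pairCoord p)]
  rw [← lintegral_prod_mul (hκ.enorm.pow_const 2) (hE.enorm.pow_const 2)]
  refine lintegral_congr fun x => ?_
  obtain ⟨w, y⟩ := x
  simp only [rel_pairCoord, cm_pairCoord, enorm_mul, mul_pow]

theorem memLp_pairLift (p : Pair N) {κ : ℂ → ℂ} {E : Rest p → ℂ} (hκ : MemLp κ 2)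
    (hE : MemLp E 2) : MemLp (fun z : Config N => κ (rel p z) * E (cm p z)) 2 := by
  have h : MeasurePreserving (pairHomeo p).symm volume volume :=
    MeasurePreserving.symm (pairHomeo p).toMeasurableEquiv (measurePreserving_pairCoord p)
  have hm : AEStronglyMeasurable (fun x : ℂ × Rest p => κ x.1 * E x.2) (volume.prod volume) :=
    hκ.1.comp_fst.mul hE.1.comp_snd
  refine memLp_two_of_lintegral (hm.comp_quasiMeasurePreserving h.quasiMeasurePreserving) ?_
  rw [enorm_prod_sq hκ.1 hE.1]
  exact mul_lt_top (MemLp.lintegral_sq_lt_top hκ) (MemLp.lintegral_sq_lt_top hE)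

theorem norm_toLp_pairLift_sq (p : Pair N) {κ : ℂ → ℂ} {E : Rest p → ℂ} (hκ : MemLp κ 2)
    (hE : MemLp E 2) : ‖(memLp_pairLift p hκ hE).toLp‖ ^ 2 =
      (∫⁻ w, ‖κ w‖ₑ ^ 2).toReal * (∫⁻ y, ‖E y‖ₑ ^ 2).toReal := by
  rw [norm_Lp_sq, ← toReal_mul, ← enorm_prod_sq hκ.1 hE.1]
  refine congrArg _ (lintegral_congr_ae ?_)
  filter_upwards [(memLp_pairLift p hκ hE).coeFn_toLp] with z hz
  rw [hz]

/-- `E ↦ κ(z_i - z_j) E(rest)` as a linear map between `L²` spaces. -/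
def pairLiftₗ (p : Pair N) {κ : ℂ → ℂ} (hκ : MemLp κ 2) :
    RestL2 p →ₗ[ℂ] L2 N where
  toFun E := (memLp_pairLift p hκ (Lp.memLp E)).toLp
  map_add' E E' := by
    rw [← MemLp.toLp_add, MemLp.toLp_eq_toLp_iff]
    filter_upwards [(quasiMeasurePreserving_cm p).ae (Lp.coeFn_add E E')] with z hz
    rw [hz, Pi.add_apply, Pi.add_apply, mul_add]
  map_smul' c E := by
    rw [RingHom.id_apply, ← MemLp.toLp_const_smul, MemLp.toLp_eq_toLp_iff]
    filter_upwards [(quasiMeasurePreserving_cm p).ae (Lp.coeFn_smul c E)] with z hz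
    rw [hz, Pi.smul_apply, Pi.smul_apply, mul_smul_comm]

theorem norm_pairLiftₗ_sq (p : Pair N) {κ : ℂ → ℂ} (hκ : MemLp κ 2) (E : RestL2 p) :
    ‖pairLiftₗ p hκ E‖ ^ 2 = (∫⁻ w, ‖κ w‖ₑ ^ 2).toReal * ‖E‖ ^ 2 := by
  rw [norm_Lp_sq E]
  exact norm_toLp_pairLift_sq p hκ (Lp.memLp E)

/-- `E ↦ κ(z_i - z_j) E(rest)` as an operator between `L²` spaces. -/
def pairLift (p : Pair N) {κ : ℂ → ℂ} (hκ : MemLp κ 2) :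
    RestL2 p →L[ℂ] L2 N :=
  (pairLiftₗ p hκ).mkContinuous (√(∫⁻ w, ‖κ w‖ₑ ^ 2).toReal) fun E => by
    refine le_of_sq_le_sq ?_ (by positivity)
    rw [mul_pow, sq_sqrt toReal_nonneg, norm_pairLiftₗ_sq]

theorem norm_pairLift_sq (p : Pair N) {κ : ℂ → ℂ} (hκ : MemLp κ 2) (E : RestL2 p) :
    ‖pairLift p hκ E‖ ^ 2 = (∫⁻ w, ‖κ w‖ₑ ^ 2).toReal * ‖E‖ ^ 2 :=
  norm_pairLiftₗ_sq p hκ E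

theorem coeFn_pairLift (p : Pair N) {κ : ℂ → ℂ} (hκ : MemLp κ 2) (E : RestL2 p) :
    pairLift p hκ E =ᵐ[volume] fun z => κ (rel p z) * E (cm p z) :=
  (memLp_pairLift p hκ (Lp.memLp E)).coeFn_toLp

theorem inner_pairLift (p : Pair N) {κ : ℂ → ℂ} (hκ : MemLp κ 2)
    (E : RestL2 p) {Φ : L2 N} {f : Config N → ℂ} (hf : Φ =ᵐ[volume] f) : ⟪pairLift p hκ E, Φ⟫_ℂ =
      ∫ y, conj (E y) * ∫ w, conj (κ w) * f (pairCoord p (w, y)) := by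
  have hi : Integrable (fun z => conj (κ (rel p z) * E (cm p z)) * f z) :=
    integrable_conj_mul_memLp (memLp_pairLift p hκ (Lp.memLp E))
      ((memLp_congr_ae hf).1 (Lp.memLp Φ))
  have e : ⟪pairLift p hκ E, Φ⟫_ℂ = ∫ z, conj (κ (rel p z) * E (cm p z)) * f z := by
    rw [L2_inner_eq]
    refine integral_congr_ae ?_
    filter_upwards [coeFn_pairLift p hκ E, hf] with z h1 h2
    rw [h1, h2]
  rw [e, integral_pairCoord p hi]
  refine integral_congr_ae (.of_forall fun y => ?_)
  simp only [rel_pairCoord, cm_pairCoord, map_mul]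
  rw [← integral_const_mul]
  refine integral_congr_ae (.of_forall fun w => ?_)
  simp only
  ring

/-- Bounded measurable radial profiles with bounded support, as functions of `|w|²`. -/
structure IsProfile (k : ℝ → ℝ) : Prop where
  measurable : Measurable k
  bounded : ∃ C, ∀ q, |k q| ≤ C
  support : ∃ R, 0 ≤ R ∧ ∀ q, R ^ 2 < q → k q = 0

/-- The function `k(|w|²) exp(|w|²/4) w^l`. -/
def radKernel (l : ℕ) (k : ℝ → ℝ) (w : ℂ) : ℂ :=
  ((k (‖w‖ ^ 2) * rexp (‖w‖ ^ 2 / 4) : ℝ) : ℂ) * w ^ l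

/-- The moment `∫ k(|w|²) |w|^{2l} dw`. -/
def moment (l : ℕ) (k : ℝ → ℝ) : ℝ := ∫ w : ℂ, k (‖w‖ ^ 2) * ‖w‖ ^ (2 * l)

theorem IsProfile.memLp_radKernel (hk : IsProfile k) (l : ℕ) (r : ℝ≥0∞) :
    MemLp (radKernel l k) r := by
  obtain ⟨C, hC⟩ := hk.bounded
  obtain ⟨R, hR, hs⟩ := hk.support
  have hm := hk.measurable
  have hC0 : 0 ≤ C := (abs_nonneg _).trans (hC 0)
  refine memLp_of_bounded_support (C := C * rexp (R ^ 2 / 4) * R ^ l) (R := R) ?_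
    (fun w hw => ?_) (fun w hw => ?_) r
  · unfold radKernel
    have : Measurable fun w : ℂ => k (‖w‖ ^ 2) := hm.comp (by fun_prop)
    fun_prop
  · rw [radKernel, norm_mul, norm_pow, norm_real, norm_mul, norm_eq_abs,
      norm_of_nonneg (exp_pos _).le]
    gcongr
    exact hC _
  · rw [radKernel, hs _ (by gcongr)]
    simp

theorem IsProfile.integrable_moment (hk : IsProfile k) (l : ℕ) :
    Integrable (fun w : ℂ => ((k (‖w‖ ^ 2) * ‖w‖ ^ (2 * l) : ℝ) : ℂ)) := by
  obtain ⟨C, hC⟩ := hk.bounded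
  obtain ⟨R, hR, hs⟩ := hk.support
  have hm := hk.measurable
  have hC0 : 0 ≤ C := (abs_nonneg _).trans (hC 0)
  refine memLp_one_iff_integrable.1 (memLp_of_bounded_support (C := C * R ^ (2 * l)) (R := R) ?_
    (fun w hw => ?_) (fun w hw => ?_) 1)
  · have : Measurable fun w : ℂ => k (‖w‖ ^ 2) := hm.comp (by fun_prop)
    fun_prop
  · rw [norm_real, norm_mul, norm_eq_abs, norm_pow, norm_norm]
    gcongr
    exact hC _
  · rw [hs _ (by gcongr)]
    simp

theorem integral_radKernel_wave (hk : IsProfile k)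
    (hφ : Differentiable ℂ φ) (p : Pair N) (y : Rest p) :
    ∫ w, conj (radKernel l k w) * wave l φ (pairCoord p (w, y)) =
      (moment l k : ℂ) * slice l φ p 0 y := by
  obtain ⟨R, hR, hs⟩ := hk.support
  have h := integral_mul_entire (μ := volume) measurePreserving_exp_smul (hk.integrable_moment l)
    (R := R) (fun w hw => by rw [hs _ (by gcongr)]; simp)
    (fun θ t => by rw [norm_smul, norm_exp_ofReal_mul_I, one_mul])
    (differentiable_slice (l := l) hφ p y) 0
  rw [integral_complex_ofReal] at h
  rw [moment, ← h]
  refine integral_congr_ae (.of_forall fun w => ?_)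
  simp only [wave_pairCoord, radKernel, map_mul, conj_ofReal, map_pow, zero_add]
  have e1 : conj w ^ l * w ^ l = ((‖w‖ ^ (2 * l) : ℝ) : ℂ) := by
    rw [← mul_pow, conj_mul', pow_mul]; push_cast; rfl
  have e2 : (rexp (‖w‖ ^ 2 / 4) : ℂ) * (rexp (-(1 / 4) * ‖w‖ ^ 2) : ℂ) = 1 := by
    rw [← ofReal_mul, ← Real.exp_add]
    ring_nf
    simp
  push_cast at e1 e2 ⊢
  linear_combination (k (‖w‖ ^ 2) : ℂ) * slice l φ p w y * (conj w ^ l * w ^ l) * e2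
    + (k (‖w‖ ^ 2) : ℂ) * slice l φ p w y * e1

/-- The profile which defines the slices. -/
def sliceProfile (l : ℕ) (q : ℝ) : ℝ :=
  (moment l ((Iic 1).indicator 1))⁻¹ * (Iic (1 : ℝ)).indicator 1 q

theorem isProfile_indicator_Iic : IsProfile ((Iic (1 : ℝ)).indicator 1) where
  measurable := measurable_one.indicator measurableSet_Iic
  bounded := ⟨1, fun q => by by_cases h : q ∈ Iic (1 : ℝ) <;> simp [h]⟩
  support := ⟨1, zero_le_one, fun q hq => indicator_of_notMem (by simpa using hq) _⟩

theorem IsProfile.const_mul (hk : IsProfile k) (c : ℝ) : IsProfile fun q => c * k q where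
  measurable := hk.measurable.const_mul c
  bounded := by
    obtain ⟨C, hC⟩ := hk.bounded
    exact ⟨|c| * C, fun q => by rw [abs_mul]; exact mul_le_mul_of_nonneg_left (hC q) (abs_nonneg _)⟩
  support := by
    obtain ⟨R, hR, hs⟩ := hk.support
    exact ⟨R, hR, fun q hq => by rw [hs q hq, mul_zero]⟩

theorem isProfile_sliceProfile (l : ℕ) : IsProfile (sliceProfile l) :=
  isProfile_indicator_Iic.const_mul _

theorem moment_pos_of_ball (l : ℕ) : 0 < moment l ((Iic (1 : ℝ)).indicator 1) := by
  unfold moment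
  have hi := (isProfile_indicator_Iic.integrable_moment l).re
  simp only [RCLike.re_eq_complex_re, ofReal_re] at hi
  have hnn : ∀ w : ℂ, 0 ≤ (Iic (1 : ℝ)).indicator (1 : ℝ → ℝ) (‖w‖ ^ 2) * ‖w‖ ^ (2 * l) := fun w =>
    mul_nonneg (indicator_nonneg (fun _ _ => zero_le_one) _) (by positivity)
  rw [integral_pos_iff_support_of_nonneg hnn hi]
  have ho : IsOpen {w : ℂ | 0 < ‖w‖ ∧ ‖w‖ < 1} :=
    (isOpen_lt continuous_const continuous_norm).inter (isOpen_lt continuous_norm continuous_const)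
  refine (ho.measure_pos volume ⟨((1 / 2 : ℝ) : ℂ), ?_⟩).trans_le (measure_mono fun w hw => ?_)
  · simp only [mem_setOf_eq, norm_real]; norm_num
  · have h1 : ‖w‖ ^ 2 ∈ Iic (1 : ℝ) := pow_le_one₀ hw.1.le hw.2.le
    rw [Function.mem_support, indicator_of_mem h1]
    have := hw.1
    simp only [Pi.one_apply]
    positivity

theorem moment_const_mul (l : ℕ) (c : ℝ) (k : ℝ → ℝ) :
    moment l (fun q => c * k q) = c * moment l k := by
  simp only [moment, mul_assoc, integral_const_mul]

theorem moment_sliceProfile (l : ℕ) : moment l (sliceProfile l) = 1 := by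
  have := moment_const_mul l (moment l ((Iic 1).indicator 1))⁻¹ ((Iic (1 : ℝ)).indicator 1)
  rw [inv_mul_cancel₀ (moment_pos_of_ball l).ne'] at this
  exact this

/-- The operator which maps a wave function in `𝔅_l` to its slice at coincidence. -/
def sliceL (l : ℕ) (p : Pair N) : L2 N →L[ℂ] RestL2 p :=
  (pairLift p ((isProfile_sliceProfile l).memLp_radKernel l 2)).adjoint

theorem inner_radKernel (hk : IsProfile k) (h : IsLLLRep l Ψ φ) (p : Pair N) (E : RestL2 p) :
    ⟪pairLift p (hk.memLp_radKernel l 2) E, Ψ⟫_ℂ =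
      moment l k * ⟪E, (memLp_slice h p (w := 0) (by simp)).toLp⟫_ℂ := by
  rw [inner_pairLift p _ E h.2, L2_inner_eq, ← integral_const_mul]
  refine integral_congr_ae ?_
  filter_upwards [(memLp_slice h p (w := 0) (by simp)).coeFn_toLp] with y hy
  rw [hy]
  have := integral_radKernel_wave hk (l := l) h.1 p y
  rw [mul_left_comm, ← this]
  rfl

theorem sliceL_eq (h : IsLLLRep l Ψ φ) (p : Pair N) :
    sliceL l p Ψ = (memLp_slice h p (w := 0) (by simp)).toLp := by
  refine ext_inner_left ℂ fun E => ?_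
  rw [sliceL, ContinuousLinearMap.adjoint_inner_right,
    inner_radKernel (isProfile_sliceProfile l) h, moment_sliceProfile]
  simp

theorem inner_radKernel_eq (hk : IsProfile k) (h : Ψ ∈ spaceB N l) (p : Pair N) (E : RestL2 p) :
    ⟪pairLift p (hk.memLp_radKernel l 2) E, Ψ⟫_ℂ = moment l k * ⟪E, sliceL l p Ψ⟫_ℂ := by
  obtain ⟨φ, h⟩ := h
  rw [inner_radKernel hk h, sliceL_eq h]

theorem norm_sliceL_sq (h : IsLLLRep l Ψ φ) (p : Pair N) :
    Integrable (pairDensity l φ p) ∧ ‖sliceL l p Ψ‖ ^ 2 = ∫ y, pairDensity l φ p y := by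
  have hm := memLp_slice h p (w := 0) (by simp)
  have hd : pairDensity l φ p = fun y => ‖slice l φ p 0 y‖ ^ 2 := funext (pairDensity_eq l φ p)
  rw [hd]
  refine ⟨(memLp_two_iff_integrable_sq_norm hm.1).1 hm, ?_⟩
  have hm2 : AEStronglyMeasurable (fun y => ‖slice l φ p 0 y‖ ^ 2) := hm.1.norm.pow 2
  rw [sliceL_eq h, norm_Lp_sq, integral_eq_lintegral_of_nonneg_ae
    (.of_forall fun y => by positivity) hm2]
  congr 1
  refine lintegral_congr_ae ?_
  filter_upwards [hm.coeFn_toLp] with y hy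
  rw [hy, ENNReal.ofReal_pow (norm_nonneg _), ofReal_norm]

end Lift


/-! ### Division by the relative coordinate, and the spaces `𝔅_l` -/

section Division

theorem contDiff_integral_unit_interval {g : Config N × ℝ → ℂ} (hg : ContDiff ℝ 1 g) :
    ContDiff ℝ 1 fun z => ∫ t in (0 : ℝ)..1, g (z, t) := by
  let θ : ContDiffBump (0 : ℝ) := ⟨1, 2, zero_lt_one, one_lt_two⟩
  have h := contDiffOn_convolution_right_with_param_comp (𝕜 := ℝ) (n := 1) (μ := volume)
    (ContinuousLinearMap.lsmul ℝ ℝ : ℝ →L[ℝ] ℂ →L[ℝ] ℂ) (s := (Set.univ : Set (Config N)))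
    (v := fun _ => (0 : ℝ)) contDiffOn_const (f := (Ioc (0 : ℝ) 1).indicator 1)
    (g := fun z s => θ s • g (z, -s)) (k := closedBall 0 2) isOpen_univ
    (isCompact_closedBall _ _) (fun z x _ hx => by
      have : θ x = 0 := θ.zero_of_le_dist (le_of_lt (by simpa using hx))
      simp only [this, zero_smul]) ?_ ?_
  · rw [contDiffOn_univ] at h
    refine (congrArg (ContDiff ℝ 1) (funext fun z => ?_)).mp h
    rw [convolution_def, integral_of_le zero_le_one,
      ← integral_indicator measurableSet_Ioc]
    refine integral_congr_ae (.of_forall fun t => ?_)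
    by_cases ht : t ∈ Ioc (0 : ℝ) 1
    · have h1 : θ (-t) = 1 := θ.one_of_mem_closedBall (by
        simpa [abs_of_pos ht.1] using ht.2)
      simp [ht, h1]
    · simp [ht]
  · exact ((integrable_indicator_iff measurableSet_Ioc).2
      (integrableOn_const (by simp))).locallyIntegrable
  · refine ContDiff.contDiffOn ?_
    have h1 : ContDiff ℝ 1 fun x : Config N × ℝ => θ x.2 := θ.contDiff.comp contDiff_snd
    have h2 : ContDiff ℝ 1 fun x : Config N × ℝ => g (x.1, -x.2) :=
      hg.comp (contDiff_fst.prodMk contDiff_snd.neg)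
    exact h1.smul h2

theorem collapse_cm (p : Pair N) (z : Config N) : collapse p (cm p z) = z - rel p z • relDir p := by
  rw [eq_sub_iff_add_eq]
  exact pairCoord_rel_cm p z

theorem exists_div_rel (hφ : Differentiable ℂ φ) (p : Pair N) (h0 : ∀ y, φ (collapse p y) = 0) :
    ∃ ψ, Differentiable ℂ ψ ∧ ∀ z, φ z = rel p z * ψ z := by
  have hφs := contDiff_of_entire hφ
  set base : Config N × ℝ → Config N := fun x => x.1 + ((x.2 - 1 : ℝ) • rel p x.1) • relDir p
    with hbase
  have hrel : ContDiff ℝ ∞ (rel p) := by unfold rel; fun_prop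
  have hb : ContDiff ℝ ∞ base :=
    contDiff_fst.add (((contDiff_snd.sub contDiff_const).smul (hrel.comp contDiff_fst)).smul
      contDiff_const)
  set g : Config N × ℝ → ℂ := fun x => fderiv ℝ φ (base x) (relDir p) with hg
  have hgs : ContDiff ℝ 1 g := ((contDiff_fderiv_apply hφs (relDir p)).comp hb).of_le (by simp)
  set ψ : Config N → ℂ := fun z => ∫ t in (0 : ℝ)..1, g (z, t) with hψ
  have hψs : ContDiff ℝ 1 ψ := contDiff_integral_unit_interval hgs
  have heq : ∀ z, φ z = rel p z * ψ z := by
    intro z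
    have hd : ∀ t : ℝ, HasDerivAt (fun t => φ (base (z, t))) (rel p z * g (z, t)) t := by
      intro t
      have h1 : HasDerivAt (fun t : ℝ => base (z, t)) (rel p z • relDir p) t := by
        have h2 : HasDerivAt (fun t : ℝ => z + ((t - 1 : ℝ) • rel p z) • relDir p)
            (((1 : ℝ) • rel p z) • relDir p) t :=
          ((((hasDerivAt_id t).sub_const 1).smul_const (rel p z)).smul_const (relDir p)).const_add z
        rwa [one_smul] at h2
      have h3 := (hφs.differentiable (by simp) (base (z, t))).hasFDerivAt.comp_hasDerivAt t h1
      have h4 : fderiv ℝ φ (base (z, t)) (rel p z • relDir p) = rel p z * g (z, t) := by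
        simp only [hg, (hφ _).fderiv_restrictScalars ℝ,
          ContinuousLinearMap.coe_restrictScalars', map_smul, smul_eq_mul]
      rwa [h4] at h3
    have hc : Continuous fun t : ℝ => rel p z * g (z, t) :=
      continuous_const.mul (hgs.continuous.comp (Continuous.prodMk_right z))
    have h5 := integral_eq_sub_of_hasDerivAt (fun t _ => hd t)
      (hc.intervalIntegrable 0 1)
    rw [intervalIntegral.integral_const_mul] at h5
    have e0 : base (z, 0) = collapse p (cm p z) := by rw [collapse_cm]; simp [hbase, sub_eq_add_neg]
    have e1 : base (z, 1) = z := by simp [hbase]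
    rw [e0, e1, h0, sub_zero] at h5
    exact h5.symm
  refine ⟨ψ, differentiable_of_dbar (hψs.differentiable (by simp)) fun z i => ?_, heq⟩
  have hc : ∀ d : Config N, Continuous fun z => fderiv ℝ ψ z d := fun d =>
    (hψs.continuous_fderiv (by simp)).clm_apply continuous_const
  have hae : (fun z => fderiv ℝ ψ z (single i I)) =ᵐ[volume]
      fun z => I * fderiv ℝ ψ z (single i 1) := by
    filter_upwards [ae_rel_ne_zero p] with z hz
    have hev : ψ =ᶠ[𝓝 z] fun z => φ z * (rel p z)⁻¹ := by
      filter_upwards [(continuous_rel p).continuousAt.eventually_ne hz] with x hx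
      rw [heq x]
      field_simp
    have hdz : DifferentiableAt ℂ ψ z :=
      ((hφ z).mul ((differentiableAt_inv hz).comp z (differentiable_rel p z))).congr_of_eventuallyEq hev
    have e : (single i I : Config N) = I • single i 1 := by
      ext k
      by_cases h : k = i
      · subst h; simp
      · simp [h]
    simp only [hdz.fderiv_restrictScalars ℝ, ContinuousLinearMap.coe_restrictScalars', e, map_smul,
      smul_eq_mul]
  exact congrFun ((Continuous.ae_eq_iff_eq volume (hc _) (continuous_const.mul (hc _))).1 hae) z

theorem eq_zero_of_ae_eq_zero {V : Type*} [TopologicalSpace V] [MeasurableSpace V] {μ : Measure V}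
    [μ.IsOpenPosMeasure] {f : V → ℂ} (hf : Continuous f) (h : ∀ᵐ x ∂μ, f x = 0) (x : V) : f x = 0 :=
  congrFun ((Continuous.ae_eq_iff_eq μ hf continuous_zero).1 h) x

theorem exists_div_prod (s : Finset (Pair N)) (hφ : Differentiable ℂ φ)
    (h0 : ∀ p ∈ s, ∀ y, φ (collapse p y) = 0) :
    ∃ ψ, Differentiable ℂ ψ ∧ ∀ z, φ z = (∏ p ∈ s, rel p z) * ψ z := by
  classical
  induction s using Finset.induction with
  | empty => exact ⟨φ, hφ, fun z => by simp⟩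
  | insert a s ha ih =>
    obtain ⟨ψ, hψ, he⟩ := ih fun p hp => h0 p (Finset.mem_insert_of_mem hp)
    have hz : ∀ y, ψ (collapse a y) = 0 := by
      refine eq_zero_of_ae_eq_zero (μ := volume) (hψ.continuous.comp (continuous_collapse a)) ?_
      have hne : ∀ᵐ y : Rest a, ∀ q ∈ s, rel q (collapse a y) ≠ 0 :=
        (Finset.eventually_all s).2 fun q hq => ae_rel_collapse_ne_zero fun e => ha (e ▸ hq)
      filter_upwards [hne] with y hy
      have := h0 a (Finset.mem_insert_self _ _) y
      rw [he] at this
      exact (mul_eq_zero.1 this).resolve_left (Finset.prod_ne_zero_iff.2 hy)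
    obtain ⟨ψ', hψ', he'⟩ := exists_div_rel hψ a hz
    refine ⟨ψ', hψ', fun z => ?_⟩
    rw [he, he', prod_insert ha]
    ring

theorem rel_collapse_self (p : Pair N) (y : Rest p) : rel p (collapse p y) = 0 := by
  rw [rel, collapse_fst, collapse_of_ne p y p.2.ne', sub_self]

theorem sliceL_eq_zero_iff (h : IsLLLRep l Ψ φ)
    (p : Pair N) : sliceL l p Ψ = 0 ↔ ∀ᵐ y, slice l φ p 0 y = 0 := by
  have hc := (memLp_slice h p (w := 0) (by simp)).coeFn_toLp
  rw [sliceL_eq h, Lp.eq_zero_iff_ae_eq_zero]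
  constructor
  · intro h0
    filter_upwards [h0, hc] with y h1 h2
    rw [← h2, h1, Pi.zero_apply]
  · intro h0
    filter_upwards [h0, hc] with y h1 h2
    rw [h2, h1, Pi.zero_apply]

theorem mem_spaceB_succ_iff : Ψ ∈ spaceB N (l + 1) ↔ Ψ ∈ spaceB N l ∧ ∀ p, sliceL l p Ψ = 0 := by
  constructor
  · rintro ⟨φ, hφ, he⟩
    have hrep : IsLLLRep l Ψ fun z => φ z * ∏ p : Pair N, rel p z := by
      refine ⟨hφ.mul (differentiable_prod _ fun q _ => differentiable_rel q), ?_⟩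
      filter_upwards [he] with z hz
      rw [hz]
      simp only [pow_succ, Finset.prod_mul_distrib, rel]
      ring
    refine ⟨⟨_, hrep⟩, fun p => ?_⟩
    refine (sliceL_eq_zero_iff hrep p).2 (.of_forall fun y => ?_)
    simp only [slice, reduced, pairCoord_zero]
    rw [Finset.prod_eq_zero (mem_univ p) (rel_collapse_self p y)]
    simp
  · rintro ⟨⟨φ, hφ⟩, hs⟩
    have hz : ∀ p ∈ (univ : Finset (Pair N)), ∀ y, φ (collapse p y) = 0 := by
      intro p _
      refine eq_zero_of_ae_eq_zero (μ := volume) (hφ.1.continuous.comp (continuous_collapse p)) ?_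
      have h2 := (sliceL_eq_zero_iff hφ p).1 (hs p)
      have hne : ∀ᵐ y : Rest p, ∀ q ∈ univ.erase p, rel q (collapse p y) ≠ 0 :=
        (Finset.eventually_all _).2 fun q hq => ae_rel_collapse_ne_zero (ne_of_mem_erase hq)
      filter_upwards [h2, hne] with y hy hy'
      simp only [slice, reduced, pairCoord_zero, mul_eq_zero, ofReal_eq_zero,
        (expSq_pos _ _).ne', false_or] at hy
      exact hy.resolve_right (Finset.prod_ne_zero_iff.2 fun q hq => pow_ne_zero _ (hy' q hq))
    obtain ⟨ψ, hψ, he⟩ := exists_div_prod _ hφ.1 hz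
    refine ⟨ψ, hψ, ?_⟩
    filter_upwards [hφ.2] with z hz
    rw [hz, he]
    simp only [pow_succ, Finset.prod_mul_distrib, rel]
    ring

theorem isClosed_spaceB (l : ℕ) : IsClosed (spaceB N l : Set (L2 N)) := by
  induction l with
  | zero => exact isClosed_spaceB_zero
  | succ l ih =>
    have : (spaceB N (l + 1) : Set (L2 N)) =
        (spaceB N l : Set (L2 N)) ∩ ⋂ p, {Ψ | sliceL l p Ψ = 0} := by
      ext Ψ
      simp only [SetLike.mem_coe, mem_spaceB_succ_iff, Set.mem_inter_iff, mem_iInter,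
        mem_setOf_eq]
    rw [this]
    exact ih.inter (isClosed_iInter fun p => isClosed_eq (sliceL l p).continuous continuous_const)

instance completeSpace_spaceB (l : ℕ) : CompleteSpace (spaceB N l) :=
  (isClosed_spaceB l).completeSpace_coe

/-- The operator `∑ S_p^* S_p` on `𝔅_l`. -/
def coincidenceOp (N l : ℕ) : spaceB N l →L[ℂ] spaceB N l :=
  ∑ p : Pair N, ((sliceL l p).comp (spaceB N l).subtypeL).adjoint.comp
    ((sliceL l p).comp (spaceB N l).subtypeL)

theorem inner_coincidenceOp (Φ Ψ : spaceB N l) : ⟪Φ, coincidenceOp N l Ψ⟫_ℂ =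
    ∑ p : Pair N, ⟪sliceL l p (Φ : L2 N), sliceL l p (Ψ : L2 N)⟫_ℂ := by
  rw [coincidenceOp, ContinuousLinearMap.sum_apply, inner_sum]
  refine sum_congr rfl fun p _ => ?_
  rw [ContinuousLinearMap.comp_apply, ContinuousLinearMap.adjoint_inner_right]
  rfl

theorem isPseudoHamiltonian_coincidenceOp (N l : ℕ) :
    IsPseudoHamiltonian N l (coincidenceOp N l) := by
  intro Ψ φ h
  refine ⟨fun p => (norm_sliceL_sq h p).1, ?_⟩
  rw [inner_coincidenceOp]
  push_cast
  refine sum_congr rfl fun p _ => ?_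
  rw [← (norm_sliceL_sq h p).2, inner_self_eq_norm_sq_to_K]
  push_cast
  rfl

theorem IsPseudoHamiltonian.eq_coincidenceOp {T : spaceB N l →L[ℂ] spaceB N l}
    (h : IsPseudoHamiltonian N l T) : T = coincidenceOp N l := by
  have key : ∀ Ψ, ⟪T Ψ, Ψ⟫_ℂ = ⟪coincidenceOp N l Ψ, Ψ⟫_ℂ := by
    intro Ψ
    obtain ⟨φ, hφ⟩ := Ψ.2
    have e : ∀ T' : spaceB N l →L[ℂ] spaceB N l, ⟪T' Ψ, Ψ⟫_ℂ = conj ⟪Ψ, T' Ψ⟫_ℂ := fun T' =>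
      (inner_conj_symm (𝕜 := ℂ) (E := spaceB N l) (T' Ψ) Ψ).symm
    rw [e, e, (h Ψ φ hφ).2, (isPseudoHamiltonian_coincidenceOp N l Ψ φ hφ).2]
  exact ContinuousLinearMap.coe_injective ((ext_inner_map (T : spaceB N l →ₗ[ℂ] spaceB N l) _).1 key)

theorem existsUnique_isPseudoHamiltonian (N l : ℕ) : ∃! T, IsPseudoHamiltonian N l T :=
  ⟨_, isPseudoHamiltonian_coincidenceOp N l, fun _ h => h.eq_coincidenceOp⟩

theorem pseudoHamiltonian_eq (N l : ℕ) : pseudoHamiltonian N l = coincidenceOp N l := by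
  rw [pseudoHamiltonian, dif_pos (existsUnique_isPseudoHamiltonian N l)]
  exact (existsUnique_isPseudoHamiltonian N l).choose_spec.1.eq_coincidenceOp

end Division


/-! ### Radial profiles -/

section Radial

theorem volume_norm_sq_le (q : ℝ) (hq : 0 ≤ q) : volume {w : ℂ | ‖w‖ ^ 2 ≤ q} = toE π * toE q := by
  have : {w : ℂ | ‖w‖ ^ 2 ≤ q} = closedBall 0 (√q) := by
    ext w
    simp only [mem_setOf_eq, mem_closedBall_zero_iff, Real.le_sqrt (norm_nonneg w) hq]
  rw [this, Complex.volume_closedBall, ← ENNReal.ofReal_pow (sqrt_nonneg _), sq_sqrt hq,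
    mul_comm]
  congr 1
  rw [← NNReal.coe_real_pi, ofReal_coe_nnreal]

theorem measurePreserving_norm_sq : MeasurePreserving (fun w : ℂ => ‖w‖ ^ 2) volume
    (toE π • (volume.restrict (Ioi (0 : ℝ)))) := by
  have hm : Measurable fun w : ℂ => ‖w‖ ^ 2 := by fun_prop
  refine ⟨hm, ?_⟩
  symm
  have : IsLocallyFiniteMeasure (toE π • (volume.restrict (Ioi (0 : ℝ)))) :=
    ⟨fun x => ⟨ball x 1, Metric.ball_mem_nhds x one_pos, by
      rw [Measure.smul_apply, smul_eq_mul]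
      exact mul_lt_top ofReal_lt_top
        ((Measure.restrict_apply_le _ _).trans_lt measure_ball_lt_top)⟩⟩
  refine Measure.ext_of_Ioc _ _ fun a b hab => ?_
  rw [Measure.smul_apply, Measure.restrict_apply measurableSet_Ioc, Set.Ioc_inter_Ioi,
    Real.volume_Ioc, smul_eq_mul, Measure.map_apply hm measurableSet_Ioc]
  rcases le_or_gt 0 a with ha | ha
  · have h1 : (fun w : ℂ => ‖w‖ ^ 2) ⁻¹' Ioc a b =
        {w : ℂ | ‖w‖ ^ 2 ≤ b} \ {w : ℂ | ‖w‖ ^ 2 ≤ a} := by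
      ext w; simp [and_comm]
    have hsub : {w : ℂ | ‖w‖ ^ 2 ≤ a} ⊆ {w : ℂ | ‖w‖ ^ 2 ≤ b} :=
      fun w hw => le_trans (Set.mem_setOf.1 hw) hab.le
    rw [h1, measure_sdiff hsub
      (measurableSet_le hm measurable_const).nullMeasurableSet, volume_norm_sq_le b (ha.trans hab.le),
      volume_norm_sq_le a ha, max_eq_left ha, ENNReal.ofReal_sub _ ha, ENNReal.mul_sub]
    · simp
    · rw [volume_norm_sq_le a ha]
      exact mul_ne_top ofReal_ne_top ofReal_ne_top
  · have h1 : (fun w : ℂ => ‖w‖ ^ 2) ⁻¹' Ioc a b = {w : ℂ | ‖w‖ ^ 2 ≤ b} := by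
      ext w
      simp only [Set.mem_preimage, Set.mem_Ioc, mem_setOf_eq, and_iff_right_iff_imp]
      exact fun _ => ha.trans_le (by positivity)
    rw [h1, max_eq_right ha.le, sub_zero]
    rcases le_or_gt 0 b with hb | hb
    · rw [volume_norm_sq_le b hb]
    · have : {w : ℂ | ‖w‖ ^ 2 ≤ b} = ∅ := by
        ext w
        simp only [mem_setOf_eq, Set.mem_empty_iff_false, iff_false, not_le]
        exact hb.trans_le (by positivity)
      rw [this, measure_empty, ENNReal.ofReal_of_nonpos hb.le, mul_zero]

theorem lintegral_norm_sq {f : ℝ → ℝ≥0∞} (hf : Measurable f) :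
    ∫⁻ w : ℂ, f (‖w‖ ^ 2) = toE π * ∫⁻ q in Ioi 0, f q := by
  rw [measurePreserving_norm_sq.lintegral_comp hf, lintegral_smul_measure, smul_eq_mul]

theorem integral_norm_sq {f : ℝ → ℝ} (hf : Measurable f) :
    ∫ w : ℂ, f (‖w‖ ^ 2) = π * ∫ q in Ioi 0, f q := by
  have h := integral_map (μ := (volume : Measure ℂ)) measurePreserving_norm_sq.measurable.aemeasurable
    (f := f) hf.aestronglyMeasurable
  rw [← h, measurePreserving_norm_sq.map_eq, integral_smul_measure,
    toReal_ofReal Real.pi_pos.le, smul_eq_mul]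

theorem ae_norm_sq {P : ℝ → Prop} (h : ∀ᵐ q, P q) : ∀ᵐ w : ℂ, P (‖w‖ ^ 2) := by
  refine measurePreserving_norm_sq.quasiMeasurePreserving.ae ?_
  exact (Measure.AbsolutelyContinuous.smul_left (Measure.restrict_le_self.absolutelyContinuous)
    _).ae_le h

/-- The primitive `∫_0^q k(τ) τ^l dτ`. -/
def prim (l : ℕ) (k : ℝ → ℝ) (q : ℝ) : ℝ := ∫ τ in (0 : ℝ)..q, k τ * τ ^ l

/-- Bounded measurable functions supported in `[ε, Q]` without `l`-th moment. -/
structure IsBalanced (l : ℕ) (ε Q : ℝ) (k : ℝ → ℝ) : Prop where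
  pos : 0 < ε
  measurable : Measurable k
  bounded : ∃ C, ∀ q, |k q| ≤ C
  support : ∀ q, q ∉ Icc ε Q → k q = 0
  prim_eq_zero : prim l k Q = 0

theorem intervalIntegrable_of_bounded (hm : Measurable k) {C : ℝ}
    (hC : ∀ q, |k q| ≤ C) (a b : ℝ) : IntervalIntegrable k volume a b := by
  refine (intervalIntegrable_const (c := C)).mono_fun hm.aestronglyMeasurable
    (Eventually.of_forall fun q => ?_)
  exact (hC q).trans (le_abs_self C)

theorem intervalIntegrable_mul_pow (hm : Measurable k) (hC : ∃ C, ∀ q, |k q| ≤ C)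
    (l : ℕ) (a b : ℝ) : IntervalIntegrable (fun τ => k τ * τ ^ l) volume a b := by
  obtain ⟨C, hC⟩ := hC
  exact (intervalIntegrable_of_bounded hm hC a b).mul_continuousOn (by fun_prop)

theorem prim_eq_of_zero_Ici (hm : Measurable k) (hC : ∃ C, ∀ q, |k q| ≤ C)
    {q : ℝ} (hs : ∀ q, Q < q → k q = 0) (hq : Q ≤ q) : prim l k q = prim l k Q := by
  have hi := intervalIntegrable_mul_pow hm hC l
  rw [prim, prim, ← integral_add_adjacent_intervals (hi 0 Q) (hi Q q)]
  have : ∫ τ in Q..q, k τ * τ ^ l = 0 := by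
    rw [integral_of_le hq]
    refine setIntegral_eq_zero_of_forall_eq_zero fun τ hτ => ?_
    rw [hs τ hτ.1, zero_mul]
  rw [this, add_zero]

theorem prim_eq_zero_of_le {q : ℝ} (h0 : 0 ≤ ε)
    (hs : ∀ q, q < ε → k q = 0) (hq : q ≤ ε) : prim l k q = 0 := by
  rw [prim]
  refine intervalIntegral.integral_zero_ae ?_
  have : ∀ᵐ τ : ℝ, τ ≠ ε := by simp [ae_iff]
  filter_upwards [this] with τ hne hτ
  have : τ ≤ ε := by
    rcases le_total 0 q with h | h
    · rw [Set.uIoc_of_le h] at hτ; exact hτ.2.trans hq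
    · rw [Set.uIoc_of_ge h] at hτ; exact hτ.2.trans h0
  rw [hs τ (lt_of_le_of_ne this hne), zero_mul]

theorem IsBalanced.prim_of_ge (h : IsBalanced l ε Q k) {q : ℝ} (hq : Q ≤ q) : prim l k q = 0 := by
  rw [prim_eq_of_zero_Ici h.measurable h.bounded
    (fun q hq => h.support q fun hc => hc.2.not_gt hq) hq, h.prim_eq_zero]

theorem IsBalanced.prim_of_le (h : IsBalanced l ε Q k) {q : ℝ} (hq : q ≤ ε) : prim l k q = 0 :=
  prim_eq_zero_of_le h.pos.le (fun q hq => h.support q fun hc => hc.1.not_gt hq) hq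

theorem abs_prim_le {C q : ℝ} (hC : ∀ q, |k q| ≤ C) (h0 : 0 ≤ q)
    (hq : q ≤ Q) : |prim l k q| ≤ C * Q ^ l * Q := by
  have hC0 : 0 ≤ C := (abs_nonneg _).trans (hC 0)
  have := intervalIntegral.norm_integral_le_of_norm_le_const (a := 0) (b := q)
    (f := fun τ => k τ * τ ^ l) (C := C * Q ^ l) fun τ hτ => by
      rw [Set.uIoc_of_le h0] at hτ
      rw [norm_mul, norm_eq_abs, norm_pow, norm_of_nonneg hτ.1.le]
      have : τ ≤ Q := hτ.2.trans hq
      have := hτ.1.le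
      gcongr
      exact hC τ
  rw [norm_eq_abs, sub_zero, abs_of_nonneg h0] at this
  exact this.trans (by have : 0 ≤ Q := h0.trans hq; gcongr)

theorem continuous_prim (hm : Measurable k) (hC : ∃ C, ∀ q, |k q| ≤ C) : Continuous (prim l k) :=
  intervalIntegral.continuous_primitive (intervalIntegrable_mul_pow hm hC l) 0

theorem contDiff_prim (hk : ContDiff ℝ ∞ k) :
    ContDiff ℝ ∞ (prim l k) ∧ ∀ q, HasDerivAt (prim l k) (k q * q ^ l) q := by
  have hc : ContDiff ℝ ∞ fun q : ℝ => k q * q ^ l := hk.mul (contDiff_id.pow l)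
  have hd : ∀ q, HasDerivAt (prim l k) (k q * q ^ l) q := fun q =>
    integral_hasDerivAt_right (hc.continuous.intervalIntegrable 0 q)
      (hc.continuous.stronglyMeasurableAtFilter _ _) hc.continuous.continuousAt
  refine ⟨contDiff_infty_iff_deriv.2 ⟨fun q => (hd q).differentiableAt, ?_⟩, hd⟩
  rwa [show deriv (prim l k) = fun q => k q * q ^ l from funext fun q => (hd q).deriv]

theorem tendsto_prim {κ : ℕ → ℝ → ℝ} {C : ℝ} (hm : ∀ n, Measurable (κ n))
    (hC : ∀ n q, |κ n q| ≤ C) (h : ∀ᵐ q, Tendsto (fun n => κ n q) atTop (𝓝 (k q))) (q : ℝ) :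
    Tendsto (fun n => prim l (κ n) q) atTop (𝓝 (prim l k q)) := by
  refine intervalIntegral.tendsto_integral_filter_of_dominated_convergence
    (fun τ => C * |τ| ^ l) (.of_forall fun n => ?_)
    (.of_forall fun n => .of_forall fun τ _ => ?_) ?_ ?_
  · exact ((hm n).mul (by fun_prop)).aestronglyMeasurable
  · rw [norm_mul, norm_pow, norm_eq_abs, norm_eq_abs]
    gcongr
    exact hC n τ
  · exact intervalIntegrable (by fun_prop) _ _
  · filter_upwards [h] with τ hτ _ using hτ.mul_const _

/-- Approximation of balanced profiles by smooth ones. -/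
theorem IsBalanced.exists_smooth_approx (h : IsBalanced l ε Q k)
    (hεQ : ε ≤ Q) : ∃ (C : ℝ) (κ : ℕ → ℝ → ℝ), (∀ n, ContDiff ℝ ∞ (κ n)) ∧ (∀ n q, |κ n q| ≤ C) ∧
      (∀ n, IsBalanced l (ε / 2) (Q + 1) (κ n)) ∧
      ∀ᵐ q, Tendsto (fun n => κ n q) atTop (𝓝 (k q)) := by
  obtain ⟨C, hC⟩ := h.bounded
  have hε := h.pos
  have hC0 : 0 ≤ C := (abs_nonneg _).trans (hC 0)
  have hk : LocallyIntegrable k volume := by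
    intro x
    exact ⟨Icc (x - 1) (x + 1), Icc_mem_nhds (by linarith) (by linarith),
      (intervalIntegrable_iff_integrableOn_Icc_of_le (by linarith)).1
        (intervalIntegrable_of_bounded h.measurable hC _ _)⟩
  let θ : ContDiffBump (3 / 4 * ε) := ⟨ε / 8, ε / 4, by positivity, by linarith⟩
  have hθs : ∀ q, q ∉ Icc (ε / 2) ε → θ q = 0 := fun q hq => θ.zero_of_le_dist (by
    rw [Real.dist_eq]
    by_contra hc
    rw [not_le, abs_lt] at hc
    have e : θ.rOut = ε / 4 := rfl
    rw [e] at hc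
    exact hq ⟨by linarith [hc.1], by linarith [hc.2]⟩)
  have hθc : ContDiff ℝ ∞ θ := θ.contDiff
  have hQ : 0 ≤ Q + 1 := by linarith
  have hθpos : 0 < prim l θ (Q + 1) := by
    refine intervalIntegral.integral_pos (by linarith)
      (hθc.continuous.mul (continuous_pow l)).continuousOn (fun τ hτ =>
      mul_nonneg θ.nonneg (pow_nonneg hτ.1.le _)) ⟨3 / 4 * ε, ⟨by positivity, by linarith⟩, ?_⟩
    have : θ (3 / 4 * ε) = 1 := θ.one_of_mem_closedBall (by simp [θ.rIn_pos.le])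
    rw [this]
    positivity
  obtain ⟨m, hm⟩ := (tendsto_shrinkingBump_rOut (E := ℝ)).eventually_lt_const
    (show (0 : ℝ) < min (ε / 2) 1 by positivity) |>.exists_forall_of_atTop
  set β : ℕ → ℝ → ℝ := fun n => (shrinkingBump ℝ (n + m)).normed volume
    ⋆ᵥ k with hβ
  have hβc : ∀ n, ContDiff ℝ ∞ (β n) := fun n =>
    HasCompactSupport.contDiff_convolution_left (n := ⊤) _
      (ContDiffBump.hasCompactSupport_normed _) (ContDiffBump.contDiff_normed _) hk
  have hβd : ∀ n q (e : ℝ), 0 ≤ e → (∀ x ∈ ball q (shrinkingBump ℝ (n + m)).rOut,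
      |k x| ≤ e) → |β n q| ≤ e := fun n q e he hx => by
    have := dist_convolution_le (x₀ := q) (z₀ := (0 : ℝ)) (ε := e) he
      (shrinkingBump ℝ (n + m)).support_normed_eq.subset
      (shrinkingBump ℝ (n + m)).nonneg_normed ((shrinkingBump ℝ (n + m)).integral_normed)
      (μ := volume) h.measurable.aestronglyMeasurable (fun x hx' => by
        rw [Real.dist_eq, sub_zero]; exact hx x hx')
    rwa [Real.dist_eq, sub_zero] at this
  have hβC : ∀ n q, |β n q| ≤ C := fun n q => hβd n q C hC0 fun x _ => hC x
  have hβs : ∀ n q, q ∉ Icc (ε / 2) (Q + 1) → β n q = 0 := fun n q hq => by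
    refine abs_eq_zero.1 (le_antisymm (hβd n q 0 le_rfl fun x hx => ?_) (abs_nonneg _))
    have h1 := hm (n + m) (by omega)
    rw [Metric.mem_ball, Real.dist_eq] at hx
    have h2 := abs_lt.1 (hx.trans h1)
    have h3 := min_le_left (ε / 2) 1
    have h4 := min_le_right (ε / 2) 1
    rw [h.support x fun hc => hq ⟨by linarith [hc.1], by linarith [hc.2]⟩, abs_zero]
  have hβl : ∀ᵐ q, Tendsto (fun n => β n q) atTop (𝓝 (k q)) := by
    filter_upwards [ae_tendsto_mollify volume hk] with q hq
    exact hq.comp (tendsto_add_atTop_nat m)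
  set s : ℕ → ℝ := fun n => prim l (β n) (Q + 1) / prim l θ (Q + 1) with hs
  have hs0 : Tendsto s atTop (𝓝 0) := by
    have := tendsto_prim (l := l) (fun n => (hβc n).continuous.measurable) hβC hβl (Q + 1)
    rw [h.prim_of_ge (by linarith)] at this
    simpa using this.div_const (prim l θ (Q + 1))
  obtain ⟨S, hS⟩ := hs0.norm.isBoundedUnder_le.bddAbove_range
  have hS' : ∀ n, |s n| ≤ S := fun n => hS ⟨n, rfl⟩
  have hkC : ∀ n, ContDiff ℝ ∞ fun q => β n q - s n * θ q := fun n =>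
    (hβc n).sub (contDiff_const.mul hθc)
  have hbd : ∀ n q, |β n q - s n * θ q| ≤ C + S := fun n q => by
    refine (abs_sub _ _).trans (add_le_add (hβC n q) ?_)
    rw [abs_mul, abs_of_nonneg θ.nonneg]
    exact (mul_le_of_le_one_right (abs_nonneg _) θ.le_one).trans (hS' n)
  refine ⟨C + S, fun n q => β n q - s n * θ q, hkC, hbd, fun n => ⟨by positivity,
    (hkC n).continuous.measurable, ⟨_, hbd n⟩, fun q hq => ?_, ?_⟩, ?_⟩
  · dsimp only
    rw [hβs n q hq, hθs q fun hc => hq ⟨hc.1, by linarith [hc.2]⟩]; simp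
  · have e : prim l (fun q => β n q - s n * θ q) (Q + 1)
        = prim l (β n) (Q + 1) - s n * prim l θ (Q + 1) := by
      have c1 := (hβc n).continuous
      have c2 := hθc.continuous
      simp only [prim, sub_mul, mul_assoc]
      rw [intervalIntegral.integral_sub (intervalIntegrable (by fun_prop) _ _)
        (intervalIntegrable (by fun_prop) _ _), intervalIntegral.integral_const_mul]
    rw [e, hs]
    field_simp
    ring
  · filter_upwards [hβl] with q hq
    simpa using hq.sub (hs0.mul_const (θ q))

end Radial


/-! ### Test functions concentrated near the coincidence of a pair -/

section Core

/-- The function on the relative coordinate which the creation operators map to `-2 radKernel`. -/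
def dualKernel (l : ℕ) (k : ℝ → ℝ) (w : ℂ) : ℂ :=
  -2 * I * ((prim l k (‖w‖ ^ 2) / (4 * (‖w‖ ^ 2) ^ (l + 1)) * rexp (‖w‖ ^ 2 / 4) : ℝ) : ℂ) *
    w ^ (l + 1)

theorem norm_dualKernel_sq (l : ℕ) (k : ℝ → ℝ) (w : ℂ) : ‖dualKernel l k w‖ ^ 2 =
    prim l k (‖w‖ ^ 2) ^ 2 / (4 * (‖w‖ ^ 2) ^ (l + 1)) * rexp (‖w‖ ^ 2 / 2) := by
  rw [dualKernel, norm_mul, norm_mul, norm_mul, norm_neg, norm_I, norm_real, norm_eq_abs,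
    norm_pow, mul_pow, mul_pow, sq_abs, mul_pow, mul_pow, ← Real.exp_nat_mul, div_pow]
  have e : ((2 : ℕ) : ℝ) * (‖w‖ ^ 2 / 4) = ‖w‖ ^ 2 / 2 := by push_cast; ring
  rw [e]
  simp only [norm_ofNat, mul_one]
  by_cases hw : ‖w‖ = 0
  · simp [hw]
  · field_simp
    ring

theorem norm_radKernel_sq (l : ℕ) (k : ℝ → ℝ) (w : ℂ) : ‖radKernel l k w‖ ^ 2 =
    k (‖w‖ ^ 2) ^ 2 * (‖w‖ ^ 2) ^ l * rexp (‖w‖ ^ 2 / 2) := by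
  rw [radKernel, norm_mul, norm_pow, norm_real, norm_eq_abs, mul_pow, sq_abs, mul_pow,
    ← Real.exp_nat_mul]
  have e : ((2 : ℕ) : ℝ) * (‖w‖ ^ 2 / 4) = ‖w‖ ^ 2 / 2 := by push_cast; ring
  rw [e]
  ring

theorem measurable_dualKernel (hm : Measurable k) (hC : ∃ C, ∀ q, |k q| ≤ C) :
    Measurable (dualKernel l k) := by
  have h1 : Measurable (prim l k) := (continuous_prim hm hC).measurable
  have h2 : Measurable fun w : ℂ => prim l k (‖w‖ ^ 2) := h1.comp (by fun_prop)
  unfold dualKernel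
  fun_prop

theorem IsBalanced.norm_dualKernel_le {C : ℝ} (h : IsBalanced l ε Q k)
    (hC : ∀ q, |k q| ≤ C) (w : ℂ) :
    ‖dualKernel l k w‖ ≤ √((C * Q ^ l * Q) ^ 2 / (4 * ε ^ (l + 1)) * rexp (Q / 2)) := by
  refine Real.le_sqrt_of_sq_le ?_
  have hε := h.pos
  rw [norm_dualKernel_sq]
  rcases le_total (‖w‖ ^ 2) ε with h1 | h1
  · rw [h.prim_of_le h1]
    simp only [ne_eq, OfNat.ofNat_ne_zero, not_false_eq_true, zero_pow, zero_div, zero_mul]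
    positivity
  rcases le_total Q (‖w‖ ^ 2) with h2 | h2
  · rw [h.prim_of_ge h2]
    simp only [ne_eq, OfNat.ofNat_ne_zero, not_false_eq_true, zero_pow, zero_div, zero_mul]
    positivity
  have h3 := abs_prim_le (l := l) hC (by positivity : (0 : ℝ) ≤ ‖w‖ ^ 2) h2
  have h4 : prim l k (‖w‖ ^ 2) ^ 2 ≤ (C * Q ^ l * Q) ^ 2 := by rw [← sq_abs]; gcongr
  gcongr

theorem IsBalanced.dualKernel_eq_zero (h : IsBalanced l ε Q k)
    {w : ℂ} (hw : Q ≤ ‖w‖ ^ 2) : dualKernel l k w = 0 := by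
  rw [dualKernel, h.prim_of_ge hw]; simp

theorem lt_norm_sq_of_sqrt_lt {w : ℂ} (hw : √Q < ‖w‖) : Q < ‖w‖ ^ 2 :=
  (Real.sqrt_lt' ((sqrt_nonneg _).trans_lt hw)).1 hw

theorem IsBalanced.memLp_dualKernel (h : IsBalanced l ε Q k) : MemLp (dualKernel l k) 2 := by
  obtain ⟨C, hC⟩ := h.bounded
  exact memLp_of_bounded_support (R := √Q) (measurable_dualKernel h.measurable h.bounded)
    (fun w _ => h.norm_dualKernel_le hC w)
    (fun w hw => h.dualKernel_eq_zero (lt_norm_sq_of_sqrt_lt hw).le) 2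

theorem IsBalanced.isProfile (h : IsBalanced l ε Q k) : IsProfile k where
  measurable := h.measurable
  bounded := h.bounded
  support := ⟨Real.sqrt |Q|, sqrt_nonneg _, fun q hq => h.support q fun hc => by
    rw [sq_sqrt (abs_nonneg Q)] at hq
    exact (hq.trans_le hc.2).not_ge (le_abs_self Q)⟩

theorem tendsto_pairLift (p : Pair N) {κ : ℕ → ℂ → ℂ} {κ' : ℂ → ℂ} (h : ∀ n, MemLp (κ n) 2)
    (h' : MemLp κ' 2) (hl : Tendsto (fun n => ∫⁻ w, ‖κ n w - κ' w‖ₑ ^ 2) atTop (𝓝 0))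
    (E : RestL2 p) : Tendsto (fun n => pairLift p (h n) E) atTop (𝓝 (pairLift p h' E)) := by
  have hd : ∀ n, ‖pairLift p (h n) E - pairLift p h' E‖ ^ 2 =
      (∫⁻ w, ‖κ n w - κ' w‖ₑ ^ 2).toReal * ‖E‖ ^ 2 := fun n => by
    have e : pairLift p (h n) E - pairLift p h' E = pairLift p ((h n).sub h') E := by
      refine Lp.ext ?_
      filter_upwards [Lp.coeFn_sub (pairLift p (h n) E) (pairLift p h' E), coeFn_pairLift p (h n) E,
        coeFn_pairLift p h' E, coeFn_pairLift p ((h n).sub h') E] with z h1 h2 h3 h4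
      rw [h1, Pi.sub_apply, h2, h3, h4, Pi.sub_apply, sub_mul]
    rw [e, norm_pairLift_sq]
    rfl
  have h0 : Tendsto (fun n => ‖pairLift p (h n) E - pairLift p h' E‖ ^ 2) atTop (𝓝 0) := by
    simp only [hd]
    simpa using ((tendsto_toReal (by simp)).comp hl).mul_const (‖E‖ ^ 2)
  rw [tendsto_iff_norm_sub_tendsto_zero]
  simpa [Function.comp_def, sqrt_sq (norm_nonneg _)] using (Real.continuous_sqrt.tendsto 0).comp h0

theorem tendsto_L2_of_bounded_support {f : ℕ → ℂ → ℂ} {g : ℂ → ℂ} (hf : ∀ n, MemLp (f n) 2)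
    (hg : MemLp g 2) {C R : ℝ} (hC : ∀ n w, ‖f n w‖ ≤ C) (hC' : ∀ w, ‖g w‖ ≤ C)
    (hR : ∀ n w, R < ‖w‖ → f n w = 0) (hR' : ∀ w, R < ‖w‖ → g w = 0)
    (hl : ∀ᵐ w, Tendsto (fun n => f n w) atTop (𝓝 (g w))) :
    Tendsto (fun n => ∫⁻ w, ‖f n w - g w‖ₑ ^ 2) atTop (𝓝 0) := by
  refine tendsto_lintegral_enorm_sq_zero (fun n => (hf n).1.sub hg.1)
    (memLp_indicator_const 2 (μ := volume) (Metric.isClosed_closedBall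
    (x := (0 : ℂ)) (ε := R)).measurableSet ((C + C : ℝ) : ℂ) (Or.inr measure_closedBall_lt_top.ne))
    (fun n => .of_forall fun w => ?_) ?_
  · by_cases h : ‖w‖ ≤ R
    · rw [indicator_of_mem (by simpa using h), norm_real]
      exact (norm_sub_le _ _).trans ((add_le_add (hC n w) (hC' w)).trans (le_abs_self _))
    · rw [hR n w (not_le.1 h), hR' w (not_le.1 h)]; simp
  · filter_upwards [hl] with w hw
    simpa using hw.sub_const (g w)

theorem IsBalanced.contDiff_quotient (h : IsBalanced l ε Q k)
    (hk : ContDiff ℝ ∞ k) : ContDiff ℝ ∞ (fun q => prim l k q / (4 * q ^ (l + 1))) ∧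
      ∀ q, ∃ m, HasDerivAt (fun q => prim l k q / (4 * q ^ (l + 1))) m q ∧
        4 * ((l + 1) * (prim l k q / (4 * q ^ (l + 1))) + q * m) = k q := by
  have hz : ∀ q, q < ε → (fun q => prim l k q / (4 * q ^ (l + 1))) =ᶠ[𝓝 q] fun _ => 0 := by
    intro q hq
    filter_upwards [Iio_mem_nhds hq] with x hx
    rw [h.prim_of_le (le_of_lt hx), zero_div]
  obtain ⟨h1, h2⟩ := contDiff_prim (l := l) hk
  constructor
  · rw [contDiff_iff_contDiffAt]
    intro q
    rcases lt_or_ge q ε with hq | hq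
    · exact contDiffAt_const.congr_of_eventuallyEq (hz q hq)
    · have : 0 < q := h.pos.trans_le hq
      exact h1.contDiffAt.div (by fun_prop) (by positivity)
  · intro q
    rcases lt_or_ge q ε with hq | hq
    · refine ⟨0, (hasDerivAt_const q (0 : ℝ)).congr_of_eventuallyEq (hz q hq), ?_⟩
      rw [h.prim_of_le hq.le, h.support q fun hc => hc.1.not_gt hq]
      simp
    · have hq0 : 0 < q := h.pos.trans_le hq
      have h3 := (h2 q).div (((hasDerivAt_pow (l + 1) q)).const_mul 4)
        (by positivity : 4 * q ^ (l + 1) ≠ 0)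
      refine ⟨_, h3, ?_⟩
      simp only [Nat.add_sub_cancel]
      push_cast
      field_simp
      ring

theorem contDiff_rel (p : Pair N) : ContDiff ℝ ∞ (rel p) := by unfold rel; fun_prop

theorem contDiff_cm (p : Pair N) : ContDiff ℝ ∞ (cm p) := by
  refine contDiff_pi.2 fun k => ?_
  by_cases h : (k : Fin N) = p.1.2
  · simp only [cm, h, if_true]; fun_prop
  · simp only [cm, h, if_false]; fun_prop

theorem IsBalanced.contDiff_dualKernel (h : IsBalanced l ε Q k)
    (hk : ContDiff ℝ ∞ k) : ContDiff ℝ ∞ (dualKernel l k) := by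
  have h1 : ContDiff ℝ ∞ fun w : ℂ => ‖w‖ ^ 2 := contDiff_norm_sq ℝ
  have h2 := (h.contDiff_quotient hk).1.comp h1
  have h3 : ContDiff ℝ ∞ fun w : ℂ => rexp (‖w‖ ^ 2 / 4) :=
    Real.contDiff_exp.comp (h1.div_const 4)
  exact (contDiff_const.mul (ofRealCLM.contDiff.comp (h2.mul h3))).mul (contDiff_id.pow _)

theorem hasCompactSupport_pairLift (p : Pair N) {κ : ℂ → ℂ} {E : Rest p → ℂ}
    (hκ : HasCompactSupport κ) (hE : HasCompactSupport E) :
    HasCompactSupport fun z : Config N => κ (rel p z) * E (cm p z) := by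
  refine HasCompactSupport.intro ((hκ.isCompact.prod hE.isCompact).image (continuous_pairCoord p))
    fun z hz => ?_
  by_contra hne
  refine hz ⟨(rel p z, cm p z), ⟨subset_tsupport _ (left_ne_zero_of_mul hne),
    subset_tsupport _ (right_ne_zero_of_mul hne)⟩, pairCoord_rel_cm p z⟩

theorem IsBalanced.annihAdjFun_pairLift (h : IsBalanced l ε Q k)
    (hk : ContDiff ℝ ∞ k) (p : Pair N) {E : Rest p → ℂ} (hE : ContDiff ℝ ∞ E) (z : Config N) :
    annihAdjFun p.1.1 (fun z => dualKernel l k (rel p z) * E (cm p z)) z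
      - annihAdjFun p.1.2 (fun z => dualKernel l k (rel p z) * E (cm p z)) z =
      -2 * (radKernel l k (rel p z) * E (cm p z)) := by
  set X : Config N → ℂ := fun z => dualKernel l k (rel p z) * E (cm p z) with hX
  set w := rel p z with hw
  have hXs : ContDiff ℝ ∞ X :=
    ((h.contDiff_dualKernel hk).comp (contDiff_rel p)).mul (hE.comp (contDiff_cm p))
  obtain ⟨m, hm, hmk⟩ := (h.contDiff_quotient hk).2 (‖w‖ ^ 2)
  set M : ℝ := prim l k (‖w‖ ^ 2) / (4 * (‖w‖ ^ 2) ^ (l + 1)) with hM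
  set e : ℝ := rexp (‖w‖ ^ 2 / 4) with he
  have hD : ∀ d : ℂ, fderiv ℝ X z (single p.1.1 d) - fderiv ℝ X z (single p.1.2 d) =
      -2 * I * (((m * e + M * (e / 4)) * (2 * (w.re * (2 * d.re) + w.im * (2 * d.im))) : ℝ) * w ^ (l + 1)
        + (M * e : ℝ) * ((l + 1) * w ^ l * (2 * d))) * E (cm p z) := by
    intro d
    rw [← map_sub]
    have hl := ((hXs.differentiable (by simp) z).hasFDerivAt.hasLineDerivAt
      (single p.1.1 d - single p.1.2 d))
    refine HasDerivAt.unique hl ?_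
    have hrel : ∀ t : ℝ, rel p (z + t • (single p.1.1 d - single p.1.2 d)) = w + t • (2 * d) := by
      intro t
      simp [rel, p.2.ne, p.2.ne', hw]
      ring
    have hcm : ∀ t : ℝ, cm p (z + t • (single p.1.1 d - single p.1.2 d)) = cm p z := by
      intro t
      ext ⟨i, hi⟩
      by_cases hj : i = p.1.2
      · simp [cm, hj, p.2.ne, p.2.ne']
        ring
      · simp [cm, hj, hi]
    simp only [hX, hrel, hcm, dualKernel]
    have a1 : HasDerivAt (fun t : ℝ => w + t • (2 * d)) (2 * d) 0 := by
      simpa using ((hasDerivAt_id (0 : ℝ)).smul_const (2 * d)).const_add w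
    have a2 := a1.norm_sq
    simp only [zero_smul, add_zero] at a2
    have a3 : HasDerivAt (fun t : ℝ => prim l k (‖w + t • (2 * d)‖ ^ 2) /
        (4 * (‖w + t • (2 * d)‖ ^ 2) ^ (l + 1))) (m * (2 * ⟪w, 2 * d⟫_ℝ)) 0 :=
      HasDerivAt.comp_of_eq (h₂ := fun q => prim l k q / (4 * q ^ (l + 1))) 0 hm a2 (by simp)
    have a4 := ((a2.div_const 4).exp)
    have a5 := (a3.mul a4).ofReal_comp
    have a6 := a1.pow (l + 1)
    have a7 := ((a5.const_mul (-2 * I)).mul a6).mul_const (E (cm p z))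
    refine (a7.congr_deriv ?_)
    simp only [zero_smul, add_zero, Complex.inner, ← hM, ← he, Pi.pow_apply, Pi.mul_apply]
    simp
    ring
  have hre : (w.re : ℂ) - I * w.im = conj w := by apply Complex.ext <;> simp
  have hqw : ((‖w‖ ^ 2 : ℝ) : ℂ) = conj w * w := by rw [conj_mul']; push_cast; rfl
  rw [annihAdjFun_eq, annihAdjFun_eq]
  have hd1 := hD 1
  have hdI := hD I
  have hmk' : (4 * ((l + 1) * (M : ℂ) + (‖w‖ ^ 2 : ℝ) * m)) = k (‖w‖ ^ 2) := by exact_mod_cast hmk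
  have hXz : X z = -2 * I * ((M * e : ℝ) : ℂ) * w ^ (l + 1) * E (cm p z) := rfl
  have hR : radKernel l k w = ((k (‖w‖ ^ 2) : ℝ) * e : ℂ) * w ^ l := by rw [radKernel, ofReal_mul]
  have hcw : conj (z p.1.1) - conj (z p.1.2) = conj w := by rw [hw, rel, map_sub]
  have hcalc : -I * (del p.1.1 X z - conj (z p.1.1) * X z)
      - -I * (del p.1.2 X z - conj (z p.1.2) * X z) =
      -I * ((fderiv ℝ X z (single p.1.1 1) - fderiv ℝ X z (single p.1.2 1))
        - I * (fderiv ℝ X z (single p.1.1 I) - fderiv ℝ X z (single p.1.2 I))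
        - (conj (z p.1.1) - conj (z p.1.2)) * X z) := by
    simp only [del]; ring
  rw [hcalc, hd1, hdI, hcw, hXz, hR, ← hmk', hqw]
  simp only [one_re, one_im, I_re, I_im, ← hre]
  push_cast
  simp only [pow_succ]
  linear_combination (8 * e * m * w * (w.re - I * w.im) * E (cm p z) * w ^ l
    + 4 * (l + 1) * M * e * E (cm p z) * w ^ l * (2 - I * I)) * I_mul_I

theorem IsBalanced.inner_dualKernel_of_contDiff
    (h : IsBalanced l ε Q k) (hk : ContDiff ℝ ∞ k) (p : Pair N) {E : Rest p → ℂ}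
    (hE : ContDiff ℝ ∞ E) (hs : HasCompactSupport E) (hm : MemLp E 2) {u : L2 N}
    (hu : ∀ i k, ∃ g, HasWeakMagD i k u g) :
    ⟪pairLift p h.memLp_dualKernel hm.toLp, annih p.1.1 u - annih p.1.2 u⟫_ℂ =
      -2 * ⟪pairLift p (h.isProfile.memLp_radKernel l 2) hm.toLp, u⟫_ℂ := by
  set X : Config N → ℂ := fun z => dualKernel l k (rel p z) * E (cm p z) with hX
  have hXs : ContDiff ℝ ∞ X :=
    ((h.contDiff_dualKernel hk).comp (contDiff_rel p)).mul (hE.comp (contDiff_cm p))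
  have hds : HasCompactSupport (dualKernel l k) := by
    refine HasCompactSupport.intro (isCompact_closedBall (0 : ℂ) (√Q)) fun w hw => ?_
    exact h.dualKernel_eq_zero (lt_norm_sq_of_sqrt_lt (by simpa using hw)).le
  have hXc : HasCompactSupport X := hasCompactSupport_pairLift p hds hs
  have hcoe := (quasiMeasurePreserving_cm p).ae hm.coeFn_toLp
  have e1 : pairLift p h.memLp_dualKernel hm.toLp = (memLp_test hXs.continuous hXc).toLp := by
    refine Lp.ext ?_
    filter_upwards [coeFn_pairLift p h.memLp_dualKernel hm.toLp, hcoe,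
      (memLp_test hXs.continuous hXc).coeFn_toLp] with z h1 h2 h3
    rw [h1, h2, h3]
  have e2 : annihAdj p.1.1 hXs hXc - annihAdj p.1.2 hXs hXc =
      (-2 : ℂ) • pairLift p (h.isProfile.memLp_radKernel l 2) hm.toLp := by
    rw [annihAdj, annihAdj, ← MemLp.toLp_sub]
    refine Lp.ext ?_
    filter_upwards [MemLp.coeFn_toLp ((memLp_test (continuous_annihAdjFun p.1.1 hXs)
        (hasCompactSupport_annihAdjFun p.1.1 hXc)).sub (memLp_test
        (continuous_annihAdjFun p.1.2 hXs) (hasCompactSupport_annihAdjFun p.1.2 hXc))),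
      Lp.coeFn_smul (-2 : ℂ) (pairLift p (h.isProfile.memLp_radKernel l 2) hm.toLp),
      coeFn_pairLift p (h.isProfile.memLp_radKernel l 2) hm.toLp, hcoe] with z h1 h2 h3 h4
    rw [h1, h2, Pi.smul_apply, h3, h4, Pi.sub_apply, smul_eq_mul]
    exact h.annihAdjFun_pairLift hk p hE z
  rw [e1, inner_sub_right, ← inner_annihAdj_eq p.1.1 hXs hXc (hu _),
    ← inner_annihAdj_eq p.1.2 hXs hXc (hu _), ← inner_sub_left, e2, inner_smul_left,
    map_neg, map_ofNat]

/-- The action of the annihilation operators tested with dual kernels. -/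
theorem IsBalanced.inner_dualKernel (h : IsBalanced l ε Q k)
    (hεQ : ε ≤ Q) (p : Pair N) {E : Rest p → ℂ} (hE : ContDiff ℝ ∞ E) (hs : HasCompactSupport E)
    (hm : MemLp E 2) {u : L2 N} (hu : ∀ i k, ∃ g, HasWeakMagD i k u g) :
    ⟪pairLift p h.memLp_dualKernel hm.toLp, annih p.1.1 u - annih p.1.2 u⟫_ℂ =
      -2 * ⟪pairLift p (h.isProfile.memLp_radKernel l 2) hm.toLp, u⟫_ℂ := by
  obtain ⟨C, κ, hκ, hC, hb, hl⟩ := h.exists_smooth_approx hεQ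
  obtain ⟨C', hC'⟩ := h.bounded
  have hl' := ae_norm_sq hl
  have t1 : Tendsto (fun n => ∫⁻ w, ‖dualKernel l (κ n) w - dualKernel l k w‖ₑ ^ 2) atTop (𝓝 0) := by
    refine tendsto_L2_of_bounded_support (fun n => (hb n).memLp_dualKernel) h.memLp_dualKernel
      (C := max _ _) (R := √(Q + 1))
      (fun n w => ((hb n).norm_dualKernel_le (hC n) w).trans (le_max_left _ _))
      (fun w => (h.norm_dualKernel_le hC' w).trans (le_max_right _ _))
      (fun n w hw => (hb n).dualKernel_eq_zero (lt_norm_sq_of_sqrt_lt hw).le)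
      (fun w hw => h.dualKernel_eq_zero (by linarith [lt_norm_sq_of_sqrt_lt hw]))
      (.of_forall fun w => ?_)
    have := tendsto_prim (l := l) (fun n => (hκ n).continuous.measurable) hC hl (‖w‖ ^ 2)
    exact (((((this.div_const _).mul_const _).ofReal).const_mul _).mul_const _)
  have hbd : ∀ (k' : ℝ → ℝ) (C₀ : ℝ), (∀ q, |k' q| ≤ C₀) → (∀ q, Q + 1 < q → k' q = 0) → ∀ w,
      ‖radKernel l k' w‖ ≤ √(C₀ ^ 2 * (Q + 1) ^ l * rexp ((Q + 1) / 2)) := by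
    intro k' C₀ h1 h2 w
    refine Real.le_sqrt_of_sq_le ?_
    rw [norm_radKernel_sq]
    have hQ : 0 ≤ Q + 1 := by linarith [h.pos]
    rcases le_or_gt (‖w‖ ^ 2) (Q + 1) with h3 | h3
    · have : k' (‖w‖ ^ 2) ^ 2 ≤ C₀ ^ 2 := by
        rw [← sq_abs]
        have := h1 (‖w‖ ^ 2)
        gcongr
      gcongr
    · rw [h2 _ h3]
      simp only [ne_eq, OfNat.ofNat_ne_zero, not_false_eq_true, zero_pow, zero_mul]
      positivity
  have hs1 : ∀ n q, Q + 1 < q → κ n q = 0 := fun n q hq => (hb n).support q fun hc => hc.2.not_gt hq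
  have hs2 : ∀ q, Q + 1 < q → k q = 0 := fun q hq => h.support q fun hc => by linarith [hc.2]
  have t2 : Tendsto (fun n => ∫⁻ w, ‖radKernel l (κ n) w - radKernel l k w‖ₑ ^ 2) atTop (𝓝 0) := by
    refine tendsto_L2_of_bounded_support (fun n => (hb n).isProfile.memLp_radKernel l 2)
      (h.isProfile.memLp_radKernel l 2) (C := max _ _) (R := √(Q + 1))
      (fun n w => (hbd _ C (hC n) (hs1 n) w).trans (le_max_left _ _))
      (fun w => (hbd _ C' hC' hs2 w).trans (le_max_right _ _))
      (fun n w hw => by rw [radKernel, hs1 n _ (lt_norm_sq_of_sqrt_lt hw)]; simp)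
      (fun w hw => by rw [radKernel, hs2 _ (lt_norm_sq_of_sqrt_lt hw)]; simp) ?_
    filter_upwards [hl'] with w hw
    exact ((hw.mul_const _).ofReal).mul_const _
  have l1 := (tendsto_pairLift p (fun n => (hb n).memLp_dualKernel) h.memLp_dualKernel t1
    hm.toLp).inner (𝕜 := ℂ) (tendsto_const_nhds (x := annih p.1.1 u - annih p.1.2 u))
  have l2 := (tendsto_pairLift p (fun n => (hb n).isProfile.memLp_radKernel l 2)
    (h.isProfile.memLp_radKernel l 2) t2 hm.toLp).inner (𝕜 := ℂ) (tendsto_const_nhds (x := u))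
  refine tendsto_nhds_unique l1 ((l2.const_mul (-2)).congr fun n => ?_)
  exact ((hb n).inner_dualKernel_of_contDiff (hκ n) p hE hs hm hu).symm

end Core


/-! ### Lower bounds on the energy -/

section Lower

/-- If test vectors for different pairs are orthogonal, then no kinetic energy is counted twice. -/
theorem sum_re_inner_pair_le {H : Type*} [NormedAddCommGroup H] [InnerProductSpace ℂ H]
    (X : Pair N → H) (hX : ∀ p q, p ≠ q → ⟪X p, X q⟫_ℂ = 0) (A : Fin N → H) :
    ∑ p, 2 * (⟪X p, A p.1.1 - A p.1.2⟫_ℂ).re ≤ ∑ i, ‖A i‖ ^ 2 + 2 * ∑ p, ‖X p‖ ^ 2 := by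
  set s : Fin N → Pair N → ℂ := fun i p => (if i = p.1.1 then 1 else 0) - if i = p.1.2 then 1 else 0
    with hs
  set W : Fin N → H := fun i => ∑ p, s i p • X p with hW
  have hconj : ∀ i p, conj (s i p) = s i p := fun i p => by simp only [hs]; split_ifs <;> simp
  have h1 : ∑ i, ⟪W i, A i⟫_ℂ = ∑ p, ⟪X p, A p.1.1 - A p.1.2⟫_ℂ := by
    simp only [hW, sum_inner, inner_smul_left, hconj]
    rw [sum_comm]
    refine sum_congr rfl fun p _ => ?_
    simp [hs, sub_mul, inner_sub_right, sum_sub_distrib]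
  have h2 : ∀ i, ⟪W i, W i⟫_ℂ = ∑ p, s i p * s i p * ⟪X p, X p⟫_ℂ := fun i => by
    simp only [hW, sum_inner, inner_sum, inner_smul_left, inner_smul_right, hconj]
    refine sum_congr rfl fun p _ => ?_
    rw [sum_eq_single p (fun q _ hq => by rw [hX q p hq]; simp) (by simp)]
    ring
  have h3 : ∑ i, ⟪W i, W i⟫_ℂ = 2 * ∑ p, ⟪X p, X p⟫_ℂ := by
    simp only [h2]
    rw [sum_comm, mul_sum]
    refine sum_congr rfl fun p _ => ?_
    rw [← sum_mul]
    congr 1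
    have : ∀ i, s i p * s i p = (if i = p.1.1 then 1 else 0) + if i = p.1.2 then 1 else 0 := by
      intro i
      have := p.2.ne
      simp only [hs]
      split_ifs with h h' <;> simp_all
    simp only [this, sum_add_distrib]
    norm_num
  have h4 : ∑ i, ‖W i‖ ^ 2 = 2 * ∑ p, ‖X p‖ ^ 2 := by
    have := congrArg Complex.re h3
    simp only [inner_self_eq_norm_sq_to_K] at this
    simpa [← ofReal_pow, Complex.re_sum] using this
  have h5 : ∀ i, 2 * (⟪W i, A i⟫_ℂ).re ≤ ‖A i‖ ^ 2 + ‖W i‖ ^ 2 := fun i => by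
    have h6 := norm_sub_sq (𝕜 := ℂ) (W i) (A i)
    have h7 := sq_nonneg ‖W i - A i‖
    simp only [RCLike.re_eq_complex_re] at h6
    linarith
  calc ∑ p, 2 * (⟪X p, A p.1.1 - A p.1.2⟫_ℂ).re = ∑ i, 2 * (⟪W i, A i⟫_ℂ).re := by
        rw [← mul_sum, ← mul_sum, ← Complex.re_sum, ← Complex.re_sum, h1]
    _ ≤ ∑ i, (‖A i‖ ^ 2 + ‖W i‖ ^ 2) := sum_le_sum fun i _ => h5 i
    _ = _ := by rw [sum_add_distrib, h4]

theorem toReal_lintegral_norm_sq_le {F : ℂ → ℂ} {h : ℝ → ℝ} (hm : Measurable h)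
    (hQ : 0 ≤ Q) (hi : IntervalIntegrable h volume 0 Q) (hF : ∀ w, ‖w‖ ^ 2 ≤ Q → ‖F w‖ ^ 2 ≤ h (‖w‖ ^ 2))
    (h0 : ∀ w, Q < ‖w‖ ^ 2 → F w = 0) (hnn : ∀ q, 0 ≤ q → q ≤ Q → 0 ≤ h q) :
    (∫⁻ w, ‖F w‖ₑ ^ 2).toReal ≤ π * ∫ q in (0 : ℝ)..Q, h q := by
  have h1 : ∫⁻ w, ‖F w‖ₑ ^ 2 ≤
      toE π * ∫⁻ q in Ioc 0 Q, toE (h q) := by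
    calc ∫⁻ w, ‖F w‖ₑ ^ 2 ≤ ∫⁻ w : ℂ, (Iic Q).indicator (fun q => toE (h q)) (‖w‖ ^ 2) := by
          refine lintegral_mono fun w => ?_
          rcases le_or_gt (‖w‖ ^ 2) Q with hw | hw
          · rw [indicator_of_mem (Set.mem_Iic.2 hw), ← ofReal_norm, ← ENNReal.ofReal_pow (norm_nonneg _)]
            exact ofReal_le_ofReal (hF w hw)
          · rw [h0 w hw]; simp
      _ = _ := by
          rw [lintegral_norm_sq ((hm.ennreal_ofReal).indicator measurableSet_Iic),
            lintegral_indicator measurableSet_Iic, Measure.restrict_restrict measurableSet_Iic,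
            Set.inter_comm, Set.Ioi_inter_Iic]
  have h2 : ∫⁻ q in Ioc 0 Q, toE (h q) = toE (∫ q in (0 : ℝ)..Q, h q) := by
    rw [integral_of_le hQ, ofReal_integral_eq_lintegral_ofReal
      ((intervalIntegrable_iff_integrableOn_Ioc_of_le hQ).1 hi)]
    exact (ae_restrict_iff' measurableSet_Ioc).2 (Eventually.of_forall fun q hq => hnn q hq.1.le hq.2)
  rw [h2, ← ENNReal.ofReal_mul Real.pi_pos.le] at h1
  exact toReal_le_of_le_ofReal (mul_nonneg Real.pi_pos.le
    (intervalIntegral.integral_nonneg hQ fun q hq => hnn q hq.1 hq.2)) h1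

theorem moment_eq_prim (hk : Measurable k) (hQ : 0 ≤ Q)
    (hs : ∀ q, Q < q → k q = 0) : moment l k = π * prim l k Q := by
  have e : ∀ w : ℂ, k (‖w‖ ^ 2) * ‖w‖ ^ (2 * l) = (fun q => k q * q ^ l) (‖w‖ ^ 2) := fun w => by
    simp only [pow_mul]
  simp only [moment, e]
  rw [integral_norm_sq (f := fun q => k q * q ^ l) (by fun_prop), prim,
    integral_of_le hQ, ← Set.Ioi_inter_Iic, ← setIntegral_indicator measurableSet_Iic]
  congr 2
  ext q
  by_cases h : q ∈ Iic Q
  · rw [indicator_of_mem h]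
  · rw [indicator_of_notMem h, hs q (by simpa using h), zero_mul]

/-- The normalized profile on `[R², 4R²]`. -/
def shell (l : ℕ) (R q : ℝ) : ℝ :=
  (moment l ((Icc (R ^ 2) (4 * R ^ 2)).indicator 1))⁻¹ *
    (Icc (R ^ 2) (4 * R ^ 2)).indicator 1 q

theorem isProfile_shell (l : ℕ) {R : ℝ} (hR : 0 < R) : IsProfile (shell l R) := by
  have : IsProfile ((Icc (R ^ 2) (4 * R ^ 2)).indicator (1 : ℝ → ℝ)) := by
    refine ⟨measurable_one.indicator measurableSet_Icc, ⟨1, fun q => ?_⟩,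
      2 * R, by positivity, fun q hq => indicator_of_notMem (fun hc => ?_) _⟩
    · by_cases h : q ∈ Icc (R ^ 2) (4 * R ^ 2) <;> simp [h]
    · nlinarith [hc.2]
  exact this.const_mul _

theorem moment_indicator_pos (l : ℕ) {R : ℝ} (hR : 0 < R) :
    0 < moment l ((Icc (R ^ 2) (4 * R ^ 2)).indicator 1) := by
  have hm : Measurable ((Icc (R ^ 2) (4 * R ^ 2)).indicator (1 : ℝ → ℝ)) :=
    measurable_one.indicator measurableSet_Icc
  have hbd : ∃ C, ∀ q, |(Icc (R ^ 2) (4 * R ^ 2)).indicator (1 : ℝ → ℝ) q| ≤ C := ⟨1, fun q => by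
    by_cases h : q ∈ Icc (R ^ 2) (4 * R ^ 2) <;> simp [h]⟩
  have hR2 : 0 < R ^ 2 := by positivity
  rw [moment_eq_prim hm (Q := 4 * R ^ 2) (by positivity)
    (fun q hq => indicator_of_notMem (fun hc => hc.2.not_gt hq) _)]
  refine mul_pos pi_pos ?_
  have hi := intervalIntegrable_mul_pow hm hbd l
  rw [prim, ← integral_add_adjacent_intervals (hi 0 (R ^ 2)) (hi _ _)]
  have h1 : 0 ≤ ∫ τ in (0 : ℝ)..R ^ 2, (Icc (R ^ 2) (4 * R ^ 2)).indicator (1 : ℝ → ℝ) τ * τ ^ l :=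
    intervalIntegral.integral_nonneg hR2.le fun τ hτ =>
      mul_nonneg (indicator_nonneg (fun _ _ => zero_le_one) _) (pow_nonneg hτ.1 _)
  have h2 : 0 < ∫ τ in R ^ 2..4 * R ^ 2,
      (Icc (R ^ 2) (4 * R ^ 2)).indicator (1 : ℝ → ℝ) τ * τ ^ l := by
    refine intervalIntegral.intervalIntegral_pos_of_pos_on (hi _ _) (fun τ hτ => ?_) (by linarith)
    rw [indicator_of_mem (Set.mem_Icc.2 ⟨hτ.1.le, hτ.2.le⟩)]
    exact mul_pos one_pos (pow_pos (hR2.trans hτ.1) _)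
  linarith

theorem moment_shell (l : ℕ) {R : ℝ} (hR : 0 < R) : moment l (shell l R) = 1 := by
  have := moment_const_mul l (moment l ((Icc (R ^ 2) (4 * R ^ 2)).indicator 1))⁻¹
    ((Icc (R ^ 2) (4 * R ^ 2)).indicator 1)
  rw [inv_mul_cancel₀ (moment_indicator_pos l hR).ne'] at this
  exact this

theorem shell_nonneg (l : ℕ) {R : ℝ} (hR : 0 < R) (q : ℝ) : 0 ≤ shell l R q :=
  mul_nonneg (inv_nonneg.2 (moment_indicator_pos l hR).le)
    (indicator_nonneg (fun _ _ => zero_le_one) _)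

theorem shell_eq_zero (l : ℕ) {R q : ℝ} (hq : q ∉ Icc (R ^ 2) (4 * R ^ 2)) : shell l R q = 0 := by
  rw [shell, indicator_of_notMem hq, mul_zero]

theorem prim_sub {k' : ℝ → ℝ} (hm : Measurable k) (hC : ∃ C, ∀ q, |k q| ≤ C)
    (hm' : Measurable k') (hC' : ∃ C, ∀ q, |k' q| ≤ C) (c q : ℝ) :
    prim l (fun q => k q - c * k' q) q = prim l k q - c * prim l k' q := by
  simp only [prim, sub_mul, mul_assoc]
  rw [intervalIntegral.integral_sub (intervalIntegrable_mul_pow hm hC l 0 q)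
    ((intervalIntegrable_mul_pow hm' hC' l 0 q).const_mul c), intervalIntegral.integral_const_mul]

theorem prim_nonneg (h : ∀ q, 0 ≤ k q) {q : ℝ} (hq : 0 ≤ q) : 0 ≤ prim l k q :=
  intervalIntegral.integral_nonneg hq fun τ hτ => mul_nonneg (h τ) (pow_nonneg hτ.1 _)

theorem prim_mono (hm : Measurable k) (hC : ∃ C, ∀ q, |k q| ≤ C)
    (h : ∀ q, 0 ≤ k q) {q q' : ℝ} (h0 : 0 ≤ q) (hq : q ≤ q') : prim l k q ≤ prim l k q' := by
  have hi := intervalIntegrable_mul_pow hm hC l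
  rw [prim, prim, ← integral_add_adjacent_intervals (hi 0 q) (hi q q')]
  refine le_add_of_nonneg_right (intervalIntegral.integral_nonneg hq fun τ hτ => ?_)
  exact mul_nonneg (h τ) (pow_nonneg (h0.trans hτ.1) _)

/-- Completion of a profile to a balanced one. -/
theorem isBalanced_sub_shell (hm : Measurable k) (hC : ∃ C, ∀ q, |k q| ≤ C)
    {R : ℝ} (hR : 0 < R) (hε : 0 < ε) (hεR : ε ≤ R ^ 2)
    (hs : ∀ q, q ∉ Icc ε (R ^ 2) → k q = 0) (hk : ∀ q, 0 ≤ k q) :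
    IsBalanced l ε (4 * R ^ 2) (fun q => k q - moment l k * shell l R q) ∧
    ∀ q, 0 ≤ q → q ≤ 4 * R ^ 2 →
      prim l (fun q => k q - moment l k * shell l R q) q ^ 2 ≤ prim l k q ^ 2 := by
  have hR2 : 0 < R ^ 2 := by positivity
  have hsh := isProfile_shell l hR
  have hmom : moment l k = π * prim l k (R ^ 2) :=
    moment_eq_prim hm hR2.le fun q hq => hs q fun hc => hc.2.not_gt hq
  have hsm : π * prim l (shell l R) (4 * R ^ 2) = 1 := by
    rw [← moment_shell l hR]
    exact (moment_eq_prim hsh.measurable (by positivity) fun q hq =>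
      shell_eq_zero l fun hc => hc.2.not_gt hq).symm
  have hks : ∀ q, R ^ 2 < q → k q = 0 := fun q hq => hs q fun hc => hc.2.not_gt hq
  have hsub := prim_sub (l := l) hm hC hsh.measurable hsh.bounded (moment l k)
  refine ⟨⟨hε, hm.sub (hsh.measurable.const_mul _), ?_, fun q hq => ?_, ?_⟩, fun q h0 hq => ?_⟩
  · obtain ⟨C, hC⟩ := hC
    obtain ⟨C', hC'⟩ := (hsh.const_mul (moment l k)).bounded
    exact ⟨C + C', fun q => (abs_sub _ _).trans (add_le_add (hC q) (hC' q))⟩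
  · rw [hs q fun hc => hq ⟨hc.1, by linarith [hc.2]⟩,
      shell_eq_zero l fun hc => hq ⟨by linarith [hc.1], hc.2⟩]
    simp
  · rw [hsub, prim_eq_of_zero_Ici hm hC hks (by linarith), hmom]
    linear_combination -(prim l k (R ^ 2)) * hsm
  · rw [hsub]
    have hsn := prim_nonneg (l := l) (shell_nonneg l hR) h0
    have hkn := prim_nonneg (l := l) hk hR2.le
    rcases le_total q (R ^ 2) with h | h
    · rw [prim_eq_zero_of_le (k := shell l R) hR2.le
        (fun q hq => shell_eq_zero l fun hc => hc.1.not_gt hq) h]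
      simp
    · rw [prim_eq_of_zero_Ici hm hC hks h, hmom]
      have h1 := prim_mono (l := l) hsh.measurable hsh.bounded (shell_nonneg l hR) h0 hq
      have h2 : π * prim l (shell l R) q ≤ 1 := by
        rw [← hsm]; exact mul_le_mul_of_nonneg_left h1 Real.pi_pos.le
      have h3 := mul_nonneg Real.pi_pos.le hsn
      refine pow_le_pow_left₀ ?_ ?_ 2
      · nlinarith
      · nlinarith

end Lower

section Lower

/-- The value of the quadratic form of `H_a`. -/
def energy (N : ℕ) (v : ℝ → ℝ≥0∞) (a : ℝ) (u : L2 N) : ℝ :=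
  ∑ i, ‖annih i u‖ ^ 2 + (potEnergy N v a u).toReal

theorem energy_nonneg (v : ℝ → ℝ≥0∞) (a : ℝ) (u : L2 N) : 0 ≤ energy N v a u :=
  add_nonneg (sum_nonneg fun _ _ => sq_nonneg _) toReal_nonneg

/-- A one-body certificate for a lower bound on the energy: `V ≤ v_a` is a bounded radial potential
and `y` approximates a multiple of the corresponding scattering solution, both as functions of the
squared distance. -/
structure IsLowCert (v : ℝ → ℝ≥0∞) (l : ℕ) (a c κ R δ ε : ℝ) (V y : ℝ → ℝ) : Prop where
  pos : 0 < ε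
  le_sq : ε ≤ R ^ 2
  radius_pos : 0 < R
  scale_nonneg : 0 ≤ c
  measurable_V : Measurable V
  measurable_y : Measurable y
  V_nonneg : ∀ q, 0 ≤ V q
  y_nonneg : ∀ q, 0 ≤ y q
  V_bounded : ∃ C, ∀ q, V q ≤ C
  y_bounded : ∃ C, ∀ q, y q ≤ C
  support : ∀ q, q ∉ Icc ε (R ^ 2) → V q = 0
  V_le : ∀ w : ℂ, toE (V (‖w‖ ^ 2)) ≤ vScaled v a ‖w‖
  moment_eq : 2 * c * moment l (fun q => V q * y q / 2) = κ
  bound : c * (2 * (π * ∫ q in (0 : ℝ)..4 * R ^ 2,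
      prim l (fun q => V q * y q / 2) q ^ 2 / (4 * q ^ (l + 1))) +
      π * ∫ q in (0 : ℝ)..R ^ 2, V q * y q ^ 2 * q ^ l) ≤ κ + δ

theorem pairLift_smul_kernel (p : Pair N) {κ κ' : ℂ → ℂ} (h : MemLp κ 2)
    (h' : MemLp κ' 2) (c : ℂ) (e : ∀ w, κ w = c * κ' w)
    (E : RestL2 p) : pairLift p h E = c • pairLift p h' E := by
  refine Lp.ext ?_
  filter_upwards [coeFn_pairLift p h E, coeFn_pairLift p h' E, Lp.coeFn_smul c (pairLift p h' E)]
    with z h1 h2 h3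
  rw [h1, h3, Pi.smul_apply, h2, e, smul_eq_mul, mul_assoc]

theorem pairLift_sub_kernel (p : Pair N) {κ κ₁ κ₂ : ℂ → ℂ} (h : MemLp κ 2)
    (h₁ : MemLp κ₁ 2) (h₂ : MemLp κ₂ 2) (e : ∀ w, κ w = κ₁ w - κ₂ w) (E : RestL2 p) :
    pairLift p h E = pairLift p h₁ E - pairLift p h₂ E := by
  refine Lp.ext ?_
  filter_upwards [coeFn_pairLift p h E, coeFn_pairLift p h₁ E, coeFn_pairLift p h₂ E,
    Lp.coeFn_sub (pairLift p h₁ E) (pairLift p h₂ E)] with z h1 h2 h3 h4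
  rw [h1, h4, Pi.sub_apply, h2, h3, e, sub_mul]

theorem inner_pairLift_eq_zero {p q : Pair N} {κ κ' : ℂ → ℂ} (h : MemLp κ 2)
    (h' : MemLp κ' 2) {E : Rest p → ℂ} {E' : Rest q → ℂ} (hE : MemLp E 2) (hE' : MemLp E' 2)
    (hd : ∀ z, κ (rel p z) * E (cm p z) = 0 ∨ κ' (rel q z) * E' (cm q z) = 0) :
    ⟪pairLift p h hE.toLp, pairLift q h' hE'.toLp⟫_ℂ = 0 := by
  rw [L2_inner_eq]
  refine integral_eq_zero_of_ae ?_
  filter_upwards [coeFn_pairLift p h hE.toLp, coeFn_pairLift q h' hE'.toLp,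
    (quasiMeasurePreserving_cm p).ae hE.coeFn_toLp,
    (quasiMeasurePreserving_cm q).ae hE'.coeFn_toLp] with z h1 h2 h3 h4
  rw [h1, h2, h3, h4]
  rcases hd z with hz | hz <;> simp [hz]

theorem two_re_inner_le {H : Type*} [NormedAddCommGroup H] [InnerProductSpace ℂ H] (x y : H) :
    2 * (⟪x, y⟫_ℂ).re ≤ ‖x‖ ^ 2 + ‖y‖ ^ 2 := by
  have h6 := norm_sub_sq (𝕜 := ℂ) x y
  have h7 := sq_nonneg ‖x - y‖
  simp only [RCLike.re_eq_complex_re] at h6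
  linarith

/-- The bounded potential `V` is controlled by the interaction energy. -/
theorem sum_norm_sqrt_mul_le (hv : Measurable v) {a : ℝ} (hV : Measurable V) (h0 : ∀ q, 0 ≤ V q)
    (hle : ∀ w : ℂ, toE (V (‖w‖ ^ 2)) ≤ vScaled v a ‖w‖) {u : L2 N} (hu : u ∈ formDomain N hv a)
    (hm : ∀ p : Pair N, MemLp (fun z => (√(V (‖rel p z‖ ^ 2)) : ℂ) * u z) 2) :
    ∑ p, ‖(hm p).toLp‖ ^ 2 ≤ (potEnergy N v a u).toReal := by
  have e : ∀ p : Pair N, ‖(hm p).toLp‖ ^ 2 =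
      (∫⁻ z, toE (V (‖rel p z‖ ^ 2)) * ‖u z‖ₑ ^ 2).toReal := fun p => by
    rw [norm_Lp_sq]
    congr 1
    refine lintegral_congr_ae ?_
    filter_upwards [(hm p).coeFn_toLp] with z hz
    rw [hz, enorm_mul, mul_pow]
    congr 1
    rw [← ofReal_norm, norm_real, norm_of_nonneg (sqrt_nonneg _),
      ← ENNReal.ofReal_pow (sqrt_nonneg _), sq_sqrt (h0 _)]
  have hmeas : ∀ p : Pair N, AEMeasurable
      (fun z => toE (V (‖rel p z‖ ^ 2)) * ‖u z‖ₑ ^ 2) volume := fun p => by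
    refine AEMeasurable.mul ?_ ((Lp.aestronglyMeasurable u).enorm.pow_const 2)
    exact (hV.comp ((continuous_rel p).norm.pow 2).measurable).ennreal_ofReal.aemeasurable
  have hle' : ∑ p : Pair N, ∫⁻ z, toE (V (‖rel p z‖ ^ 2)) * ‖u z‖ₑ ^ 2 ≤
      potEnergy N v a u := by
    rw [← lintegral_finsetSum' _ fun p _ => hmeas p]
    refine lintegral_mono fun z => ?_
    rw [← sum_mul]
    gcongr
    exact sum_le_sum fun p _ => hle (rel p z)
  have hfin : potEnergy N v a u ≠ ⊤ := hu.2.ne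
  simp only [e]
  rw [← toReal_sum fun p _ => ?_]
  · exact toReal_mono hfin hle'
  · exact ne_top_of_le_ne_top hfin ((single_le_sum (f := fun p : Pair N =>
      ∫⁻ z, toE (V (‖rel p z‖ ^ 2)) * ‖u z‖ₑ ^ 2) (fun _ _ => zero_le)
      (mem_univ p)).trans hle')

theorem continuous_prim_sq_div (hm : Measurable k) (hC : ∃ C, ∀ q, |k q| ≤ C)
    (hε : 0 < ε) (hs : ∀ q, q < ε → k q = 0) :
    Continuous fun q => prim l k q ^ 2 / (4 * q ^ (l + 1)) := by
  refine continuous_iff_continuousAt.2 fun q => ?_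
  rcases lt_or_ge q ε with h | h
  · refine (continuousAt_const (y := (0 : ℝ))).congr ?_
    filter_upwards [Iio_mem_nhds h] with x hx
    rw [prim_eq_zero_of_le hε.le hs hx.le]
    simp
  · exact ((continuous_prim hm hC).continuousAt.pow 2).div (by fun_prop)
      (by have := hε.trans_le h; positivity)

theorem IsLowCert.energy_ge (hv : Measurable v) {a c κ R δ : ℝ}
    {y : ℝ → ℝ} (h : IsLowCert v l a c κ R δ ε V y) {E : ∀ p : Pair N, Rest p → ℂ}
    (hE : ∀ p, ContDiff ℝ ∞ (E p)) (hs : ∀ p, HasCompactSupport (E p)) (hm : ∀ p, MemLp (E p) 2)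
    (hd : ∀ p q, p ≠ q → ∀ z, ‖rel p z‖ ^ 2 ≤ 4 * R ^ 2 → ‖rel q z‖ ^ 2 ≤ 4 * R ^ 2 →
      E p (cm p z) = 0 ∨ E q (cm q z) = 0) {u : L2 N} (hu : u ∈ formDomain N hv a) :
    ∑ p, (2 * κ * (⟪pairLift p ((isProfile_shell l h.radius_pos).memLp_radKernel l 2) (hm p).toLp,
        u⟫_ℂ).re - rexp (2 * R ^ 2) * (κ + δ) * ‖(hm p).toLp‖ ^ 2) ≤ c * energy N v a u := by
  have hR2 : 0 < R ^ 2 := pow_pos h.radius_pos 2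
  obtain ⟨CV, hCV⟩ := h.V_bounded
  obtain ⟨Cy, hCy⟩ := h.y_bounded
  have hCV0 : 0 ≤ CV := (h.V_nonneg 0).trans (hCV 0)
  set k : ℝ → ℝ := fun q => V q * y q / 2 with hk
  have hkm : Measurable k := (h.measurable_V.mul h.measurable_y).div_const 2
  have hk0 : ∀ q, 0 ≤ k q := fun q => div_nonneg (mul_nonneg (h.V_nonneg q) (h.y_nonneg q)) zero_le_two
  have hkC : ∃ C, ∀ q, |k q| ≤ C := ⟨CV * Cy / 2, fun q => by
    rw [abs_of_nonneg (hk0 q)]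
    exact div_le_div_of_nonneg_right (mul_le_mul (hCV q) (hCy q) (h.y_nonneg q) hCV0) zero_le_two⟩
  have hks : ∀ q, q ∉ Icc ε (R ^ 2) → k q = 0 := fun q hq => by simp [hk, h.support q hq]
  obtain ⟨hb, hprim⟩ := isBalanced_sub_shell (l := l) hkm hkC h.radius_pos h.pos h.le_sq hks hk0
  set b : ℝ → ℝ := fun q => k q - moment l k * shell l R q with hbdef
  have hsh := isProfile_shell l h.radius_pos
  have hkp : IsProfile k := ⟨hkm, hkC, R, h.radius_pos.le, fun q hq =>
    hks q fun hc => hc.2.not_gt hq⟩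
  set f : ℝ → ℝ := fun q => √(V q) * y q with hf
  have hfp : IsProfile f := by
    refine ⟨(Real.continuous_sqrt.measurable.comp h.measurable_V).mul h.measurable_y,
      ⟨√CV * Cy, fun q => ?_⟩, R, h.radius_pos.le, fun q hq => ?_⟩
    · rw [abs_of_nonneg (mul_nonneg (sqrt_nonneg _) (h.y_nonneg q))]
      exact mul_le_mul (Real.sqrt_le_sqrt (hCV q)) (hCy q) (h.y_nonneg q) (sqrt_nonneg _)
    · simp [hf, h.support q fun hc => hc.2.not_gt hq]
  have hUm : ∀ p : Pair N,
      MemLp (fun z => (√(V (‖rel p z‖ ^ 2)) : ℂ) * u z) 2 := fun p => by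
    refine (MemLp.const_mul (Lp.memLp u) (√CV : ℂ)).mono ?_ (Eventually.of_forall fun z => ?_)
    · refine AEStronglyMeasurable.mul ?_ (Lp.aestronglyMeasurable u)
      exact (measurable_ofReal.comp (Real.continuous_sqrt.measurable.comp (h.measurable_V.comp
        ((continuous_rel p).norm.pow 2).measurable))).aestronglyMeasurable
    · rw [norm_mul, norm_mul, norm_real, norm_real, norm_of_nonneg (sqrt_nonneg _),
        norm_of_nonneg (sqrt_nonneg _)]
      exact mul_le_mul_of_nonneg_right (Real.sqrt_le_sqrt (hCV _)) (norm_nonneg _)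
  set X : Pair N → L2 N := fun p => pairLift p hb.memLp_dualKernel (hm p).toLp with hX
  set F : Pair N → L2 N := fun p => pairLift p (hfp.memLp_radKernel l 2) (hm p).toLp with hF
  set G : Pair N → L2 N := fun p => pairLift p (hsh.memLp_radKernel l 2) (hm p).toLp with hG
  set K : Pair N → L2 N := fun p => pairLift p (hkp.memLp_radKernel l 2) (hm p).toLp with hK
  have hexp : ∀ q, q ≤ 4 * R ^ 2 → rexp (q / 2) ≤ rexp (2 * R ^ 2) := fun q hq =>
    Real.exp_le_exp.2 (by linarith)
  set e := rexp (2 * R ^ 2) with he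
  -- the norms of the test vectors
  have hXn : ∀ p, ‖X p‖ ^ 2 ≤ e * (π * ∫ q in (0 : ℝ)..4 * R ^ 2,
      prim l k q ^ 2 / (4 * q ^ (l + 1))) * ‖(hm p).toLp‖ ^ 2 := fun p => by
    rw [hX]
    dsimp only
    rw [norm_pairLift_sq]
    refine mul_le_mul_of_nonneg_right ?_ (sq_nonneg _)
    have hc : Continuous fun q => prim l k q ^ 2 / (4 * q ^ (l + 1)) * e :=
      (continuous_prim_sq_div (l := l) hkm hkC h.pos fun q hq =>
        hks q fun hc => hc.1.not_gt hq).mul continuous_const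
    have := toReal_lintegral_norm_sq_le (F := dualKernel l b) hc.measurable
      (Q := 4 * R ^ 2) (by positivity) (hc.intervalIntegrable _ _) (fun w hw => ?_)
      (fun w hw => hb.dualKernel_eq_zero hw.le) (fun q h0 _ => ?_)
    · rw [intervalIntegral.integral_mul_const] at this
      calc _ ≤ _ := this
        _ = _ := by ring
    · rw [norm_dualKernel_sq]
      refine mul_le_mul ?_ (hexp _ hw) (exp_pos _).le (by positivity)
      exact div_le_div_of_nonneg_right (hprim _ (sq_nonneg _) hw) (by positivity)
    · exact mul_nonneg (div_nonneg (sq_nonneg _) (by positivity)) (exp_pos _).le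
  have hFn : ∀ p, ‖F p‖ ^ 2 ≤ e * (π * ∫ q in (0 : ℝ)..R ^ 2, V q * y q ^ 2 * q ^ l)
      * ‖(hm p).toLp‖ ^ 2 := fun p => by
    rw [hF]
    dsimp only
    rw [norm_pairLift_sq]
    refine mul_le_mul_of_nonneg_right ?_ (sq_nonneg _)
    have hi : IntervalIntegrable (fun q => V q * y q ^ 2 * q ^ l * e) volume 0 (R ^ 2) := by
      refine IntervalIntegrable.mul_const (intervalIntegrable_mul_pow
        (h.measurable_V.mul (h.measurable_y.pow_const 2)) ⟨CV * Cy ^ 2, fun q => ?_⟩ l _ _) _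
      rw [Pi.mul_apply, abs_of_nonneg (mul_nonneg (h.V_nonneg q) (sq_nonneg _))]
      exact mul_le_mul (hCV q) (pow_le_pow_left₀ (h.y_nonneg q) (hCy q) 2) (sq_nonneg _) hCV0
    have := toReal_lintegral_norm_sq_le (F := radKernel l f) (((h.measurable_V.mul
      (h.measurable_y.pow_const 2)).mul (measurable_id.pow_const l)).mul_const e)
      hR2.le hi (fun w hw => ?_) (fun w hw => ?_) (fun q h0 _ => ?_)
    · simp only [Pi.mul_apply, id] at this
      rw [intervalIntegral.integral_mul_const] at this
      calc _ ≤ _ := this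
        _ = _ := by ring
    · rw [norm_radKernel_sq, hf]
      dsimp only [Pi.mul_apply, id]
      rw [mul_pow, sq_sqrt (h.V_nonneg _)]
      exact mul_le_mul_of_nonneg_left (hexp _ (by linarith)) (mul_nonneg (mul_nonneg (h.V_nonneg _)
        (sq_nonneg _)) (by positivity))
    · simp [radKernel, hf, h.support _ fun hc => hc.2.not_gt hw]
    · exact mul_nonneg (mul_nonneg (mul_nonneg (h.V_nonneg _) (sq_nonneg _)) (pow_nonneg h0 _))
        (exp_pos _).le
  -- the kinetic energy
  have hkin := sum_re_inner_pair_le X (fun p q hpq => inner_pairLift_eq_zero _ _ _ _ fun z => by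
    rcases le_or_gt (4 * R ^ 2) (‖rel p z‖ ^ 2) with h1 | h1
    · rw [hb.dualKernel_eq_zero h1]; simp
    rcases le_or_gt (4 * R ^ 2) (‖rel q z‖ ^ 2) with h2 | h2
    · rw [hb.dualKernel_eq_zero h2]; simp
    rcases hd p q hpq z h1.le h2.le with h3 | h3 <;> simp [h3]) (fun i => annih i u)
  have hXi : ∀ p, (⟪X p, annih p.1.1 u - annih p.1.2 u⟫_ℂ).re =
      2 * moment l k * (⟪G p, u⟫_ℂ).re - 2 * (⟪K p, u⟫_ℂ).re := fun p => by
    rw [hX]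
    dsimp only
    rw [hb.inner_dualKernel (h.le_sq.trans (by linarith)) p (hE p) (hs p) (hm p) hu.1]
    have e1 : pairLift p (hb.isProfile.memLp_radKernel l 2) (hm p).toLp =
        K p - (moment l k : ℂ) • G p := by
      rw [hG]
      dsimp only
      rw [← pairLift_smul_kernel p (((hsh.memLp_radKernel l 2)).const_mul (moment l k : ℂ))
        (hsh.memLp_radKernel l 2) _ (fun w => rfl)]
      refine pairLift_sub_kernel p _ _ _ (fun w => ?_) _
      simp only [radKernel, hbdef]
      push_cast
      ring
    rw [e1, inner_sub_left, inner_smul_left, conj_ofReal]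
    simp only [neg_mul, neg_re, mul_re, sub_re, ofReal_re, ofReal_im, zero_mul, sub_zero, re_ofNat,
      im_ofNat]
    ring
  -- the interaction energy
  have hpot := sum_norm_sqrt_mul_le hv h.measurable_V h.V_nonneg h.V_le hu hUm
  have hFi : ∀ p, ⟪F p, (hUm p).toLp⟫_ℂ = 2 * ⟪K p, u⟫_ℂ := fun p => by
    rw [L2_inner_eq, L2_inner_eq, ← integral_const_mul]
    refine integral_congr_ae ?_
    filter_upwards [coeFn_pairLift p (hfp.memLp_radKernel l 2) (hm p).toLp,
      coeFn_pairLift p (hkp.memLp_radKernel l 2) (hm p).toLp, (hUm p).coeFn_toLp] with z h1 h2 h3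
    rw [hF, hK]
    dsimp only
    rw [h1, h2, h3]
    have h4 : (√(V (‖rel p z‖ ^ 2)) : ℂ) * (√(V (‖rel p z‖ ^ 2)) : ℂ) =
        (V (‖rel p z‖ ^ 2) : ℂ) := by
      rw [← ofReal_mul, Real.mul_self_sqrt (h.V_nonneg _)]
    simp only [radKernel, hf, hk, map_mul, conj_ofReal, map_pow]
    push_cast
    linear_combination ((y (‖rel p z‖ ^ 2) : ℂ) * cexp (‖rel p z‖ ^ 2 / 4)
      * (starRingEnd ℂ (rel p z)) ^ l * (starRingEnd ℂ (((hm p).toLp : Lp ℂ 2) (cm p z))) * u z) * h4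
  have hFU : ∑ p, 4 * (⟪K p, u⟫_ℂ).re ≤ ∑ p, ‖F p‖ ^ 2 + (potEnergy N v a u).toReal := by
    refine le_trans ?_ (add_le_add_right hpot _)
    rw [← sum_add_distrib]
    refine sum_le_sum fun p _ => ?_
    have := two_re_inner_le (F p) (hUm p).toLp
    rw [hFi p] at this
    simp only [mul_re, re_ofNat, im_ofNat, zero_mul, sub_zero] at this
    linarith
  have htot : ∑ p, 4 * moment l k * (⟪G p, u⟫_ℂ).re ≤
      energy N v a u + ∑ p, (2 * ‖X p‖ ^ 2 + ‖F p‖ ^ 2) := by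
    simp only [hXi] at hkin
    have e2 : ∑ p, 2 * (2 * moment l k * (⟪G p, u⟫_ℂ).re - 2 * (⟪K p, u⟫_ℂ).re) =
        ∑ p, 4 * moment l k * (⟪G p, u⟫_ℂ).re - ∑ p, 4 * (⟪K p, u⟫_ℂ).re := by
      rw [← sum_sub_distrib]
      exact sum_congr rfl fun p _ => by ring
    rw [e2] at hkin
    rw [sum_add_distrib, ← mul_sum (f := fun p => ‖X p‖ ^ 2), energy]
    linarith
  have hnorm : ∀ p, c * (2 * ‖X p‖ ^ 2 + ‖F p‖ ^ 2) ≤ e * (κ + δ) * ‖(hm p).toLp‖ ^ 2 := fun p => by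
    have h1 := mul_le_mul_of_nonneg_left (add_le_add (mul_le_mul_of_nonneg_left (hXn p) zero_le_two)
      (hFn p)) h.scale_nonneg
    have h2 := mul_le_mul_of_nonneg_left h.bound
      (mul_nonneg (exp_pos (2 * R ^ 2)).le (sq_nonneg ‖(hm p).toLp‖))
    refine h1.trans (le_trans (le_of_eq ?_) (h2.trans (le_of_eq ?_)))
    · rw [hk, he]; ring
    · rw [he]; ring
  have hfin := mul_le_mul_of_nonneg_left htot h.scale_nonneg
  rw [mul_add, mul_sum, mul_sum] at hfin
  have h3 := sum_le_sum fun p (_ : p ∈ univ) => hnorm p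
  rw [sum_sub_distrib]
  have h4 : ∑ p, 2 * κ * (⟪G p, u⟫_ℂ).re = ∑ p, c * (4 * moment l k * (⟪G p, u⟫_ℂ).re) :=
    sum_congr rfl fun p _ => by rw [← h.moment_eq]; ring
  change ∑ p, 2 * κ * (⟪G p, u⟫_ℂ).re - _ ≤ _
  rw [h4]
  linarith

end Lower

section Negligible

/-- The vectors `h` for which `⟨h, u⟩` is small, uniformly on sets of bounded energy. -/
def negligible (N : ℕ) (hv : Measurable v) (c : ℝ → ℝ) : Submodule ℂ (L2 N) where
  carrier := {h | ∀ δ > 0, ∀ᶠ a in 𝓝₊, ∀ u ∈ formDomain N hv a,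
    ‖⟪h, u⟫_ℂ‖ ^ 2 ≤ δ * (‖u‖ ^ 2 + |c a| * energy N v a u)}
  zero_mem' := fun δ hδ => .of_forall fun a u _ => by
    have := mul_nonneg (abs_nonneg (c a)) (energy_nonneg v a u)
    rw [inner_zero_left, norm_zero, zero_pow two_ne_zero]
    positivity
  add_mem' := by
    intro x y hx hy δ hδ
    filter_upwards [hx (δ / 4) (by positivity), hy (δ / 4) (by positivity)] with a h1 h2 u hu
    have h3 := h1 u hu
    have h4 := h2 u hu
    rw [inner_add_left]
    have h5 := norm_add_le ⟪x, u⟫_ℂ ⟪y, u⟫_ℂ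
    have h6 := pow_le_pow_left₀ (norm_nonneg _) h5 2
    nlinarith [sq_nonneg (‖⟪x, u⟫_ℂ‖ - ‖⟪y, u⟫_ℂ‖)]
  smul_mem' := by
    intro t x hx δ hδ
    filter_upwards [hx (δ / (‖t‖ ^ 2 + 1)) (by positivity)] with a h1 u hu
    have h2 := h1 u hu
    rw [inner_smul_left, norm_mul, mul_pow, RCLike.norm_conj]
    have h3 : (‖t‖ ^ 2 + 1) * ‖⟪x, u⟫_ℂ‖ ^ 2 ≤ δ * (‖u‖ ^ 2 + |c a| * energy N v a u) := by
      have := mul_le_mul_of_nonneg_left h2 (by positivity : 0 ≤ ‖t‖ ^ 2 + 1)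
      refine this.trans (le_of_eq ?_)
      field_simp
    nlinarith [sq_nonneg ‖⟪x, u⟫_ℂ‖]

theorem isClosed_negligible (hv : Measurable v) (c : ℝ → ℝ) :
    IsClosed (negligible N hv c : Set (L2 N)) := by
  refine isClosed_of_closure_subset fun x hx δ hδ => ?_
  obtain ⟨y, hy, hxy⟩ := Metric.mem_closure_iff.1 hx (√(δ / 4)) (by positivity)
  filter_upwards [hy (δ / 4) (by positivity)] with a h1 u hu
  have h3 := h1 u hu
  have h4 : ⟪x, u⟫_ℂ = ⟪x - y, u⟫_ℂ + ⟪y, u⟫_ℂ := by rw [inner_sub_left]; ring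
  have h5 : ‖⟪x - y, u⟫_ℂ‖ ^ 2 ≤ δ / 4 * ‖u‖ ^ 2 := by
    calc _ ≤ (‖x - y‖ * ‖u‖) ^ 2 := pow_le_pow_left₀ (norm_nonneg _) (norm_inner_le_norm _ _) 2
      _ = ‖x - y‖ ^ 2 * ‖u‖ ^ 2 := mul_pow _ _ _
      _ ≤ _ := by
        refine mul_le_mul_of_nonneg_right ?_ (sq_nonneg _)
        rw [dist_eq_norm] at hxy
        calc _ ≤ √(δ / 4) ^ 2 := pow_le_pow_left₀ (norm_nonneg _) hxy.le 2
          _ = δ / 4 := sq_sqrt (by positivity)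
  have h6 := mul_nonneg (abs_nonneg (c a)) (energy_nonneg v a u)
  rw [h4]
  have h7 := pow_le_pow_left₀ (norm_nonneg _) (norm_add_le ⟪x - y, u⟫_ℂ ⟪y, u⟫_ℂ) 2
  nlinarith [sq_nonneg (‖⟪x - y, u⟫_ℂ‖ - ‖⟪y, u⟫_ℂ‖)]

theorem negligible_mono (hv : Measurable v) {c c' : ℝ → ℝ}
    (h : ∀ᶠ a in 𝓝₊, |c a| ≤ |c' a|) : negligible N hv c ≤ negligible N hv c' := by
  intro x hx δ hδ
  filter_upwards [hx δ hδ, h] with a h1 h2 u hu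
  have := mul_le_mul_of_nonneg_right h2 (energy_nonneg v a u)
  have := h1 u hu
  nlinarith

/-- To be negligible, it suffices to be controlled by the energy on a slower scale. -/
theorem mem_negligible_of_le (hv : Measurable v) {c c' : ℝ → ℝ} {h : L2 N} {C : ℝ}
    (hC : 0 ≤ C) (hc' : ∀ᶠ a in 𝓝₊, 0 < c' a) (hlim : Tendsto (fun a => c a / c' a) (𝓝₊) (𝓝 0))
    (hb : ∀ᶠ a in 𝓝₊, ∀ u ∈ formDomain N hv a, ‖⟪h, u⟫_ℂ‖ ^ 2 ≤ C * (c a * energy N v a u)) :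
    h ∈ negligible N hv c' := by
  intro δ hδ
  have h1 : ∀ᶠ a in 𝓝₊, c a / c' a < δ / (C + 1) := hlim.eventually (gt_mem_nhds (by positivity))
  filter_upwards [h1, hc', hb] with a h1 h2 h3 u hu
  refine (h3 u hu).trans ?_
  rw [abs_of_pos h2]
  have h4 := energy_nonneg v a u
  rw [div_lt_div_iff₀ h2 (by positivity)] at h1
  have h5 : C * c a ≤ δ * c' a := by
    rcases le_or_gt 0 (c a) with h | h
    · nlinarith
    · nlinarith [mul_pos hδ h2, mul_nonneg hC (neg_nonneg.2 h.le)]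
  nlinarith [sq_nonneg ‖u‖, mul_le_mul_of_nonneg_right h5 h4, mul_nonneg hδ.le (sq_nonneg ‖u‖)]

theorem orthogonal_le_of_isClosed {H : Type*} [NormedAddCommGroup H] [InnerProductSpace ℂ H]
    [CompleteSpace H] {B M : Submodule ℂ H} (hM : IsClosed (M : Set H)) (h : Mᗮ ≤ B) : Bᗮ ≤ M := by
  have := Submodule.orthogonal_le h
  rwa [Submodule.orthogonal_orthogonal_eq_closure, hM.submodule_topologicalClosure_eq] at this

theorem orthogonal_spaceB_zero_le_negligible (hv : Measurable v) {c : ℝ → ℝ}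
    (hc : Tendsto c (𝓝₊) atTop) : (spaceB N 0)ᗮ ≤ negligible N hv c := by
  have hpos : ∀ᶠ a in 𝓝₊, 0 < c a := hc.eventually_gt_atTop 0
  refine orthogonal_le_of_isClosed (isClosed_negligible hv c) ?_
  intro Ψ hΨ
  refine mem_spaceB_zero_iff.2 fun i χ hχ hs => hΨ _ ?_
  refine mem_negligible_of_le hv (c := fun _ => 1) (sq_nonneg ‖(memLp_test hχ.continuous hs).toLp‖)
    hpos ?_ (.of_forall fun a u hu => ?_)
  · simp only [one_div]
    exact hc.inv_tendsto_atTop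
  · rw [inner_annihAdj_eq i hχ hs (hu.1 i), one_mul]
    calc _ ≤ (‖(memLp_test hχ.continuous hs).toLp‖ * ‖annih i u‖) ^ 2 :=
          pow_le_pow_left₀ (norm_nonneg _) (norm_inner_le_norm _ _) 2
      _ = ‖(memLp_test hχ.continuous hs).toLp‖ ^ 2 * ‖annih i u‖ ^ 2 := mul_pow _ _ _
      _ ≤ _ := by
        refine mul_le_mul_of_nonneg_left ?_ (sq_nonneg _)
        have h1 := single_le_sum (f := fun i => ‖annih i u‖ ^ 2) (fun _ _ => sq_nonneg _)
          (mem_univ i)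
        exact h1.trans (le_add_of_nonneg_right toReal_nonneg)

/-! ### Test functions away from the other coincidences -/

/-- The smooth functions with compact support, away from the coincidences other than `p`. -/
def testSpace (p : Pair N) : Submodule ℂ (Rest p → ℂ) where
  carrier := {E | ContDiff ℝ ∞ E ∧ HasCompactSupport E ∧
    ∀ y ∈ tsupport E, ∀ q ≠ p, rel q (collapse p y) ≠ 0}
  zero_mem' := ⟨contDiff_const, HasCompactSupport.zero, by simp [tsupport]⟩
  add_mem' := by
    rintro E F ⟨h1, h2, h3⟩ ⟨h4, h5, h6⟩
    refine ⟨h1.add h4, h2.add h5, fun y hy => ?_⟩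
    have : tsupport (E + F) ⊆ tsupport E ∪ tsupport F := by
      rw [tsupport, tsupport, tsupport, ← closure_union]
      exact closure_mono (Function.support_add _ _)
    rcases this hy with h | h
    · exact h3 y h
    · exact h6 y h
  smul_mem' := by
    rintro c E ⟨h1, h2, h3⟩
    refine ⟨h1.const_smul c, h2.smul_left (f := fun _ => c), fun y hy => h3 y ?_⟩
    exact closure_mono (Function.support_const_smul_subset c E) hy

theorem testSpace_memLp {p : Pair N} {E : Rest p → ℂ} (h : E ∈ testSpace p) : MemLp E 2 :=
  h.1.continuous.memLp_of_hasCompactSupport h.2.1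

theorem eq_zero_of_inner_testSpace {p : Pair N} {F : RestL2 p}
    (hF : ∀ E (h : E ∈ testSpace p), ⟪(testSpace_memLp h).toLp, F⟫_ℂ = 0) : F = 0 := by
  set U : Set (Rest p) := ⋂ q ∈ (univ.erase p : Finset (Pair N)), {y | rel q (collapse p y) ≠ 0}
    with hU
  have hUo : IsOpen U := isOpen_biInter_finset fun q _ =>
    isOpen_ne_fun ((continuous_rel q).comp (continuous_collapse p)) continuous_const
  have hUae : ∀ᵐ y : Rest p, y ∈ U := by
    have hne : ∀ᵐ y : Rest p, ∀ q ∈ univ.erase p, rel q (collapse p y) ≠ 0 :=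
      (Finset.eventually_all _).2 fun q hq => ae_rel_collapse_ne_zero (ne_of_mem_erase hq)
    filter_upwards [hne] with y hy
    simpa [hU] using hy
  have h1 : ∀ᵐ y : Rest p, y ∈ U → F y = 0 := by
    refine hUo.ae_eq_zero_of_integral_contDiff_smul_eq_zero
      (((Lp.memLp F).locallyIntegrable (by norm_num)).locallyIntegrableOn _) fun g hg hs hsub => ?_
    have hE : (fun y => (g y : ℂ)) ∈ testSpace p := by
      refine ⟨ofRealCLM.contDiff.comp hg, hs.comp_left (g := fun r : ℝ => (r : ℂ)) rfl,
        fun y hy q hq => ?_⟩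
      have : y ∈ U := hsub (closure_mono (fun x hx => by simpa using hx) hy)
      simp only [hU, mem_iInter] at this
      exact this q (by simp [hq])
    have := hF _ hE
    rw [inner_toLp] at this
    simpa [conj_ofReal, real_smul] using this
  refine Lp.ext ?_
  filter_upwards [h1, hUae, Lp.coeFn_zero ℂ 2 (volume : Measure (Rest p))] with y h2 h3 h4
  rw [h2 h3, h4]; rfl

theorem exists_testSpace_near {p : Pair N} (F : RestL2 p) {δ : ℝ}
    (hδ : 0 < δ) : ∃ E, ∃ h : E ∈ testSpace p, ‖(testSpace_memLp h).toLp - F‖ < δ := by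
  set L : testSpace p →ₗ[ℂ] RestL2 p :=
    { toFun := fun E => (testSpace_memLp E.2).toLp
      map_add' := fun E F => rfl
      map_smul' := fun c E => rfl } with hL
  have hd : (LinearMap.range L).topologicalClosure = ⊤ := by
    rw [Submodule.topologicalClosure_eq_top_iff, Submodule.eq_bot_iff]
    intro G hG
    exact eq_zero_of_inner_testSpace fun E h => hG _ ⟨⟨E, h⟩, rfl⟩
  have hF : F ∈ closure (LinearMap.range L : Set (RestL2 p)) := by
    have : F ∈ (LinearMap.range L).topologicalClosure := by rw [hd]; trivial
    exact this
  obtain ⟨_, ⟨E, rfl⟩, hE⟩ := Metric.mem_closure_iff.1 hF δ hδ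
  refine ⟨E.1, E.2, ?_⟩
  rw [dist_comm, dist_eq_norm] at hE
  exact hE

theorem norm_rel_relDir_le (p q : Pair N) : ‖rel q (relDir p)‖ ≤ 1 := by
  have h : ∀ k, ‖relDir p k‖ ≤ 1 / 2 := fun k => by
    rw [relDir]
    split_ifs <;> norm_num
  calc _ ≤ ‖relDir p q.1.1‖ + ‖relDir p q.1.2‖ := norm_sub_le _ _
    _ ≤ 1 := by linarith [h q.1.1, h q.1.2]

/-- For small radii, the test functions belonging to different pairs do not interfere. -/
theorem eventually_disjoint {E : ∀ p : Pair N, Rest p → ℂ} (hE : ∀ p, E p ∈ testSpace p) :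
    ∀ᶠ R in 𝓝₊, ∀ p q, p ≠ q → ∀ z, ‖rel p z‖ ^ 2 ≤ 4 * R ^ 2 → ‖rel q z‖ ^ 2 ≤ 4 * R ^ 2 →
      E p (cm p z) = 0 ∨ E q (cm q z) = 0 := by
  have key : ∀ p q : Pair N, p ≠ q → ∃ m : ℝ, 0 < m ∧
      ∀ y ∈ tsupport (E p), m ≤ ‖rel q (collapse p y)‖ := fun p q hpq => by
    obtain ⟨m, hm, h⟩ := IsCompact.exists_forall_le' (a := 0) (hE p).2.1
      (f := fun y => ‖rel q (collapse p y)‖)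
      ((continuous_rel q).comp (continuous_collapse p)).norm.continuousOn
      (fun y hy => norm_pos_iff.2 ((hE p).2.2 y hy q hpq.symm))
    exact ⟨m, hm, h⟩
  refine eventually_all.2 fun p => eventually_all.2 fun q => ?_
  by_cases hpq : p = q
  · exact .of_forall fun R h => absurd hpq h
  obtain ⟨m, hm, hle⟩ := key p q hpq
  have hR : ∀ᶠ R in 𝓝₊, R < m / 4 := nhdsWithin_le_nhds (gt_mem_nhds (by positivity))
  filter_upwards [hR, self_mem_nhdsWithin] with R hR hR0 _ z h1 h2
  left
  by_contra hne
  have h3 := hle (cm p z) (subset_tsupport _ hne)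
  have hR0' : (0 : ℝ) < R := hR0
  have h1' : ‖rel p z‖ ≤ 2 * R := abs_le_of_sq_le_sq' (by nlinarith) (by positivity) |>.2
  have h2' : ‖rel q z‖ ≤ 2 * R := abs_le_of_sq_le_sq' (by nlinarith) (by positivity) |>.2
  have h4 : rel q (collapse p (cm p z)) = rel q z - rel p z * rel q (relDir p) := by
    rw [collapse_cm]
    simp only [rel, Pi.sub_apply, Pi.smul_apply, smul_eq_mul]
    ring
  have h5 := norm_rel_relDir_le p q
  rw [h4] at h3
  have h6 := (norm_sub_le (rel q z) (rel p z * rel q (relDir p)))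
  rw [norm_mul] at h6
  nlinarith [norm_nonneg (rel p z), norm_nonneg (rel q (relDir p))]

/-- The factor by which the energy is scaled. -/
def energyScale (l : ℕ) (a : ℝ) : ℝ := if l = 0 then Real.log (1 / a ^ 2) else (a ^ (2 * l))⁻¹

theorem tendsto_energyScale (l : ℕ) : Tendsto (energyScale l) (𝓝₊) atTop := by
  have h : ∀ n : ℕ, n ≠ 0 → Tendsto (fun a : ℝ => (a ^ n)⁻¹) (𝓝₊) atTop := fun n hn => by
    have h1 : Tendsto (fun a : ℝ => a ^ n) (𝓝₊) (𝓝[>] 0) := by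
      refine tendsto_nhdsWithin_iff.2 ⟨?_, ?_⟩
      · simpa [hn] using ((continuous_pow n).tendsto (0 : ℝ)).mono_left
          (nhdsWithin_le_nhds (s := Ioi (0 : ℝ)))
      · filter_upwards [self_mem_nhdsWithin] with a ha
        exact pow_pos (Set.mem_Ioi.1 ha) n
    exact tendsto_inv_nhdsGT_zero.comp h1
  unfold energyScale
  split_ifs with hl
  · simp only [one_div]
    exact Real.tendsto_log_atTop.comp (h 2 two_ne_zero)
  · exact h _ (by omega)

theorem energyScale_pos (l : ℕ) : ∀ᶠ a in 𝓝₊, 0 < energyScale l a :=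
  (tendsto_energyScale l).eventually_gt_atTop 0

theorem tendsto_energyScale_div (l : ℕ) :
    Tendsto (fun a => energyScale l a / energyScale (l + 1) a) (𝓝₊) (𝓝 0) := by
  rcases Nat.eq_zero_or_pos l with rfl | hl
  · have h1 := (tendsto_log_mul_rpow_nhdsGT_zero (r := 2) two_pos).const_mul (-2)
    rw [mul_zero] at h1
    refine h1.congr' ?_
    filter_upwards [self_mem_nhdsWithin] with a ha
    have ha' : (0 : ℝ) < a := ha
    simp only [energyScale, one_div, Real.log_inv, Real.log_pow, if_true]
    norm_num
    ring
  · have h1 : Tendsto (fun a : ℝ => a ^ 2) (𝓝₊) (𝓝 0) := by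
      simpa using ((continuous_pow 2).tendsto (0 : ℝ)).mono_left
        (nhdsWithin_le_nhds (s := Ioi (0 : ℝ)))
    refine h1.congr' ?_
    filter_upwards [self_mem_nhdsWithin] with a ha
    have ha' : (0 : ℝ) < a := ha
    simp only [energyScale, hl.ne', Nat.succ_ne_zero, if_false]
    field_simp
    ring

/-- Certificates for the lower bound exist at all radii and precisions. -/
def HasLowCerts (v : ℝ → ℝ≥0∞) (l : ℕ) (κ : ℝ) : Prop :=
  ∀ R > 0, ∀ δ > 0, ∀ᶠ a in 𝓝₊, ∃ ε V y, IsLowCert v l a (energyScale l a) κ R δ ε V y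

theorem inner_shell_sq_le (hv : Measurable v) {a c κ R δ : ℝ}
    {y : ℝ → ℝ} (h : IsLowCert v l a c κ R δ ε V y) (hκ : 0 < κ) (hδ : 0 < δ) {p : Pair N}
    {E : Rest p → ℂ} (hE : E ∈ testSpace p) {u : L2 N} (hu : u ∈ formDomain N hv a) :
    ‖⟪pairLift p ((isProfile_shell l h.radius_pos).memLp_radKernel l 2) (testSpace_memLp hE).toLp,
      u⟫_ℂ‖ ^ 2 ≤ rexp (2 * R ^ 2) * (κ + δ) * (‖(testSpace_memLp hE).toLp‖ ^ 2 + 1) / κ ^ 2 *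
        (c * energy N v a u) := by
  classical
  set x := ⟪pairLift p ((isProfile_shell l h.radius_pos).memLp_radKernel l 2)
    (testSpace_memLp hE).toLp, u⟫_ℂ with hx
  set D := rexp (2 * R ^ 2) * (κ + δ) * (‖(testSpace_memLp hE).toLp‖ ^ 2 + 1) with hD
  have hDpos : 0 < D := by positivity
  set t : ℂ := (κ / D : ℝ) * x with ht
  set F : ∀ q : Pair N, Rest q → ℂ := Function.update 0 p (t • E) with hF
  have hFp : F p = t • E := Function.update_self ..
  have hFq : ∀ q, q ≠ p → F q = 0 := fun q hq => Function.update_of_ne hq ..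
  have hFt : ∀ q, F q ∈ testSpace q := fun q => by
    by_cases hq : q = p
    · subst hq; rw [hFp]; exact Submodule.smul_mem _ _ hE
    · rw [hFq q hq]; exact Submodule.zero_mem _
  have hm := fun q => testSpace_memLp (hFt q)
  have key := h.energy_ge hv (fun q => (hFt q).1) (fun q => (hFt q).2.1) hm (fun q r hqr z _ _ => by
    by_cases hq : q = p
    · right
      rw [hFq r fun hr => hqr (hq.trans hr.symm)]; rfl
    · left
      rw [hFq q hq]; rfl) hu
  have hz : ∀ q, q ≠ p → (hm q).toLp = 0 := fun q hq => by
    have : (hm q).toLp = (MemLp.zero : MemLp (0 : Rest q → ℂ) 2).toLp := by simp only [hFq q hq]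
    rw [this]; rfl
  have hpp : (hm p).toLp = t • (testSpace_memLp hE).toLp := by
    have : (hm p).toLp = ((testSpace_memLp hE).const_smul t).toLp := by simp only [hFp]
    rw [this]; rfl
  rw [sum_eq_single p (fun q _ hq => by rw [hz q hq]; simp) (by simp), hpp, map_smul,
    inner_smul_left, norm_smul, ← hx] at key
  have e1 : (conj t * x).re = κ / D * ‖x‖ ^ 2 := by
    rw [ht, map_mul, conj_ofReal, mul_assoc, Complex.conj_mul', ← ofReal_pow, ← ofReal_mul, ofReal_re]
  have e2 : ‖t‖ = κ / D * ‖x‖ := by rw [ht, norm_mul, norm_real, norm_of_nonneg (by positivity)]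
  rw [e1, e2] at key
  have h1 : rexp (2 * R ^ 2) * (κ + δ) * (κ / D * ‖x‖ * ‖(testSpace_memLp hE).toLp‖) ^ 2 ≤
      D * (κ / D * ‖x‖) ^ 2 := by
    rw [hD, mul_pow _ ‖(testSpace_memLp hE).toLp‖]
    have : 0 ≤ rexp (2 * R ^ 2) * (κ + δ) * (κ / D * ‖x‖) ^ 2 := by positivity
    nlinarith
  have h2 : 2 * κ * (κ / D * ‖x‖ ^ 2) - D * (κ / D * ‖x‖) ^ 2 = κ ^ 2 / D * ‖x‖ ^ 2 := by
    field_simp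
    ring
  have h3 : κ ^ 2 / D * ‖x‖ ^ 2 ≤ c * energy N v a u := by linarith
  calc ‖x‖ ^ 2 = D / κ ^ 2 * (κ ^ 2 / D * ‖x‖ ^ 2) := by field_simp
    _ ≤ _ := mul_le_mul_of_nonneg_left h3 (by positivity)

theorem orthogonal_spaceB_le_negligible (hv : Measurable v) (l : ℕ)
    (hcert : ∀ j < l, ∃ κ > 0, HasLowCerts v j κ) :
    (spaceB N l)ᗮ ≤ negligible N hv (energyScale l) := by
  induction l with
  | zero => exact orthogonal_spaceB_zero_le_negligible hv (tendsto_energyScale 0)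
  | succ l ih =>
    have ih' := ih fun j hj => hcert j (by omega)
    obtain ⟨κ, hκ, hc⟩ := hcert l (by omega)
    have hmono : negligible N hv (energyScale l) ≤ negligible N hv (energyScale (l + 1)) := by
      refine negligible_mono hv ?_
      filter_upwards [(tendsto_energyScale_div l).eventually (gt_mem_nhds one_pos),
        energyScale_pos l, energyScale_pos (l + 1)] with a h1 h2 h3
      rw [abs_of_pos h2, abs_of_pos h3]
      exact ((div_lt_one h3).1 h1).le
    refine orthogonal_le_of_isClosed (isClosed_negligible hv _) fun Ψ hΨ => ?_
    have hB : Ψ ∈ spaceB N l := by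
      have h1 : Ψ ∈ (spaceB N l)ᗮᗮ := Submodule.orthogonal_le (ih'.trans hmono) hΨ
      rwa [Submodule.orthogonal_orthogonal] at h1
    refine mem_spaceB_succ_iff.2 ⟨hB, fun p => eq_zero_of_inner_testSpace fun E hE => ?_⟩
    have h1 := inner_radKernel_eq (isProfile_shell l one_pos) hB p (testSpace_memLp hE).toLp
    rw [moment_shell l one_pos, ofReal_one, one_mul] at h1
    rw [← h1]
    refine hΨ _ (mem_negligible_of_le hv (c := energyScale l)
      (C := rexp (2 * 1 ^ 2) * (κ + 1) * (‖(testSpace_memLp hE).toLp‖ ^ 2 + 1) / κ ^ 2) ?_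
      (energyScale_pos _) (tendsto_energyScale_div l) ((hc 1 one_pos 1 one_pos).mono fun a => ?_))
    · positivity
    · rintro ⟨ε, V, y, h⟩ u hu
      exact inner_shell_sq_le hv h hκ one_pos hE hu

/-- The adjoint of the restriction to coincident configurations. -/
def coSlice (l : ℕ) (p : Pair N) : RestL2 p →L[ℂ] spaceB N l :=
  ((sliceL l p).comp (spaceB N l).subtypeL).adjoint

theorem coincidenceOp_apply (w : spaceB N l) :
    coincidenceOp N l w = ∑ p, coSlice l p (sliceL l p (w : L2 N)) := by
  rw [coincidenceOp, ContinuousLinearMap.sum_apply]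
  rfl

theorem inner_coSlice (p : Pair N) (e : RestL2 p) {Φ : L2 N}
    (hΦ : Φ ∈ spaceB N l) : ⟪(coSlice l p e : L2 N), Φ⟫_ℂ = ⟪e, sliceL l p Φ⟫_ℂ :=
  ContinuousLinearMap.adjoint_inner_left ((sliceL l p).comp (spaceB N l).subtypeL) ⟨Φ, hΦ⟩ e

theorem exists_test_family (w : spaceB N l) {η : ℝ} (hη : 0 < η) (κ : ℝ) :
    ∃ (E : ∀ p : Pair N, Rest p → ℂ) (hE : ∀ p, E p ∈ testSpace p),
      ‖(∑ p, coSlice l p (testSpace_memLp (hE p)).toLp) - coincidenceOp N l w‖ < η ∧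
      κ * ∑ p, ‖(testSpace_memLp (hE p)).toLp‖ ^ 2 < κ * ∑ p, ‖sliceL l p (w : L2 N)‖ ^ 2 + η := by
  choose E hE hEn using fun (n : ℕ) (p : Pair N) =>
    exists_testSpace_near (sliceL l p (w : L2 N)) (Nat.one_div_pos_of_nat (n := n) (α := ℝ))
  have hlim : ∀ p, Tendsto (fun n => (testSpace_memLp (hE n p)).toLp) atTop
      (𝓝 (sliceL l p (w : L2 N))) := fun p => by
    refine tendsto_iff_norm_sub_tendsto_zero.2 ?_
    exact squeeze_zero (fun _ => norm_nonneg _) (fun n => (hEn n p).le)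
      tendsto_one_div_add_atTop_nhds_zero_nat
  have h1 : Tendsto (fun n => ‖(∑ p, coSlice l p (testSpace_memLp (hE n p)).toLp)
      - coincidenceOp N l w‖) atTop (𝓝 0) := by
    rw [← tendsto_iff_norm_sub_tendsto_zero, coincidenceOp_apply]
    exact tendsto_finsetSum _ fun p _ => ((coSlice l p).continuous.tendsto _).comp (hlim p)
  have h2 : Tendsto (fun n => κ * ∑ p, ‖(testSpace_memLp (hE n p)).toLp‖ ^ 2) atTop
      (𝓝 (κ * ∑ p, ‖sliceL l p (w : L2 N)‖ ^ 2)) :=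
    (tendsto_finsetSum _ fun p _ => (hlim p).norm.pow 2).const_mul κ
  obtain ⟨n, hn⟩ := ((h1.eventually (gt_mem_nhds hη)).and
    (h2.eventually (gt_mem_nhds (lt_add_of_pos_right _ hη)))).exists
  exact ⟨E n, hE n, hn⟩

theorem sum_pairLift_sub_mem_orthogonal {R : ℝ} (hR : 0 < R) (e : ∀ p : Pair N, RestL2 p) :
    (∑ p, pairLift p ((isProfile_shell l hR).memLp_radKernel l 2) (e p))
      - ((∑ p, coSlice l p (e p) : spaceB N l) : L2 N) ∈ (spaceB N l)ᗮ := by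
  rw [Submodule.mem_orthogonal']
  intro Φ hΦ
  rw [inner_sub_left, sum_inner, Submodule.coe_sum, sum_inner, sub_eq_zero]
  refine sum_congr rfl fun p _ => ?_
  rw [inner_radKernel_eq (isProfile_shell l hR) hΦ, moment_shell l hR, ofReal_one, one_mul,
    inner_coSlice p _ hΦ]

/-- The lower bound on the energy in terms of the limiting operator. -/
theorem energy_lower_bound (hv : Measurable v) {κ : ℝ} (hκ : 0 < κ)
    (hcert : HasLowCerts v l κ) (hneg : (spaceB N l)ᗮ ≤ negligible N hv (energyScale l))
    (w : spaceB N l) {δ : ℝ} (hδ : 0 < δ) : ∀ᶠ a in 𝓝₊, ∀ u ∈ formDomain N hv a,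
      2 * κ * (⟪(coincidenceOp N l w : L2 N), u⟫_ℂ).re - κ * ∑ p, ‖sliceL l p (w : L2 N)‖ ^ 2
        - δ * (1 + ‖u‖ ^ 2 + energyScale l a * energy N v a u) ≤ energyScale l a * energy N v a u := by
  set η : ℝ := δ / (4 * (κ + 1)) with hη
  have hη0 : 0 < η := by positivity
  have hη1 : η ≤ δ / 4 := div_le_div_of_nonneg_left hδ.le (by norm_num) (by linarith)
  have hηκ : κ * η ≤ δ / 4 := by
    rw [hη, mul_div_assoc', div_le_div_iff₀ (by positivity) (by positivity)]
    nlinarith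
  obtain ⟨E, hE, hn1, hn2⟩ := exists_test_family w hη0 κ
  set e : ∀ p : Pair N, RestL2 p := fun p => (testSpace_memLp (hE p)).toLp with he
  set t : spaceB N l := ∑ p, coSlice l p (e p) with ht
  have hRlim : ∀ᶠ R in 𝓝₊, rexp (2 * R ^ 2) * (κ + R) * ∑ p, ‖e p‖ ^ 2 <
      κ * ∑ p, ‖e p‖ ^ 2 + δ / 4 := by
    have hcont : Continuous fun R : ℝ => rexp (2 * R ^ 2) * (κ + R) * ∑ p, ‖e p‖ ^ 2 := by
      fun_prop
    have := (hcont.tendsto 0).mono_left (nhdsWithin_le_nhds (s := Ioi (0 : ℝ)))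
    simp only [ne_eq, OfNat.ofNat_ne_zero, not_false_eq_true, zero_pow, mul_zero, Real.exp_zero,
      add_zero, one_mul] at this
    exact this.eventually (gt_mem_nhds (by linarith))
  obtain ⟨R, hR1, hR2, hR0⟩ := (hRlim.and ((eventually_disjoint hE).and self_mem_nhdsWithin)).exists
  have hR0' : (0 : ℝ) < R := hR0
  set G : Pair N → L2 N := fun p =>
    pairLift p ((isProfile_shell l hR0').memLp_radKernel l 2) (e p) with hG
  have hperp : (∑ p, G p) - (t : L2 N) ∈ (spaceB N l)ᗮ := sum_pairLift_sub_mem_orthogonal hR0' e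
  filter_upwards [hcert R hR0' R hR0', hneg hperp (η ^ 2) (by positivity), energyScale_pos l]
    with a hcer hsmall hpos u hu
  obtain ⟨ε, V, y, hc⟩ := hcer
  have h1 := hc.energy_ge hv (fun p => (hE p).1) (fun p => (hE p).2.1)
    (fun p => testSpace_memLp (hE p)) hR2 hu
  rw [sum_sub_distrib, ← mul_sum, ← mul_sum, ← Complex.re_sum, ← sum_inner] at h1
  have h2 : ⟪∑ p, G p, u⟫_ℂ = ⟪(coincidenceOp N l w : L2 N), u⟫_ℂ +
      ⟪(t : L2 N) - (coincidenceOp N l w : L2 N), u⟫_ℂ + ⟪(∑ p, G p) - (t : L2 N), u⟫_ℂ := by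
    rw [inner_sub_left, inner_sub_left]; ring
  have h3 := hsmall u hu
  rw [abs_of_pos hpos] at h3
  set X := energyScale l a * energy N v a u with hX
  have hX0 : 0 ≤ X := mul_nonneg hpos.le (energy_nonneg v a u)
  have h4 : ‖⟪(t : L2 N) - (coincidenceOp N l w : L2 N), u⟫_ℂ‖ ≤ η * ‖u‖ :=
    (norm_inner_le_norm _ _).trans (mul_le_mul_of_nonneg_right hn1.le (norm_nonneg _))
  have h5 := (abs_le.1 (Complex.abs_re_le_norm
    ⟪(t : L2 N) - (coincidenceOp N l w : L2 N), u⟫_ℂ)).1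
  have h6 := (abs_le.1 (Complex.abs_re_le_norm ⟪(∑ p, G p) - (t : L2 N), u⟫_ℂ)).1
  set x := ‖⟪(∑ p, G p) - (t : L2 N), u⟫_ℂ‖ with hx
  have h7 : 2 * x ≤ η * (1 + ‖u‖ ^ 2 + X) := by
    have : 2 * x * η ≤ η * (1 + ‖u‖ ^ 2 + X) * η := by nlinarith [sq_nonneg (x - η)]
    exact le_of_mul_le_mul_right this hη0
  have h8 : 2 * (η * ‖u‖) ≤ η * (1 + ‖u‖ ^ 2) := by nlinarith [sq_nonneg (‖u‖ - 1)]
  have h9 : (⟪(coincidenceOp N l w : L2 N), u⟫_ℂ).re - η * (1 + ‖u‖ ^ 2 + X) ≤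
      (⟪∑ p, G p, u⟫_ℂ).re := by
    rw [h2, add_re, add_re]
    nlinarith
  have h10 := mul_le_mul_of_nonneg_left h9 (by positivity : 0 ≤ 2 * κ)
  have h11 : 2 * κ * (η * (1 + ‖u‖ ^ 2 + X)) ≤ δ / 2 * (1 + ‖u‖ ^ 2 + X) := by
    have := mul_le_mul_of_nonneg_right hηκ (by positivity : 0 ≤ 1 + ‖u‖ ^ 2 + X)
    linarith
  have h12 : δ / 2 ≤ δ / 2 * (1 + ‖u‖ ^ 2 + X) := by
    have : 0 ≤ δ / 2 * (‖u‖ ^ 2 + X) := by positivity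
    linarith
  change 2 * κ * (⟪∑ p, G p, u⟫_ℂ).re - rexp (2 * R ^ 2) * (κ + R) * ∑ p, ‖e p‖ ^ 2 ≤ X at h1
  linarith

end Negligible

/-! ### Upper bounds on the energy -/

section Upper

theorem continuous_magD_of_contDiff_one (i : Fin N) (k : Fin 2) {Φ : Config N → ℂ}
    (h : ContDiff ℝ 1 Φ) : Continuous (magD i k Φ) := by
  have h1 : Continuous fun z => fderiv ℝ Φ z (single i (dir k)) :=
    (h.continuous_fderiv (by simp)).clm_apply continuous_const
  have h2 : Continuous fun z : Config N => (vecPot k (z i) : ℂ) := (contDiff_vecPot i k).continuous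
  have h3 := h.continuous
  unfold magD
  fun_prop

theorem weakMagD_toLp (i : Fin N) (k : Fin 2) {Φ : Config N → ℂ} (hΦ : ContDiff ℝ 1 Φ)
    (h : MemLp Φ 2) (h' : MemLp (magD i k Φ) 2) : weakMagD i k h.toLp = h'.toLp :=
  have e := HasWeakMagD.of_contDiff i k hΦ h h'
  (weakMagD_spec ⟨_, e⟩).unique e

theorem coeFn_annih_toLp (i : Fin N) {Φ : Config N → ℂ} (hΦ : ContDiff ℝ 1 Φ)
    (h : MemLp Φ 2) (h' : ∀ k, MemLp (magD i k Φ) 2) : annih i h.toLp =ᵐ[volume] annihFun i Φ := by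
  rw [annih, weakMagD_toLp i 0 hΦ h (h' 0), weakMagD_toLp i 1 hΦ h (h' 1)]
  filter_upwards [(h' 0).coeFn_toLp, (h' 1).coeFn_toLp, Lp.coeFn_smul I (h' 1).toLp,
    Lp.coeFn_add (h' 0).toLp (I • (h' 1).toLp)] with z h1 h2 h3 h4
  rw [h4, Pi.add_apply, h3, Pi.smul_apply, h1, h2, smul_eq_mul, annihFun]

/-- Functions in the lowest Landau level have finite kinetic energy. -/
theorem memLp_magD_of_annihFun_eq_zero {W : Config N → ℂ} (hW : ContDiff ℝ ∞ W)
    (hL : MemLp W 2) (i : Fin N) (h0 : ∀ z, annihFun i W z = 0) (k : Fin 2) :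
    MemLp (magD i k W) 2 := by
  obtain ⟨C, hC0, hC⟩ := exists_fderiv_cutoff_le N
  set χ : ℕ → Config N → ℂ := fun n z => (cutoff N n z : ℂ) with hχ
  have hχc : ∀ n, ContDiff ℝ ∞ (χ n) := fun n => ofRealCLM.contDiff.comp (contDiff_cutoff n)
  have hχf : ∀ n z d, fderiv ℝ (χ n) z d = (fderiv ℝ (cutoff N n) z d : ℂ) := fun n z d => by
    have h := ofRealCLM.hasFDerivAt.comp z
      ((contDiff_cutoff (N := N) n).differentiable (by simp) z).hasFDerivAt
    have h' : fderiv ℝ (χ n) z = _ := h.fderiv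
    rw [h']; simp
  set u : ℕ → Config N → ℂ := fun n z => χ n z * W z with hu
  have huc : ∀ n, ContDiff ℝ ∞ (u n) := fun n => (hχc n).mul hW
  have hus : ∀ n, HasCompactSupport (u n) := fun n =>
    ((hasCompactSupport_cutoff n).comp_left (g := fun r : ℝ => (r : ℂ)) rfl).mul_right
  have hm : ∀ n, MemLp (u n) 2 := fun n => memLp_test (huc n).continuous (hus n)
  have hmD : ∀ n k, MemLp (magD i k (u n)) 2 := fun n k =>
    memLp_test (continuous_magD i k (huc n)) (hasCompactSupport_magD i k (hus n))
  have hbound : ∀ n z k, ‖fderiv ℝ (χ n) z (single i (dir k))‖ ≤ C / (n + 1) := fun n z k => by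
    rw [hχf, norm_real, norm_eq_abs]
    refine (hC n z _).trans (le_of_eq ?_)
    rw [Pi.norm_single, norm_dir, mul_one]
  have hC1 : ∀ n : ℕ, C / (n + 1) ≤ C := fun n => div_le_self hC0 (by linarith [n.cast_nonneg (α := ℝ)])
  have hA : ∀ n, ‖annih i (hm n).toLp‖ ≤ 2 * C * ‖hL.toLp‖ := fun n => by
    refine Lp.norm_le_mul_norm_of_ae_le_mul ?_
    filter_upwards [coeFn_annih_toLp i ((huc n).of_le (by simp)) (hm n) (hmD n), hL.coeFn_toLp] with
      z hz hz'
    rw [hz, hz', hu, annihFun_mul i ((hχc n).differentiable (by simp) z)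
      (hW.differentiable (by simp) z), h0 z, mul_zero, zero_sub, norm_neg, norm_mul]
    gcongr
    have h1 := (hbound n z 0).trans (hC1 n)
    have h2 := (hbound n z 1).trans (hC1 n)
    rw [dir_zero] at h1
    rw [dir_one] at h2
    rw [norm_mul, norm_I, one_mul, dbar]
    refine (norm_add_le _ _).trans ?_
    rw [norm_mul, norm_I, one_mul]
    linarith
  have hun : ∀ n, ‖(hm n).toLp‖ ≤ ‖hL.toLp‖ := fun n => by
    rw [Lp.norm_toLp, Lp.norm_toLp]
    refine toReal_mono hL.2.ne (eLpNorm_mono fun z => ?_)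
    rw [hu, norm_mul, hχ, norm_real, norm_of_nonneg (cutoff_nonneg n z)]
    exact mul_le_of_le_one_left (norm_nonneg _) (cutoff_le_one n z)
  have hD : ∀ n, eLpNorm (magD i k (u n)) 2 ≤ toE (2 * (C + 1) * ‖hL.toLp‖) := fun n => by
    have h1 := norm_weakMagD_sq_le (i := i) (u := (hm n).toLp) (fun k =>
      ⟨_, HasWeakMagD.of_contDiff i k ((huc n).of_le (by simp)) (hm n) (hmD n k)⟩) k
    rw [weakMagD_toLp i k ((huc n).of_le (by simp)) (hm n) (hmD n k)] at h1
    refine (ENNReal.le_ofReal_iff_toReal_le (hmD n k).2.ne (by positivity)).2 ?_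
    rw [← Lp.norm_toLp _ (hmD n k)]
    refine abs_le_of_sq_le_sq' (h1.trans ?_) (by positivity) |>.2
    nlinarith [pow_le_pow_left₀ (norm_nonneg _) (hun n) 2, pow_le_pow_left₀ (norm_nonneg _) (hA n) 2,
      mul_nonneg hC0 (sq_nonneg ‖hL.toLp‖)]
  have hlim : ∀ z, Tendsto (fun n => magD i k (u n) z) atTop (𝓝 (magD i k W z)) := fun z => by
    have e : ∀ n, magD i k (u n) z = χ n z * magD i k W z
        - I * fderiv ℝ (χ n) z (single i (dir k)) * W z := fun n =>
      magD_mul i k ((hχc n).differentiable (by simp) z) (hW.differentiable (by simp) z)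
    simp only [e]
    have h2 : Tendsto (fun n => χ n z) atTop (𝓝 1) := by
      refine tendsto_const_nhds.congr' ?_
      filter_upwards [cutoff_eq_one z] with n hn
      simp [hχ, hn]
    have h3 : Tendsto (fun n => fderiv ℝ (χ n) z (single i (dir k))) atTop (𝓝 0) := by
      refine squeeze_zero_norm (fun n => hbound n z k) ?_
      simpa [div_eq_mul_inv] using
        (tendsto_one_div_add_atTop_nhds_zero_nat (𝕜 := ℝ)).const_mul C
    simpa using (h2.mul_const (magD i k W z)).sub ((h3.const_mul I).mul_const (W z))
  refine ⟨(continuous_magD i k hW).aestronglyMeasurable, (Lp.eLpNorm_lim_le_liminf_eLpNorm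
    (fun n => (hmD n k).1) _ (.of_forall hlim)).trans_lt ?_⟩
  exact (liminf_le_of_frequently_le' (.of_forall hD)).trans_lt ofReal_lt_top

theorem contDiff_wave (hφ : Differentiable ℂ φ) :
    ContDiff ℝ ∞ (wave l φ) ∧ ∀ i z, annihFun i (wave l φ) z = 0 := by
  have hd : Differentiable ℂ fun z => φ z * ∏ p : Pair N, rel p z ^ l :=
    hφ.mul (differentiable_prod _ fun q _ => (differentiable_rel q).pow l)
  have e : wave l φ = fun z => (φ z * ∏ p : Pair N, rel p z ^ l) * (expSq (-(1 / 2)) z : ℂ) := by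
    ext z
    rw [wave]
    ring
  rw [e]
  exact ⟨contDiff_lll hd, annihFun_lll hd⟩

/-! ### Correlation factors -/

/-- The product of the correlation factors `F(|z_i - z_j|²)`. -/
def jastrow (F : ℝ → ℝ) (z : Config N) : ℂ := ∏ p : Pair N, (F (‖rel p z‖ ^ 2) : ℂ)

/-- The sign of particle `i` in the pair `p`. -/
def pairSign (i : Fin N) (p : Pair N) : ℝ :=
  (if i = p.1.1 then 1 else 0) - if i = p.1.2 then 1 else 0

theorem rel_single (i : Fin N) (p : Pair N) (d : ℂ) : rel p (single i d) = pairSign i p * d := by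
  simp only [rel, pairSign, Pi.single_apply, eq_comm (a := i)]
  split_ifs <;> simp

theorem sum_pairSign_sq (p : Pair N) : ∑ i, pairSign i p ^ 2 = 2 := by
  have h : ∀ i, pairSign i p ^ 2 = (if i = p.1.1 then 1 else 0) + if i = p.1.2 then 1 else 0 := by
    intro i
    have := p.2.ne
    simp only [pairSign]
    split_ifs <;> simp_all
  simp only [h, sum_add_distrib]
  norm_num

theorem fderiv_pairFactor (hF : ContDiff ℝ 1 F) (p : Pair N) (z : Config N) :
    DifferentiableAt ℝ (fun z : Config N => (F (‖rel p z‖ ^ 2) : ℂ)) z ∧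
    ∀ d, fderiv ℝ (fun z : Config N => (F (‖rel p z‖ ^ 2) : ℂ)) z d =
      (deriv F (‖rel p z‖ ^ 2) * (2 * ((rel p z).re * (rel p d).re + (rel p z).im * (rel p d).im)) : ℝ)
    := by
  have hrel : HasFDerivAt (rel p) (ContinuousLinearMap.proj (R := ℝ) p.1.1
      - ContinuousLinearMap.proj (R := ℝ) (φ := fun _ : Fin N => ℂ) p.1.2) z :=
    ContinuousLinearMap.hasFDerivAt (ContinuousLinearMap.proj (R := ℝ) p.1.1
      - ContinuousLinearMap.proj (R := ℝ) (φ := fun _ : Fin N => ℂ) p.1.2)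
  have h1 := hrel.norm_sq
  have h2 := ((hF.differentiable (by simp) (‖rel p z‖ ^ 2)).hasDerivAt.comp_hasFDerivAt z h1)
  have h3 := ofRealCLM.hasFDerivAt.comp z h2
  refine ⟨h3.differentiableAt, fun d => ?_⟩
  have h4 : fderiv ℝ (fun z : Config N => (F (‖rel p z‖ ^ 2) : ℂ)) z = _ := h3.fderiv
  rw [h4]
  simp [rel, Complex.inner]
  left
  ring

theorem contDiff_pairFactor (hF : ContDiff ℝ 1 F) (p : Pair N) :
    ContDiff ℝ 1 (fun z : Config N => (F (‖rel p z‖ ^ 2) : ℂ)) :=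
  ofRealCLM.contDiff.comp (hF.comp (((contDiff_rel p).of_le (by simp)).norm_sq ℝ))

theorem contDiff_jastrow (hF : ContDiff ℝ 1 F) : ContDiff ℝ 1 (jastrow F : Config N → ℂ) :=
  contDiff_prod fun p _ => contDiff_pairFactor hF p

theorem fderiv_jastrow (hF : ContDiff ℝ 1 F) (z d : Config N) :
    fderiv ℝ (jastrow F) z d = ∑ p, (∏ q ∈ univ.erase p, (F (‖rel q z‖ ^ 2) : ℂ)) *
      fderiv ℝ (fun z : Config N => (F (‖rel p z‖ ^ 2) : ℂ)) z d := by
  have h := HasFDerivAt.finsetProd (u := univ) (g := fun (p : Pair N) (z : Config N) =>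
    (F (‖rel p z‖ ^ 2) : ℂ)) fun p _ => (fderiv_pairFactor hF p z).1.hasFDerivAt
  have h' : fderiv ℝ (jastrow F) z = _ := h.fderiv
  rw [h']
  simp [ContinuousLinearMap.sum_apply]

theorem dbar_jastrow (hF : ContDiff ℝ 1 F) (i : Fin N) (z : Config N) :
    dbar i (jastrow F) z = ∑ p, (∏ q ∈ univ.erase p, (F (‖rel q z‖ ^ 2) : ℂ)) *
      ((pairSign i p * (2 * deriv F (‖rel p z‖ ^ 2)) : ℝ) * rel p z) := by
  rw [dbar, fderiv_jastrow hF, fderiv_jastrow hF, mul_sum, ← sum_add_distrib]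
  refine sum_congr rfl fun p _ => ?_
  rw [(fderiv_pairFactor hF p z).2, (fderiv_pairFactor hF p z).2, rel_single, rel_single]
  have h : rel p z = (rel p z).re + (rel p z).im * I := (re_add_im _).symm
  simp only [mul_re, mul_im, ofReal_re, ofReal_im, one_re, one_im, I_re, I_im]
  push_cast
  linear_combination -(∏ q ∈ univ.erase p, (F (‖rel q z‖ ^ 2) : ℂ)) *
    ((pairSign i p : ℝ) * (2 * ((deriv F (‖rel p z‖ ^ 2) : ℝ) : ℂ))) * h

theorem norm_prod_le_one {ι : Type*} (s : Finset ι) {f : ι → ℝ} (h : ∀ i, 0 ≤ f i ∧ f i ≤ 1) :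
    ‖∏ i ∈ s, (f i : ℂ)‖ ≤ 1 := by
  rw [norm_prod]
  refine Finset.prod_le_one (fun _ _ => norm_nonneg _) fun i _ => ?_
  rw [norm_real, norm_of_nonneg (h i).1]
  exact (h i).2

end Upper

section Upper

theorem sq_sum_le_of_active {ι : Type*} [Fintype ι] [DecidableEq ι] (x : ι → ℝ) (P : ι → Prop)
    [∀ q, Decidable (P q)] (h : ∀ p, x p ≠ 0 → P p) : (∑ p, x p) ^ 2 ≤ ∑ p, x p ^ 2 *
      (1 + card ι * ∑ q ∈ univ.erase p, if P q then (1 : ℝ) else 0) := by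
  have hnn : ∀ p, 0 ≤ ∑ q ∈ univ.erase p, if P q then (1 : ℝ) else 0 := fun p =>
    sum_nonneg fun q _ => by split_ifs <;> norm_num
  have hcard : (0 : ℝ) ≤ card ι := Nat.cast_nonneg _
  by_cases hc : ∃ p, x p ≠ 0 ∧ ∀ q, q ≠ p → ¬ P q
  · obtain ⟨p, -, hq⟩ := hc
    rw [sum_eq_single p (fun q _ hqp => by
      by_contra hne
      exact hq q hqp (h q hne)) (by simp)]
    have h1 := single_le_sum (f := fun p => x p ^ 2 *
      (1 + card ι * ∑ q ∈ univ.erase p, if P q then (1 : ℝ) else 0))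
      (fun p _ => mul_nonneg (sq_nonneg _) (by have := mul_nonneg hcard (hnn p); linarith))
      (mem_univ p)
    refine le_trans ?_ h1
    have := mul_nonneg hcard (hnn p)
    exact le_mul_of_one_le_right (sq_nonneg _) (by linarith)
  · push Not at hc
    have h1 : (∑ p, x p) ^ 2 ≤ card ι * ∑ p, x p ^ 2 := sq_sum_le_card_mul_sum_sq
    refine h1.trans ?_
    rw [mul_sum]
    refine sum_le_sum fun p _ => ?_
    by_cases hp : x p = 0
    · simp [hp]
    obtain ⟨q, hqp, hq⟩ := hc p hp
    have h2 : (1 : ℝ) ≤ ∑ q ∈ univ.erase p, if P q then (1 : ℝ) else 0 := by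
      simpa [hq] using single_le_sum (f := fun q => if P q then (1 : ℝ) else 0)
        (fun q _ => by split_ifs <;> norm_num) (Finset.mem_erase.2 ⟨hqp, mem_univ q⟩)
    rw [mul_comm]
    refine mul_le_mul_of_nonneg_left ?_ (sq_nonneg _)
    nlinarith

open scoped Classical in
/-- A weight that exceeds `1` only if some pair other than `p` is at distance at most `s`. -/
def crowd (p : Pair N) (s : ℝ) (z : Config N) : ℝ :=
  1 + card (Pair N) * ∑ q ∈ univ.erase p, if ‖rel q z‖ ≤ s then (1 : ℝ) else 0

theorem one_le_crowd (p : Pair N) (s : ℝ) (z : Config N) : 1 ≤ crowd p s z :=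
  le_add_of_nonneg_right (mul_nonneg (Nat.cast_nonneg _)
    (sum_nonneg fun q _ => by split_ifs <;> norm_num))

theorem crowd_le (p : Pair N) (s : ℝ) (z : Config N) :
    crowd p s z ≤ 1 + card (Pair N) * card (Pair N) := by
  refine add_le_add_right (mul_le_mul_of_nonneg_left ?_ (Nat.cast_nonneg _)) _
  calc _ ≤ ∑ q ∈ univ.erase p, (1 : ℝ) :=
        sum_le_sum fun q _ => by split_ifs <;> norm_num
    _ ≤ ∑ q : Pair N, (1 : ℝ) := Finset.sum_le_sum_of_subset_of_nonneg (Finset.erase_subset _ _)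
        fun _ _ _ => zero_le_one
    _ = _ := by simp

theorem measurable_crowd (p : Pair N) (s : ℝ) : Measurable (crowd p s) := by
  unfold crowd
  refine measurable_const.add (Measurable.const_mul (Finset.measurable_sum _ fun q _ => ?_) _)
  exact Measurable.ite (measurableSet_le (continuous_rel q).norm.measurable measurable_const)
    measurable_const measurable_const

theorem rel_pairCoord_ne (p q : Pair N) (w : ℂ) (y : Rest p) :
    rel q (pairCoord p (w, y)) = rel q (collapse p y) + w * rel q (relDir p) := by
  simp only [rel, pairCoord, Pi.add_apply, Pi.smul_apply, smul_eq_mul]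
  ring

theorem crowd_pairCoord_le (p : Pair N) {s : ℝ} {w : ℂ} (hw : ‖w‖ ≤ s) (y : Rest p) :
    crowd p s (pairCoord p (w, y)) ≤ crowd p (2 * s) (collapse p y) := by
  refine add_le_add_right (mul_le_mul_of_nonneg_left (sum_le_sum fun q _ => ?_)
    (Nat.cast_nonneg _)) _
  by_cases h : ‖rel q (pairCoord p (w, y))‖ ≤ s
  · have h1 : ‖rel q (collapse p y)‖ ≤ 2 * s := by
      have e : rel q (collapse p y) = rel q (pairCoord p (w, y)) - w * rel q (relDir p) := by
        rw [rel_pairCoord_ne]; ring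
      rw [e]
      refine (norm_sub_le _ _).trans ?_
      rw [norm_mul]
      have := mul_le_mul hw (norm_rel_relDir_le p q) (norm_nonneg _) ((norm_nonneg _).trans hw)
      linarith
    rw [if_pos h, if_pos h1]
  · rw [if_neg h]
    split_ifs <;> norm_num

theorem continuous_slice_right (hφ : Differentiable ℂ φ) (p : Pair N)
    (w : ℂ) : Continuous (slice l φ p w) :=
  Continuous.comp (g := fun x : ℂ × Rest p => slice l φ p x.1 x.2) (f := fun y => (w, y))
    (continuous_slice hφ p) (Continuous.prodMk continuous_const continuous_id)

theorem eventually_crowd_eq_one {p : Pair N} {z : Config N} (hz : ∀ q ∈ univ.erase p, rel q z ≠ 0) :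
    ∀ᶠ s in 𝓝₊, crowd p (2 * s) z = 1 := by
  have h2 : ∀ᶠ s in 𝓝₊, ∀ q ∈ univ.erase p, ¬ ‖rel q z‖ ≤ 2 * s := by
    refine (Finset.eventually_all _).2 fun q hq => ?_
    have h3 : 0 < ‖rel q z‖ := norm_pos_iff.2 (hz q hq)
    have h4 : ∀ᶠ s in 𝓝₊, s < ‖rel q z‖ / 2 := nhdsWithin_le_nhds (gt_mem_nhds (by positivity))
    filter_upwards [h4] with s hs
    linarith
  filter_upwards [h2] with s hs
  rw [crowd, Finset.sum_eq_zero fun q hq => if_neg (hs q hq)]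
  simp

theorem lintegral_slice_zero_sq (h : IsLLLRep l Ψ φ)
    (p : Pair N) : ∫⁻ y, ‖slice l φ p 0 y‖ₑ ^ 2 = toE (‖sliceL l p Ψ‖ ^ 2) := by
  rw [sliceL_eq h, norm_Lp_sq, ofReal_toReal (MemLp.lintegral_sq_lt_top (Lp.memLp _)).ne]
  exact lintegral_congr_ae (by
    filter_upwards [(memLp_slice h p (w := 0) (by simp)).coeFn_toLp] with y hy
    rw [hy])

theorem tendsto_slice_sq (h : IsLLLRep l Ψ φ) (p : Pair N) :
    Tendsto (fun x : ℂ × ℝ => ∫⁻ y, ‖slice l φ p x.1 y‖ₑ ^ 2 *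
      toE (crowd p (2 * x.2) (collapse p y))) (𝓝 (0 : ℂ) ×ˢ 𝓝₊)
      (𝓝 (∫⁻ y, ‖slice l φ p 0 y‖ₑ ^ 2)) := by
  obtain ⟨C, hC, hb⟩ := exists_slice_sq_le (N := N)
  set n : ℝ := (card (Pair N) : ℝ)
  have hmeas : ∀ x : ℂ × ℝ, Measurable fun y => ‖slice l φ p x.1 y‖ₑ ^ 2 *
      toE (crowd p (2 * x.2) (collapse p y)) := fun x =>
    ((continuous_slice_right h.1 p x.1).enorm.measurable.pow_const 2).mul
      ((measurable_crowd p _).comp (continuous_collapse p).measurable).ennreal_ofReal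
  have hdom : ∀ᶠ x : ℂ × ℝ in 𝓝 (0 : ℂ) ×ˢ 𝓝₊, ∀ᵐ y : Rest p,
      ‖slice l φ p x.1 y‖ₑ ^ 2 * toE (crowd p (2 * x.2) (collapse p y)) ≤
        (C * ∫⁻ s : ℂ, ‖wave l φ (pairCoord p (s, y))‖ₑ ^ 2) * toE (1 + n * n) := by
    have h0 : ∀ᶠ w in 𝓝 (0 : ℂ), ‖w‖ ≤ 1 := by
      filter_upwards [Metric.closedBall_mem_nhds (0 : ℂ) one_pos] with w hw
      simpa using hw
    filter_upwards [tendsto_fst.eventually h0] with x hx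
    exact .of_forall fun y => mul_le_mul' (hb l φ h.1 p y x.1 hx)
      (ofReal_le_ofReal (crowd_le p _ _))
  have hfin : ∫⁻ y : Rest p, (C * ∫⁻ s : ℂ, ‖wave l φ (pairCoord p (s, y))‖ₑ ^ 2) *
      toE (1 + n * n) ≠ ⊤ := by
    rw [lintegral_mul_const' _ _ ofReal_ne_top, lintegral_const_mul' _ _ hC,
      lintegral_wave_sq h]
    exact mul_ne_top (mul_ne_top hC (by simp)) ofReal_ne_top
  have hpt : ∀ᵐ y : Rest p, Tendsto (fun x : ℂ × ℝ => ‖slice l φ p x.1 y‖ₑ ^ 2 *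
      toE (crowd p (2 * x.2) (collapse p y))) (𝓝 (0 : ℂ) ×ˢ 𝓝₊)
      (𝓝 (‖slice l φ p 0 y‖ₑ ^ 2)) := by
    have hne : ∀ᵐ y : Rest p, ∀ q ∈ univ.erase p, rel q (collapse p y) ≠ 0 :=
      (Finset.eventually_all _).2 fun q hq => ae_rel_collapse_ne_zero (ne_of_mem_erase hq)
    filter_upwards [hne] with y hy
    have h6 : Continuous fun w => ‖slice l φ p w y‖ₑ ^ 2 :=
      (ENNReal.continuous_pow 2).comp (differentiable_slice h.1 p y).continuous.enorm
    refine ((h6.tendsto 0).comp tendsto_fst).congr' ?_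
    filter_upwards [tendsto_snd.eventually (eventually_crowd_eq_one hy)] with x hx
    rw [hx]
    simp
  exact tendsto_lintegral_filter_of_dominated_convergence _ (.of_forall hmeas) hdom hfin hpt

/-- The integrated square of a wave function near a coincidence plane. -/
theorem eventually_slice_le (h : IsLLLRep l Ψ φ) (p : Pair N)
    {δ : ℝ} (hδ : 0 < δ) : ∀ᶠ s in 𝓝₊, ∀ w : ℂ, ‖w‖ ≤ s →
      ∫⁻ y, ‖slice l φ p w y‖ₑ ^ 2 * toE (crowd p (2 * s) (collapse p y)) ≤
        toE (‖sliceL l p Ψ‖ ^ 2 + δ) := by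
  have hlim := tendsto_slice_sq h p
  rw [lintegral_slice_zero_sq h p] at hlim
  have hev := hlim.eventually (gt_mem_nhds
    ((ENNReal.ofReal_lt_ofReal_iff (by positivity)).2 (lt_add_of_pos_right _ hδ)))
  obtain ⟨pa, hpa, pb, hpb, hab⟩ := eventually_prod_iff.1 hev
  obtain ⟨r, hr, hball⟩ := Metric.eventually_nhds_iff.1 hpa
  have hsr : ∀ᶠ s in 𝓝₊, s < r := nhdsWithin_le_nhds (gt_mem_nhds hr)
  filter_upwards [hpb, hsr] with s h1 h2 w hw
  exact (hab (hball (by simpa using hw.trans_lt h2)) h1).le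

/-- The energy density of a correlation factor, as a function of the relative coordinate. -/
def upKernel (v : ℝ → ℝ≥0∞) (a : ℝ) (F : ℝ → ℝ) (w : ℂ) : ℝ≥0∞ :=
  toE (8 * ‖w‖ ^ 2 * deriv F (‖w‖ ^ 2) ^ 2) +
    vScaled v a ‖w‖ * toE (F (‖w‖ ^ 2) ^ 2)

theorem measurable_vScaled (hv : Measurable v) (a : ℝ) : Measurable (vScaled v a) :=
  (hv.comp (measurable_id.div_const a)).const_mul _

theorem measurable_upKernel (hv : Measurable v) (a : ℝ)
    (hF : ContDiff ℝ 1 F) : Measurable (upKernel v a F) := by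
  have h1 : Continuous (deriv F) := hF.continuous_deriv (by simp)
  have h2 : Continuous F := hF.continuous
  have h3 : Continuous fun w : ℂ => 8 * ‖w‖ ^ 2 * deriv F (‖w‖ ^ 2) ^ 2 := by fun_prop
  have h4 : Continuous fun w : ℂ => F (‖w‖ ^ 2) ^ 2 := by fun_prop
  exact h3.measurable.ennreal_ofReal.add
    (((measurable_vScaled hv a).comp measurable_norm).mul h4.measurable.ennreal_ofReal)

theorem deriv_eq_zero_of_eq_one {t : ℝ} (h : ∀ q, t ≤ q → F q = 1) {q : ℝ}
    (hq : t < q) : deriv F q = 0 := by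
  have : F =ᶠ[𝓝 q] fun _ => 1 := by
    filter_upwards [lt_mem_nhds hq] with x hx
    exact h x hx.le
  rw [this.deriv_eq]
  simp

theorem sum_dbar_jastrow_sq_le (hF : ContDiff ℝ 1 F) (h01 : ∀ q, 0 ≤ F q ∧ F q ≤ 1)
    {s : ℝ} (hs : 0 ≤ s) (h1 : ∀ q, s ^ 2 ≤ q → F q = 1) (z : Config N) :
    ∑ i, ‖dbar i (jastrow F) z‖ ^ 2 ≤
      ∑ p : Pair N, 8 * ‖rel p z‖ ^ 2 * deriv F (‖rel p z‖ ^ 2) ^ 2 * crowd p s z := by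
  set x : Fin N → Pair N → ℝ := fun i p =>
    |pairSign i p| * (2 * |deriv F (‖rel p z‖ ^ 2)| * ‖rel p z‖) with hx
  have hx0 : ∀ i p, 0 ≤ x i p := fun i p => by positivity
  have h2 : ∀ i, ‖dbar i (jastrow F) z‖ ≤ ∑ p, x i p := fun i => by
    rw [dbar_jastrow hF]
    refine (norm_sum_le _ _).trans (sum_le_sum fun p _ => ?_)
    rw [norm_mul, norm_mul, norm_real, norm_eq_abs, abs_mul, abs_mul, abs_two]
    refine (mul_le_of_le_one_left (by positivity) (norm_prod_le_one _ fun q => h01 _)).trans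
      (le_of_eq ?_)
    rw [hx]; ring
  have h3 : ∀ i, ‖dbar i (jastrow F) z‖ ^ 2 ≤ ∑ p, x i p ^ 2 * crowd p s z := fun i => by
    refine (pow_le_pow_left₀ (norm_nonneg _) (h2 i) 2).trans ?_
    classical
    refine sq_sum_le_of_active (x i) (fun p => ‖rel p z‖ ≤ s) fun p hp => ?_
    by_contra hlt
    have : deriv F (‖rel p z‖ ^ 2) = 0 :=
      deriv_eq_zero_of_eq_one h1 (pow_lt_pow_left₀ (not_le.1 hlt) hs two_ne_zero)
    exact hp (by simp [hx, this])
  refine (sum_le_sum fun i _ => h3 i).trans (le_of_eq ?_)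
  rw [sum_comm]
  refine sum_congr rfl fun p _ => ?_
  rw [← sum_mul]
  congr 1
  have : ∀ i, x i p ^ 2 = pairSign i p ^ 2 * (4 * ‖rel p z‖ ^ 2 * deriv F (‖rel p z‖ ^ 2) ^ 2) :=
    fun i => by
      rw [hx]
      dsimp only
      rw [mul_pow, mul_pow, mul_pow, sq_abs, sq_abs]
      ring
  simp only [this]
  rw [← sum_mul, sum_pairSign_sq]
  ring

theorem norm_jastrow_le (h01 : ∀ q, 0 ≤ F q ∧ F q ≤ 1) (p : Pair N) (z : Config N) :
    ‖jastrow F z‖ₑ ^ 2 ≤ toE (F (‖rel p z‖ ^ 2) ^ 2) := by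
  rw [← ofReal_norm, ← ENNReal.ofReal_pow (norm_nonneg _)]
  refine ofReal_le_ofReal (pow_le_pow_left₀ (norm_nonneg _) ?_ 2)
  rw [jastrow, ← Finset.mul_prod_erase _ _ (mem_univ p), norm_mul, norm_real,
    norm_of_nonneg (h01 _).1]
  exact mul_le_of_le_one_right (h01 _).1 (norm_prod_le_one _ fun q => h01 _)

theorem jastrow_energy_density_le {a : ℝ} {W : Config N → ℂ} (hW : ContDiff ℝ ∞ W)
    (h0 : ∀ i z, annihFun i W z = 0) (hF : ContDiff ℝ 1 F)
    (h01 : ∀ q, 0 ≤ F q ∧ F q ≤ 1) {s : ℝ} (hs : 0 ≤ s) (h1 : ∀ q, s ^ 2 ≤ q → F q = 1)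
    (z : Config N) : ∑ i, ‖annihFun i (fun z => jastrow F z * W z) z‖ₑ ^ 2 +
      interaction N v a z * ‖jastrow F z * W z‖ₑ ^ 2 ≤
      ∑ p : Pair N, ‖W z‖ₑ ^ 2 * (upKernel v a F (rel p z) * toE (crowd p s z)) := by
  have hk : ∑ i, ‖annihFun i (fun z => jastrow F z * W z) z‖ₑ ^ 2 ≤ ∑ p : Pair N, ‖W z‖ₑ ^ 2 *
      (toE (8 * ‖rel p z‖ ^ 2 * deriv F (‖rel p z‖ ^ 2) ^ 2) *
        toE (crowd p s z)) := by
    have e : ∀ i, ‖annihFun i (fun z => jastrow F z * W z) z‖ₑ ^ 2 =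
        ‖W z‖ₑ ^ 2 * toE (‖dbar i (jastrow F) z‖ ^ 2) := fun i => by
      rw [annihFun_mul i ((contDiff_jastrow hF).differentiable (by simp) z)
        (hW.differentiable (by simp) z), h0 i z, mul_zero, zero_sub, enorm_neg, enorm_mul, enorm_mul,
        mul_pow, mul_pow, ENNReal.ofReal_pow (norm_nonneg _), ofReal_norm, ← ofReal_norm I, norm_I]
      simp [mul_comm]
    simp only [e, ← mul_sum]
    gcongr
    rw [← ofReal_sum_of_nonneg fun i _ => sq_nonneg _]
    refine (ofReal_le_ofReal (sum_dbar_jastrow_sq_le hF h01 hs h1 z)).trans (le_of_eq ?_)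
    rw [ofReal_sum_of_nonneg fun p _ => mul_nonneg (by positivity)
      (zero_le_one.trans (one_le_crowd p s z))]
    exact sum_congr rfl fun p _ => ENNReal.ofReal_mul (by positivity)
  have hp : interaction N v a z * ‖jastrow F z * W z‖ₑ ^ 2 ≤ ∑ p : Pair N, ‖W z‖ₑ ^ 2 *
      (vScaled v a ‖rel p z‖ * toE (F (‖rel p z‖ ^ 2) ^ 2) *
        toE (crowd p s z)) := by
    rw [interaction, sum_mul]
    refine sum_le_sum fun p _ => ?_
    rw [enorm_mul, mul_pow]
    have h2 := norm_jastrow_le h01 p z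
    have h3 : 1 ≤ toE (crowd p s z) := ENNReal.one_le_ofReal.2 (one_le_crowd p s z)
    calc vScaled v a ‖z p.1.1 - z p.1.2‖ * (‖jastrow F z‖ₑ ^ 2 * ‖W z‖ₑ ^ 2)
        ≤ vScaled v a ‖rel p z‖ * (toE (F (‖rel p z‖ ^ 2) ^ 2) * ‖W z‖ₑ ^ 2) * 1 := by
          rw [mul_one]; exact mul_le_mul' le_rfl (mul_le_mul' h2 le_rfl)
      _ ≤ vScaled v a ‖rel p z‖ * (toE (F (‖rel p z‖ ^ 2) ^ 2) * ‖W z‖ₑ ^ 2) *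
          toE (crowd p s z) := mul_le_mul' le_rfl h3
      _ = _ := by ring
  refine (add_le_add hk hp).trans (le_of_eq ?_)
  rw [← sum_add_distrib]
  refine sum_congr rfl fun p _ => ?_
  rw [upKernel]
  ring

end Upper

section Upper

theorem enorm_wave_sq_le (l : ℕ) (φ : Config N → ℂ) (p : Pair N) (w : ℂ) (y : Rest p) :
    ‖wave l φ (pairCoord p (w, y))‖ₑ ^ 2 ≤ toE (‖w‖ ^ (2 * l)) * ‖slice l φ p w y‖ₑ ^ 2 := by
  rw [wave_pairCoord, enorm_mul, mul_pow]
  gcongr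
  rw [← ofReal_norm, ← ENNReal.ofReal_pow (norm_nonneg _)]
  refine ofReal_le_ofReal ?_
  rw [norm_mul, norm_real, norm_of_nonneg (exp_pos _).le, norm_pow, mul_pow, ← pow_mul,
    mul_comm l 2]
  refine mul_le_of_le_one_left (by positivity) (pow_le_one₀ (exp_pos _).le ?_)
  rw [Real.exp_le_one_iff]
  nlinarith [sq_nonneg ‖w‖]

theorem lintegral_pair_le (hv : Measurable v) {a : ℝ}
    (hφ : Differentiable ℂ φ) (hF : ContDiff ℝ 1 F) {s : ℝ} (hs : 0 ≤ s)
    (h1 : ∀ q, s ^ 2 ≤ q → F q = 1) (hvs : ∀ r, s < r → vScaled v a r = 0) (p : Pair N)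
    {M : ℝ≥0∞} (hM : ∀ w : ℂ, ‖w‖ ≤ s → ∫⁻ y, ‖slice l φ p w y‖ₑ ^ 2 *
      toE (crowd p (2 * s) (collapse p y)) ≤ M) :
    ∫⁻ z, ‖wave l φ z‖ₑ ^ 2 * (upKernel v a F (rel p z) * toE (crowd p s z)) ≤
      M * ∫⁻ w : ℂ, toE (‖w‖ ^ (2 * l)) * upKernel v a F w := by
  have hK0 : ∀ w : ℂ, s < ‖w‖ → upKernel v a F w = 0 := fun w hw => by
    rw [upKernel, hvs _ hw, deriv_eq_zero_of_eq_one h1 (pow_lt_pow_left₀ hw hs two_ne_zero)]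
    simp
  have hKm := measurable_upKernel hv a hF
  have hm : Measurable fun z => ‖wave l φ z‖ₑ ^ 2 *
      (upKernel v a F (rel p z) * toE (crowd p s z)) :=
    ((continuous_wave hφ).enorm.measurable.pow_const 2).mul
      ((hKm.comp (continuous_rel p).measurable).mul (measurable_crowd p s).ennreal_ofReal)
  have hg : Measurable fun x : Rest p × ℂ => toE (‖x.2‖ ^ (2 * l)) * upKernel v a F x.2 *
      (‖slice l φ p x.2 x.1‖ₑ ^ 2 * toE (crowd p (2 * s) (collapse p x.1))) := by
    have m1 : Measurable fun x : Rest p × ℂ => toE (‖x.2‖ ^ (2 * l)) :=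
      (measurable_snd.norm.pow_const _).ennreal_ofReal
    have m2 : Measurable fun x : Rest p × ℂ => ‖slice l φ p x.2 x.1‖ₑ ^ 2 :=
      ((continuous_slice hφ p).comp continuous_swap).enorm.measurable.pow_const 2
    exact (m1.mul (hKm.comp measurable_snd)).mul (m2.mul (((measurable_crowd p _).comp
      (continuous_collapse p).measurable).comp measurable_fst).ennreal_ofReal)
  rw [lintegral_pairCoord p hm.aemeasurable]
  calc _ ≤ ∫⁻ y : Rest p, ∫⁻ w : ℂ, toE (‖w‖ ^ (2 * l)) * upKernel v a F w *
        (‖slice l φ p w y‖ₑ ^ 2 * toE (crowd p (2 * s) (collapse p y))) := by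
        refine lintegral_mono fun y => lintegral_mono fun w => ?_
        dsimp only
        rw [rel_pairCoord]
        rcases le_or_gt ‖w‖ s with hw | hw
        · calc _ ≤ (toE (‖w‖ ^ (2 * l)) * ‖slice l φ p w y‖ₑ ^ 2) *
              (upKernel v a F w * toE (crowd p (2 * s) (collapse p y))) :=
                mul_le_mul' (enorm_wave_sq_le l φ p w y) (mul_le_mul' le_rfl
                  (ofReal_le_ofReal (crowd_pairCoord_le p hw y)))
            _ = _ := by ring
        · rw [hK0 w hw]; simp
    _ = ∫⁻ w : ℂ, ∫⁻ y : Rest p, toE (‖w‖ ^ (2 * l)) * upKernel v a F w *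
        (‖slice l φ p w y‖ₑ ^ 2 * toE (crowd p (2 * s) (collapse p y))) :=
        lintegral_lintegral_swap hg.aemeasurable
    _ ≤ ∫⁻ w : ℂ, M * (toE (‖w‖ ^ (2 * l)) * upKernel v a F w) := by
        refine lintegral_mono fun w => ?_
        dsimp only
        rcases le_or_gt ‖w‖ s with hw | hw
        · have hm' : Measurable fun y => ‖slice l φ p w y‖ₑ ^ 2 *
              toE (crowd p (2 * s) (collapse p y)) :=
            ((continuous_slice_right hφ p w).enorm.measurable.pow_const 2).mul
              ((measurable_crowd p _).comp (continuous_collapse p).measurable).ennreal_ofReal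
          rw [lintegral_const_mul _ hm', mul_comm M]
          exact mul_le_mul' le_rfl (hM w hw)
        · rw [hK0 w hw]; simp
    _ = _ := by
        rw [lintegral_const_mul]
        exact ((measurable_norm.pow_const _).ennreal_ofReal).mul hKm

theorem memLp_jastrow_mul (hF : ContDiff ℝ 1 F) (h01 : ∀ q, 0 ≤ F q ∧ F q ≤ 1)
    {W : Config N → ℂ} (hL : MemLp W 2) : MemLp (fun z => jastrow F z * W z) 2 :=
  hL.mono ((contDiff_jastrow hF).continuous.aestronglyMeasurable.mul hL.1)
    (.of_forall fun z => by
      rw [norm_mul]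
      exact mul_le_of_le_one_left (norm_nonneg _) (norm_prod_le_one _ fun q => h01 _))

theorem memLp_magD_jastrow_mul (hF : ContDiff ℝ 1 F) (h01 : ∀ q, 0 ≤ F q ∧ F q ≤ 1)
    {s : ℝ} (hs : 0 ≤ s) (h1 : ∀ q, s ^ 2 ≤ q → F q = 1) {W : Config N → ℂ} (hW : ContDiff ℝ ∞ W)
    (hL : MemLp W 2) (i : Fin N) (k : Fin 2) (hD : MemLp (magD i k W) 2) :
    MemLp (magD i k fun z => jastrow F z * W z) 2 := by
  obtain ⟨C, hC⟩ : ∃ C, ∀ z : Config N, ‖fderiv ℝ (jastrow F) z (single i (dir k))‖ ≤ C := by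
    have hc : ContinuousOn (deriv F) (Icc 0 (s ^ 2)) := (hF.continuous_deriv (by simp)).continuousOn
    obtain ⟨B, hB⟩ := isCompact_Icc.exists_bound_of_continuousOn hc
    have hB0 : 0 ≤ B := (norm_nonneg _).trans (hB 0 ⟨le_rfl, sq_nonneg _⟩)
    refine ⟨∑ p : Pair N, B * (2 * (2 * (s * 1))), fun z => ?_⟩
    rw [fderiv_jastrow hF]
    refine (norm_sum_le _ _).trans (sum_le_sum fun p _ => ?_)
    rw [norm_mul, (fderiv_pairFactor hF p z).2, norm_real, norm_eq_abs, abs_mul, abs_mul, abs_two]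
    refine (mul_le_of_le_one_left (by positivity) (norm_prod_le_one _ fun q => h01 _)).trans ?_
    rcases le_or_gt ‖rel p z‖ s with h | h
    · have h2 : ‖rel p z‖ ^ 2 ∈ Icc 0 (s ^ 2) := ⟨sq_nonneg _, pow_le_pow_left₀ (norm_nonneg _) h 2⟩
      have h3 := hB _ h2
      rw [norm_eq_abs] at h3
      have h5 : ‖rel p (single i (dir k))‖ ≤ 1 := by
        rw [rel_single, norm_mul, norm_dir, mul_one, norm_real, pairSign]
        split_ifs <;> norm_num
      have h4 : ∀ x y : ℝ, |x| ≤ s → |y| ≤ 1 → |x * y| ≤ s * 1 := fun x y hx hy => by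
        rw [abs_mul]; exact mul_le_mul hx hy (abs_nonneg _) hs
      have h6 := h4 _ _ ((abs_re_le_norm (rel p z)).trans h) ((abs_re_le_norm _).trans h5)
      have h7 := h4 _ _ ((abs_im_le_norm (rel p z)).trans h) ((abs_im_le_norm _).trans h5)
      refine mul_le_mul h3 (mul_le_mul_of_nonneg_left ?_ zero_le_two) (by positivity) hB0
      exact (abs_add_le _ _).trans (by linarith)
    · rw [deriv_eq_zero_of_eq_one h1 (pow_lt_pow_left₀ h hs two_ne_zero)]
      simp only [abs_zero, zero_mul]
      positivity
  have e : (magD i k fun z => jastrow F z * W z) = fun z => jastrow F z * magD i k W z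
      - I * fderiv ℝ (jastrow F) z (single i (dir k)) * W z := by
    ext z
    exact magD_mul i k ((contDiff_jastrow hF).differentiable (by simp) z)
      (hW.differentiable (by simp) z)
  rw [e]
  refine (memLp_jastrow_mul hF h01 hD).sub ((hL.const_mul (C : ℂ)).mono ?_
    (.of_forall fun z => ?_))
  · exact (continuous_const.mul (((contDiff_jastrow hF).continuous_fderiv (by simp)).clm_apply
      continuous_const)).aestronglyMeasurable.mul hL.1
  · rw [norm_mul, norm_mul, norm_mul, norm_I, one_mul, norm_real]
    exact mul_le_mul_of_nonneg_right ((hC z).trans (Real.le_norm_self C)) (norm_nonneg _)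

/-- The energy of a wave function in the lowest Landau level with correlation factors. -/
theorem jastrow_energy_le (hv : Measurable v) {a : ℝ} (h : IsLLLRep l Ψ φ) (hF : ContDiff ℝ 1 F)
    (h01 : ∀ q, 0 ≤ F q ∧ F q ≤ 1) {s : ℝ} (hs : 0 ≤ s) (h1 : ∀ q, s ^ 2 ≤ q → F q = 1)
    (hvs : ∀ r, s < r → vScaled v a r = 0) {M : Pair N → ℝ}
    (hM : ∀ p, ∀ w : ℂ, ‖w‖ ≤ s → ∫⁻ y, ‖slice l φ p w y‖ₑ ^ 2 *
      toE (crowd p (2 * s) (collapse p y)) ≤ toE (M p))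
    (hM0 : ∀ p, 0 ≤ M p) (hL : MemLp (wave l φ) 2) {D : ℝ} (hD0 : 0 ≤ D)
    (hD : ∫⁻ w : ℂ, toE (‖w‖ ^ (2 * l)) * upKernel v a F w ≤ toE D) :
    (memLp_jastrow_mul hF h01 hL).toLp ∈ formDomain N hv a ∧
      energy N v a (memLp_jastrow_mul hF h01 hL).toLp ≤ (∑ p, M p) * D := by
  set W := wave l φ with hW
  obtain ⟨hWc, h0⟩ : ContDiff ℝ ∞ W ∧ ∀ i z, annihFun i W z = 0 := contDiff_wave h.1
  set u := (memLp_jastrow_mul hF h01 hL).toLp with hu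
  have hu1 : ContDiff ℝ 1 fun z => jastrow F z * W z := (contDiff_jastrow hF).mul (hWc.of_le (by simp))
  have hmD : ∀ i k, MemLp (magD i k fun z => jastrow F z * W z) 2 := fun i k =>
    memLp_magD_jastrow_mul hF h01 hs h1 hWc hL i k (memLp_magD_of_annihFun_eq_zero hWc hL i (h0 i) k)
  have hmA : ∀ i, Measurable fun z => ‖annihFun i (fun z => jastrow F z * W z) z‖ₑ ^ 2 := fun i =>
    ((continuous_magD_of_contDiff_one i 0 hu1).add (continuous_const.mul
      (continuous_magD_of_contDiff_one i 1 hu1))).enorm.measurable.pow_const 2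
  have hpot : potEnergy N v a u = ∫⁻ z, interaction N v a z * ‖jastrow F z * W z‖ₑ ^ 2 :=
    lintegral_congr_ae (by
      filter_upwards [(memLp_jastrow_mul hF h01 hL).coeFn_toLp] with z hz
      rw [hz])
  have htot : (∑ i, ∫⁻ z, ‖annihFun i (fun z => jastrow F z * W z) z‖ₑ ^ 2) + potEnergy N v a u ≤
      toE ((∑ p, M p) * D) := by
    rw [hpot, ← lintegral_finsetSum _ fun i _ => hmA i,
      ← lintegral_add_left (Finset.measurable_sum _ fun i _ => hmA i)]
    refine (lintegral_mono fun z => jastrow_energy_density_le hWc h0 hF h01 hs h1 z).trans ?_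
    rw [lintegral_finsetSum _ fun p _ => ?_]
    · rw [ENNReal.ofReal_mul (sum_nonneg fun p _ => hM0 p),
        ofReal_sum_of_nonneg fun p _ => hM0 p, sum_mul]
      refine sum_le_sum fun p _ => ?_
      exact (lintegral_pair_le hv h.1 hF hs h1 hvs p (hM p)).trans (mul_le_mul' le_rfl hD)
    · exact (hWc.continuous.enorm.measurable.pow_const 2).mul
        (((measurable_upKernel hv a hF).comp (continuous_rel p).measurable).mul
          (measurable_crowd p s).ennreal_ofReal)
  have hfin := htot.trans_lt ofReal_lt_top
  have hpf : potEnergy N v a u < ⊤ := (le_add_self).trans_lt hfin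
  have hsf := (le_self_add).trans_lt hfin
  refine ⟨⟨fun i k => ⟨_, HasWeakMagD.of_contDiff i k hu1 _ (hmD i k)⟩, hpf⟩, ?_⟩
  have e : energy N v a u = ((∑ i, ∫⁻ z, ‖annihFun i (fun z => jastrow F z * W z) z‖ₑ ^ 2)
      + potEnergy N v a u).toReal := by
    rw [toReal_add hsf.ne hpf.ne, toReal_sum fun i _ =>
      (ENNReal.sum_lt_top.1 hsf i (mem_univ i)).ne, energy]
    congr 1
    exact sum_congr rfl fun i _ => by
      rw [norm_Lp_sq]
      refine congrArg _ (lintegral_congr_ae ?_)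
      filter_upwards [coeFn_annih_toLp i hu1 _ (hmD i)] with z hz
      rw [hz]
  rw [e]
  exact toReal_le_of_le_ofReal (mul_nonneg (sum_nonneg fun p _ => hM0 p) hD0) htot

/-- Correlation factors for the upper bound exist at all precisions. -/
def HasUpCerts (v : ℝ → ℝ≥0∞) (l : ℕ) (κ : ℝ) : Prop :=
  ∀ δ > 0, ∃ F : ℝ → ℝ → ℝ, (∀ η > 0, ∀ᶠ a in 𝓝₊, ∀ q, η ≤ q → F a q = 1) ∧
    ∀ᶠ a in 𝓝₊, ContDiff ℝ 1 (F a) ∧ (∀ q, 0 ≤ F a q ∧ F a q ≤ 1) ∧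
      ∫⁻ w : ℂ, toE (‖w‖ ^ (2 * l)) * upKernel v a (F a) w ≤
        toE ((κ + δ) / energyScale l a)

theorem eventually_vScaled_eq_zero (hsupp : ∃ R₀ : ℝ, ∀ r, R₀ < r → v r = 0) {s : ℝ}
    (hs : 0 < s) : ∀ᶠ a in 𝓝₊, ∀ r, s < r → vScaled v a r = 0 := by
  obtain ⟨R₀, hR⟩ := hsupp
  have h1 : ∀ᶠ a in 𝓝₊, a < s / (|R₀| + 1) := nhdsWithin_le_nhds (gt_mem_nhds (by positivity))
  filter_upwards [h1, self_mem_nhdsWithin] with a h2 h3 r hr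
  have h3' : 0 < a := h3
  rw [vScaled, hR (r / a), mul_zero]
  rw [lt_div_iff₀ h3']
  rw [lt_div_iff₀ (by positivity)] at h2
  nlinarith [le_abs_self R₀]

theorem energy_upper_bound (hv : Measurable v)
    (hsupp : ∃ R₀ : ℝ, ∀ r, R₀ < r → v r = 0) {κ : ℝ} (hκ : 0 < κ)
    (hcert : HasUpCerts v l κ) (w : spaceB N l) {δ : ℝ} (hδ : 0 < δ) :
    ∀ᶠ a in 𝓝₊, ∃ u ∈ formDomain N hv a, ‖u - (w : L2 N)‖ < δ ∧
      energyScale l a * energy N v a u ≤ κ * ∑ p, ‖sliceL l p (w : L2 N)‖ ^ 2 + δ := by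
  obtain ⟨φ, h⟩ := w.2
  have hL : MemLp (wave l φ) 2 := (memLp_congr_ae (isLLLRep_iff.1 h).2).1 (Lp.memLp _)
  set S : ℝ := ∑ p, ‖sliceL l p (w : L2 N)‖ ^ 2 with hS
  obtain ⟨t, ht1, ht0⟩ : ∃ t : ℝ, (∑ p, (‖sliceL l p (w : L2 N)‖ ^ 2 + t)) * (κ + t) < κ * S + δ ∧
      0 < t := by
    have hcont : Continuous fun t : ℝ => (∑ p : Pair N, (‖sliceL l p (w : L2 N)‖ ^ 2 + t)) * (κ + t) := by
      fun_prop
    have h1 := (hcont.tendsto 0).mono_left (nhdsWithin_le_nhds (s := Ioi (0 : ℝ)))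
    simp only [add_zero] at h1
    have h2 : ∀ᶠ t in 𝓝₊, (∑ p, (‖sliceL l p (w : L2 N)‖ ^ 2 + t)) * (κ + t) < κ * S + δ :=
      h1.eventually (gt_mem_nhds (by rw [hS]; linarith))
    exact (h2.and self_mem_nhdsWithin).exists
  obtain ⟨F, hF1, hF⟩ := hcert t ht0
  have hslice : ∀ᶠ s in 𝓝₊, ∀ p, ∀ x : ℂ, ‖x‖ ≤ s →
      ∫⁻ y, ‖slice l φ p x y‖ₑ ^ 2 * toE (crowd p (2 * s) (collapse p y)) ≤
        toE (‖sliceL l p (w : L2 N)‖ ^ 2 + t) :=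
    eventually_all.2 fun p => eventually_slice_le h p ht0
  obtain ⟨s, hs1, hs0⟩ := (hslice.and self_mem_nhdsWithin).exists
  have hs0' : (0 : ℝ) < s := hs0
  -- convergence to the uncorrelated function
  have hconv : ∀ᶠ a in 𝓝₊, ∀ (hc : ContDiff ℝ 1 (F a)) (h01 : ∀ q, 0 ≤ F a q ∧ F a q ≤ 1),
      ‖(memLp_jastrow_mul hc h01 hL).toLp - (w : L2 N)‖ < δ := by
    have hlim : Tendsto (fun a => ∫⁻ z, ‖(jastrow (F a) z - 1) * wave l φ z‖ₑ ^ 2) (𝓝₊)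
        (𝓝 (∫⁻ _ : Config N, 0)) := by
      refine tendsto_lintegral_filter_of_dominated_convergence (fun z => 4 * ‖wave l φ z‖ₑ ^ 2)
        ?_ ?_ ?_ ?_
      · filter_upwards [hF] with a ha
        exact (((contDiff_jastrow ha.1).continuous.sub continuous_const).mul
          (continuous_wave h.1)).enorm.measurable.pow_const 2
      · filter_upwards [hF] with a ha
        refine .of_forall fun z => ?_
        rw [enorm_mul, mul_pow]
        gcongr
        have h2 : ‖jastrow (F a) z - 1‖ ≤ 2 := by
          refine (norm_sub_le _ _).trans ?_
          have : ‖jastrow (F a) z‖ ≤ 1 := norm_prod_le_one _ fun q => ha.2.1 _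
          rw [norm_one]
          linarith
        calc ‖jastrow (F a) z - 1‖ₑ ^ 2 ≤ (2 : ℝ≥0∞) ^ 2 := by
              gcongr
              rw [← ofReal_norm]
              exact (ofReal_le_ofReal h2).trans (by simp)
          _ = 4 := by norm_num
      · rw [lintegral_const_mul' _ _ (by simp)]
        exact mul_ne_top (by simp) (MemLp.lintegral_sq_lt_top hL).ne
      · have hne : ∀ᵐ z : Config N, ∀ p : Pair N, rel p z ≠ 0 :=
          ae_all_iff.2 fun p => ae_rel_ne_zero p
        filter_upwards [hne] with z hz
        refine tendsto_const_nhds.congr' ?_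
        have h2 : ∀ᶠ a in 𝓝₊, ∀ p, F a (‖rel p z‖ ^ 2) = 1 :=
          eventually_all.2 fun p => by
            filter_upwards [hF1 (‖rel p z‖ ^ 2) (pow_pos (norm_pos_iff.2 (hz p)) 2)] with a ha
            exact ha _ le_rfl
        filter_upwards [h2] with a ha
        simp [jastrow, ha]
    rw [lintegral_zero] at hlim
    have hev := hlim.eventually (gt_mem_nhds (ENNReal.ofReal_pos.2 (pow_pos hδ 2)))
    filter_upwards [hev] with a ha hc h01
    have h3 : ‖(memLp_jastrow_mul hc h01 hL).toLp - (w : L2 N)‖ ^ 2 < δ ^ 2 := by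
      rw [norm_Lp_sq]
      have e : ∫⁻ z, ‖((memLp_jastrow_mul hc h01 hL).toLp - (w : L2 N) : L2 N) z‖ₑ ^ 2 =
          ∫⁻ z, ‖(jastrow (F a) z - 1) * wave l φ z‖ₑ ^ 2 :=
        lintegral_congr_ae (by
          filter_upwards [(memLp_jastrow_mul hc h01 hL).coeFn_toLp, (isLLLRep_iff.1 h).2,
            Lp.coeFn_sub (memLp_jastrow_mul hc h01 hL).toLp (w : L2 N)] with z e1 e2 e3
          rw [e3, Pi.sub_apply, e1, e2]
          ring_nf)
      rw [e]
      exact (ENNReal.toReal_lt_of_lt_ofReal ha)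
    exact lt_of_pow_lt_pow_left₀ 2 hδ.le h3
  filter_upwards [hF, hconv, hF1 (s ^ 2) (pow_pos hs0' 2), eventually_vScaled_eq_zero hsupp hs0',
    energyScale_pos l] with a ha hcv h1 hvs hc
  obtain ⟨hmem, hen⟩ := jastrow_energy_le hv h ha.1 ha.2.1 hs0'.le h1 hvs hs1
    (fun p => by positivity) hL (D := (κ + t) / energyScale l a) (by positivity) ha.2.2
  refine ⟨_, hmem, hcv ha.1 ha.2.1, ?_⟩
  calc _ ≤ energyScale l a * ((∑ p, (‖sliceL l p (w : L2 N)‖ ^ 2 + t)) *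
        ((κ + t) / energyScale l a)) := mul_le_mul_of_nonneg_left hen hc.le
    _ = (∑ p, (‖sliceL l p (w : L2 N)‖ ^ 2 + t)) * (κ + t) := by field_simp
    _ ≤ _ := ht1.le

end Upper

/-! ### Convergence of the resolvents -/

section Resolvent

/-- The resolvent minimizes `μ ‖u‖² + c q(u) - 2 Re ⟨u, ψ⟩`, and obeys the usual bounds. -/
theorem resolvent_minimizes (hv : Measurable v) {a μ c : ℝ} (hμ : 0 < μ) (hc : 0 < c) (ψ : L2 N) :
    ∃ r ∈ formDomain N hv a, resolventAt ((c : ℂ) • hamiltonian N hv a) μ ψ = r ∧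
      μ * ‖r‖ ^ 2 + c * energy N v a r = (⟪r, ψ⟫_ℂ).re ∧
      ∀ u ∈ formDomain N hv a, μ * ‖r‖ ^ 2 + c * energy N v a r - 2 * (⟪r, ψ⟫_ℂ).re ≤
        μ * ‖u‖ ^ 2 + c * energy N v a u - 2 * (⟪u, ψ⟫_ℂ).re := by
  obtain ⟨h, hw⟩ := ((isClosedForm_hamForm (N := N) hv a).resolvent hμ hc).2 ψ
  set r := resolventAt ((c : ℂ) • formOperator (formDomain N hv a) (hamForm N hv a)) μ ψ with hr
  have hself : ∀ u : formDomain N hv a, (hamForm N hv a u u).re = energy N v a (u : L2 N) := fun u => by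
    rw [hamForm_self, ofReal_re, energy]
  have hnsq : ∀ u : L2 N, (⟪u, u⟫_ℂ).re = ‖u‖ ^ 2 := fun u => inner_self_eq_norm_sq (𝕜 := ℂ) u
  refine ⟨r, h, rfl, ?_, fun u hu => ?_⟩
  · have h1 := congrArg Complex.re (hw ⟨r, h⟩)
    rwa [add_re, re_ofReal_mul, re_ofReal_mul, hself, hnsq] at h1
  · set U : formDomain N hv a := ⟨u, hu⟩ with hU
    set Rr : formDomain N hv a := ⟨r, h⟩ with hRr
    have h1 := congrArg Complex.re (hw (U - Rr))
    have h2 := (isClosedForm_hamForm (N := N) hv a).nonneg (U - Rr)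
    have h3 : hamForm N hv a (U - Rr) (U - Rr) = hamForm N hv a U U + hamForm N hv a Rr Rr
        - hamForm N hv a U Rr - hamForm N hv a Rr U := by
      simp only [map_sub, LinearMap.sub_apply]
      ring
    have h4 : (hamForm N hv a Rr U).re = (hamForm N hv a U Rr).re := by
      rw [← hamForm_conj hv U Rr, conj_re]
    have h5 : hamForm N hv a (U - Rr) Rr = hamForm N hv a U Rr - hamForm N hv a Rr Rr := by
      simp only [map_sub, LinearMap.sub_apply]
    rw [h3] at h2
    simp only [sub_re, add_re, h4, hself] at h2
    rw [add_re, re_ofReal_mul, re_ofReal_mul, h5] at h1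
    simp only [Submodule.coe_sub, inner_sub_left, sub_re, hself] at h1
    have h6 := norm_sub_sq (𝕜 := ℂ) u r
    have h7 := sq_nonneg ‖u - r‖
    simp only [RCLike.re_eq_complex_re] at h6
    have h8 := hnsq r
    have h9 := mul_nonneg hμ.le h7
    have h10 := mul_nonneg hc.le h2
    change μ * ((⟪u, r⟫_ℂ).re - (⟪r, r⟫_ℂ).re) + c * ((hamForm N hv a U Rr).re - energy N v a r) =
      (⟪u, ψ⟫_ℂ).re - (⟪r, ψ⟫_ℂ).re at h1
    change 0 ≤ c * (energy N v a u + energy N v a r - _ - _) at h10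
    rw [h6] at h9
    rw [h8] at h1
    nlinarith

theorem inner_coincidenceOp_self (w : spaceB N l) :
    ⟪w, coincidenceOp N l w⟫_ℂ = ((∑ p, ‖sliceL l p (w : L2 N)‖ ^ 2 : ℝ) : ℂ) := by
  rw [inner_coincidenceOp]
  push_cast
  exact sum_congr rfl fun p _ => by rw [inner_self_eq_norm_sq_to_K]; push_cast; rfl

theorem isUnit_add_coincidenceOp {μ κ : ℝ} (hμ : 0 < μ) (hκ : 0 < κ) :
    IsUnit ((μ : ℂ) • (1 : spaceB N l →L[ℂ] spaceB N l) + (κ : ℂ) • coincidenceOp N l) := by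
  refine ContinuousLinearMap.isUnit_of_forall_le_norm_inner_map _ (c := μ.toNNReal)
    (Real.toNNReal_pos.2 hμ) fun x => ?_
  have e : ⟪x, ((μ : ℂ) • (1 : spaceB N l →L[ℂ] spaceB N l) + (κ : ℂ) • coincidenceOp N l) x⟫_ℂ =
      ((μ * ‖x‖ ^ 2 + κ * ∑ p, ‖sliceL l p (x : L2 N)‖ ^ 2 : ℝ) : ℂ) := by
    rw [ContinuousLinearMap.add_apply, inner_add_right, ContinuousLinearMap.smul_apply,
      ContinuousLinearMap.smul_apply, inner_smul_right, inner_smul_right, inner_coincidenceOp_self,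
      ContinuousLinearMap.one_apply, inner_self_eq_norm_sq_to_K]
    push_cast
    rfl
  rw [← norm_inner_symm, e, norm_real, norm_of_nonneg (by positivity), Real.coe_toNNReal _ hμ.le]
  have : 0 ≤ κ * ∑ p, ‖sliceL l p (x : L2 N)‖ ^ 2 := by positivity
  linarith

theorem norm_sq_add_le {H : Type*} [NormedAddCommGroup H] [InnerProductSpace ℂ H] {r ψ : H} {μ X : ℝ}
    (hμ : 0 < μ) (hX0 : 0 ≤ X) (hq : μ * ‖r‖ ^ 2 + X = (⟪r, ψ⟫_ℂ).re) :
    ‖r‖ ^ 2 + X ≤ ‖ψ‖ ^ 2 / μ ^ 2 + ‖ψ‖ ^ 2 / μ := by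
  have hcs : (⟪r, ψ⟫_ℂ).re ≤ ‖r‖ * ‖ψ‖ := (re_le_norm _).trans (norm_inner_le_norm _ _)
  have hrn : ‖r‖ ≤ ‖ψ‖ / μ := by
    rw [le_div_iff₀ hμ]
    by_contra hlt
    push Not at hlt
    have : 0 < ‖r‖ := by
      by_contra h0
      have : ‖r‖ = 0 := le_antisymm (not_lt.1 h0) (norm_nonneg _)
      rw [this, zero_mul] at hlt
      exact (norm_nonneg ψ).not_gt hlt
    nlinarith
  have a1 : ‖r‖ ^ 2 ≤ ‖ψ‖ ^ 2 / μ ^ 2 := by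
    rw [← div_pow]; exact pow_le_pow_left₀ (norm_nonneg _) hrn 2
  have a2 : X ≤ ‖r‖ * ‖ψ‖ := by nlinarith [mul_nonneg hμ.le (sq_nonneg ‖r‖)]
  have a3 : ‖r‖ * ‖ψ‖ ≤ ‖ψ‖ / μ * ‖ψ‖ := mul_le_mul_of_nonneg_right hrn (norm_nonneg _)
  have a4 : ‖ψ‖ / μ * ‖ψ‖ = ‖ψ‖ ^ 2 / μ := by ring
  linarith

theorem norm_sq_le_of_norm_sub_lt {H : Type*} [NormedAddCommGroup H] {u w : H} {δ : ℝ} (hδ : 0 < δ)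
    (hδ1 : δ ≤ 1) (h : ‖u - w‖ < δ) : ‖u‖ ^ 2 ≤ ‖w‖ ^ 2 + δ * (2 * ‖w‖ + 1) := by
  have e1 : ‖u‖ ≤ ‖w‖ + δ := by
    have := norm_add_le (u - w) w
    rw [sub_add_cancel] at this
    linarith
  have e3 := pow_le_pow_left₀ (norm_nonneg _) e1 2
  nlinarith [norm_nonneg w]

theorem norm_sq_resolvent_sub_le (hv : Measurable v)
    (hsupp : ∃ R₀ : ℝ, ∀ r, R₀ < r → v r = 0) {κ : ℝ} (hκ : 0 < κ) (hlow : HasLowCerts v l κ)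
    (hup : HasUpCerts v l κ) (hneg : (spaceB N l)ᗮ ≤ negligible N hv (energyScale l)) {μ : ℝ}
    (hμ : 0 < μ) {ψ : L2 N} {w : spaceB N l}
    (hw : ψ - ((μ : ℂ) • (w : L2 N) + (κ : ℂ) • (coincidenceOp N l w : L2 N)) ∈ (spaceB N l)ᗮ)
    {δ : ℝ} (hδ : 0 < δ) (hδ1 : δ ≤ 1) : ∀ᶠ a in 𝓝₊,
      μ * ‖resolventAt ((energyScale l a : ℂ) • hamiltonian N hv a) μ ψ - (w : L2 N)‖ ^ 2 ≤
        δ * (2 * (1 + (‖ψ‖ ^ 2 / μ ^ 2 + ‖ψ‖ ^ 2 / μ)) + 1 + μ * (2 * ‖w‖ + 1) + 2 * ‖ψ‖) := by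
  filter_upwards [energyScale_pos l, energy_lower_bound hv hκ hlow hneg w hδ,
    energy_upper_bound hv hsupp hκ hup w hδ, hneg hw (δ ^ 2) (by positivity)] with a hc hL hU hN
  set c := energyScale l a
  obtain ⟨r, hr, hre, hq, hmin⟩ := resolvent_minimizes hv hμ hc ψ (a := a)
  rw [hre]
  obtain ⟨u, hu, huw, hue⟩ := hU
  have h1 := hL r hr
  have h2 := hN r hr
  have h3 := hmin u hu
  set x : L2 N := ψ - ((μ : ℂ) • (w : L2 N) + (κ : ℂ) • (coincidenceOp N l w : L2 N)) with hx
  set t := ∑ p, ‖sliceL l p (w : L2 N)‖ ^ 2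
  set T : L2 N := (coincidenceOp N l w : L2 N) with hT
  have hψ : ψ = x + ((μ : ℂ) • (w : L2 N) + (κ : ℂ) • T) := by rw [hx]; abel
  have hwT : ⟪(w : L2 N), T⟫_ℂ = (t : ℂ) := inner_coincidenceOp_self w
  have hq0 := energy_nonneg v a r
  set X := c * energy N v a r with hX
  have hX0 : 0 ≤ X := mul_nonneg hc.le hq0
  -- a priori bounds
  have hK : ‖r‖ ^ 2 + X ≤ ‖ψ‖ ^ 2 / μ ^ 2 + ‖ψ‖ ^ 2 / μ := norm_sq_add_le hμ hX0 hq
  set K := ‖ψ‖ ^ 2 / μ ^ 2 + ‖ψ‖ ^ 2 / μ with hKdef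
  -- the error terms
  rw [abs_of_pos hc] at h2
  have hxr : 2 * (⟪r, x⟫_ℂ).re ≤ δ * (1 + K) := by
    have b1 : (⟪r, x⟫_ℂ).re ≤ ‖⟪x, r⟫_ℂ‖ := by rw [norm_inner_symm]; exact re_le_norm _
    have b2 : ‖⟪x, r⟫_ℂ‖ ^ 2 ≤ δ ^ 2 * K := h2.trans (mul_le_mul_of_nonneg_left hK (by positivity))
    have b3 : 2 * ‖⟪x, r⟫_ℂ‖ * δ ≤ δ * (1 + K) * δ := by nlinarith [sq_nonneg (‖⟪x, r⟫_ℂ‖ - δ)]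
    have b4 := le_of_mul_le_mul_right b3 hδ
    linarith
  have hrψ : (⟪r, ψ⟫_ℂ).re = (⟪r, x⟫_ℂ).re + μ * (⟪r, (w : L2 N)⟫_ℂ).re + κ * (⟪r, T⟫_ℂ).re := by
    rw [hψ, inner_add_right, inner_add_right, inner_smul_right, inner_smul_right, add_re, add_re,
      re_ofReal_mul, re_ofReal_mul]
    ring
  have hwψ : (⟪(w : L2 N), ψ⟫_ℂ).re = μ * ‖w‖ ^ 2 + κ * t := by
    have c1 : ⟪(w : L2 N), x⟫_ℂ = 0 := hw _ w.2
    rw [hψ, inner_add_right, inner_add_right, inner_smul_right, inner_smul_right, c1, hwT, zero_add,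
      add_re, re_ofReal_mul, re_ofReal_mul, ofReal_re]
    congr 2
    exact inner_self_eq_norm_sq (𝕜 := ℂ) (w : L2 N)
  have hTr : (⟪T, r⟫_ℂ).re = (⟪r, T⟫_ℂ).re := by rw [← inner_conj_symm, conj_re]
  have huψ : (⟪(w : L2 N), ψ⟫_ℂ).re - δ * ‖ψ‖ ≤ (⟪u, ψ⟫_ℂ).re := by
    have d1 : ⟪u, ψ⟫_ℂ = ⟪(w : L2 N), ψ⟫_ℂ + ⟪u - (w : L2 N), ψ⟫_ℂ := by rw [inner_sub_left]; ring
    have d2 := (abs_le.1 (abs_re_le_norm ⟪u - (w : L2 N), ψ⟫_ℂ)).1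
    have d3 := norm_inner_le_norm (𝕜 := ℂ) (u - (w : L2 N)) ψ
    have d4 := mul_le_mul_of_nonneg_right huw.le (norm_nonneg ψ)
    rw [d1, add_re]
    linarith
  have hun : ‖u‖ ^ 2 ≤ ‖w‖ ^ 2 + δ * (2 * ‖w‖ + 1) := norm_sq_le_of_norm_sub_lt hδ hδ1 huw
  have hrw : ‖r - (w : L2 N)‖ ^ 2 = ‖r‖ ^ 2 - 2 * (⟪r, (w : L2 N)⟫_ℂ).re + ‖w‖ ^ 2 :=
    norm_sub_sq (𝕜 := ℂ) r (w : L2 N)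
  have hdK : δ * (1 + ‖r‖ ^ 2 + X) ≤ δ * (1 + K) := by
    refine mul_le_mul_of_nonneg_left ?_ hδ.le
    linarith
  have hμu := mul_le_mul_of_nonneg_left hun hμ.le
  rw [hrw]
  rw [hTr] at h1
  rw [hrψ] at h3
  rw [hwψ] at huψ
  linarith

/-- Strong resolvent convergence, given the solution of the one-body problem. -/
theorem strongResolventLimit_of_certs (hv : Measurable v)
    (hsupp : ∃ R₀ : ℝ, ∀ r, R₀ < r → v r = 0) {κ : ℝ} (hκ : 0 < κ) (hlow : HasLowCerts v l κ)
    (hup : HasUpCerts v l κ) (hcert : ∀ j < l, ∃ κ > 0, HasLowCerts v j κ) :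
    StrongResolventLimit (fun a : ℝ => (energyScale l a : ℂ) • hamiltonian N hv a) (spaceB N l)
      ((κ : ℂ) • pseudoHamiltonian N l) := by
  have hneg := orthogonal_spaceB_le_negligible (N := N) hv l hcert
  refine ⟨inferInstance, fun μ hμ => ⟨?_, ?_, fun ψ => ?_⟩⟩
  · filter_upwards [energyScale_pos l] with a ha
    exact ((isClosedForm_hamForm (N := N) hv a).resolvent hμ ha).1
  · rw [pseudoHamiltonian_eq]
    exact isUnit_add_coincidenceOp hμ hκ
  rw [pseudoHamiltonian_eq]
  set A := (μ : ℂ) • (1 : spaceB N l →L[ℂ] spaceB N l) + (κ : ℂ) • coincidenceOp N l with hA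
  set w : spaceB N l := Ring.inverse A ((spaceB N l).orthogonalProjectionOnto ψ) with hwdef
  have hAw : A w = (spaceB N l).orthogonalProjectionOnto ψ := by
    have := Ring.mul_inverse_cancel A (isUnit_add_coincidenceOp hμ hκ)
    rw [hwdef, ← ContinuousLinearMap.mul_apply, this, ContinuousLinearMap.one_apply]
  have hw : ψ - ((μ : ℂ) • (w : L2 N) + (κ : ℂ) • (coincidenceOp N l w : L2 N)) ∈ (spaceB N l)ᗮ := by
    have e : (μ : ℂ) • (w : L2 N) + (κ : ℂ) • (coincidenceOp N l w : L2 N) =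
        ((spaceB N l).orthogonalProjectionOnto ψ : L2 N) := by
      rw [← hAw]; rfl
    rw [e]
    exact Submodule.sub_starProjection_mem_orthogonal ψ
  set L := 2 * (1 + (‖ψ‖ ^ 2 / μ ^ 2 + ‖ψ‖ ^ 2 / μ)) + 1 + μ * (2 * ‖w‖ + 1) + 2 * ‖ψ‖ with hL
  have hL0 : 0 < L := by positivity
  refine Metric.tendsto_nhds.2 fun ε hε => ?_
  set δ := min 1 (μ * ε ^ 2 / (2 * L)) with hδ
  have hδ0 : 0 < δ := lt_min one_pos (by positivity)
  filter_upwards [norm_sq_resolvent_sub_le hv hsupp hκ hlow hup hneg hμ hw hδ0 (min_le_left _ _)]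
    with a ha
  rw [dist_eq_norm]
  have h1 : δ * L ≤ μ * ε ^ 2 / 2 := by
    calc δ * L ≤ μ * ε ^ 2 / (2 * L) * L := mul_le_mul_of_nonneg_right (min_le_right _ _) hL0.le
      _ = μ * ε ^ 2 / 2 := by field_simp
  have h2 : μ * ‖resolventAt ((energyScale l a : ℂ) • hamiltonian N hv a) μ ψ - (w : L2 N)‖ ^ 2 <
      μ * ε ^ 2 := by
    have : 0 < μ * ε ^ 2 := by positivity
    linarith
  exact lt_of_pow_lt_pow_left₀ 2 hε.le (lt_of_mul_lt_mul_left h2 hμ.le)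

end Resolvent


/-! ### The radial scattering equation -/

section Scattering

/-- Bounded radial potentials supported in `[ε, Q]`. -/
structure IsPot (ε Q : ℝ) (V : ℝ → ℝ) : Prop where
  pos : 0 < ε
  le : ε ≤ Q
  measurable : Measurable V
  nonneg : ∀ q, 0 ≤ V q
  bounded : ∃ B, ∀ q, V q ≤ B
  support : ∀ q, q ∉ Icc ε Q → V q = 0

theorem IsPot.bounded_mul {f : ℝ → ℝ} (h : IsPot ε Q V) (h0 : ∀ q, 0 ≤ f q) {M : ℝ}
    (hM : ∀ q ≤ Q, f q ≤ M) : ∃ C, ∀ q, |V q * f q / 2| ≤ C := by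
  obtain ⟨B, hB⟩ := h.bounded
  refine ⟨B * M / 2, fun q => ?_⟩
  have hB0 := (h.nonneg q).trans (hB q)
  have hM0 := (h0 Q).trans (hM Q le_rfl)
  by_cases hq : q ∈ Icc ε Q
  · rw [abs_of_nonneg (div_nonneg (mul_nonneg (h.nonneg q) (h0 q)) zero_le_two)]
    have := mul_le_mul (hB q) (hM q hq.2) (h0 q) hB0
    linarith
  · rw [h.support q hq]
    simp only [zero_mul, zero_div, abs_zero]
    positivity

theorem IsPot.mul_eq_zero (h : IsPot ε Q V) (f : ℝ → ℝ) {q : ℝ}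
    (hq : q ∉ Icc ε Q) : V q * f q / 2 = 0 := by
  rw [h.support q hq]; simp

theorem continuous_prim_div (hm : Measurable k) (hC : ∃ C, ∀ q, |k q| ≤ C)
    (hε : 0 < ε) (hs : ∀ q, q < ε → k q = 0) :
    Continuous fun q => prim l k q / (4 * q ^ (l + 1)) := by
  refine continuous_iff_continuousAt.2 fun q => ?_
  rcases lt_or_ge q ε with h | h
  · refine (continuousAt_const (y := (0 : ℝ))).congr ?_
    filter_upwards [Iio_mem_nhds h] with x hx
    rw [prim_eq_zero_of_le hε.le hs hx.le]
    simp
  · exact (continuous_prim hm hC).continuousAt.div (by fun_prop)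
      (by have := hε.trans_le h; positivity)

/-- The Volterra map of the radial equation `4 (q^{l+1} f')' = ½ V q^l f`, `f(0) = 1`. -/
def volterra (l : ℕ) (V : ℝ → ℝ) : (ℝ → ℝ≥0∞) →o (ℝ → ℝ≥0∞) where
  toFun f q := 1 + ∫⁻ τ in Ioc 0 q, toE (1 / (4 * τ ^ (l + 1))) *
    ∫⁻ σ in Ioc 0 τ, toE (V σ / 2 * σ ^ l) * f σ
  monotone' f g h q := by
    dsimp only
    gcongr
    exact h _

theorem volterra_exp_le (l : ℕ) (h0 : ∀ q, 0 ≤ V q) {B : ℝ} (hB : ∀ q, V q ≤ B) :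
    volterra l V (fun q => toE (rexp (B / 8 * |q|))) ≤ fun q => toE (rexp (B / 8 * |q|)) := by
  intro q
  have hB0 : 0 ≤ B := (h0 0).trans (hB 0)
  rcases le_total q 0 with hq | hq
  · change 1 + ∫⁻ τ in Ioc 0 q, _ ≤ _
    rw [Set.Ioc_eq_empty (not_lt.2 hq)]
    simp only [Measure.restrict_empty, lintegral_zero_measure, add_zero]
    rw [← ENNReal.ofReal_one]
    exact ofReal_le_ofReal (Real.one_le_exp (by positivity))
  have hin : ∀ τ ∈ Ioc 0 q, toE (1 / (4 * τ ^ (l + 1))) *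
      ∫⁻ σ in Ioc 0 τ, toE (V σ / 2 * σ ^ l) * toE (rexp (B / 8 * |σ|))
      ≤ toE (B / 8 * rexp (B / 8 * τ)) := fun τ hτ => by
    have hτ0 : 0 < τ := hτ.1
    have : ∫⁻ σ in Ioc 0 τ, toE (V σ / 2 * σ ^ l) *
        toE (rexp (B / 8 * |σ|)) ≤
        ∫⁻ σ in Ioc 0 τ, toE (B / 2 * τ ^ l * rexp (B / 8 * τ)) := by
      refine setLIntegral_mono measurable_const fun σ hσ => ?_
      rw [← ENNReal.ofReal_mul (mul_nonneg (div_nonneg (h0 σ) zero_le_two) (pow_nonneg hσ.1.le _)),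
        abs_of_pos hσ.1]
      refine ofReal_le_ofReal ?_
      have h1 := hσ.1.le
      have h2 := hσ.2
      gcongr
      exact hB σ
    refine (mul_le_mul_right this _).trans ?_
    rw [setLIntegral_const, Real.volume_Ioc, sub_zero, ← ENNReal.ofReal_mul (by positivity),
      ← ENNReal.ofReal_mul (by positivity)]
    refine ofReal_le_ofReal (le_of_eq ?_)
    field_simp
    ring
  have hd : ∀ τ ∈ Set.uIcc 0 q, HasDerivAt (fun τ => rexp (B / 8 * τ))
      (B / 8 * rexp (B / 8 * τ)) τ := fun τ _ => by
    simpa [mul_comm] using (((hasDerivAt_id τ).const_mul (B / 8))).exp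
  have hc : Continuous fun τ => B / 8 * rexp (B / 8 * τ) := by fun_prop
  have hF := integral_eq_sub_of_hasDerivAt hd (hc.intervalIntegrable _ _)
  rw [integral_of_le hq] at hF
  calc volterra l V (fun q => toE (rexp (B / 8 * |q|))) q
      ≤ 1 + ∫⁻ τ in Ioc 0 q, toE (B / 8 * rexp (B / 8 * τ)) :=
        add_le_add_right (setLIntegral_mono (by fun_prop) hin) _
    _ = toE (rexp (B / 8 * |q|)) := by
      rw [← ofReal_integral_eq_lintegral_ofReal (hc.integrableOn_Ioc) (.of_forall fun τ => by
        positivity), hF, ← ENNReal.ofReal_one, ← ENNReal.ofReal_add zero_le_one, abs_of_nonneg hq]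
      · simp
      · simpa using Real.one_le_exp (by positivity)

/-- The regular solution of the radial equation. -/
theorem IsPot.exists_regular (h : IsPot ε Q V) (l : ℕ) : ∃ ψ : ℝ → ℝ, Monotone ψ ∧ (∀ q, 1 ≤ ψ q) ∧
      ∀ q, HasDerivAt ψ (prim l (fun q => V q * ψ q / 2) q / (4 * q ^ (l + 1))) q := by
  obtain ⟨B, hB⟩ := h.bounded
  set f := (volterra l V).lfp with hf
  have hfix : ∀ q, f q = 1 + ∫⁻ τ in Ioc 0 q, toE (1 / (4 * τ ^ (l + 1))) *
      ∫⁻ σ in Ioc 0 τ, toE (V σ / 2 * σ ^ l) * f σ := fun q =>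
    (congrFun (volterra l V).map_lfp q).symm
  have hfle : ∀ q, f q ≤ toE (rexp (B / 8 * |q|)) :=
    (volterra l V).lfp_le (volterra_exp_le l h.nonneg hB)
  have hfin : ∀ q, f q ≠ ⊤ := fun q => ne_top_of_le_ne_top ofReal_ne_top (hfle q)
  have hmono : Monotone f := fun a b hab => by
    rw [hfix a, hfix b]
    exact add_le_add_right (lintegral_mono_set (Set.Ioc_subset_Ioc_right hab)) _
  have h1 : ∀ q, 1 ≤ f q := fun q => by rw [hfix q]; exact le_self_add
  set ψ : ℝ → ℝ := fun q => (f q).toReal with hψ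
  have hψm : Monotone ψ := fun a b hab => toReal_mono (hfin b) (hmono hab)
  have hψ1 : ∀ q, 1 ≤ ψ q := fun q => by simpa using toReal_mono (hfin q) (h1 q)
  have hψ0 : ∀ q, 0 ≤ ψ q := fun q => zero_le_one.trans (hψ1 q)
  set k : ℝ → ℝ := fun q => V q * ψ q / 2 with hk
  have hkm : Measurable k := (h.measurable.mul hψm.measurable).div_const 2
  have hkC : ∃ C, ∀ q, |k q| ≤ C := h.bounded_mul hψ0 fun q hq => hψm hq
  have hks : ∀ q, q < ε → k q = 0 := fun q hq => h.mul_eq_zero ψ fun hc => hc.1.not_gt hq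
  have hk0 : ∀ q, 0 ≤ k q := fun q => div_nonneg (mul_nonneg (h.nonneg q) (hψ0 q)) zero_le_two
  have hc := continuous_prim_div (l := l) hkm hkC h.pos hks
  have hin : ∀ τ, 0 ≤ τ → ∫⁻ σ in Ioc 0 τ, toE (V σ / 2 * σ ^ l) * f σ =
      toE (prim l k τ) := fun τ hτ => by
    rw [prim, integral_of_le hτ, ofReal_integral_eq_lintegral_ofReal
      ((intervalIntegrable_mul_pow hkm hkC l 0 τ).1) ((ae_restrict_iff' measurableSet_Ioc).2
        (.of_forall fun σ hσ => mul_nonneg (hk0 σ) (pow_nonneg hσ.1.le _)))]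
    refine setLIntegral_congr_fun measurableSet_Ioc fun σ hσ => ?_
    have : f σ = toE (ψ σ) := (ofReal_toReal (hfin σ)).symm
    rw [this, ← ENNReal.ofReal_mul (mul_nonneg (div_nonneg (h.nonneg σ) zero_le_two)
      (pow_nonneg hσ.1.le _))]
    congr 1
    simp only [hk]
    ring
  have hint : ∀ q, ψ q = 1 + ∫ τ in (0 : ℝ)..q, prim l k τ / (4 * τ ^ (l + 1)) := fun q => by
    rcases le_total q 0 with hq | hq
    · have : ∫ τ in (0 : ℝ)..q, prim l k τ / (4 * τ ^ (l + 1)) = 0 := by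
        refine intervalIntegral.integral_zero_ae (.of_forall fun τ hτ => ?_)
        rw [Set.uIoc_of_ge hq] at hτ
        rw [prim_eq_zero_of_le h.pos.le hks (hτ.2.trans h.pos.le), zero_div]
      rw [this, hψ]
      dsimp only
      rw [hfix q, Set.Ioc_eq_empty (not_lt.2 hq)]
      simp
    · have e : f q = 1 + toE (∫ τ in (0 : ℝ)..q, prim l k τ / (4 * τ ^ (l + 1))) := by
        rw [hfix q, integral_of_le hq, ofReal_integral_eq_lintegral_ofReal
          hc.integrableOn_Ioc ((ae_restrict_iff' measurableSet_Ioc).2 (.of_forall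
          fun τ hτ => div_nonneg (prim_nonneg hk0 hτ.1.le) (by have := hτ.1.le; positivity)))]
        congr 1
        refine setLIntegral_congr_fun measurableSet_Ioc fun τ hτ => ?_
        have := hτ.1.le
        rw [hin τ hτ.1.le, ← ENNReal.ofReal_mul (by positivity)]
        congr 1
        ring
      rw [hψ]
      dsimp only
      rw [e, toReal_add ENNReal.one_ne_top ofReal_ne_top, ENNReal.toReal_one,
        toReal_ofReal]
      exact intervalIntegral.integral_nonneg hq fun τ hτ =>
        div_nonneg (prim_nonneg hk0 hτ.1) (by have := hτ.1; positivity)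
  refine ⟨ψ, hψm, hψ1, fun q => ?_⟩
  have hd := (integral_hasDerivAt_right (hc.intervalIntegrable 0 q)
    (hc.stronglyMeasurableAtFilter _ _) hc.continuousAt).const_add 1
  exact hd.congr_of_eventuallyEq (.of_forall hint)

theorem prim_const_mul (l : ℕ) (c : ℝ) (k : ℝ → ℝ) (q : ℝ) :
    prim l (fun q => c * k q) q = c * prim l k q := by
  simp only [prim, mul_assoc, intervalIntegral.integral_const_mul]

/-- Scattering solutions: `4 (q^{l+1} φ')' = ½ V q^l φ` with `φ → 1` at infinity. -/
structure IsScattering (l : ℕ) (ε Q : ℝ) (V φ : ℝ → ℝ) : Prop extends IsPot ε Q V where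
  hasDerivAt : ∀ q, HasDerivAt φ (prim l (fun q => V q * φ q / 2) q / (4 * q ^ (l + 1))) q
  sol_pos : ∀ q, 0 < φ q
  sol_le_one : ∀ q, φ q ≤ 1
  tail : ∀ q, Q ≤ q → φ q = 1 - prim l (fun q => V q * φ q / 2) Q / (4 * l * q ^ l)

theorem IsPot.exists_isScattering (h : IsPot ε Q V) (hl : 1 ≤ l) : ∃ φ, IsScattering l ε Q V φ := by
  obtain ⟨ψ, hm, h1, hd⟩ := h.exists_regular l
  have hψ0 : ∀ q, 0 ≤ ψ q := fun q => zero_le_one.trans (h1 q)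
  set k : ℝ → ℝ := fun q => V q * ψ q / 2 with hk
  have hkm : Measurable k := (h.measurable.mul hm.measurable).div_const 2
  have hkC : ∃ C, ∀ q, |k q| ≤ C := h.bounded_mul hψ0 fun q hq => hm hq
  have hk0 : ∀ q, 0 ≤ k q := fun q => div_nonneg (mul_nonneg (h.nonneg q) (hψ0 q)) zero_le_two
  have hQ : 0 < Q := h.pos.trans_le h.le
  have hn : 0 ≤ prim l k Q := prim_nonneg hk0 hQ.le
  have hl' : (0 : ℝ) < l := by exact_mod_cast hl
  set Z := ψ Q + prim l k Q / (4 * l * Q ^ l) with hZ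
  have htail : ∀ q, Q ≤ q → ψ q + prim l k Q / (4 * l * q ^ l) = Z := fun q hq => by
    have hder : ∀ x ∈ Set.Ico Q q, HasDerivWithinAt
        (fun q => ψ q + prim l k Q / (4 * l * q ^ l)) 0 (Set.Ici x) x := fun x hx => by
      have hx0 : 0 < x := hQ.trans_le hx.1
      have e := (hd x).add (((hasDerivAt_pow l x).const_mul (4 * (l : ℝ))).fun_inv
        (by positivity) |>.const_mul (prim l k Q))
      rw [prim_eq_of_zero_Ici hkm hkC (fun q hq => h.mul_eq_zero ψ fun hc => hc.2.not_gt hq) hx.1] at e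
      refine (e.congr_deriv ?_).hasDerivWithinAt
      obtain ⟨j, rfl⟩ : ∃ j, l = j + 1 := ⟨l - 1, by omega⟩
      simp only [Nat.add_sub_cancel]
      push_cast at hl' ⊢
      field_simp
      ring
    refine constant_of_has_deriv_right_zero (fun x hx => ?_) hder q ⟨hq, le_rfl⟩
    have hx0 : 0 < x := hQ.trans_le hx.1
    exact ((hd x).continuousAt.add (continuousAt_const.div (by fun_prop)
      (by positivity))).continuousWithinAt
  have hZ1 : ∀ q, ψ q ≤ Z := fun q => by
    have := htail (max q Q) (le_max_right _ _)
    have h2 := hm (le_max_left q Q)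
    have : 0 < max q Q := hQ.trans_le (le_max_right _ _)
    have h3 : 0 ≤ prim l k Q / (4 * l * max q Q ^ l) := by positivity
    linarith
  have hZ0 : 0 < Z := one_pos.trans_le ((h1 0).trans (hZ1 0))
  have he : (fun q => V q * (ψ q / Z) / 2) = fun q => Z⁻¹ * k q := by ext q; simp only [hk]; ring
  refine ⟨fun q => ψ q / Z, h, fun q => ?_, fun q => div_pos (one_pos.trans_le (h1 q)) hZ0,
    fun q => (div_le_one hZ0).2 (hZ1 q), fun q hq => ?_⟩
  · rw [he, prim_const_mul]
    exact ((hd q).div_const Z).congr_deriv (by ring)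
  · rw [he, prim_const_mul, eq_sub_of_add_eq (htail q hq), sub_div, div_self hZ0.ne']
    ring

/-- Integration by parts against the primitive of a bounded profile. -/
theorem integral_prim_mul_deriv (hm : Measurable k) (hC : ∃ C, ∀ q, |k q| ≤ C)
    {f : ℝ → ℝ} (hf : ContDiff ℝ 1 f) (L : ℝ) :
    (∫ q in (0 : ℝ)..L, prim l k q * deriv f q) + ∫ q in (0 : ℝ)..L, k q * q ^ l * f q =
      prim l k L * f L := by
  have hi := intervalIntegrable_mul_pow hm hC l 0 L
  have h1 : AbsolutelyContinuousOnInterval (prim l k) 0 L :=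
    hi.absolutelyContinuousOnInterval_intervalIntegral Set.left_mem_uIcc
  have h2 : AbsolutelyContinuousOnInterval f 0 L := hf.contDiffOn.absolutelyContinuousOnInterval
  have h3 : ∫ q in (0 : ℝ)..L, deriv (prim l k) q * f q = ∫ q in (0 : ℝ)..L, k q * q ^ l * f q := by
    refine intervalIntegral.integral_congr_ae ?_
    filter_upwards [hi.ae_hasDerivAt_integral] with q hq hqm
    have : deriv (prim l k) q = k q * q ^ l :=
      (hq (Set.uIoc_subset_uIcc hqm) 0 Set.left_mem_uIcc).deriv
    rw [this]
  rw [h1.integral_mul_deriv_eq_deriv_mul h2, h3, show prim l k 0 = 0 from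
    intervalIntegral.integral_same]
  ring

end Scattering


/-! ### The variational lower bound -/

section Variational

variable {φ : ℝ → ℝ}

namespace IsScattering

theorem measurable_sol (h : IsScattering l ε Q V φ) : Measurable φ :=
  (continuous_iff_continuousAt.2 fun q => (h.hasDerivAt q).continuousAt).measurable

theorem measurable_source (h : IsScattering l ε Q V φ) : Measurable fun q => V q * φ q / 2 :=
  (h.measurable.mul h.measurable_sol).div_const 2

theorem bounded_source (h : IsScattering l ε Q V φ) : ∃ C, ∀ q, |V q * φ q / 2| ≤ C :=
  h.bounded_mul (fun q => (h.sol_pos q).le) fun q _ => h.sol_le_one q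

theorem source_nonneg (h : IsScattering l ε Q V φ) (q : ℝ) : 0 ≤ V q * φ q / 2 :=
  div_nonneg (mul_nonneg (h.nonneg q) (h.sol_pos q).le) zero_le_two

theorem source_eq_zero (h : IsScattering l ε Q V φ) {q : ℝ} (hq : q < ε) : V q * φ q / 2 = 0 :=
  h.mul_eq_zero φ fun hc => hc.1.not_gt hq

theorem prim_of_ge (h : IsScattering l ε Q V φ) {q : ℝ} (hq : Q ≤ q) :
    prim l (fun q => V q * φ q / 2) q = prim l (fun q => V q * φ q / 2) Q :=
  prim_eq_of_zero_Ici h.measurable_source h.bounded_source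
    (fun _ hq => h.mul_eq_zero φ fun hc => hc.2.not_gt hq) hq

theorem prim_le (h : IsScattering l ε Q V φ) {q : ℝ} (hq : 0 ≤ q) :
    prim l (fun q => V q * φ q / 2) q ≤ prim l (fun q => V q * φ q / 2) Q :=
  (prim_mono h.measurable_source h.bounded_source h.source_nonneg hq (le_max_left q Q)).trans_eq
    (h.prim_of_ge (le_max_right q Q))

theorem contDiff (h : IsScattering l ε Q V φ) : ContDiff ℝ 1 φ := by
  refine contDiff_one_iff_deriv.2 ⟨fun q => (h.hasDerivAt q).differentiableAt, ?_⟩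
  rw [show deriv φ = _ from funext fun q => (h.hasDerivAt q).deriv]
  exact continuous_prim_div h.measurable_source h.bounded_source h.pos fun q hq => h.source_eq_zero hq

theorem prim_eq (h : IsScattering l ε Q V φ) (q : ℝ) :
    prim l (fun q => V q * φ q / 2) q = 4 * q ^ (l + 1) * deriv φ q := by
  rw [(h.hasDerivAt q).deriv]
  rcases eq_or_ne q 0 with rfl | hq
  · simp [prim]
  · field_simp

/-- The weak form of the scattering equation. -/
theorem integral_weak (h : IsScattering l ε Q V φ) {f : ℝ → ℝ} (hf : ContDiff ℝ 1 f) (L : ℝ) :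
    (∫ q in (0 : ℝ)..L, 4 * q ^ (l + 1) * deriv φ q * deriv f q) +
      ∫ q in (0 : ℝ)..L, V q / 2 * φ q * f q * q ^ l = prim l (fun q => V q * φ q / 2) L * f L := by
  rw [← integral_prim_mul_deriv h.measurable_source h.bounded_source hf L]
  congr 1
  · simp only [h.prim_eq]
  · exact intervalIntegral.integral_congr fun q _ => by ring

theorem integral_energy_le (h : IsScattering l ε Q V φ) {L : ℝ} (hL : 0 ≤ L) :
    (∫ q in (0 : ℝ)..L, prim l (fun q => V q * φ q / 2) q ^ 2 / (4 * q ^ (l + 1))) +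
      ∫ q in (0 : ℝ)..L, V q / 2 * φ q * φ q * q ^ l ≤ prim l (fun q => V q * φ q / 2) Q := by
  have := h.integral_weak h.contDiff L
  have e : ∀ q, prim l (fun q => V q * φ q / 2) q ^ 2 / (4 * q ^ (l + 1)) =
      4 * q ^ (l + 1) * deriv φ q * deriv φ q := fun q => by
    rw [← h.prim_eq, (h.hasDerivAt q).deriv]; ring
  simp only [e]
  rw [this]
  exact (mul_le_of_le_one_right (prim_nonneg h.source_nonneg hL) (h.sol_le_one L)).trans
    (h.prim_le hL)

end IsScattering

/-- The coordinates of a point of the plane. -/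
def coord (k : Fin 2) (x : ℂ) : ℝ := ![x.re, x.im] k

theorem sum_coord_sq (x : ℂ) : ∑ k, coord k x ^ 2 = ‖x‖ ^ 2 := by
  rw [Fin.sum_univ_two, Complex.sq_norm, Complex.normSq_apply]
  simp [coord]
  ring

theorem abs_coord_le (k : Fin 2) (x : ℂ) : |coord k x| ≤ ‖x‖ := by
  fin_cases k
  · exact Complex.abs_re_le_norm x
  · exact Complex.abs_im_le_norm x

theorem contDiff_coord (k : Fin 2) {n : WithTop ℕ∞} : ContDiff ℝ n (coord k) := by
  fin_cases k
  · exact Complex.reCLM.contDiff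
  · exact Complex.imCLM.contDiff

/-- Directional derivatives of radial vector fields. -/
theorem hasFDerivAt_radial {G : ℝ → ℝ} {x : ℂ} {G' : ℝ} (hG : HasDerivAt G G' (‖x‖ ^ 2)) (k : Fin 2) :
    (∃ A : ℂ →L[ℝ] ℝ, HasFDerivAt (fun x : ℂ => G (‖x‖ ^ 2)) A x ∧ A (dir k) = G' * (2 * coord k x)) ∧
    ∃ A : ℂ →L[ℝ] ℝ, HasFDerivAt (fun x : ℂ => 2 * coord k x * G (‖x‖ ^ 2)) A x ∧
      A (dir k) = 2 * G (‖x‖ ^ 2) + 4 * coord k x ^ 2 * G' := by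
  have h1 := hG.comp_hasFDerivAt x (hasStrictFDerivAt_norm_sq x).hasFDerivAt
  have e1 : (2 • innerSL ℝ x) (dir k) = 2 * coord k x := by
    fin_cases k <;> simp [coord, dir, Complex.inner]
  refine ⟨⟨_, h1, ?_⟩, ?_⟩
  · rw [ContinuousLinearMap.smul_apply, e1, smul_eq_mul]
  · have h2 : HasFDerivAt (coord k) (![Complex.reCLM, Complex.imCLM] k) x := by
      fin_cases k
      · exact Complex.reCLM.hasFDerivAt
      · exact Complex.imCLM.hasFDerivAt
    have e2 : (![Complex.reCLM, Complex.imCLM] k) (dir k) = 1 := by fin_cases k <;> simp [dir]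
    refine ⟨_, (h2.const_mul 2).mul h1, ?_⟩
    simp only [ContinuousLinearMap.add_apply, ContinuousLinearMap.smul_apply, e1, e2, smul_eq_mul,
      Function.comp]
    ring

theorem LocallyIntegrable.integrable_mul_of_bounded {f u : ℂ → ℝ} (hf : LocallyIntegrable f)
    (hu : Measurable u) {C R : ℝ} (hC : ∀ x, |u x| ≤ C) (hR : ∀ x, R < ‖x‖ → u x = 0) :
    Integrable fun x => f x * u x := by
  have h1 : IntegrableOn (fun x => f x * u x) (closedBall 0 R) :=
    (hf.integrableOn_isCompact (isCompact_closedBall 0 R)).mul_bdd hu.aestronglyMeasurable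
      (.of_forall hC)
  refine (integrableOn_iff_integrable_of_support_subset fun x hx => ?_).1 h1
  rw [mem_closedBall_zero_iff]
  by_contra hc
  exact hx (by simp [hR x (not_le.1 hc)])

theorem LocallyIntegrable.tendsto_integral_mul {f : ℂ → ℝ} (hf : LocallyIntegrable f) {u : ℕ → ℂ → ℝ}
    {u' : ℂ → ℝ} (hu : ∀ n, Measurable (u n)) {C R : ℝ} (hC : ∀ n x, |u n x| ≤ C)
    (hR : ∀ n x, R < ‖x‖ → u n x = 0) (hl : ∀ᵐ x, Tendsto (fun n => u n x) atTop (𝓝 (u' x))) :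
    Tendsto (fun n => ∫ x, f x * u n x) atTop (𝓝 (∫ x, f x * u' x)) := by
  have hi : Integrable fun x => f x * (closedBall (0 : ℂ) R).indicator (fun _ => |C|) x :=
    LocallyIntegrable.integrable_mul_of_bounded hf
      (measurable_const.indicator Metric.isClosed_closedBall.measurableSet) (C := |C|) (R := R)
      (fun x => by by_cases h : x ∈ closedBall (0 : ℂ) R <;> simp [h]) fun x hx =>
      indicator_of_notMem (by simpa using hx) _
  refine tendsto_integral_of_dominated_convergence _ (fun n => ?_) hi.norm (fun n => ?_) ?_
  · exact (LocallyIntegrable.integrable_mul_of_bounded hf (hu n) (hC n) (hR n)).aestronglyMeasurable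
  · refine .of_forall fun x => ?_
    rw [norm_mul, norm_mul]
    refine mul_le_mul_of_nonneg_left ?_ (norm_nonneg _)
    rcases le_or_gt ‖x‖ R with h | h
    · rw [indicator_of_mem (by simpa using h)]
      simpa using (hC n x).trans (le_abs_self C)
    · rw [hR n x h]; simp
  · filter_upwards [hl] with x hx using hx.const_mul _

/-- The radial vector field whose divergence is `k(|x|²) |x|^{2l}`. -/
def field (l : ℕ) (k : ℝ → ℝ) (i : Fin 2) (x : ℂ) : ℝ :=
  2 * coord i x * (prim l k (‖x‖ ^ 2) / (4 * ‖x‖ ^ 2))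

theorem measurable_field (hm : Measurable k) (hC : ∃ C, ∀ q, |k q| ≤ C) (i : Fin 2) :
    Measurable (field l k i) := by
  have h1 : Measurable (coord i) := (contDiff_coord i (n := 0)).continuous.measurable
  have h2 : Measurable fun x : ℂ => prim l k (‖x‖ ^ 2) :=
    (continuous_prim hm hC).measurable.comp (by fun_prop)
  unfold field
  fun_prop

theorem IsBalanced.field_eq_zero (h : IsBalanced l ε Q k) (i : Fin 2) {x : ℂ}
    (hx : Q ≤ ‖x‖ ^ 2) : field l k i x = 0 := by
  rw [field, h.prim_of_ge hx]; simp

theorem IsBalanced.abs_field_le (h : IsBalanced l ε Q k) {C : ℝ} (hC : ∀ q, |k q| ≤ C)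
    (i : Fin 2) (x : ℂ) : |field l k i x| ≤ 2 * (1 + |Q|) * (C * |Q| ^ l * |Q| / (4 * ε)) := by
  have hε := h.pos
  have hC0 : 0 ≤ C := (abs_nonneg _).trans (hC 0)
  by_cases hx : ‖x‖ ^ 2 ∈ Icc ε Q
  · have hq : ‖x‖ ^ 2 ≤ |Q| := hx.2.trans (le_abs_self Q)
    rw [field, abs_mul, abs_mul, abs_div, abs_two,
      abs_of_nonneg (by positivity : 0 ≤ 4 * ‖x‖ ^ 2)]
    have h1 : |coord i x| ≤ 1 + |Q| := (abs_coord_le i x).trans (by nlinarith [sq_nonneg (‖x‖ - 1)])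
    have h2 := abs_prim_le (l := l) hC (sq_nonneg ‖x‖) hq
    have h3 := hx.1
    gcongr
  · have : prim l k (‖x‖ ^ 2) = 0 := by
      rcases lt_or_ge (‖x‖ ^ 2) ε with h1 | h1
      · exact h.prim_of_le h1.le
      · exact h.prim_of_ge (not_le.1 fun h2 => hx ⟨h1, h2⟩).le
    rw [field, this]
    simp only [zero_div, mul_zero, abs_zero]
    positivity

theorem IsBalanced.integral_mul_of_contDiff (h : IsBalanced l ε Q k)
    (hk : ContDiff ℝ ∞ k) {f : ℂ → ℝ} {g : Fin 2 → ℂ → ℝ} (hfg : IsWeakGradient f g) :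
    ∫ x, f x * (k (‖x‖ ^ 2) * ‖x‖ ^ (2 * l)) = -∑ i, ∫ x, g i x * field l k i x := by
  set G : ℝ → ℝ := fun q => q ^ l * (prim l k q / (4 * q ^ (l + 1))) with hG
  have hGc : ContDiff ℝ ∞ G := (contDiff_id.pow l).mul (h.contDiff_quotient hk).1
  have hGe : ∀ q, G q = prim l k q / (4 * q) := fun q => by
    rcases eq_or_ne q 0 with rfl | hq
    · simp [hG, prim]
    · simp only [hG, pow_succ]; field_simp
  have hfe : ∀ i, field l k i = fun x => 2 * coord i x * G (‖x‖ ^ 2) := fun i => by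
    ext x; rw [field, hGe]
  have hGd : ∀ q, HasDerivAt G (deriv G q) q := fun q => (hGc.differentiable (by simp) q).hasDerivAt
  have hdiv : ∀ q, 4 * G q + 4 * q * deriv G q = k q * q ^ l := fun q => by
    have h1 := (hasDerivAt_id q).mul (hGd q)
    have h2 := ((contDiff_prim (l := l) hk).2 q).div_const 4
    have e : (id * G : ℝ → ℝ) = fun q => prim l k q / 4 := by
      ext q
      rw [Pi.mul_apply, hGe, id]
      rcases eq_or_ne q 0 with rfl | hq
      · simp [prim]
      · field_simp
    rw [e] at h1
    have := h1.unique h2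
    simp only [id] at this
    linarith
  have hcd : ∀ i, ContDiff ℝ ∞ (field l k i) := fun i => by
    rw [hfe]
    exact (contDiff_const.mul (contDiff_coord i)).mul (hGc.comp (contDiff_norm_sq ℝ))
  have hcs : ∀ i, HasCompactSupport (field l k i) := fun i =>
    HasCompactSupport.intro (isCompact_closedBall (0 : ℂ) (√Q)) fun x hx =>
      h.field_eq_zero i (lt_norm_sq_of_sqrt_lt (by simpa using hx)).le
  have hd : ∀ i x, fderiv ℝ (field l k i) x (dir i) =
      2 * G (‖x‖ ^ 2) + 4 * coord i x ^ 2 * deriv G (‖x‖ ^ 2) := fun i x => by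
    obtain ⟨A, hA, hA'⟩ := (hasFDerivAt_radial (hGd (‖x‖ ^ 2)) i).2
    rw [hfe, hA.fderiv, hA']
  have hint : ∀ i, Integrable fun x => f x * fderiv ℝ (field l k i) x (dir i) := fun i => by
    have c : Continuous fun x => fderiv ℝ (field l k i) x (dir i) :=
      ((hcd i).continuous_fderiv (by simp)).clm_apply continuous_const
    have s : HasCompactSupport fun x => fderiv ℝ (field l k i) x (dir i) :=
      ((hcs i).fderiv (𝕜 := ℝ)).comp_left (g := fun A : ℂ →L[ℝ] ℝ => A (dir i)) rfl
    simpa [mul_comm] using hfg.1.integrable_smul_right_of_hasCompactSupport c s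
  rw [← Finset.sum_neg_distrib, ← sum_congr rfl fun i _ => (hfg.2 i).2 _ (hcd i) (hcs i),
    ← integral_finsetSum _ fun i _ => hint i]
  refine integral_congr_ae (.of_forall fun x => ?_)
  dsimp only
  have hs := sum_coord_sq x
  simp only [hd, Fin.sum_univ_two] at hs ⊢
  rw [pow_mul, ← hdiv, ← hs]
  ring

/-- Partial integration with the radial field of a balanced profile. -/
theorem IsBalanced.integral_mul (h : IsBalanced l ε Q k) (hεQ : ε ≤ Q) {f : ℂ → ℝ}
    {g : Fin 2 → ℂ → ℝ} (hfg : IsWeakGradient f g) :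
    ∫ x, f x * (k (‖x‖ ^ 2) * ‖x‖ ^ (2 * l)) = -∑ i, ∫ x, g i x * field l k i x := by
  obtain ⟨C, κ, hκ, hC, hb, hl⟩ := h.exists_smooth_approx hεQ
  have hC0 : 0 ≤ C := (abs_nonneg _).trans (hC 0 0)
  have hQ : 0 ≤ Q + 1 := by linarith [h.pos]
  have hbig : ∀ x : ℂ, √(Q + 1) < ‖x‖ → Q + 1 < ‖x‖ ^ 2 := fun x => lt_norm_sq_of_sqrt_lt
  have h1 := LocallyIntegrable.tendsto_integral_mul hfg.1
    (u := fun n x => κ n (‖x‖ ^ 2) * ‖x‖ ^ (2 * l)) (u' := fun x => k (‖x‖ ^ 2) * ‖x‖ ^ (2 * l))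
    (fun n => by have := (hκ n).continuous; fun_prop) (C := C * (Q + 1) ^ l) (R := √(Q + 1))
    (fun n x => by
      rcases le_or_gt (‖x‖ ^ 2) (Q + 1) with hx | hx
      · rw [abs_mul, pow_mul, abs_of_nonneg (by positivity : 0 ≤ (‖x‖ ^ 2) ^ l)]
        gcongr
        exact hC n _
      · rw [(hb n).support _ fun hc => hc.2.not_gt hx]
        simp only [zero_mul, abs_zero]
        positivity)
    (fun n x hx => by rw [(hb n).support _ fun hc => hc.2.not_gt (hbig x hx), zero_mul])
    (by filter_upwards [ae_norm_sq hl] with x hx using hx.mul_const _)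
  have h2 : ∀ i, Tendsto (fun n => ∫ x, g i x * field l (κ n) i x) atTop
      (𝓝 (∫ x, g i x * field l k i x)) := fun i =>
    LocallyIntegrable.tendsto_integral_mul (hfg.2 i).1
      (fun n => measurable_field (hb n).measurable (hb n).bounded i)
      (fun n x => (hb n).abs_field_le (hC n) i x) (R := √(Q + 1))
      (fun n x hx => (hb n).field_eq_zero i (hbig x hx).le)
      (.of_forall fun x => ((tendsto_prim (fun n => (hb n).measurable) hC hl
        _).div_const _).const_mul _)
  have h3 := (tendsto_finsetSum univ fun i _ => h2 i).neg
  refine tendsto_nhds_unique h1 (h3.congr fun n => ?_)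
  exact ((hb n).integral_mul_of_contDiff (hκ n) hfg).symm

end Variational


section Variational

variable {φ : ℝ → ℝ}

theorem lintegral_ofReal_radial {D : ℝ → ℝ} (hm : Measurable D) {L : ℝ} (hL : 0 ≤ L)
    (hi : IntervalIntegrable D volume 0 L) (h0 : ∀ q, 0 < q → 0 ≤ D q) :
    ∫⁻ x : ℂ, toE ((Iic L).indicator D (‖x‖ ^ 2)) = toE (π * ∫ q in (0 : ℝ)..L, D q) := by
  rw [lintegral_norm_sq (f := fun q => toE ((Iic L).indicator D q))
    (hm.indicator measurableSet_Iic).ennreal_ofReal, ENNReal.ofReal_mul Real.pi_pos.le,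
    integral_of_le hL, ofReal_integral_eq_lintegral_ofReal hi.1
      ((ae_restrict_iff' measurableSet_Ioc).2 (Eventually.of_forall fun q hq => h0 q hq.1)),
    ← Set.Ioi_inter_Iic, ← lintegral_indicator measurableSet_Ioi,
    ← lintegral_indicator (measurableSet_Ioi.inter measurableSet_Iic)]
  congr 2
  ext q
  by_cases h1 : q ∈ Ioi (0 : ℝ) <;> by_cases h2 : q ∈ Iic L <;>
    simp [h1, h2, -Set.mem_Iic, -Set.mem_Ioi]

theorem IsScattering.intervalIntegrable_pot (h : IsScattering l ε Q V φ) {f g : ℝ → ℝ}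
    (hf : Continuous f) (hg : Continuous g) (a b : ℝ) :
    IntervalIntegrable (fun q => V q / 2 * f q * g q * q ^ l) volume a b := by
  obtain ⟨B, hB⟩ := h.bounded
  have := (intervalIntegrable_of_bounded h.measurable
    (fun q => (abs_of_nonneg (h.nonneg q)).trans_le (hB q)) a b).mul_continuousOn
    (show Continuous fun q => 1 / 2 * f q * g q * q ^ l by fun_prop).continuousOn
  exact this.congr_ae (Eventually.of_forall fun q => by simp only; ring)

theorem IsScattering.lintegral_dual_le (h : IsScattering l ε Q V φ) {L : ℝ} (hL : 0 ≤ L) :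
    ∫⁻ x : ℂ, toE ((Iic L).indicator (fun q =>
      prim l (fun q => V q * φ q / 2) q ^ 2 / (4 * q ^ (l + 1)) + V q / 2 * φ q * φ q * q ^ l)
      (‖x‖ ^ 2)) ≤ toE (π * prim l (fun q => V q * φ q / 2) Q) := by
  have hm := h.measurable
  have hφ := h.measurable_sol
  have hc := continuous_prim_sq_div (l := l) h.measurable_source h.bounded_source h.pos
    fun q hq => h.source_eq_zero hq
  have hi := h.intervalIntegrable_pot h.contDiff.continuous h.contDiff.continuous 0 L
  refine (lintegral_ofReal_radial (hc.measurable.add (by fun_prop)) hL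
    ((hc.intervalIntegrable 0 L).add hi) fun q hq => ?_).trans_le ?_
  · have h2 := h.nonneg q
    have h3 := (h.sol_pos q).le
    exact add_nonneg (by positivity) (by positivity)
  · simp only [Pi.add_apply]
    rw [intervalIntegral.integral_add (hc.intervalIntegrable 0 L) hi]
    exact ofReal_le_ofReal (mul_le_mul_of_nonneg_left (h.integral_energy_le hL) Real.pi_pos.le)

theorem two_mul_le_weighted {q a b : ℝ} (l : ℕ) (hq : 0 < q) :
    2 * (a * b) ≤ q ^ l * a ^ 2 + b ^ 2 / q ^ l := by
  have : 0 < q ^ l := by positivity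
  have h1 : q ^ l * a ^ 2 + b ^ 2 / q ^ l - 2 * (a * b) = (q ^ l * a - b) ^ 2 / q ^ l := by
    field_simp
    ring
  have : 0 ≤ (q ^ l * a - b) ^ 2 / q ^ l := by positivity
  linarith

theorem sum_field_sq_div (l : ℕ) (k : ℝ → ℝ) (x : ℂ) :
    (∑ i, field l k i x ^ 2) / (‖x‖ ^ 2) ^ l = prim l k (‖x‖ ^ 2) ^ 2 / (4 * (‖x‖ ^ 2) ^ (l + 1)) := by
  simp only [field, mul_pow]
  rw [← sum_mul, ← mul_sum, sum_coord_sq]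
  rcases eq_or_ne x 0 with rfl | hx
  · simp
  · field_simp
    ring

theorem IsScattering.energy_density_ge (h : IsScattering l ε Q V φ)
    (hV : ∀ w : ℂ, toE (V (‖w‖ ^ 2)) ≤ v ‖w‖) {R : ℝ} (hR : 0 < R) (hQR : Q ≤ R ^ 2)
    (f : ℂ → ℝ) (g : Fin 2 → ℂ → ℝ) {b : ℝ → ℝ} (hk : k = fun q => V q * φ q / 2)
    (hb : b = fun q => k q - moment l k * shell l R q) {x : ℂ} (hx : x ≠ 0) :
    toE (2 * (f x * (k (‖x‖ ^ 2) * ‖x‖ ^ (2 * l)) + ∑ i, g i x * field l b i x)) ≤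
      toE (‖x‖ ^ (2 * l)) * (toE (∑ i, g i x ^ 2) + v ‖x‖ / 2 * toE (f x ^ 2)) +
      toE ((Iic (4 * R ^ 2)).indicator (fun q =>
        prim l k q ^ 2 / (4 * q ^ (l + 1)) + V q / 2 * φ q * φ q * q ^ l) (‖x‖ ^ 2)) := by
  subst hk
  have hεR := h.le.trans hQR
  obtain ⟨hbal, hsq⟩ := isBalanced_sub_shell (l := l) h.measurable_source h.bounded_source hR h.pos hεR
    (fun q hq => h.mul_eq_zero φ fun hc => hq ⟨hc.1, hc.2.trans hQR⟩) h.source_nonneg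
  rw [← hb] at hbal hsq
  set q := ‖x‖ ^ 2 with hq
  have hq0 : 0 < q := by positivity
  have hVq := h.nonneg q
  have hφq := (h.sol_pos q).le
  rw [pow_mul, ← hq]
  have h1 : toE (q ^ l * ∑ i, g i x ^ 2 + q ^ l * (V q / 2 * f x ^ 2)) ≤
      toE (q ^ l) *
        (toE (∑ i, g i x ^ 2) + v ‖x‖ / 2 * toE (f x ^ 2)) := by
    rw [← mul_add, ENNReal.ofReal_mul (by positivity), ENNReal.ofReal_add (by positivity)
      (by positivity), ENNReal.ofReal_mul (by positivity), ENNReal.ofReal_div_of_pos two_pos,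
      ENNReal.ofReal_ofNat]
    gcongr
    exact hV x
  refine le_trans ?_ (add_le_add_left h1 _)
  refine le_trans ?_ ENNReal.ofReal_add_le
  refine ofReal_le_ofReal ?_
  have h2 : 2 * ∑ i, g i x * field l b i x ≤ q ^ l * ∑ i, g i x ^ 2 +
      prim l b q ^ 2 / (4 * q ^ (l + 1)) := by
    rw [← sum_field_sq_div, mul_sum, mul_sum, Finset.sum_div, ← sum_add_distrib]
    exact sum_le_sum fun i _ => two_mul_le_weighted l hq0
  have h3 : 2 * (f x * (V q * φ q / 2 * q ^ l)) ≤ q ^ l * (V q / 2 * f x ^ 2) +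
      V q / 2 * φ q * φ q * q ^ l := by
    have := mul_nonneg (mul_nonneg hVq (pow_nonneg hq0.le l)) (sq_nonneg (f x - φ q))
    linarith
  rcases le_or_gt q (4 * R ^ 2) with h4 | h4
  · rw [indicator_of_mem (Set.mem_Iic.2 h4)]
    have := div_le_div_of_nonneg_right (hsq q hq0.le h4) (by positivity : 0 ≤ 4 * q ^ (l + 1))
    linarith
  · rw [indicator_of_notMem (by simpa using h4)]
    rw [hbal.prim_of_ge h4.le] at h2
    have e : V q = 0 := h.support q fun hc => by nlinarith [hc.2]
    simp only [e, zero_mul, zero_div, mul_zero] at h3 ⊢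
    simp only [ne_eq, OfNat.ofNat_ne_zero, not_false_eq_true, zero_pow, zero_div, add_zero] at h2
    linarith

/-- Scattering solutions bound the scattering energy of all trial functions from below. -/
theorem IsScattering.le_scatteringEnergy (h : IsScattering l ε Q V φ)
    (hV : ∀ w : ℂ, toE (V (‖w‖ ^ 2)) ≤ v ‖w‖) {f : ℂ → ℝ} {g : Fin 2 → ℂ → ℝ}
    (hfg : IsWeakGradient f g) (hf : Tendsto f (cocompact ℂ) (𝓝 1)) :
    toE (π * prim l (fun q => V q * φ q / 2) Q) ≤ scatteringEnergy v l f g := by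
  set k : ℝ → ℝ := fun q => V q * φ q / 2 with hk
  have hQ0 : 0 < Q := h.pos.trans_le h.le
  set m := π * prim l k Q with hm
  have hm0 : 0 ≤ m := mul_nonneg Real.pi_pos.le (prim_nonneg h.source_nonneg hQ0.le)
  have hmom : moment l k = m := moment_eq_prim h.measurable_source hQ0.le
    fun q hq => h.mul_eq_zero φ fun hc => hc.2.not_gt hq
  refine ENNReal.le_of_forall_pos_le_add fun η hη hE => ?_
  obtain ⟨δ, hδ, hδη⟩ : ∃ δ : ℝ, 0 < δ ∧ 2 * m * δ ≤ η := by
    refine ⟨η / (2 * m + 1), by positivity, ?_⟩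
    have hη' : (0 : ℝ) < η := hη
    rw [mul_div_assoc', div_le_iff₀ (by positivity)]
    nlinarith
  obtain ⟨R₀, hR₀⟩ : ∃ R₀ : ℝ, ∀ x : ℂ, R₀ ≤ ‖x‖ → 1 - δ ≤ f x := by
    have := (tendsto_order.1 hf).1 (1 - δ) (by linarith)
    rw [← Metric.cobounded_eq_cocompact, ← comap_norm_atTop, eventually_comap] at this
    obtain ⟨R₀, h0⟩ := eventually_atTop.1 this
    exact ⟨R₀, fun x hx => (h0 _ hx x rfl).le⟩
  obtain ⟨R, hR, hR0, hQR⟩ : ∃ R : ℝ, 0 < R ∧ R₀ ≤ R ∧ Q ≤ R ^ 2 := by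
    refine ⟨max R₀ 0 + Q + 1, by positivity, by linarith [le_max_left R₀ 0], ?_⟩
    nlinarith [le_max_right R₀ 0]
  set b : ℝ → ℝ := fun q => k q - moment l k * shell l R q with hb
  obtain ⟨hbal, -⟩ := isBalanced_sub_shell (l := l) h.measurable_source h.bounded_source hR h.pos
    (h.le.trans hQR) (fun q hq => h.mul_eq_zero φ fun hc => hq ⟨hc.1, hc.2.trans hQR⟩) h.source_nonneg
  have hI := hbal.integral_mul (by nlinarith [h.le]) hfg
  have hsh := isProfile_shell l hR
  have hrad : ∀ {u : ℝ → ℝ}, IsProfile u → Measurable (fun x : ℂ => u (‖x‖ ^ 2) * ‖x‖ ^ (2 * l)) ∧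
      (∃ C, ∀ x : ℂ, |u (‖x‖ ^ 2) * ‖x‖ ^ (2 * l)| ≤ C) ∧
      ∃ R, ∀ x : ℂ, R < ‖x‖ → u (‖x‖ ^ 2) * ‖x‖ ^ (2 * l) = 0 := fun {u} hu => by
    obtain ⟨C, hC⟩ := hu.bounded
    obtain ⟨R, hR, hs⟩ := hu.support
    have hz : ∀ x : ℂ, R < ‖x‖ → u (‖x‖ ^ 2) = 0 := fun x hx => hs _ (by nlinarith)
    refine ⟨(hu.measurable.comp (by fun_prop)).mul (by fun_prop), ⟨C * R ^ (2 * l), fun x => ?_⟩,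
      R, fun x hx => by rw [hz x hx, zero_mul]⟩
    have hC0 : 0 ≤ C := (abs_nonneg _).trans (hC 0)
    rcases le_or_gt ‖x‖ R with hx | hx
    · rw [abs_mul, abs_of_nonneg (by positivity : 0 ≤ ‖x‖ ^ (2 * l))]
      gcongr
      exact hC _
    · rw [hz x hx]; simp only [zero_mul, abs_zero]; positivity
  have hint : ∀ {u : ℝ → ℝ}, IsProfile u →
      Integrable fun x => f x * (u (‖x‖ ^ 2) * ‖x‖ ^ (2 * l)) := fun {u} hu => by
    obtain ⟨h1, ⟨C, h2⟩, R, h3⟩ := hrad hu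
    exact LocallyIntegrable.integrable_mul_of_bounded hfg.1 h1 h2 h3
  have hkp : IsProfile k := ⟨h.measurable_source, h.bounded_source, R, hR.le,
    fun q hq => h.mul_eq_zero φ fun hc => by linarith [hc.2]⟩
  have hfi : ∀ i, Integrable fun x => g i x * field l b i x := fun i => by
    obtain ⟨C, hC⟩ := hbal.bounded
    exact LocallyIntegrable.integrable_mul_of_bounded (hfg.2 i).1
      (measurable_field hbal.measurable hbal.bounded i) (hbal.abs_field_le hC i)
      (R := √(4 * R ^ 2)) fun x hx => hbal.field_eq_zero i (lt_norm_sq_of_sqrt_lt hx).le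
  have hA : 1 - δ ≤ ∫ x, f x * (shell l R (‖x‖ ^ 2) * ‖x‖ ^ (2 * l)) := by
    have e : 1 - δ = ∫ x : ℂ, (1 - δ) * (shell l R (‖x‖ ^ 2) * ‖x‖ ^ (2 * l)) := by
      rw [integral_const_mul]
      change _ = (1 - δ) * moment l (shell l R)
      rw [moment_shell l hR, mul_one]
    rw [e]
    refine integral_mono ?_ (hint hsh) fun x => ?_
    · obtain ⟨h1, ⟨C, h2⟩, R, h3⟩ := hrad hsh
      exact LocallyIntegrable.integrable_mul_of_bounded (locallyIntegrable_const _) h1 h2 h3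
    · rcases lt_or_ge ‖x‖ R with hx | hx
      · dsimp only
        rw [shell_eq_zero l fun hc => by nlinarith [hc.1, norm_nonneg x]]
        simp
      · exact mul_le_mul_of_nonneg_right (hR₀ x (hR0.trans hx))
          (mul_nonneg (shell_nonneg l hR _) (by positivity))
  have hsum : ∫ x, (f x * (k (‖x‖ ^ 2) * ‖x‖ ^ (2 * l)) + ∑ i, g i x * field l b i x) =
      m * ∫ x, f x * (shell l R (‖x‖ ^ 2) * ‖x‖ ^ (2 * l)) := by
    rw [integral_add (hint hkp) (integrable_finsetSum _ fun i _ => hfi i),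
      integral_finsetSum _ fun i _ => hfi i, ← neg_eq_iff_eq_neg.2 hI, ← sub_eq_add_neg,
      ← integral_sub (hint hkp) (hint hbal.isProfile), ← integral_const_mul]
    refine integral_congr_ae (.of_forall fun x => ?_)
    change f x * (k (‖x‖ ^ 2) * ‖x‖ ^ (2 * l)) - f x * ((k (‖x‖ ^ 2) -
      moment l k * shell l R (‖x‖ ^ 2)) * ‖x‖ ^ (2 * l)) = _
    rw [hmom]
    ring
  have hmain : toE (2 * m * (1 - δ)) ≤ scatteringEnergy v l f g + toE m := by
    have hne : ∀ᵐ x : ℂ, x ≠ 0 := by simp [ae_iff]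
    have hi2 : Integrable fun x => 2 * (f x * (k (‖x‖ ^ 2) * ‖x‖ ^ (2 * l)) +
        ∑ i, g i x * field l b i x) :=
      ((hint hkp).add (integrable_finsetSum _ fun i _ => hfi i)).const_mul 2
    have hme : Measurable fun x : ℂ => toE ((Iic (4 * R ^ 2)).indicator (fun q =>
        prim l k q ^ 2 / (4 * q ^ (l + 1)) + V q / 2 * φ q * φ q * q ^ l) (‖x‖ ^ 2)) := by
      have h1 := h.measurable
      have h2 := h.measurable_sol
      have h3 := (continuous_prim (l := l) h.measurable_source h.bounded_source).measurable
      exact (((show Measurable fun q => prim l k q ^ 2 / (4 * q ^ (l + 1)) +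
        V q / 2 * φ q * φ q * q ^ l by fun_prop).indicator measurableSet_Iic).comp
        (by fun_prop : Measurable fun x : ℂ => ‖x‖ ^ 2)).ennreal_ofReal
    calc toE (2 * m * (1 - δ))
        ≤ toE (∫ x, 2 * (f x * (k (‖x‖ ^ 2) * ‖x‖ ^ (2 * l)) +
            ∑ i, g i x * field l b i x)) := by
          refine ofReal_le_ofReal ?_
          rw [integral_const_mul, hsum, mul_assoc]
          gcongr
      _ ≤ ∫⁻ x, toE (2 * (f x * (k (‖x‖ ^ 2) * ‖x‖ ^ (2 * l)) +
            ∑ i, g i x * field l b i x)) := by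
          rw [integral_eq_lintegral_pos_part_sub_lintegral_neg_part hi2]
          exact (ofReal_le_ofReal (sub_le_self _ toReal_nonneg)).trans
            ENNReal.ofReal_toReal_le
      _ ≤ _ := lintegral_mono_ae (by
          filter_upwards [hne] with x hx
          exact h.energy_density_ge hV hR hQR f g hk hb hx)
      _ = _ := lintegral_add_right _ hme
      _ ≤ _ := add_le_add_right (h.lintegral_dual_le (by positivity)) _
  have hE' := ofReal_toReal hE.ne
  rw [← hE', ← ENNReal.ofReal_add toReal_nonneg hm0] at hmain
  have h5 := (ENNReal.ofReal_le_ofReal_iff (add_nonneg toReal_nonneg hm0)).1 hmain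
  rw [← hE', ← ofReal_coe_nnreal, ← ENNReal.ofReal_add toReal_nonneg η.coe_nonneg]
  refine ofReal_le_ofReal ?_
  change m ≤ _ + (η : ℝ)
  linarith

end Variational


/-! ### Truncated potentials and trial functions -/

section Trial

variable {ε' : ℝ} {V' φ φ' : ℝ → ℝ}

theorem integral_sub_two_mul_add {a b c : ℝ → ℝ} {x y : ℝ} (ha : IntervalIntegrable a volume x y)
    (hb : IntervalIntegrable b volume x y) (hc : IntervalIntegrable c volume x y) :
    ∫ q in x..y, (a q - 2 * b q + c q) =
      (∫ q in x..y, a q) - 2 * (∫ q in x..y, b q) + ∫ q in x..y, c q := by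
  rw [intervalIntegral.integral_add (ha.sub (hb.const_mul 2)) hc,
    intervalIntegral.integral_sub ha (hb.const_mul 2), intervalIntegral.integral_const_mul]

/-- Comparison of the scattering solutions of two ordered potentials. -/
theorem IsScattering.integral_sub_sq_le (h : IsScattering l ε Q V φ) (h' : IsScattering l ε' Q V' φ')
    (hV : ∀ q, V q ≤ V' q) {L : ℝ} (hL : 0 ≤ L) :
    ∫ q in (0 : ℝ)..L, 4 * q ^ (l + 1) * (deriv φ' q - deriv φ q) ^ 2 ≤
      prim l (fun q => V' q * φ' q / 2) Q - prim l (fun q => V q * φ q / 2) Q := by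
  have c := h.contDiff.continuous_deriv_one
  have c' := h'.contDiff.continuous_deriv_one
  set M := max L Q with hM
  have hM0 : 0 ≤ M := hL.trans (le_max_left _ _)
  have hQM : Q ≤ M := le_max_right _ _
  have i : ∀ {f : ℝ → ℝ}, Continuous f → IntervalIntegrable f volume 0 M := fun hf =>
    hf.intervalIntegrable _ _
  have hmono : ∫ q in (0 : ℝ)..L, 4 * q ^ (l + 1) * (deriv φ' q - deriv φ q) ^ 2 ≤
      ∫ q in (0 : ℝ)..M, 4 * q ^ (l + 1) * (deriv φ' q - deriv φ q) ^ 2 := by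
    refine integral_mono_interval le_rfl hL (le_max_left _ _)
      ((ae_restrict_iff' measurableSet_Ioc).2 (Eventually.of_forall fun q hq => ?_))
      (i (by fun_prop))
    have := hq.1.le
    simp only [Pi.zero_apply]
    positivity
  refine hmono.trans ?_
  have w1 := h.integral_weak h.contDiff M
  have w2 := h.integral_weak h'.contDiff M
  have w3 := h'.integral_weak h'.contDiff M
  rw [h.prim_of_ge hQM] at w1 w2
  rw [h'.prim_of_ge hQM, h'.tail M hQM] at w3
  rw [h.tail M hQM] at w1
  rw [h'.tail M hQM] at w2
  have hK : ∫ q in (0 : ℝ)..M, 4 * q ^ (l + 1) * (deriv φ' q - deriv φ q) ^ 2 =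
      ∫ q in (0 : ℝ)..M, (4 * q ^ (l + 1) * deriv φ' q * deriv φ' q -
        2 * (4 * q ^ (l + 1) * deriv φ q * deriv φ' q) + 4 * q ^ (l + 1) * deriv φ q * deriv φ q) :=
    intervalIntegral.integral_congr fun q _ => by ring
  rw [hK, integral_sub_two_mul_add (i (by fun_prop)) (i (by fun_prop)) (i (by fun_prop))]
  have p1 := h.intervalIntegrable_pot h.contDiff.continuous h.contDiff.continuous 0 M
  have p2 := h.intervalIntegrable_pot h.contDiff.continuous h'.contDiff.continuous 0 M
  have p3 := h'.intervalIntegrable_pot h'.contDiff.continuous h'.contDiff.continuous 0 M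
  have hP : 0 ≤ ∫ q in (0 : ℝ)..M, (V' q / 2 * φ' q * φ' q * q ^ l -
      2 * (V q / 2 * φ q * φ' q * q ^ l) + V q / 2 * φ q * φ q * q ^ l) := by
    refine intervalIntegral.integral_nonneg hM0 fun q hq => ?_
    have e : V' q / 2 * φ' q * φ' q * q ^ l - 2 * (V q / 2 * φ q * φ' q * q ^ l) +
        V q / 2 * φ q * φ q * q ^ l = q ^ l * ((V' q - V q) / 2 * φ' q ^ 2 +
          V q / 2 * (φ' q - φ q) ^ 2) := by ring
    rw [e]
    have := sub_nonneg.2 (hV q)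
    have := h.nonneg q
    have := hq.1
    positivity
  rw [integral_sub_two_mul_add p3 p2 p1] at hP
  set e := prim l (fun q => V q * φ q / 2) Q
  set e' := prim l (fun q => V' q * φ' q / 2) Q
  have ht : 0 ≤ (e' - e) ^ 2 / (4 * l * M ^ l) := by positivity
  have et : (e' - e) ^ 2 / (4 * l * M ^ l) = e' * (e' / (4 * l * M ^ l)) -
      2 * e * (e' / (4 * l * M ^ l)) + e * (e / (4 * l * M ^ l)) := by ring
  linarith

theorem IsScattering.prim_mono_pot (h : IsScattering l ε Q V φ) (h' : IsScattering l ε' Q V' φ')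
    (hV : ∀ q, V q ≤ V' q) :
    prim l (fun q => V q * φ q / 2) Q ≤ prim l (fun q => V' q * φ' q / 2) Q := by
  simpa using h.integral_sub_sq_le h' hV le_rfl

theorem IsScattering.prim_nonneg (h : IsScattering l ε Q V φ) :
    0 ≤ prim l (fun q => V q * φ q / 2) Q :=
  QHall.prim_nonneg h.source_nonneg (h.pos.le.trans h.le)

theorem IsScattering.one_sub_le (h : IsScattering l ε Q V φ) (hl : 1 ≤ l) {L q : ℝ}
    (hQL : Q ≤ L) (hLq : L ≤ q) : 1 - prim l (fun q => V q * φ q / 2) Q / (4 * l * L ^ l) ≤ φ q := by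
  rw [h.tail q (hQL.trans hLq)]
  have : 0 < L := (h.pos.trans_le h.le).trans_le hQL
  have := h.prim_nonneg
  have : (0 : ℝ) < l := by exact_mod_cast hl
  gcongr

theorem IsScattering.prim_le_const (h : IsScattering l ε Q V φ) (hl : 1 ≤ l) :
    prim l (fun q => V q * φ q / 2) Q ≤ 4 * l * Q ^ l := by
  have h1 := h.tail Q le_rfl
  have : 0 < Q := h.pos.trans_le h.le
  have : (0 : ℝ) < l := by exact_mod_cast hl
  exact (div_le_one (by positivity : 0 < 4 * (l : ℝ) * Q ^ l)).1 (by linarith [h.sol_pos Q])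

theorem IsScattering.le_add_of_le (h : IsScattering l ε Q V φ) (h' : IsScattering l ε' Q V' φ')
    (hV : ∀ q, V q ≤ V' q) (hl : 1 ≤ l) {r L s q : ℝ} (hr : 0 < r) (hQL : Q ≤ L) (hs : 0 < s)
    (hq : r ≤ q) : φ q ≤ φ' q + (prim l (fun q => V' q * φ' q / 2) Q / (4 * l * L ^ l) +
      s * (prim l (fun q => V' q * φ' q / 2) Q - prim l (fun q => V q * φ q / 2) Q) +
      L / (16 * s * r ^ (l + 1))) := by
  have hL0 : 0 < L := (h.pos.trans_le h.le).trans_le hQL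
  have hle := h.prim_mono_pot h' hV
  set e := prim l (fun q => V q * φ q / 2) Q
  set e' := prim l (fun q => V' q * φ' q / 2) Q
  have h1 : 0 ≤ s * (e' - e) := mul_nonneg hs.le (sub_nonneg.2 hle)
  have h2 : 0 ≤ L / (16 * s * r ^ (l + 1)) := by positivity
  rcases le_total L q with hLq | hLq
  · have := h'.one_sub_le hl hQL hLq
    have := h.sol_le_one q
    linarith
  have c := h.contDiff.continuous_deriv_one
  have c' := h'.contDiff.continuous_deriv_one
  have hF : ∫ τ in q..L, (deriv φ' τ - deriv φ τ) = (φ' L - φ L) - (φ' q - φ q) :=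
    integral_eq_sub_of_hasDerivAt (f := fun q => φ' q - φ q) (fun τ _ =>
      ((h'.contDiff.differentiable (by simp) τ).hasDerivAt.sub
        (h.contDiff.differentiable (by simp) τ).hasDerivAt))
      ((c'.sub c).intervalIntegrable _ _)
  have hq0 : 0 < q := hr.trans_le hq
  have hb : ∫ τ in q..L, (deriv φ' τ - deriv φ τ) ≤
      ∫ τ in q..L, (s * (4 * τ ^ (l + 1) * (deriv φ' τ - deriv φ τ) ^ 2) +
        1 / (16 * s * r ^ (l + 1))) := by
    refine integral_mono_on hLq (intervalIntegrable (by fun_prop) _ _)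
      (intervalIntegrable (by fun_prop) _ _) fun τ hτ => ?_
    have hτ0 : r ≤ τ := hq.trans hτ.1
    have hp : r ^ (l + 1) ≤ τ ^ (l + 1) := by gcongr
    have hrp : 0 < r ^ (l + 1) := by positivity
    generalize deriv φ' τ - deriv φ τ = d
    have e1 : s * (4 * r ^ (l + 1) * d ^ 2) + 1 / (16 * s * r ^ (l + 1)) - d =
        (8 * s * r ^ (l + 1) * d - 1) ^ 2 / (16 * s * r ^ (l + 1)) := by field_simp; ring
    have e2 : 0 ≤ (8 * s * r ^ (l + 1) * d - 1) ^ 2 / (16 * s * r ^ (l + 1)) := by positivity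
    have e3 : s * (4 * r ^ (l + 1) * d ^ 2) ≤ s * (4 * τ ^ (l + 1) * d ^ 2) := by gcongr
    linarith
  rw [hF, intervalIntegral.integral_add (intervalIntegrable (by fun_prop) _ _)
    (by simp), intervalIntegral.integral_const_mul, intervalIntegral.integral_const, smul_eq_mul] at hb
  have hk : ∫ τ in q..L, 4 * τ ^ (l + 1) * (deriv φ' τ - deriv φ τ) ^ 2 ≤ e' - e := by
    refine le_trans ?_ (h.integral_sub_sq_le h' hV hL0.le)
    refine integral_mono_interval hq0.le hLq le_rfl
      ((ae_restrict_iff' measurableSet_Ioc).2 (.of_forall fun τ hτ => ?_))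
      (intervalIntegrable (by fun_prop) _ _)
    have := hτ.1.le
    simp only [Pi.zero_apply]
    positivity
  have h3 := h'.one_sub_le hl hQL le_rfl
  have h4 := h.sol_le_one L
  have h5 := mul_le_mul_of_nonneg_left hk hs.le
  have h6 : (L - q) * (1 / (16 * s * r ^ (l + 1))) ≤ L / (16 * s * r ^ (l + 1)) := by
    rw [mul_one_div]
    gcongr
    linarith
  linarith

/-- A smooth step. -/
theorem exists_step (h0 : 0 < ε) (h1 : ε ≤ 1 / 8) : ∃ Θ : ℝ → ℝ, ContDiff ℝ 1 Θ ∧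
    (∀ x, 0 ≤ Θ x ∧ Θ x ≤ 1) ∧ (∀ x ≤ ε, Θ x = 0) ∧ (∀ x, 1 - ε ≤ x → Θ x = 1) ∧
    (∀ x, 0 ≤ deriv Θ x ∧ deriv Θ x ≤ (1 - 4 * ε)⁻¹) ∧ ∀ x, ε ≤ x → Θ x ≤ (1 - 4 * ε)⁻¹ * (x - ε) := by
  let θ : ContDiffBump (1 / 2 : ℝ) := ⟨1 / 2 - 2 * ε, 1 / 2 - ε, by linarith, by linarith⟩
  have hc : Continuous θ := θ.continuous
  have hi : ∀ a b, IntervalIntegrable θ volume a b := fun a b => hc.intervalIntegrable a b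
  have hz : ∀ x, x ≤ ε ∨ 1 - ε ≤ x → θ x = 0 := fun x hx => θ.zero_of_le_dist (by
    rw [Real.dist_eq]
    rcases hx with hx | hx
    · exact le_trans (by change 1 / 2 - ε ≤ _; linarith) (neg_le_abs _)
    · exact le_trans (by change 1 / 2 - ε ≤ _; linarith) (le_abs_self _))
  have hI0 : ∀ x ≤ ε, ∫ t in ε..x, θ t = 0 := fun x hx => by
    rw [intervalIntegral.integral_symm, integral_of_le hx,
      setIntegral_eq_zero_of_forall_eq_zero fun t ht => hz t (Or.inl ht.2), neg_zero]
  have hI1 : ∀ x, 1 - ε ≤ x → ∫ t in ε..x, θ t = ∫ t in ε..1 - ε, θ t := fun x hx => by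
    rw [← integral_add_adjacent_intervals (hi ε (1 - ε)) (hi (1 - ε) x),
      integral_of_le hx,
      setIntegral_eq_zero_of_forall_eq_zero fun t ht => hz t (Or.inr ht.1.le), add_zero]
  set Z := ∫ t in ε..1 - ε, θ t with hZ
  have hZ1 : 1 - 4 * ε ≤ Z := by
    have e : ∫ t in (2 * ε)..1 - 2 * ε, θ t = 1 - 4 * ε := by
      rw [intervalIntegral.integral_congr (g := fun _ => (1 : ℝ)) fun t ht =>
        θ.one_of_mem_closedBall ?_]
      · simp; ring
      · rw [uIcc_of_le (by linarith)] at ht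
        rw [Metric.mem_closedBall, Real.dist_eq, abs_le]
        exact ⟨by change -(1 / 2 - 2 * ε) ≤ _; linarith [ht.1],
          by change _ ≤ 1 / 2 - 2 * ε; linarith [ht.2]⟩
    rw [← e]
    exact integral_mono_interval (by linarith) (by linarith) (by linarith)
      (Eventually.of_forall fun t => θ.nonneg) (hi _ _)
  have hZ0 : 0 < Z := by linarith
  have hinv : Z⁻¹ ≤ (1 - 4 * ε)⁻¹ := inv_anti₀ (by linarith) hZ1
  have hmono : Monotone fun x => ∫ t in ε..x, θ t := fun a b hab => by
    dsimp only
    rw [← integral_add_adjacent_intervals (hi ε a) (hi a b)]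
    exact le_add_of_nonneg_right (intervalIntegral.integral_nonneg hab fun t _ => θ.nonneg)
  have hd : ∀ x, HasDerivAt (fun x => Z⁻¹ * ∫ t in ε..x, θ t) (Z⁻¹ * θ x) x := fun x =>
    (integral_hasDerivAt_right (hi ε x) (hc.stronglyMeasurableAtFilter _ _)
      hc.continuousAt).const_mul _
  refine ⟨fun x => Z⁻¹ * ∫ t in ε..x, θ t, contDiff_one_iff_deriv.2
    ⟨fun x => (hd x).differentiableAt, ?_⟩, fun x => ⟨?_, ?_⟩, fun x hx => ?_, fun x hx => ?_,
    fun x => ?_, fun x hx => ?_⟩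
  · rw [show deriv _ = _ from funext fun x => (hd x).deriv]
    exact hc.const_mul _
  · refine mul_nonneg (inv_nonneg.2 hZ0.le) ?_
    rw [← hI0 _ (min_le_right x ε)]
    exact hmono (min_le_left x ε)
  · rw [inv_mul_le_iff₀ hZ0, mul_one, ← hI1 _ (le_max_right x (1 - ε))]
    exact hmono (le_max_left _ _)
  · simp only [hI0 x hx, mul_zero]
  · simp only [hI1 x hx]
    exact inv_mul_cancel₀ hZ0.ne'
  · rw [(hd x).deriv]
    exact ⟨mul_nonneg (inv_nonneg.2 hZ0.le) θ.nonneg,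
      (mul_le_of_le_one_right (inv_nonneg.2 hZ0.le) θ.le_one).trans hinv⟩
  · refine mul_le_mul hinv ?_ (intervalIntegral.integral_nonneg hx fun t _ => θ.nonneg)
      (inv_nonneg.2 (by linarith))
    simpa using integral_mono_on hx (hi ε x) (by simp : IntervalIntegrable
      (fun _ => (1 : ℝ)) volume ε x) fun t _ => θ.le_one

end Trial


section Trial

/-- The potential, truncated at height `n` and near the origin. -/
def trunc (v : ℝ → ℝ≥0∞) (Q : ℝ) (n : ℕ) : ℝ → ℝ :=
  (Icc ((n : ℝ) + 1)⁻¹ Q).indicator fun q => (min (v (√q)) n).toReal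

theorem isPot_trunc (hv : Measurable v) (hQ : 1 ≤ Q) (n : ℕ) :
    IsPot ((n : ℝ) + 1)⁻¹ Q (trunc v Q n) where
  pos := by positivity
  le := (inv_le_one_of_one_le₀ (by simp)).trans hQ
  measurable := ((hv.comp Real.continuous_sqrt.measurable).min
    measurable_const).ennreal_toReal.indicator measurableSet_Icc
  nonneg q := indicator_nonneg (fun _ _ => toReal_nonneg) q
  bounded := ⟨n, fun q => Set.indicator_le' (fun _ _ => by
    simpa using toReal_mono (by simp) (min_le_right _ (n : ℝ≥0∞)))
    (fun _ _ => Nat.cast_nonneg n) q⟩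
  support q hq := indicator_of_notMem hq _

theorem monotone_trunc (q : ℝ) : Monotone fun n => trunc v Q n q := fun m n hmn => by
  have h1 : ((n : ℝ) + 1)⁻¹ ≤ ((m : ℝ) + 1)⁻¹ := by gcongr
  by_cases hq : q ∈ Icc ((m : ℝ) + 1)⁻¹ Q
  · simp only [trunc]
    rw [indicator_of_mem hq, indicator_of_mem (Set.mem_Icc.2 ⟨h1.trans hq.1, hq.2⟩)]
    exact toReal_mono (by simp) (min_le_min_left _ (by exact_mod_cast hmn))
  · simp only [trunc]
    rw [indicator_of_notMem hq]
    exact indicator_nonneg (fun _ _ => toReal_nonneg) q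

theorem ofReal_trunc_le (n : ℕ) (w : ℂ) : toE (trunc v Q n (‖w‖ ^ 2)) ≤ v ‖w‖ := by
  by_cases hq : ‖w‖ ^ 2 ∈ Icc ((n : ℝ) + 1)⁻¹ Q
  · rw [trunc, indicator_of_mem hq, sqrt_sq (norm_nonneg w)]
    exact ENNReal.ofReal_toReal_le.trans (min_le_left _ _)
  · rw [trunc, indicator_of_notMem hq]; simp

theorem iSup_trunc (hs : ∀ r, 0 ≤ r → Q < r ^ 2 → v r = 0) {w : ℂ} (hw : w ≠ 0) :
    ⨆ n, toE (trunc v Q n (‖w‖ ^ 2)) = v ‖w‖ := by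
  refine le_antisymm (iSup_le fun n => ofReal_trunc_le n w) ?_
  rcases lt_or_ge Q (‖w‖ ^ 2) with h | h
  · rw [hs _ (norm_nonneg w) h]; exact zero_le
  refine le_of_forall_lt fun c hc => ?_
  obtain ⟨n, hn⟩ := ENNReal.exists_nat_gt hc.ne_top
  obtain ⟨m, hm⟩ := exists_nat_one_div_lt (show 0 < ‖w‖ ^ 2 by positivity)
  rw [lt_iSup_iff]
  refine ⟨max m n, ?_⟩
  have h1 : ((max m n : ℕ) + 1 : ℝ)⁻¹ ≤ ‖w‖ ^ 2 := by
    refine le_trans ?_ hm.le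
    rw [one_div]
    gcongr
    exact le_max_left m n
  rw [trunc, indicator_of_mem (Set.mem_Icc.2 ⟨h1, h⟩), sqrt_sq (norm_nonneg w),
    ofReal_toReal (by simp), lt_min_iff]
  exact ⟨hc, hn.trans_le (by exact_mod_cast le_max_right m n)⟩

theorem add_sq_le_of_pos {t : ℝ} (ht : 0 < t) (a b : ℝ) :
    (a + b) ^ 2 ≤ (1 + t) * a ^ 2 + (1 + t⁻¹) * b ^ 2 := by
  have e : (1 + t) * a ^ 2 + (1 + t⁻¹) * b ^ 2 - (a + b) ^ 2 = (t * a - b) ^ 2 / t := by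
    field_simp
    ring
  have : 0 ≤ (t * a - b) ^ 2 / t := by positivity
  linarith

theorem kinetic_trial_le {Θ φ : ℝ → ℝ} (hΘ : ContDiff ℝ 1 Θ) {c : ℝ}
    (hd : ∀ x, 0 ≤ deriv Θ x ∧ deriv Θ x ≤ c) (h1 : ∀ x, 1 ≤ x → Θ x = 1) (hφ : ContDiff ℝ 1 φ)
    {r L t : ℝ} (hr : 0 < r) (hL : 2 * r ≤ L) (ht : 0 < t) :
    ∫ q in (0 : ℝ)..L, 4 * q ^ (l + 1) * deriv (fun q => Θ (φ q - 1 + Θ (q / r - 1))) q ^ 2 ≤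
      c ^ 2 * ((1 + t) * (∫ q in (0 : ℝ)..L, 4 * q ^ (l + 1) * deriv φ q ^ 2) +
        (1 + t⁻¹) * (c ^ 2 * 2 ^ (l + 4) * r ^ l)) := by
  have hΘd : ∀ x, HasDerivAt Θ (deriv Θ x) x := fun x => (hΘ.differentiable (by simp) x).hasDerivAt
  have hφd : ∀ x, HasDerivAt φ (deriv φ x) x := fun x => (hφ.differentiable (by simp) x).hasDerivAt
  have cΘ := hΘ.continuous_deriv_one
  have cφ := hφ.continuous_deriv_one
  have c1 := hΘ.continuous
  have c2 := hφ.continuous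
  have hin : ∀ q, HasDerivAt (fun q => Θ (q / r - 1)) (deriv Θ (q / r - 1) * r⁻¹) q := fun q => by
    have := (hΘd (q / r - 1)).comp q (((hasDerivAt_id q).div_const r).sub_const 1)
    rw [one_div] at this
    exact this
  have hF : ∀ q, deriv (fun q => Θ (φ q - 1 + Θ (q / r - 1))) q =
      deriv Θ (φ q - 1 + Θ (q / r - 1)) * (deriv φ q + deriv Θ (q / r - 1) * r⁻¹) := fun q =>
    ((hΘd _).comp q (((hφd q).sub_const 1).add (hin q))).deriv
  have hc0 : 0 ≤ c := (hd 0).1.trans (hd 0).2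
  have hsq : ∀ x, deriv Θ x ^ 2 ≤ c ^ 2 := fun x => pow_le_pow_left₀ (hd x).1 (hd x).2 2
  set D : ℝ → ℝ := fun q => 4 * q ^ (l + 1) * (deriv Θ (q / r - 1) * r⁻¹) ^ 2 with hD
  have hDc : Continuous D := by fun_prop
  have hDi : ∫ q in (0 : ℝ)..L, D q ≤ c ^ 2 * 2 ^ (l + 4) * r ^ l := by
    rw [← integral_add_adjacent_intervals (hDc.intervalIntegrable 0 (2 * r))
      (hDc.intervalIntegrable (2 * r) L), integral_of_le hL,
      setIntegral_eq_zero_of_forall_eq_zero fun q hq => ?_, add_zero]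
    · have := integral_mono_on (by positivity : (0 : ℝ) ≤ 2 * r)
        (hDc.intervalIntegrable 0 (2 * r)) (by simp : IntervalIntegrable
          (fun _ => 4 * (2 * r) ^ (l + 1) * (c ^ 2 * r⁻¹ ^ 2)) volume 0 (2 * r)) fun q hq => by
        have h0 := hq.1
        simp only [hD, mul_pow (deriv Θ _)]
        gcongr
        · exact hq.2
        · exact (hd _).1
        · exact (hd _).2
      rw [intervalIntegral.integral_const, smul_eq_mul] at this
      refine this.trans_eq ?_
      field_simp
      ring
    · have : 1 < q / r - 1 := by
        rw [lt_sub_iff_add_lt, lt_div_iff₀ hr]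
        linarith [hq.1]
      simp only [hD, deriv_eq_zero_of_eq_one h1 this]
      ring
  have hL0 : 0 ≤ L := by linarith
  calc _ ≤ ∫ q in (0 : ℝ)..L, c ^ 2 * ((1 + t) * (4 * q ^ (l + 1) * deriv φ q ^ 2) +
        (1 + t⁻¹) * D q) := by
        simp only [hF]
        refine integral_mono_on hL0 (intervalIntegrable (by fun_prop) _ _)
          (intervalIntegrable (by fun_prop) _ _) fun q hq => ?_
        have hq0 := hq.1
        have hp : 0 ≤ 4 * q ^ (l + 1) := by positivity
        have e1 := mul_le_mul (hsq (φ q - 1 + Θ (q / r - 1)))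
          (add_sq_le_of_pos ht (deriv φ q) (deriv Θ (q / r - 1) * r⁻¹)) (sq_nonneg _) (sq_nonneg c)
        have e2 := mul_le_mul_of_nonneg_left e1 hp
        rw [mul_pow]
        refine e2.trans_eq ?_
        simp only [hD]
        ring
    _ ≤ _ := by
        rw [intervalIntegral.integral_const_mul, intervalIntegral.integral_add
          (intervalIntegrable (by fun_prop) _ _)
          (intervalIntegrable (by fun_prop) _ _), intervalIntegral.integral_const_mul,
          intervalIntegral.integral_const_mul]
        gcongr

theorem lintegral_pot_le (hv : Measurable v) (hs : ∀ r, 0 ≤ r → Q < r ^ 2 → v r = 0)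
    (hF : Continuous F) {c P L : ℝ} {n : ℕ} (hL0 : 0 ≤ L) (hL : Q ≤ L)
    {φ : ℕ → ℝ → ℝ} {ε : ℕ → ℝ} (h : ∀ n, IsScattering l (ε n) Q (trunc v Q n) (φ n))
    (hFφ : ∀ m, n ≤ m → ∀ q, 0 < q → F q ^ 2 ≤ c ^ 2 * φ m q ^ 2)
    (hP : ∀ m, n ≤ m → ∫ q in (0 : ℝ)..L, trunc v Q m q / 2 * φ m q * φ m q * q ^ l ≤ P) :
    ∫⁻ w : ℂ, toE (‖w‖ ^ (2 * l)) * (v ‖w‖ * toE (F (‖w‖ ^ 2) ^ 2)) ≤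
      toE (2 * (π * (c ^ 2 * P))) := by
  have hne : ∀ᵐ x : ℂ, x ≠ 0 := by simp [ae_iff]
  have hmono : ∀ w : ℂ, Monotone fun m => toE (‖w‖ ^ (2 * l)) *
      (toE (trunc v Q m (‖w‖ ^ 2)) * toE (F (‖w‖ ^ 2) ^ 2)) :=
    fun w m m' hm => by
      have := monotone_trunc (v := v) (Q := Q) (‖w‖ ^ 2) hm
      dsimp only at this ⊢
      gcongr
  rw [lintegral_congr_ae (g := fun w : ℂ => ⨆ m, toE (‖w‖ ^ (2 * l)) *
    (toE (trunc v Q m (‖w‖ ^ 2)) * toE (F (‖w‖ ^ 2) ^ 2))), lintegral_iSup]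
  · refine iSup_le fun m => (lintegral_mono fun w => hmono w (le_max_left m n)).trans ?_
    have hm := le_max_right m n
    generalize max m n = m at hm ⊢
    have hi := h m |>.intervalIntegrable_pot (h m).contDiff.continuous (h m).contDiff.continuous 0 L
    have h1 := (h m).measurable
    have h2 := (h m).measurable_sol
    have hr := lintegral_ofReal_radial (D := fun q => 2 * c ^ 2 *
      (trunc v Q m q / 2 * φ m q * φ m q * q ^ l)) (by fun_prop) hL0 (hi.const_mul _) fun q hq => by
        have := (h m).nonneg q
        have := (h m).sol_pos q
        positivity
    refine le_trans ?_ (hr.trans_le (ofReal_le_ofReal ?_))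
    · refine lintegral_mono_ae ?_
      filter_upwards [hne] with w hw
      have hq : 0 < ‖w‖ ^ 2 := by positivity
      have hV := (h m).nonneg (‖w‖ ^ 2)
      rw [pow_mul]
      rcases le_or_gt (‖w‖ ^ 2) L with hwL | hwL
      · rw [indicator_of_mem (Set.mem_Iic.2 hwL), ← ENNReal.ofReal_mul hV,
          ← ENNReal.ofReal_mul (by positivity)]
        refine ofReal_le_ofReal ?_
        have := mul_le_mul_of_nonneg_left (hFφ m hm _ hq) (mul_nonneg (pow_nonneg hq.le l) hV)
        linarith
      · rw [(h m).support _ fun hc => by linarith [hc.2]]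
        simp
    · rw [intervalIntegral.integral_const_mul]
      have := mul_le_mul_of_nonneg_left (hP m hm) (by positivity : 0 ≤ 2 * π * c ^ 2)
      linarith
  · intro m
    have h1 := (h m).measurable
    have h2 := hF.measurable
    fun_prop
  · exact fun m m' hm w => hmono w hm
  · filter_upwards [hne] with w hw
    rw [← iSup_trunc hs hw, ENNReal.iSup_mul, ENNReal.mul_iSup]

/-- Trial functions whose energy is close to the limit of the truncated scattering energies. -/
theorem exists_trial (hv : Measurable v) (hQ : 1 ≤ Q) (hs : ∀ r, 0 ≤ r → Q < r ^ 2 → v r = 0)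
    (hl : 1 ≤ l) {φ : ℕ → ℝ → ℝ} {ε : ℕ → ℝ} (h : ∀ n, IsScattering l (ε n) Q (trunc v Q n) (φ n))
    {e : ℝ} (he : Tendsto (fun n => prim l (fun q => trunc v Q n q * φ n q / 2) Q) atTop (𝓝 e))
    {δ : ℝ} (hδ : 0 < δ) : ∃ F : ℝ → ℝ, ContDiff ℝ 1 F ∧ (∀ q, 0 ≤ F q ∧ F q ≤ 1) ∧
      (∃ L, ∀ q, L ≤ q → F q = 1) ∧ ∫⁻ w : ℂ, toE (‖w‖ ^ (2 * l)) * upKernel v 1 F w ≤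
        toE (2 * (π * (e + δ))) := by
  set E : ℕ → ℝ := fun n => prim l (fun q => trunc v Q n q * φ n q / 2) Q with hE
  have hle : ∀ {m n : ℕ}, m ≤ n → ∀ q, trunc v Q m q ≤ trunc v Q n q := fun hmn q =>
    monotone_trunc q hmn
  have hEm : Monotone E := fun m n hmn => (h m).prim_mono_pot (h n) (hle hmn)
  have hEe : ∀ n, E n ≤ e := hEm.ge_of_tendsto he
  have he0 : 0 ≤ e := (h 0).prim_nonneg.trans (hEe 0)
  have hl' : (1 : ℝ) ≤ l := by exact_mod_cast hl
  obtain ⟨t, ht0, ht8, htδ⟩ : ∃ t : ℝ, 0 < t ∧ t ≤ 1 / 8 ∧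
      (1 - 4 * t)⁻¹ ^ 2 * (e + 2 * t * e + 2 * t) ≤ e + δ := by
    have hc : ContinuousAt (fun t : ℝ => (1 - 4 * t)⁻¹ ^ 2 * (e + 2 * t * e + 2 * t)) 0 := by
      have : ContinuousAt (fun t : ℝ => (1 - 4 * t)⁻¹) 0 :=
        ContinuousAt.inv₀ (by fun_prop) (by norm_num)
      fun_prop
    have h1 := hc.tendsto.eventually_lt_const (u := e + δ) (by simpa using hδ)
    have h2 : ∀ᶠ t : ℝ in 𝓝[>] 0, t < 1 / 8 := nhdsWithin_le_nhds (gt_mem_nhds (by norm_num))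
    obtain ⟨t, h3, h4, h5⟩ := ((h1.filter_mono nhdsWithin_le_nhds).and (h2.and self_mem_nhdsWithin)).exists
    exact ⟨t, h5, h4.le, h3.le⟩
  obtain ⟨Θ, hΘ, hΘ1, hΘ0, hΘs, hΘd, hΘl⟩ := exists_step ht0 ht8
  set c := (1 - 4 * t)⁻¹ with hc
  have hc0 : 0 < c := inv_pos.2 (by linarith)
  obtain ⟨r, hr0, hr1, hr⟩ : ∃ r : ℝ, 0 < r ∧ r ≤ 1 ∧ (1 + t⁻¹) * (c ^ 2 * 2 ^ (l + 4) * r ^ l) ≤ t := by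
    set K := (1 + t⁻¹) * (c ^ 2 * 2 ^ (l + 4)) with hK
    have hK0 : 0 < K := by positivity
    refine ⟨min 1 (t / K), by positivity, min_le_left _ _, ?_⟩
    have h1 : min 1 (t / K) ^ l ≤ t / K :=
      (pow_le_of_le_one (by positivity) (min_le_left _ _) (by omega)).trans (min_le_right _ _)
    calc _ = K * min 1 (t / K) ^ l := by ring
      _ ≤ K * (t / K) := by gcongr
      _ = t := by field_simp
  set L := Q + 2 + e / t with hL
  have hQL : Q ≤ L := by have : 0 ≤ e / t := by positivity
                         linarith
  have hL1 : 2 ≤ L := by have : 0 ≤ e / t := by positivity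
                         linarith
  have hEL : ∀ m, E m / (4 * l * L ^ l) ≤ t / 4 := fun m => by
    rw [div_le_iff₀ (by positivity)]
    have h1 : L ≤ L ^ l := le_self_pow₀ (by linarith) (by omega)
    have h2 : e ≤ t * L := by
      rw [hL, mul_add, mul_div_cancel₀ _ ht0.ne']
      nlinarith
    calc E m ≤ t * L := (hEe m).trans h2
      _ ≤ t * (l * L ^ l) := by gcongr; nlinarith
      _ = _ := by ring
  set s := L / (4 * t * r ^ (l + 1)) with hsd
  have hs0 : 0 < s := by positivity
  obtain ⟨n, hn⟩ : ∃ n, s * (e - E n) ≤ t / 4 ∧ (1 + t⁻¹) * (e - E n) ≤ t := by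
    have h1 : Tendsto (fun n => s * (e - E n)) atTop (𝓝 0) := by
      simpa using (he.const_sub e).const_mul s
    have h2 : Tendsto (fun n => (1 + t⁻¹) * (e - E n)) atTop (𝓝 0) := by
      simpa using (he.const_sub e).const_mul (1 + t⁻¹)
    obtain ⟨n, h3, h4⟩ := ((h1.eventually_lt_const (by positivity : 0 < t / 4)).and
      (h2.eventually_lt_const ht0)).exists
    exact ⟨n, h3.le, h4.le⟩
  have hclose : ∀ m, n ≤ m → ∀ q, r ≤ q → φ n q ≤ φ m q + t := fun m hm q hq => by
    have h1 := (h n).le_add_of_le (h m) (hle hm) hl hr0 hQL hs0 hq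
    have h2 := hEL m
    have h3 : s * (E m - E n) ≤ s * (e - E n) := by gcongr; exact hEe m
    have h4 : L / (16 * s * r ^ (l + 1)) = t / 4 := by rw [hsd]; field_simp; norm_num
    linarith [hn.1]
  set F : ℝ → ℝ := fun q => Θ (φ n q - 1 + Θ (q / r - 1)) with hF
  have hFc : ContDiff ℝ 1 F := hΘ.comp (((h n).contDiff.sub contDiff_const).add
    (hΘ.comp ((contDiff_id.div_const r).sub contDiff_const)))
  have hF1 : ∀ q, L ≤ q → F q = 1 := fun q hq => hΘs _ (by
    rw [hΘs (q / r - 1)]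
    · have := (h n).one_sub_le hl hQL hq
      linarith [hEL n]
    · have : 2 ≤ q / r := by rw [le_div_iff₀ hr0]; nlinarith
      linarith)
  refine ⟨F, hFc, fun q => hΘ1 _, ⟨L, hF1⟩, ?_⟩
  set k : ℕ → ℝ := fun m => ∫ q in (0 : ℝ)..L, 4 * q ^ (l + 1) * deriv (φ m) q ^ 2 with hk
  have hcd : ∀ m, Continuous (deriv (φ m)) := fun m => (h m).contDiff.continuous_deriv_one
  have hL0 : 0 ≤ L := by linarith
  have hkp : ∀ m, k m + (∫ q in (0 : ℝ)..L, trunc v Q m q / 2 * φ m q * φ m q * q ^ l) ≤ e := fun m => by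
    have h1 := (h m).integral_weak (h m).contDiff L
    rw [(h m).prim_of_ge hQL] at h1
    simp only [hk, sq, ← mul_assoc]
    rw [h1]
    exact (mul_le_of_le_one_right (h m).prim_nonneg ((h m).sol_le_one L)).trans (hEe m)
  have hknn : ∀ m, 0 ≤ k m := fun m => intervalIntegral.integral_nonneg hL0 fun q hq => by
    have := hq.1
    positivity
  have hkk : ∀ m, n ≤ m → k n ≤ (1 + t) * k m + t := fun m hm => by
    have h1 := (h n).integral_sub_sq_le (h m) (hle hm) hL0
    have c1 := hcd n
    have c2 := hcd m
    have h2 : k n ≤ ∫ q in (0 : ℝ)..L, ((1 + t) * (4 * q ^ (l + 1) * deriv (φ m) q ^ 2) +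
        (1 + t⁻¹) * (4 * q ^ (l + 1) * (deriv (φ m) q - deriv (φ n) q) ^ 2)) := by
      refine integral_mono_on hL0 (intervalIntegrable (by fun_prop) _ _)
        (intervalIntegrable (by fun_prop) _ _) fun q hq => ?_
      have hp : 0 ≤ 4 * q ^ (l + 1) := by have := hq.1; positivity
      have := mul_le_mul_of_nonneg_left (add_sq_le_of_pos ht0 (deriv (φ m) q)
        (deriv (φ n) q - deriv (φ m) q)) hp
      rw [add_sub_cancel] at this
      refine this.trans_eq ?_
      ring
    rw [intervalIntegral.integral_add (intervalIntegrable (by fun_prop) _ _)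
      (intervalIntegrable (by fun_prop) _ _), intervalIntegral.integral_const_mul,
      intervalIntegral.integral_const_mul] at h2
    have h3 : (1 + t⁻¹) * (∫ q in (0 : ℝ)..L, 4 * q ^ (l + 1) *
        (deriv (φ m) q - deriv (φ n) q) ^ 2) ≤ (1 + t⁻¹) * (e - E n) := by
      gcongr
      exact h1.trans (sub_le_sub_right (hEe m) _)
    linarith [hn.2]
  have hpot := lintegral_pot_le (c := c) (P := e - (1 - t) * k n + t) (n := n) hv hs hFc.continuous hL0
    hQL h (fun m hm q hq => by
      rw [← mul_pow]
      refine pow_le_pow_left₀ (hΘ1 _).1 ?_ 2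
      have hφm := (h m).sol_pos q
      rcases le_or_gt (φ n q - 1 + Θ (q / r - 1)) t with h1 | h1
      · rw [hΘ0 _ h1]
        positivity
      · refine (hΘl _ h1.le).trans (mul_le_mul_of_nonneg_left ?_ hc0.le)
        have h2 := (hΘ1 (q / r - 1)).2
        have h3 : r ≤ q := by
          by_contra hlt
          rw [hΘ0 (q / r - 1)] at h1
          · linarith [(h n).sol_le_one q]
          · have := (div_lt_one hr0).2 (not_le.1 hlt)
            linarith
        linarith [hclose m hm q h3]) fun m hm => by
      have h1 := hkp m
      have h2 := hkk m hm
      have h3 := hknn m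
      have h5 := hknn n
      have h6 : (1 - t) * k n ≤ k m + t := by
        have := mul_le_mul_of_nonneg_left h2 (by linarith : 0 ≤ 1 - t)
        nlinarith [mul_nonneg (sq_nonneg t) h3]
      linarith
  have hkin : ∫⁻ w : ℂ, toE (‖w‖ ^ (2 * l)) *
      toE (8 * ‖w‖ ^ 2 * deriv F (‖w‖ ^ 2) ^ 2) ≤
      toE (2 * (π * (c ^ 2 * ((1 + t) * k n + t)))) := by
    have c3 := hFc.continuous_deriv_one
    have hD : Continuous fun q => 2 * (4 * q ^ (l + 1) * deriv F q ^ 2) := by fun_prop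
    have hr' := lintegral_ofReal_radial hD.measurable hL0 (hD.intervalIntegrable 0 L)
      fun q hq => by positivity
    refine le_trans (lintegral_mono fun w => ?_) (hr'.trans_le (ofReal_le_ofReal ?_))
    · rw [← ENNReal.ofReal_mul (by positivity), pow_mul]
      rcases le_or_gt (‖w‖ ^ 2) L with hw | hw
      · rw [indicator_of_mem (Set.mem_Iic.2 hw)]
        exact ofReal_le_ofReal (by ring_nf; rfl)
      · rw [deriv_eq_zero_of_eq_one hF1 hw]
        simp
    · rw [intervalIntegral.integral_const_mul]
      have h1 := kinetic_trial_le (l := l) (r := r) (L := L) (t := t) hΘ hΘd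
        (fun x hx => hΘs x (by linarith)) (h n).contDiff hr0 (by linarith) ht0
      have h2 := mul_le_mul_of_nonneg_left (h1.trans (mul_le_mul_of_nonneg_left
        (add_le_add_right hr _) (sq_nonneg c))) Real.pi_pos.le
      linarith
  have hm1 : Measurable fun w : ℂ => toE (‖w‖ ^ (2 * l)) *
      toE (8 * ‖w‖ ^ 2 * deriv F (‖w‖ ^ 2) ^ 2) := by
    have := hFc.continuous_deriv_one.measurable
    fun_prop
  have hk0 := hknn n
  have hke : k n ≤ e := by
    have := hkp n
    have h2 : 0 ≤ ∫ q in (0 : ℝ)..L, trunc v Q n q / 2 * φ n q * φ n q * q ^ l :=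
      intervalIntegral.integral_nonneg hL0 fun q hq => by
        have := (h n).nonneg q
        have := (h n).sol_pos q
        have := hq.1
        positivity
    linarith
  have htk : t * k n ≤ t * e := by gcongr
  calc _ = (∫⁻ w : ℂ, toE (‖w‖ ^ (2 * l)) *
        toE (8 * ‖w‖ ^ 2 * deriv F (‖w‖ ^ 2) ^ 2)) + ∫⁻ w : ℂ,
        toE (‖w‖ ^ (2 * l)) * (v ‖w‖ * toE (F (‖w‖ ^ 2) ^ 2)) := by
        rw [← lintegral_add_left hm1]
        simp [upKernel, vScaled, mul_add]
    _ ≤ _ := add_le_add hkin hpot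
    _ = toE (2 * (π * (c ^ 2 * (e + 2 * t * k n + 2 * t)))) := by
        rw [← ENNReal.ofReal_add (by positivity)]
        · congr 1
          ring
        · have : 0 ≤ e - (1 - t) * k n + t := by nlinarith
          positivity
    _ ≤ _ := by
        refine ofReal_le_ofReal ?_
        have := mul_le_mul_of_nonneg_left (by linarith : e + 2 * t * k n + 2 * t ≤
          e + 2 * t * e + 2 * t) (sq_nonneg c)
        gcongr
        exact this.trans htδ

end Trial


/-! ### Certificates for the effective coupling constants -/

section Certificates

theorem integral_eq_scale {b : ℝ} (hb : b ≠ 0) (g : ℝ → ℝ) (M : ℝ) :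
    ∫ q in (0 : ℝ)..M, g q = b * ∫ x in (0 : ℝ)..M / b, g (b * x) := by
  rw [intervalIntegral.integral_comp_mul_left _ hb, mul_zero, mul_div_cancel₀ _ hb, smul_eq_mul,
    mul_inv_cancel_left₀ hb]

theorem isLowCert_scaled {y : ℝ → ℝ} (h : IsPot ε Q V)
    (hV : ∀ w : ℂ, toE (V (‖w‖ ^ 2)) ≤ v ‖w‖) (hy : Measurable y)
    (hy0 : ∀ q, 0 ≤ y q) (hy1 : ∀ q, y q ≤ 1) {a c s κ R δ : ℝ} (ha : 0 < a) (hR : 0 < R)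
    (haQ : a ^ 2 * Q ≤ R ^ 2) (hc : 0 ≤ c) (hs : 0 ≤ s)
    (hκ : 2 * c * (π * (a ^ (2 * l) * s * prim l (fun q => V q * y q / 2) Q)) = κ)
    (hb : c * a ^ (2 * l) * s ^ 2 * (2 * π) * ((∫ q in (0 : ℝ)..4 * R ^ 2 / a ^ 2,
      prim l (fun q => V q * y q / 2) q ^ 2 / (4 * q ^ (l + 1))) +
      ∫ q in (0 : ℝ)..4 * R ^ 2 / a ^ 2, V q / 2 * y q * y q * q ^ l) ≤ κ + δ) :
    IsLowCert v l a c κ R δ (a ^ 2 * ε) (fun q => (a ^ 2)⁻¹ * V (q / a ^ 2))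
      fun q => s * y (q / a ^ 2) := by
  obtain ⟨B, hB⟩ := h.bounded
  have ha2 : 0 < a ^ 2 := by positivity
  have hm := h.measurable
  rw [pow_mul] at hκ hb
  generalize hbe : a ^ 2 = b at *
  have hVm : Measurable fun q => b⁻¹ * V (q / b) := by fun_prop
  have hsup : ∀ q, q ∉ Icc (b * ε) (R ^ 2) → b⁻¹ * V (q / b) = 0 := fun q hq => by
    rw [h.support _ fun hc => hq ⟨?_, ?_⟩, mul_zero]
    · have := (le_div_iff₀ ha2).1 hc.1
      linarith
    · have := (div_le_iff₀ ha2).1 hc.2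
      linarith
  have hprim : ∀ q, prim l (fun q => b⁻¹ * V (q / b) * (s * y (q / b)) / 2) q =
      b ^ l * s * prim l (fun q => V q * y q / 2) (q / b) := fun q => by
    rw [prim, integral_eq_scale ha2.ne', prim, ← intervalIntegral.integral_const_mul,
      ← intervalIntegral.integral_const_mul]
    refine intervalIntegral.integral_congr fun x _ => ?_
    simp only [mul_div_cancel_left₀ x ha2.ne', mul_pow]
    field_simp
  refine ⟨mul_pos ha2 h.pos, ?_, hR, hc, hVm, by fun_prop, fun q => ?_, fun q => mul_nonneg hs (hy0 _),
    ⟨b⁻¹ * B, fun q => ?_⟩, ⟨s * 1, fun q => mul_le_mul_of_nonneg_left (hy1 _) hs⟩, hsup,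
    fun w => ?_, ?_, ?_⟩
  · exact (mul_le_mul_of_nonneg_left h.le ha2.le).trans haQ
  · exact mul_nonneg (inv_nonneg.2 ha2.le) (h.nonneg _)
  · exact mul_le_mul_of_nonneg_left (hB _) (inv_nonneg.2 ha2.le)
  · rw [vScaled, hbe, ENNReal.ofReal_mul (inv_nonneg.2 ha2.le)]
    refine mul_le_mul_right ?_ _
    have := hV (w / a)
    rwa [norm_div, Complex.norm_of_nonneg ha.le, div_pow, hbe] at this
  · rw [moment_eq_prim (by fun_prop) (sq_nonneg R) fun q hq => by
      rw [hsup q fun hc => by linarith [hc.2]]; simp, hprim, ← hκ, prim_eq_of_zero_Ici (Q := Q) (by fun_prop)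
      (h.bounded_mul hy0 fun q _ => hy1 q) (fun q hq => h.mul_eq_zero y fun hc => by linarith [hc.2])
      ((le_div_iff₀ ha2).2 (by linarith))]
  · have e1 : ∫ q in (0 : ℝ)..4 * R ^ 2,
        prim l (fun q => b⁻¹ * V (q / b) * (s * y (q / b)) / 2) q ^ 2 / (4 * q ^ (l + 1)) =
        b ^ l * s ^ 2 * ∫ q in (0 : ℝ)..4 * R ^ 2 / b,
          prim l (fun q => V q * y q / 2) q ^ 2 / (4 * q ^ (l + 1)) := by
      rw [integral_eq_scale ha2.ne', ← intervalIntegral.integral_const_mul,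
        ← intervalIntegral.integral_const_mul]
      refine intervalIntegral.integral_congr fun x _ => ?_
      simp only [hprim, mul_div_cancel_left₀ x ha2.ne', mul_pow]
      rcases eq_or_ne x 0 with rfl | hx
      · simp
      · field_simp
        ring
    have e2 : ∫ q in (0 : ℝ)..R ^ 2, b⁻¹ * V (q / b) * (s * y (q / b)) ^ 2 * q ^ l =
        2 * (b ^ l * s ^ 2 * ∫ q in (0 : ℝ)..R ^ 2 / b, V q / 2 * y q * y q * q ^ l) := by
      rw [integral_eq_scale ha2.ne', ← intervalIntegral.integral_const_mul,
        ← intervalIntegral.integral_const_mul, ← intervalIntegral.integral_const_mul]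
      refine intervalIntegral.integral_congr fun x _ => ?_
      simp only [mul_div_cancel_left₀ x ha2.ne', mul_pow]
      field_simp
    have hyC : ∃ C, ∀ q, |V q / 2 * y q * y q| ≤ C := ⟨B / 2, fun q => by
      have h1 := h.nonneg q
      have h2 := hy0 q
      rw [abs_of_nonneg (by positivity), mul_assoc]
      have := mul_le_mul (hB q) (mul_le_one₀ (hy1 q) h2 (hy1 q)) (by positivity) (h1.trans (hB q))
      linarith⟩
    have e3 : ∫ q in (0 : ℝ)..R ^ 2 / b, V q / 2 * y q * y q * q ^ l ≤
        ∫ q in (0 : ℝ)..4 * R ^ 2 / b, V q / 2 * y q * y q * q ^ l :=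
      prim_mono (k := fun q => V q / 2 * y q * y q) (by fun_prop) hyC (fun q => by
        have := h.nonneg q
        have := hy0 q
        positivity) (by positivity) (by gcongr; linarith [sq_nonneg R])
    rw [e1, e2]
    refine le_trans ?_ hb
    have := mul_le_mul_of_nonneg_left e3
      (by positivity : 0 ≤ c * b ^ l * s ^ 2 * (2 * π))
    linarith

theorem eventually_sq_mul_le (K : ℝ) {M : ℝ} (hM : 0 < M) : ∀ᶠ a in 𝓝₊, a ^ 2 * K ≤ M := by
  have : Tendsto (fun a : ℝ => a ^ 2 * K) (𝓝 0) (𝓝 (0 ^ 2 * K)) :=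
    (by fun_prop : Continuous fun a : ℝ => a ^ 2 * K).tendsto 0
  exact ((this.eventually_lt_const (by simpa using hM)).mono fun a => le_of_lt).filter_mono
    nhdsWithin_le_nhds

theorem exists_prim_trunc_pos (hv : Measurable v) (hv0 : ¬ ∀ᵐ x : ℂ, v ‖x‖ = 0) (hQ : 1 ≤ Q)
    (hs : ∀ r, 0 ≤ r → Q < r ^ 2 → v r = 0) (l : ℕ) {y : ℕ → ℝ → ℝ} (hy : ∀ n, Measurable (y n))
    (hy0 : ∀ n q, 0 < y n q) (hy1 : ∀ n q, y n q ≤ 1) :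
    ∃ n, 0 < prim l (fun q => trunc v Q n q * y n q / 2) Q := by
  by_contra! hc
  refine hv0 ?_
  have h1 : ∀ n, ∀ᵐ q, 0 < q → trunc v Q n q = 0 := fun n => by
    have hp := isPot_trunc hv hQ n
    have hk0 : ∀ q, 0 ≤ trunc v Q n q * y n q / 2 := fun q =>
      div_nonneg (mul_nonneg (hp.nonneg q) (hy0 n q).le) zero_le_two
    have hQ0 : 0 ≤ Q := by linarith
    have h2 := (intervalIntegral.integral_eq_zero_iff_of_le_of_nonneg_ae hQ0
      ((ae_restrict_iff' measurableSet_Ioc).2 (.of_forall fun q hq =>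
        mul_nonneg (hk0 q) (pow_nonneg hq.1.le l)))
      (intervalIntegrable_mul_pow ((hp.measurable.mul (hy n)).div_const 2)
        (hp.bounded_mul (fun q => (hy0 n q).le) fun q _ => hy1 n q) l 0 Q)).1
      (le_antisymm (hc n) (prim_nonneg hk0 hQ0))
    filter_upwards [(ae_restrict_iff' measurableSet_Ioc).1 h2] with q hq hq0
    rcases le_or_gt q Q with h3 | h3
    · have h4 : trunc v Q n q * y n q / 2 * q ^ l = 0 := hq ⟨hq0, h3⟩
      simpa [(hy0 n q).ne', hq0.ne'] using h4
    · exact hp.support q fun hc => hc.2.not_gt h3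
  have hne : ∀ᵐ x : ℂ, x ≠ 0 := by simp [ae_iff]
  filter_upwards [ae_norm_sq (ae_all_iff.2 h1), hne] with w hw hw0
  rw [← iSup_trunc hs hw0]
  simp [fun n => hw n (by positivity)]

theorem lintegral_upKernel_scaled (hv : Measurable v) (hF : ContDiff ℝ 1 F) {a : ℝ}
    (ha : 0 < a) : ∫⁻ w : ℂ, toE (‖w‖ ^ (2 * l)) * upKernel v a (fun q => F (q / a ^ 2)) w =
      toE (a ^ (2 * l)) * ∫⁻ w : ℂ, toE (‖w‖ ^ (2 * l)) * upKernel v 1 F w := by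
  have hm := measurable_upKernel hv a (hF.comp (contDiff_id.div_const (a ^ 2)))
  have hm1 := measurable_upKernel hv 1 hF
  have hmap := Measure.map_addHaar_smul (volume : Measure ℂ) ha.ne'
  rw [Complex.finrank_real_complex, abs_of_pos (by positivity)] at hmap
  have h1 := lintegral_map (μ := (volume : Measure ℂ)) (f := fun w : ℂ => toE (‖w‖ ^ (2 * l)) *
    upKernel v a (fun q => F (q / a ^ 2)) w) (g := fun w => a • w)
    ((by fun_prop : Measurable fun w : ℂ => toE (‖w‖ ^ (2 * l))).mul hm) (by fun_prop)
  rw [hmap, lintegral_smul_measure, smul_eq_mul] at h1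
  have hd : ∀ q, deriv (fun q => F (q / a ^ 2)) (a ^ 2 * q) = deriv F q / a ^ 2 := fun q => by
    have h2 := (hF.differentiable (by simp) (a ^ 2 * q / a ^ 2)).hasDerivAt.comp (a ^ 2 * q)
      ((hasDerivAt_id (a ^ 2 * q)).div_const (a ^ 2))
    rw [mul_div_cancel_left₀ _ (by positivity : a ^ 2 ≠ 0)] at h2
    rw [← mul_one_div]
    exact h2.deriv
  have e : ∀ w : ℂ, toE (‖a • w‖ ^ (2 * l)) * upKernel v a (fun q => F (q / a ^ 2)) (a • w) =
      toE (a ^ 2)⁻¹ * (toE (a ^ (2 * l)) *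
        (toE (‖w‖ ^ (2 * l)) * upKernel v 1 F w)) := fun w => by
    have e1 : toE (8 * (a ^ 2 * ‖w‖ ^ 2) * (deriv F (‖w‖ ^ 2) / a ^ 2) ^ 2) =
        toE (a ^ 2)⁻¹ * toE (8 * ‖w‖ ^ 2 * deriv F (‖w‖ ^ 2) ^ 2) := by
      rw [← ENNReal.ofReal_mul (by positivity)]
      congr 1
      field_simp
    simp only [upKernel, norm_smul, norm_of_nonneg ha.le, mul_pow a, hd,
      mul_div_cancel_left₀ _ (by positivity : a ^ 2 ≠ 0), vScaled, mul_div_cancel_left₀ _ ha.ne', e1,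
      ENNReal.ofReal_mul (by positivity : 0 ≤ a ^ (2 * l))]
    simp only [one_pow, inv_one, ENNReal.ofReal_one, div_one, one_mul]
    ring
  simp only [e] at h1
  have hm2 : Measurable fun w : ℂ => toE (‖w‖ ^ (2 * l)) * upKernel v 1 F w :=
    (by fun_prop : Measurable fun w : ℂ => toE (‖w‖ ^ (2 * l))).mul hm1
  rw [lintegral_const_mul _ (hm2.const_mul _), lintegral_const_mul _ hm2] at h1
  exact (ENNReal.mul_right_inj (by simpa using by positivity) ofReal_ne_top).1 h1

theorem isWeakGradient_radial (hF : ContDiff ℝ 1 F) :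
    IsWeakGradient (fun x => F (‖x‖ ^ 2)) fun k x => deriv F (‖x‖ ^ 2) * (2 * coord k x) := by
  have cF := hF.continuous
  have cF' := hF.continuous_deriv_one
  have hA : ∀ k x, ∃ A : ℂ →L[ℝ] ℝ, HasFDerivAt (fun x : ℂ => F (‖x‖ ^ 2)) A x ∧
      A (dir k) = deriv F (‖x‖ ^ 2) * (2 * coord k x) := fun k x =>
    (hasFDerivAt_radial (hF.differentiable (by simp) (‖x‖ ^ 2)).hasDerivAt k).1
  have c0 : Continuous fun x : ℂ => F (‖x‖ ^ 2) := by fun_prop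
  refine ⟨c0.locallyIntegrable, fun k => ?_⟩
  have ck := (contDiff_coord k (n := 0)).continuous
  have cg : Continuous fun x : ℂ => deriv F (‖x‖ ^ 2) * (2 * coord k x) := by fun_prop
  refine ⟨cg.locallyIntegrable, fun χ hχ hs => ?_⟩
  have hfd : ∀ x, fderiv ℝ (fun x : ℂ => F (‖x‖ ^ 2)) x (dir k) =
      deriv F (‖x‖ ^ 2) * (2 * coord k x) := fun x => by
    obtain ⟨A, h1, h2⟩ := hA k x
    rw [h1.fderiv, h2]
  have cχ : Continuous fun x => fderiv ℝ χ x (dir k) :=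
    (hχ.continuous_fderiv (by simp)).clm_apply continuous_const
  have sχ : HasCompactSupport fun x => fderiv ℝ χ x (dir k) :=
    (hs.fderiv (𝕜 := ℝ)).comp_left (g := fun A : ℂ →L[ℝ] ℝ => A (dir k)) rfl
  simpa only [hfd] using integral_mul_fderiv_eq_neg_fderiv_mul_of_integrable (μ := volume) (v := dir k)
    (f := fun x : ℂ => F (‖x‖ ^ 2)) (g := χ)
    (by simp only [hfd]; exact (cg.mul hχ.continuous).integrable_of_hasCompactSupport hs.mul_left)
    ((c0.mul cχ).integrable_of_hasCompactSupport sχ.mul_left)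
    ((c0.mul hχ.continuous).integrable_of_hasCompactSupport hs.mul_left)
    (fun x _ => (hA k x).choose_spec.1.differentiableAt) (fun x _ => hχ.differentiable (by simp) x)

theorem scatteringEnergy_radial (F : ℝ → ℝ) :
    2 * scatteringEnergy v l (fun x => F (‖x‖ ^ 2)) (fun k x => deriv F (‖x‖ ^ 2) * (2 * coord k x)) =
      ∫⁻ w : ℂ, toE (‖w‖ ^ (2 * l)) * upKernel v 1 F w := by
  rw [scatteringEnergy, ← lintegral_const_mul' _ _ ofNat_ne_top]
  refine lintegral_congr fun x => ?_
  have e : ∑ k, (deriv F (‖x‖ ^ 2) * (2 * coord k x)) ^ 2 = 4 * ‖x‖ ^ 2 * deriv F (‖x‖ ^ 2) ^ 2 := by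
    rw [← sum_coord_sq, mul_sum, sum_mul]
    exact sum_congr rfl fun k _ => by ring
  rw [e, mul_left_comm, mul_add, ← mul_assoc 2 (_ / _), ENNReal.mul_div_cancel two_ne_zero
    ofNat_ne_top, ← ENNReal.ofReal_ofNat 2, ← ENNReal.ofReal_mul zero_le_two]
  simp only [upKernel, vScaled, one_pow, inv_one, ENNReal.ofReal_one, one_mul, div_one]
  ring_nf

end Certificates


section Certificates

theorem exists_certs_of_pos (hv : Measurable v) (hv0 : ¬ ∀ᵐ x : ℂ, v ‖x‖ = 0) (hQ : 1 ≤ Q)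
    (hs : ∀ r, 0 ≤ r → Q < r ^ 2 → v r = 0) (hl : 1 ≤ l) : 0 < 8 * π * l * scatteringParam v l ∧
      HasLowCerts v l (8 * π * l * scatteringParam v l) ∧
      HasUpCerts v l (8 * π * l * scatteringParam v l) := by
  choose φ h using fun n => (isPot_trunc hv hQ n).exists_isScattering hl
  set E : ℕ → ℝ := fun n => prim l (fun q => trunc v Q n q * φ n q / 2) Q with hE
  have hEm : Monotone E := fun m n hmn => (h m).prim_mono_pot (h n) fun q => monotone_trunc q hmn
  have he := tendsto_atTop_ciSup hEm ⟨_, Set.forall_mem_range.2 fun n => (h n).prim_le_const hl⟩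
  set e := ⨆ n, E n
  have hEe : ∀ n, E n ≤ e := hEm.ge_of_tendsto he
  obtain ⟨n₀, hn₀⟩ := exists_prim_trunc_pos hv hv0 hQ hs l (fun n => (h n).measurable_sol)
    (fun n => (h n).sol_pos) fun n => (h n).sol_le_one
  have he0 : 0 < e := hn₀.trans_le (hEe n₀)
  have hpi := pi_pos
  have hI : (⨅ (f : ℂ → ℝ) (g : Fin 2 → ℂ → ℝ) (_ : IsWeakGradient f g)
      (_ : Tendsto f (cocompact ℂ) (𝓝 1)), scatteringEnergy v l f g) =
      toE (π * e) := by
    refine le_antisymm ?_ ?_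
    · refine ENNReal.le_of_forall_pos_le_add fun δ hδ _ => ?_
      have hδ' : (0 : ℝ) < δ := hδ
      obtain ⟨F, hF, -, ⟨L, hL⟩, hen⟩ := exists_trial hv hQ hs hl h he (δ := δ / π) (by positivity)
      have hlim : Tendsto (fun x : ℂ => F (‖x‖ ^ 2)) (cocompact ℂ) (𝓝 1) := by
        refine tendsto_const_nhds.congr' ?_
        have := (tendsto_pow_atTop two_ne_zero).comp (tendsto_norm_cocompact_atTop (E := ℂ))
        filter_upwards [this.eventually_ge_atTop L] with x hx using (hL _ hx).symm
      refine (iInf₂_le_of_le _ _ (iInf₂_le (isWeakGradient_radial hF) hlim)).trans ?_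
      rw [← scatteringEnergy_radial, ENNReal.ofReal_mul zero_le_two, ENNReal.ofReal_ofNat,
        ENNReal.mul_le_mul_iff_right two_ne_zero ofNat_ne_top, mul_add,
        mul_div_cancel₀ _ hpi.ne', ENNReal.ofReal_add (by positivity) hδ'.le,
        ofReal_coe_nnreal] at hen
      exact hen
    · refine le_iInf₂ fun f g => le_iInf₂ fun hfg hf => ?_
      refine le_of_tendsto (tendsto_ofReal (he.const_mul π)) (.of_forall
        fun n => (h n).le_scatteringEnergy (ofReal_trunc_le n) hfg hf)
  have hl' : (0 : ℝ) < l := by exact_mod_cast hl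
  have hκ : 8 * π * l * scatteringParam v l = 2 * (π * e) := by
    rw [scatteringParam, hI, toReal_ofReal (by positivity)]
    field_simp
    norm_num
  have hsc : ∀ a, energyScale l a = (a ^ (2 * l))⁻¹ := fun a => if_neg (by omega)
  rw [hκ]
  refine ⟨by positivity, fun R hR δ hδ => ?_, fun δ hδ => ?_⟩
  · have hlim : Tendsto (fun n => 2 * π * (e ^ 2 / E n)) atTop (𝓝 (2 * π * (e ^ 2 / e))) :=
      (tendsto_const_nhds.div he he0.ne').const_mul _
    rw [show 2 * π * (e ^ 2 / e) = 2 * (π * e) by field_simp] at hlim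
    obtain ⟨n, h1, h2⟩ := ((hlim.eventually_lt_const (lt_add_of_pos_right _ hδ)).and
      (he.eventually_const_lt he0)).exists
    filter_upwards [eventually_sq_mul_le Q (pow_pos hR 2), self_mem_nhdsWithin] with a ha ha0
    have ha0' : 0 < a := ha0
    have hE0 : E n ≠ 0 := h2.ne'
    refine ⟨_, _, _, isLowCert_scaled (s := e / E n) (isPot_trunc hv hQ n) (ofReal_trunc_le n)
      (h n).measurable_sol (fun q => ((h n).sol_pos q).le) (h n).sol_le_one ha0' hR ha
      (by rw [hsc]; positivity) (by positivity) ?_ ?_⟩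
    · change 2 * _ * (π * (_ * _ * E n)) = _
      rw [hsc]
      field_simp
    · refine le_trans (mul_le_mul_of_nonneg_left ((h n).integral_energy_le (by positivity)) ?_) ?_
      · rw [hsc]; positivity
      · change _ * E n ≤ _
        refine le_trans (le_of_eq ?_) h1.le
        rw [hsc]
        field_simp
  · obtain ⟨F, hF, hF1, ⟨L, hL⟩, hen⟩ := exists_trial hv hQ hs hl h he (δ := δ / (2 * π))
      (by positivity)
    refine ⟨fun a q => F (q / a ^ 2), fun η hη => ?_, ?_⟩
    · filter_upwards [eventually_sq_mul_le L hη, self_mem_nhdsWithin] with a ha ha0 q hq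
      have ha0' : 0 < a := ha0
      exact hL _ ((le_div_iff₀ (by positivity)).2 (by linarith))
    · filter_upwards [self_mem_nhdsWithin] with a ha0
      have ha0' : 0 < a := ha0
      refine ⟨hF.comp (contDiff_id.div_const _), fun q => hF1 _, ?_⟩
      rw [lintegral_upKernel_scaled hv hF ha0', hsc, div_inv_eq_mul, mul_comm _ (a ^ _),
        ENNReal.ofReal_mul (by positivity)]
      refine mul_le_mul_right (hen.trans_eq ?_) _
      congr 1
      field_simp

theorem hasLowCerts_zero (hv : Measurable v) (hv0 : ¬ ∀ᵐ x : ℂ, v ‖x‖ = 0) (hQ : 1 ≤ Q)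
    (hs : ∀ r, 0 ≤ r → Q < r ^ 2 → v r = 0) : HasLowCerts v 0 (8 * π) := by
  intro R hR δ hδ
  obtain ⟨n, hn⟩ := exists_prim_trunc_pos hv hv0 hQ hs 0 (y := fun _ _ => 1) (fun _ => measurable_const)
    (fun _ _ => one_pos) fun _ _ => le_rfl
  have hp := isPot_trunc hv hQ n
  set k : ℝ → ℝ := fun q => trunc v Q n q * 1 / 2 with hk
  have hkm : Measurable k := (hp.measurable.mul_const 1).div_const 2
  have hkC : ∃ C, ∀ q, |k q| ≤ C := hp.bounded_mul (fun _ => zero_le_one) fun _ _ => le_rfl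
  have hk0 : ∀ q, 0 ≤ k q := fun q => div_nonneg (mul_nonneg (hp.nonneg q) zero_le_one) zero_le_two
  have hks : ∀ q, Q < q → k q = 0 := fun q hq => hp.mul_eq_zero (fun _ => 1) fun hc => hc.2.not_gt hq
  have hke : ∀ q, q < ((n : ℝ) + 1)⁻¹ → k q = 0 := fun q hq =>
    hp.mul_eq_zero (fun _ => 1) fun hc => hc.1.not_gt hq
  have hε := hp.pos
  generalize ((n : ℝ) + 1)⁻¹ = ε at hp hke hε
  set E := prim 0 k Q with hE
  have hpi := pi_pos
  have hc := tendsto_energyScale 0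
  have hlim : Tendsto (fun a => 8 * π + (8 * π * Real.log (4 * R ^ 2 / ε) +
      32 * π / E) / energyScale 0 a) (𝓝[>] 0) (𝓝 (8 * π)) := by
    simpa using (hc.const_div_atTop _).const_add (8 * π)
  filter_upwards [eventually_sq_mul_le Q (pow_pos hR 2), self_mem_nhdsWithin, energyScale_pos 0,
    hlim.eventually_lt_const (lt_add_of_pos_right _ hδ)] with a ha ha0 hc0 hlt
  have ha0' : 0 < a := ha0
  have hcl : energyScale 0 a = Real.log (1 / a ^ 2) := if_pos rfl
  set c := energyScale 0 a
  have hM : Q ≤ 4 * R ^ 2 / a ^ 2 := (le_div_iff₀ (by positivity)).2 (by nlinarith)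
  have hB : ∫ q in (0 : ℝ)..4 * R ^ 2 / a ^ 2, trunc v Q n q / 2 * 1 * 1 * q ^ 0 = E := by
    rw [hE, ← prim_eq_of_zero_Ici hkm hkC hks hM, prim]
    exact intervalIntegral.integral_congr fun q _ => by simp only [hk]; ring
  have hlog : Real.log (4 * R ^ 2 / a ^ 2 / ε) = c + Real.log (4 * R ^ 2 / ε) := by
    rw [hcl, ← Real.log_mul (by positivity) (by positivity)]
    congr 1
    field_simp
  have hεM : ε ≤ 4 * R ^ 2 / a ^ 2 := hp.le.trans hM
  have hA : ∫ q in (0 : ℝ)..4 * R ^ 2 / a ^ 2, prim 0 k q ^ 2 / (4 * q ^ (0 + 1)) ≤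
      E ^ 2 / 4 * (c + Real.log (4 * R ^ 2 / ε)) := by
    have hcd := continuous_prim_sq_div (l := 0) hkm hkC hε hke
    rw [← integral_add_adjacent_intervals (hcd.intervalIntegrable 0 ε)
      (hcd.intervalIntegrable ε _), integral_of_le hε.le,
      setIntegral_eq_zero_of_forall_eq_zero fun q hq => by
        rw [prim_eq_zero_of_le hε.le hke hq.2]; simp, zero_add, ← hlog,
      ← integral_one_div_of_pos hε (hε.trans_le hεM), ← intervalIntegral.integral_const_mul]
    refine integral_mono_on hεM (hcd.intervalIntegrable ε _)
      (ContinuousOn.intervalIntegrable fun q hq => ?_) fun q hq => ?_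
    · rw [uIcc_of_le hεM] at hq
      have : q ≠ 0 := (hε.trans_le hq.1).ne'
      exact ContinuousAt.continuousWithinAt (by fun_prop (disch := exact this))
    · have hq0 := hε.trans_le hq.1
      have h1 := prim_nonneg (l := 0) hk0 hq0.le
      have h2 : prim 0 k q ≤ E := (prim_mono hkm hkC hk0 hq0.le (le_max_left q Q)).trans_eq
        (prim_eq_of_zero_Ici hkm hkC hks (le_max_right q Q))
      rw [zero_add, pow_one, div_mul_div_comm, mul_one]
      gcongr
  refine ⟨_, _, _, isLowCert_scaled (l := 0) (s := 4 / (c * E)) (y := fun _ => 1) hp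
    (ofReal_trunc_le n) measurable_const (fun _ => zero_le_one) (fun _ => le_rfl) ha0' hR ha hc0.le
    (by positivity) ?_ ?_⟩
  · change 2 * c * (π * (_ * _ * E)) = _
    field_simp
    norm_num
  · rw [hB]
    refine le_trans (mul_le_mul_of_nonneg_left (add_le_add_left hA E) (by positivity)) ?_
    refine le_trans (le_of_eq ?_) hlt.le
    field_simp
    ring

theorem hasUpCerts_zero (hQ : 1 ≤ Q) (hs : ∀ r, 0 ≤ r → Q < r ^ 2 → v r = 0) :
    HasUpCerts v 0 (8 * π) := by
  intro δ hδ
  have hpi := pi_pos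
  obtain ⟨t, ht0, ht8, htδ⟩ : ∃ t : ℝ, 0 < t ∧ t ≤ 1 / 8 ∧
      8 * π * (1 - 4 * t)⁻¹ ^ 2 ≤ 8 * π + δ := by
    have hc : ContinuousAt (fun t : ℝ => 8 * π * (1 - 4 * t)⁻¹ ^ 2) 0 := by
      have : ContinuousAt (fun t : ℝ => (1 - 4 * t)⁻¹) 0 :=
        ContinuousAt.inv₀ (by fun_prop) (by norm_num)
      fun_prop
    have h1 := hc.tendsto.eventually_lt_const (u := 8 * π + δ) (by simpa using hδ)
    have h2 : ∀ᶠ t : ℝ in 𝓝[>] 0, t < 1 / 8 := nhdsWithin_le_nhds (gt_mem_nhds (by norm_num))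
    obtain ⟨t, h3, h4, h5⟩ :=
      ((h1.filter_mono nhdsWithin_le_nhds).and (h2.and self_mem_nhdsWithin)).exists
    exact ⟨t, h5, h4.le, h3.le⟩
  obtain ⟨Θ, hΘ, hΘ1, hΘ0, hΘs, hΘd, -⟩ := exists_step ht0 ht8
  set C := (1 - 4 * t)⁻¹ with hC
  have hE := tendsto_energyScale 0
  set F : ℝ → ℝ → ℝ := fun a q => if q ≤ 0 then 0 else Θ (1 + Real.log q / energyScale 0 a) with hF
  refine ⟨F, fun η hη => ?_, ?_⟩
  · have h1 : Tendsto (fun a => 1 + Real.log η / energyScale 0 a) (𝓝[>] 0) (𝓝 1) := by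
      simpa using (hE.const_div_atTop (Real.log η)).const_add 1
    filter_upwards [h1.eventually_const_lt (by linarith : 1 - t < 1), energyScale_pos 0] with a h2 h3 q hq
    simp only [hF]
    rw [if_neg (not_le.2 (hη.trans_le hq))]
    refine hΘs _ (h2.le.trans ?_)
    gcongr
  have h1 : Tendsto (fun a => Real.log Q / energyScale 0 a) (𝓝[>] 0) (𝓝 0) := hE.const_div_atTop _
  filter_upwards [h1.eventually_lt_const ht0, energyScale_pos 0, self_mem_nhdsWithin] with a h2 h3 ha0
  have ha : 0 < a := ha0
  have hcl : energyScale 0 a = Real.log (1 / a ^ 2) := if_pos rfl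
  set c := energyScale 0 a with hc
  set r := rexp (-c * (1 - t)) with hr
  have hr0 : 0 < r := exp_pos _
  have hzero : ∀ q ≤ r, F a q = 0 := fun q hq => by
    simp only [hF]
    split_ifs with h4
    · rfl
    · refine hΘ0 _ ?_
      have := Real.log_le_log (not_le.1 h4) hq
      rw [hr, Real.log_exp] at this
      have := div_le_div_of_nonneg_right this h3.le
      rw [show -c * (1 - t) / c = t - 1 by field_simp; ring] at this
      linarith
  have hone : ∀ q, 1 ≤ q → F a q = 1 := fun q hq => by
    simp only [hF]
    rw [if_neg (by linarith)]
    exact hΘs _ (by have := div_nonneg (Real.log_nonneg hq) h3.le; linarith)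
  have hr1 : r ≤ 1 := Real.exp_le_one_iff.2 (by nlinarith)
  have hev : ∀ q, 0 < q → F a =ᶠ[𝓝 q] fun q => Θ (1 + Real.log q / c) := fun q hq => by
    filter_upwards [lt_mem_nhds hq] with x hx
    simp only [hF]
    rw [if_neg (not_le.2 hx)]
  have hcd : ContDiff ℝ 1 (F a) := contDiff_iff_contDiffAt.2 fun q => by
    rcases lt_or_ge q r with hq | hq
    · refine contDiffAt_const (c := (0 : ℝ)) |>.congr_of_eventuallyEq ?_
      filter_upwards [gt_mem_nhds hq] with x hx using hzero x hx.le
    · have hq0 := hr0.trans_le hq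
      exact (hΘ.contDiffAt.comp q (contDiffAt_const.add
        ((Real.contDiffAt_log.2 hq0.ne').div_const c))).congr_of_eventuallyEq (hev q hq0)
  refine ⟨hcd, fun q => ?_, ?_⟩
  · simp only [hF]
    split_ifs
    · simp
    · exact hΘ1 _
  have hder : ∀ q, 0 < q → 8 * q * deriv (F a) q ^ 2 ≤ 8 * C ^ 2 / c ^ 2 * (1 / q) := fun q hq => by
    have h4 : HasDerivAt (fun q => Θ (1 + Real.log q / c)) _ q :=
      (hΘ.differentiable (by simp) (1 + Real.log q / c)).hasDerivAt.comp q
        (((Real.hasDerivAt_log hq.ne').div_const c).const_add 1)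
    rw [(hev q hq).deriv_eq, h4.deriv]
    have h5 := pow_le_pow_left₀ (hΘd (1 + Real.log q / c)).1 (hΘd _).2 2
    calc _ = 8 * deriv Θ (1 + Real.log q / c) ^ 2 / c ^ 2 * (1 / q) := by field_simp
      _ ≤ _ := by gcongr
  set D : ℝ → ℝ := fun q => 8 * q * deriv (F a) q ^ 2 with hD
  have hDc : Continuous D := by
    have := hcd.continuous_deriv_one
    fun_prop
  have hrad := lintegral_ofReal_radial hDc.measurable zero_le_one (hDc.intervalIntegrable 0 1)
    fun q hq => by positivity
  have hint : ∫ q in (0 : ℝ)..1, D q ≤ 8 * C ^ 2 / c := by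
    have hz : ∀ q ∈ Set.Ioo 0 r, D q = 0 := fun q hq => by
      have : F a =ᶠ[𝓝 q] fun _ => 0 := by
        filter_upwards [gt_mem_nhds hq.2] with x hx using hzero x hx.le
      simp only [hD, this.deriv_eq]
      simp
    rw [← integral_add_adjacent_intervals (hDc.intervalIntegrable 0 r)
      (hDc.intervalIntegrable r 1), integral_of_le hr0.le, integral_Ioc_eq_integral_Ioo,
      setIntegral_eq_zero_of_forall_eq_zero hz, zero_add]
    have hi : IntervalIntegrable (fun q : ℝ => 8 * C ^ 2 / c ^ 2 * (1 / q)) volume r 1 :=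
      ContinuousOn.intervalIntegrable fun q hq => by
        rw [uIcc_of_le hr1] at hq
        have : q ≠ 0 := (hr0.trans_le hq.1).ne'
        exact ContinuousAt.continuousWithinAt (by fun_prop (disch := exact this))
    refine (integral_mono_on hr1 (hDc.intervalIntegrable r 1) hi fun q hq =>
      hder q (hr0.trans_le hq.1)).trans ?_
    rw [intervalIntegral.integral_const_mul, integral_one_div_of_pos hr0 one_pos, one_div,
      Real.log_inv, hr, Real.log_exp]
    calc _ = 8 * C ^ 2 / c * (1 - t) := by field_simp
      _ ≤ _ := mul_le_of_le_one_right (by positivity) (by linarith)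
  calc _ ≤ ∫⁻ w : ℂ, toE ((Iic 1).indicator D (‖w‖ ^ 2)) := by
        refine lintegral_mono fun w => ?_
        simp only [mul_zero, pow_zero, ENNReal.ofReal_one, one_mul, upKernel]
        have hpot : vScaled v a ‖w‖ * toE (F a (‖w‖ ^ 2) ^ 2) = 0 := by
          rcases le_or_gt (‖w‖ ^ 2) (a ^ 2 * Q) with h4 | h4
          · rw [hzero]
            · simp
            refine h4.trans ((Real.log_le_log_iff (by positivity) hr0).1 ?_)
            rw [hr, Real.log_exp, Real.log_mul (by positivity) (by positivity)]
            rw [one_div, Real.log_inv] at hcl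
            rw [div_lt_iff₀ h3] at h2
            linarith
          · rw [vScaled, hs _ (by positivity), mul_zero, zero_mul]
            rw [div_pow, lt_div_iff₀ (by positivity)]
            linarith
        rw [hpot, add_zero]
        rcases le_or_gt (‖w‖ ^ 2) 1 with h4 | h4
        · rw [indicator_of_mem (Set.mem_Iic.2 h4)]
        · rw [deriv_eq_zero_of_eq_one hone h4]
          simp
    _ = _ := hrad
    _ ≤ _ := by
        refine ofReal_le_ofReal ((mul_le_mul_of_nonneg_left hint hpi.le).trans ?_)
        rw [mul_div_assoc']
        gcongr
        linarith

/-- Lower certificates and limits for all scales. -/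
theorem strongResolventLimit_hamiltonian (N : ℕ) (hv : Measurable v)
    (hsupp : ∃ R₀ : ℝ, ∀ r, R₀ < r → v r = 0) (hv0 : ¬ ∀ᵐ x : ℂ, v ‖x‖ = 0) (l : ℕ) :
    StrongResolventLimit (fun a : ℝ => (energyScale l a : ℂ) • hamiltonian N hv a) (spaceB N l)
      (((if l = 0 then 8 * π else 8 * π * l * scatteringParam v l : ℝ) : ℂ) •
        pseudoHamiltonian N l) := by
  obtain ⟨R₀, hR₀⟩ := hsupp
  have hQ : 1 ≤ R₀ ^ 2 + 1 := by nlinarith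
  have hs : ∀ r, 0 ≤ r → R₀ ^ 2 + 1 < r ^ 2 → v r = 0 := fun r hr h => hR₀ r (by
    by_contra hc
    nlinarith [not_lt.1 hc])
  have hcert : ∀ j : ℕ, ∃ κ > 0, HasLowCerts v j κ ∧ HasUpCerts v j κ ∧
      κ = if j = 0 then 8 * π else 8 * π * j * scatteringParam v j := fun j => by
    rcases Nat.eq_zero_or_pos j with rfl | hj
    · exact ⟨8 * π, by positivity, hasLowCerts_zero hv hv0 hQ hs, hasUpCerts_zero hQ hs, by simp⟩
    · obtain ⟨h1, h2, h3⟩ := exists_certs_of_pos hv hv0 hQ hs hj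
      exact ⟨_, h1, h2, h3, by rw [if_neg hj.ne']⟩
  obtain ⟨κ, h1, h2, h3, h4⟩ := hcert l
  rw [← h4]
  exact strongResolventLimit_of_certs hv ⟨R₀, hR₀⟩ h1 h2 h3 fun j _ => by
    obtain ⟨κ', h1', h2', -⟩ := hcert j
    exact ⟨κ', h1', h2'⟩

end Certificates

end QHall

end

theorem theorem1 (N : ℕ) (hN : 2 ≤ N) (v : ℝ → ℝ≥0∞) (hv : Measurable v)
    (hsupp : ∃ R₀ : ℝ, ∀ r, R₀ < r → v r = 0)
    (hv0 : ¬ ∀ᵐ x : ℂ, v ‖x‖ = 0) :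
    (∀ ℓ : ℕ, ∃! T, QHall.IsPseudoHamiltonian N ℓ T) ∧
    (∀ ℓ : ℕ, 1 ≤ ℓ →
      QHall.StrongResolventLimit
        (fun a : ℝ => (((a ^ (2 * ℓ))⁻¹ : ℝ) : ℂ) • QHall.hamiltonian N hv a)
        (QHall.spaceB N ℓ)
        (((8 * Real.pi * ℓ * QHall.scatteringParam v ℓ : ℝ) : ℂ) •
          QHall.pseudoHamiltonian N ℓ)) ∧
    QHall.StrongResolventLimit
      (fun a : ℝ => ((Real.log (1 / a ^ 2) : ℝ) : ℂ) • QHall.hamiltonian N hv a)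
      (QHall.spaceB N 0)
      (((8 * Real.pi : ℝ) : ℂ) • QHall.pseudoHamiltonian N 0) := by
  refine ⟨fun ℓ => QHall.existsUnique_isPseudoHamiltonian N ℓ, fun ℓ hℓ => ?_, ?_⟩
  · have := QHall.strongResolventLimit_hamiltonian N hv hsupp hv0 ℓ
    simpa only [QHall.energyScale, if_neg (show ℓ ≠ 0 by omega)] using this
  · have := QHall.strongResolventLimit_hamiltonian N hv hsupp hv0 0
    simpa only [QHall.energyScale, if_true] using this
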